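/- Let $k$ be a commutative ring, $A$ a $k$-algebra, $H$ a Hopf algebra over $k$ with counit $\epsilon$ and antipode $S$, and write $\otimes=\otimes_k$ and $\Delta(h)=h^{(1)}\otimes h^{(2)}$. Let $(h,a)\mapsto a^h$ be a weak action of $H$ on $A$ (a bilinear map with $(ab)^h=a^{h^{(1)}}b^{h^{(2)}}$, $1^h=\epsilon(h)1$, $a^1=a$) and $f\colon H\otimes H\to A$ a $k$-linear map such that $E=A\#_fH$, i.e. $A\otimes H$ with the product $(a\# h)(b\# l)=a\,b^{h^{(1)}}f(h^{(2)},l^{(1)})\# h^{(3)}l^{(2)}$, is associative with identity $1\#1$. Assume that $f$ is convolution invertible, and put $(1\#h)^{-1}=f^{-1}(S(h^{(2)}),h^{(3)})\#S(h^{(1)})$. Let $M$ be an $E$-bimodule on which the two actions of $k$ agree, and let $A$ act on $M$ through $a\mapsto a\#1$. Notation. $\overline A=A/k\cdot1$ and $\overline H=H/k\cdot 1$, with $\overline A^r$, $\overline H^s$ their tensor powers. For $\mathbf h=h_1\otimes\cdots\otimes h_s$ put $\mathbf h_{ij}=h_i\otimes\cdots\otimes h_j$, $\mathfrak h_{ij}=h_i\cdots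 h_j$, $\mathbf h^{(1)}\otimes\mathbf h^{(2)}=(h_1^{(1)}\otimes\cdots\otimes h_s^{(1)})\otimes(h_1^{(2)}\otimes\cdots\otimes h_s^{(2)})$, $a^{\overline{\mathbf h}}=(\cdots(a^{h_s})^{h_{s-1}}\cdots)^{h_1}$; for $\mathbf a=a_1\otimes\cdots\otimes a_r$ put $\mathbf a_{ij}=a_i\otimes\cdots\otimes a_j$ and $\mathbf a^{\overline{\mathbf h}}=a_1^{\overline{\mathbf h^{(1)}}}\otimes\cdots\otimes a_r^{\overline{\mathbf h^{(r)}}}$ (which is $\epsilon(h_1)\cdots\epsilon(h_s)$ if $r=0$). The maps $F_r^{(l)}\colon \mathbf h\otimes\mathbf a\mapsto F_r^{(l)}(\mathbf h\otimes\mathbf a)$, with $l$ factors in $\mathbf h$, $r$ factors in $\mathbf a$ and values in $(r+l-1)$-fold tensors over $A$, are defined by $F_r^{(1)}(h\otimes\mathbf a)=\mathbf a^h$ and, for $l\ge1$, $$F_r^{(l+1)}(\mathbf h\otimes\mathbf a)=\sum_{j=1}^{l}\sum_{i=0}^{r}(-1)^{il+j}\,\mathbf a_{1i}^{\overline{\mathbf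 h^{(1)}}}\otimes f(h_j^{(2)},h_{j+1}^{(2)})^{\overline{\mathbf h_{1,j-1}^{(2)}}}\otimes F_{r-i}^{(l)}\bigl((\mathbf h_{1,j-1}^{(3)}\otimes h_j^{(3)}h_{j+1}^{(3)}\otimes\mathbf h_{j+2,l+1}^{(2)})\otimes\mathbf a_{i+1,r}\bigr).$$ Let $\widehat X_n=\bigoplus_{r+s=n}M\otimes\overline H^s\otimes\overline A^r$ and $\overline X_n=\bigoplus_{r+s=n}M\otimes\overline A^r\otimes\overline H^s$, with the differentials $\widehat d_n=\sum\widehat d^{\,l}_{rs}$ and $\overline d_n=\sum\overline d^{\,l}_{rs}$ (sums over $r+s=n$, $0\le l\le s$, $r+l>0$), where $\widehat d^{\,l}_{rs}$ has values in $M\otimes\overline H^{s-l}\otimes\overline A^{r+l-1}$, $\overline d^{\,l}_{rs}$ has values in $M\otimes\overline A^{r+l-1}\otimes\overline H^{s-l}$, and $$\widehat d^{\,0}(m\otimes\mathbf h\otimes\mathbf a)=m a_1^{\overline{\mathbf h^{(1)}}}\otimes\mathbf h^{(2)}\otimes\mathbf a_{2r}+\sum_{i=1}^{r-1}(-1)^i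 m\otimes\mathbf h\otimes\mathbf a_{1,i-1}\otimes a_ia_{i+1}\otimes\mathbf a_{i+2,r}+(-1)^r a_rm\otimes\mathbf h\otimes\mathbf a_{1,r-1},$$ $$\widehat d^{\,1}(m\otimes\mathbf h\otimes\mathbf a)=(-1)^r m(1\#h_1)\otimes\mathbf h_{2s}\otimes\mathbf a+\sum_{i=1}^{s-1}(-1)^{r+i}m f(h_i^{(1)},h_{i+1}^{(1)})^{\overline{\mathbf h_{1,i-1}^{(1)}}}\otimes\mathbf h_{1,i-1}^{(2)}\otimes h_i^{(2)}h_{i+1}^{(2)}\otimes\mathbf h_{i+2,s}\otimes\mathbf a+(-1)^{r+s}(1\#h_s^{(2)})m\otimes\mathbf h_{1,s-1}\otimes\mathbf a^{h_s^{(1)}},$$ $$\widehat d^{\,l}(m\otimes\mathbf h\otimes\mathbf a)=(-1)^{l(r+s)}(1\#\mathfrak h_{s-l+1,s}^{(2)})m\otimes\mathbf h_{1,s-l}\otimes F_r^{(l)}(\mathbf h_{s-l+1,s}^{(1)}\otimes\mathbf a)\qquad(l\ge2),$$ $$\overline d^{\,0}(m\otimes\mathbf a\otimes\mathbf h)=ma_1\otimes\mathbf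 a_{2r}\otimes\mathbf h+\sum_{i=1}^{r-1}(-1)^i m\otimes\mathbf a_{1,i-1}\otimes a_ia_{i+1}\otimes\mathbf a_{i+2,r}\otimes\mathbf h+(-1)^ra_rm\otimes\mathbf a_{1,r-1}\otimes\mathbf h,$$ $$\overline d^{\,1}(m\otimes\mathbf a\otimes\mathbf h)=(-1)^r m\,\epsilon(h_1)\otimes\mathbf a\otimes\mathbf h_{2s}+\sum_{i=1}^{s-1}(-1)^{r+i}m\otimes\mathbf a\otimes\mathbf h_{1,i-1}\otimes h_ih_{i+1}\otimes\mathbf h_{i+2,s}+(-1)^{r+s}(1\#h_s^{(3)})m(1\#h_s^{(1)})^{-1}\otimes\mathbf a^{h_s^{(2)}}\otimes\mathbf h_{1,s-1},$$ $$\overline d^{\,l}(m\otimes\mathbf a\otimes\mathbf h)=(-1)^{l(r+s)}(1\#\mathfrak h_{s-l+1,s}^{(3)})\,m\,(1\#h_s^{(1)})^{-1}\cdots(1\#h_{s-l+1}^{(1)})^{-1}\otimes F_r^{(l)}(\mathbf h_{s-l+1,s}^{(2)}\otimes\mathbf a)\otimes\mathbf h_{1,s-l}\qquad(l\ge2).$$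 Theorem. These formulas give well defined maps, $\widehat X_*(E,M)=(\widehat X_*,\widehat d_*)$ and $\overline X_*(E,M)=(\overline X_*,\overline d_*)$ are chain complexes, and the maps $\theta_n\colon\widehat X_n\to\overline X_n$ given on $M\otimes\overline H^s\otimes\overline A^r$, $r+s=n$, by $$\theta_n(m\otimes\mathbf h\otimes\mathbf a)=m(1\#h_1^{(1)})\cdots(1\#h_s^{(1)})\otimes\mathbf a\otimes\mathbf h^{(2)}$$ are well defined and form an isomorphism of complexes $\theta_*\colon\widehat X_*(E,M)\to\overline X_*(E,M)$. Consequently the Hochschild homology $\operatorname{H}_n(E,M)$ is isomorphic to the $n$-th homology module of $\overline X_*(E,M)$, for every $n\ge0$. -/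

import Mathlib

open scoped TensorProduct

universe u v

namespace HopfCrossed

noncomputable section

/-! ### Tensor powers of a module -/

section TensorPowers

variable (k : Type u) [CommRing k]

/-- The tensor power `V^{⊗ n}` over `k`: `V^{⊗ 0} = k` and `V^{⊗ (n+1)} = V ⊗ V^{⊗ n}`. -/
def TPow (V : Type u) [AddCommGroup V] [Module k V] : ℕ → ModuleCat.{u} k
  | 0 => ModuleCat.of k k
  | n + 1 => ModuleCat.of k (V ⊗[k] (TPow V n))

variable {k}
variable {V W : Type u} [AddCommGroup V] [Module k V] [AddCommGroup W] [Module k W]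

/-- `k = V^{⊗ 0}`. -/
def nil : k ≃ₗ[k] TPow k V 0 := LinearEquiv.refl k k

/-- `V ⊗ V^{⊗ n} = V^{⊗ (n+1)}`. -/
def cons {n : ℕ} : V ⊗[k] TPow k V n ≃ₗ[k] TPow k V (n + 1) :=
  LinearEquiv.refl k (V ⊗[k] TPow k V n)

/-- `V^{⊗ n} → W^{⊗ n}` induced by a linear map `V → W`. -/
def powMap (g : V →ₗ[k] W) : (n : ℕ) → TPow k V n →ₗ[k] TPow k W n
  | 0 => nil.toLinearMap ∘ₗ nil.symm.toLinearMap
  | n + 1 => cons.toLinearMap ∘ₗ TensorProduct.map g (powMap g n) ∘ₗ cons.symm.toLinearMap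

/-- `v₁ ⊗ ⋯ ⊗ v_{n+1} ↦ v_{n+1} ⊗ (v₁ ⊗ ⋯ ⊗ v_n)`. -/
def unsnoc : (n : ℕ) → TPow k V (n + 1) →ₗ[k] V ⊗[k] TPow k V n
  | 0 => cons.symm.toLinearMap
  | n + 1 => LinearMap.lTensor V cons.toLinearMap
      ∘ₗ (TensorProduct.leftComm k V V (TPow k V n)).toLinearMap
      ∘ₗ LinearMap.lTensor V (unsnoc n) ∘ₗ cons.symm.toLinearMap

/-- The identity map `V^{⊗ n} → V^{⊗ m}` if `n = m` (and `0` if `n ≠ m`). -/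
def idPow : (n m : ℕ) → TPow k V n →ₗ[k] TPow k V m
  | 0, 0 => LinearMap.id
  | n + 1, m + 1 => cons.toLinearMap ∘ₗ LinearMap.lTensor V (idPow n m) ∘ₗ cons.symm.toLinearMap
  | 0, _ + 1 => 0
  | _ + 1, 0 => 0

/-- `v₁ ⊗ ⋯ ⊗ v_s ↦ (v₁ ⊗ ⋯ ⊗ v_t) ⊗ (v_{t+1} ⊗ ⋯ ⊗ v_s)` if `s = t + l`
(and `0` if `s ≠ t + l`). -/
def split : (s t l : ℕ) → TPow k V s →ₗ[k] TPow k V t ⊗[k] TPow k V l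
  | s, 0, l => LinearMap.rTensor (TPow k V l) nil.toLinearMap
      ∘ₗ (TensorProduct.lid k (TPow k V l)).symm.toLinearMap ∘ₗ idPow s l
  | 0, _ + 1, _ => 0
  | s + 1, t + 1, l => LinearMap.rTensor (TPow k V l) cons.toLinearMap
      ∘ₗ (TensorProduct.assoc k V (TPow k V t) (TPow k V l)).symm.toLinearMap
      ∘ₗ LinearMap.lTensor V (split s t l) ∘ₗ cons.symm.toLinearMap

/-- The tensor powers of a coalgebra `C` are coalgebras: if `𝐜 = c₁ ⊗ ⋯ ⊗ c_n` then
`Δ(𝐜) = (c₁⁽¹⁾ ⊗ ⋯ ⊗ c_n⁽¹⁾) ⊗ (c₁⁽²⁾ ⊗ ⋯ ⊗ c_n⁽²⁾)` and `ε(𝐜) = ε(c₁) ⋯ ε(c_n)`. -/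
instance instCoalgebraTPow (C : Type u) [AddCommGroup C] [Module k C] [Coalgebra k C] :
    (n : ℕ) → Coalgebra k (TPow k C n)
  | 0 => inferInstanceAs (Coalgebra k k)
  | n + 1 =>
    letI := instCoalgebraTPow C n
    inferInstanceAs (Coalgebra k (C ⊗[k] TPow k C n))

variable {B : Type u} [Ring B] [Algebra k B]

/-- `b₁ ⊗ ⋯ ⊗ b_{n+2} ↦ b₁ ⊗ ⋯ ⊗ b_{i+1} b_{i+2} ⊗ ⋯ ⊗ b_{n+2}`, for `0 ≤ i ≤ n`. -/
def mulAt : (i n : ℕ) → TPow k B (n + 2) →ₗ[k] TPow k B (n + 1)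
  | 0, n => cons.toLinearMap ∘ₗ LinearMap.rTensor (TPow k B n) (LinearMap.mul' k B)
      ∘ₗ (TensorProduct.assoc k B B (TPow k B n)).symm.toLinearMap
      ∘ₗ LinearMap.lTensor B cons.symm.toLinearMap ∘ₗ cons.symm.toLinearMap
  | i + 1, n + 1 => cons.toLinearMap ∘ₗ LinearMap.lTensor B (mulAt i n) ∘ₗ cons.symm.toLinearMap
  | _ + 1, 0 => 0

/-- `b₁ ⊗ ⋯ ⊗ b_{n+1} ↦ ∑_{i=1}^{n} (-1)^i b₁ ⊗ ⋯ ⊗ b_i b_{i+1} ⊗ ⋯ ⊗ b_{n+1}`. -/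
def innerSum : (n : ℕ) → TPow k B (n + 1) →ₗ[k] TPow k B n
  | 0 => 0
  | n + 1 => ∑ i ∈ Finset.range (n + 1), (-1 : k) ^ (i + 1) • mulAt i n

/-- `b₁ ⊗ ⋯ ⊗ b_n ↦ b₁ ⋯ b_n`. -/
def prodPow : (n : ℕ) → TPow k B n →ₗ[k] B
  | 0 => Algebra.linearMap k B ∘ₗ nil.symm.toLinearMap
  | n + 1 => LinearMap.mul' k B ∘ₗ LinearMap.lTensor B (prodPow n) ∘ₗ cons.symm.toLinearMap

/-- For `g : V → B`, the map `v₁ ⊗ ⋯ ⊗ v_n ↦ g(v_n) ⋯ g(v₁)`. -/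
def revProd (g : V →ₗ[k] B) : (n : ℕ) → TPow k V n →ₗ[k] B
  | 0 => Algebra.linearMap k B ∘ₗ nil.symm.toLinearMap
  | n + 1 => LinearMap.mul' k B ∘ₗ TensorProduct.map (revProd g n) g
      ∘ₗ (TensorProduct.comm k V (TPow k V n)).toLinearMap ∘ₗ cons.symm.toLinearMap

variable (k B) in
/-- The reduced module `B / k·1` of a `k`-algebra `B`. -/
abbrev Red : Type u := B ⧸ Submodule.span k {(1 : B)}

variable (k B) in
/-- The class map `B → B / k·1`. -/
def red : B →ₗ[k] Red k B := (Submodule.span k {(1 : B)}).mkQ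

end TensorPowers

/-! ### Bimodules and Hochschild homology -/

section Bimodules

variable {k : Type u} [CommRing k] {R : Type u} [Ring R] [Algebra k R]
variable {M : Type v} [AddCommGroup M] [Module k M] [Module R M] [Module Rᵐᵒᵖ M]
variable [IsScalarTower k R M] [IsScalarTower k Rᵐᵒᵖ M]

variable (k R M) in
/-- The left action `e ↦ (m ↦ e m)` of an `R`-bimodule. -/
def leftMul : R →ₗ[k] M →ₗ[k] M := (Algebra.lsmul k k M : R →ₐ[k] Module.End k M).toLinearMap

variable (k R M) in
/-- The right action `e ↦ (m ↦ m e)` of an `R`-bimodule. -/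
def rightMul : R →ₗ[k] M →ₗ[k] M :=
  (Algebra.lsmul k k M : Rᵐᵒᵖ →ₐ[k] Module.End k M).toLinearMap
    ∘ₗ (MulOpposite.opLinearEquiv k : R ≃ₗ[k] Rᵐᵒᵖ).toLinearMap

variable {V Q : Type u} [AddCommGroup V] [Module k V] [AddCommGroup Q] [Module k Q]

variable (M) in
/-- For `g : V → R`, the map `m ⊗ (v ⊗ q) ↦ m g(v) ⊗ q`. -/
def onRight (g : V →ₗ[k] R) (Q : Type u) [AddCommGroup Q] [Module k Q] :
    M ⊗[k] (V ⊗[k] Q) →ₗ[k] M ⊗[k] Q :=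
  LinearMap.rTensor Q (TensorProduct.lift (rightMul k R M ∘ₗ g).flip)
    ∘ₗ (TensorProduct.assoc k M V Q).symm.toLinearMap

variable (M) in
/-- For `g : V → R`, the map `m ⊗ (v ⊗ q) ↦ g(v) m ⊗ q`. -/
def onLeft (g : V →ₗ[k] R) (Q : Type u) [AddCommGroup Q] [Module k Q] :
    M ⊗[k] (V ⊗[k] Q) →ₗ[k] M ⊗[k] Q :=
  LinearMap.rTensor Q (TensorProduct.lift (leftMul k R M ∘ₗ g).flip)
    ∘ₗ (TensorProduct.assoc k M V Q).symm.toLinearMap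

variable (M) in
/-- For an algebra `B` and a linear map `g : B → R`,
`m ⊗ b₁ ⊗ ⋯ ⊗ b_{r+1} ↦ m g(b₁) ⊗ b₂ ⊗ ⋯ ⊗ b_{r+1}
  + ∑_{i=1}^{r} (-1)^i m ⊗ b₁ ⊗ ⋯ ⊗ b_i b_{i+1} ⊗ ⋯ ⊗ b_{r+1}
  + (-1)^{r+1} g(b_{r+1}) m ⊗ b₁ ⊗ ⋯ ⊗ b_r`. -/
def hochB {B : Type u} [Ring B] [Algebra k B] (g : B →ₗ[k] R) (r : ℕ) :
    M ⊗[k] TPow k B (r + 1) →ₗ[k] M ⊗[k] TPow k B r :=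
  onRight M g (TPow k B r) ∘ₗ LinearMap.lTensor M cons.symm.toLinearMap
    + LinearMap.lTensor M (innerSum r)
    + (-1 : k) ^ (r + 1) • (onLeft M g (TPow k B r) ∘ₗ LinearMap.lTensor M (unsnoc r))

end Bimodules

/-- The `n`-th homology module of a sequence `⋯ → C₂ → C₁ → C₀` of `k`-modules with maps
`d n : C (n+1) → C n`: it is `C₀ / im d₀` for `n = 0` and `ker d_{n-1} / im d_n` for `n ≥ 1`
(used when consecutive maps compose to zero). -/
def Homology {k : Type u} [CommRing k] {C : ℕ → Type v} [∀ n, AddCommGroup (C n)]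
    [∀ n, Module k (C n)] (d : ∀ n, C (n + 1) →ₗ[k] C n) : ℕ → ModuleCat.{v} k
  | 0 => ModuleCat.of k (C 0 ⧸ LinearMap.range (d 0))
  | n + 1 => ModuleCat.of k
      (LinearMap.ker (d n) ⧸
        (LinearMap.range (d (n + 1))).comap (LinearMap.ker (d n)).subtype)

/-- The Hochschild homology `H_n(R, M)` of a `k`-algebra `R` with coefficients in an `R`-bimodule
`M`: the homology of the standard Hochschild complex `(M ⊗ R^{⊗ *}, b)`. -/
def HochschildHomology (k : Type u) [CommRing k] (R : Type u) [Ring R] [Algebra k R]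
    (M : Type v) [AddCommGroup M] [Module k M] [Module R M] [Module Rᵐᵒᵖ M]
    [IsScalarTower k R M] [IsScalarTower k Rᵐᵒᵖ M] (n : ℕ) : ModuleCat.{max u v} k :=
  Homology (C := fun r => M ⊗[k] TPow k R r)
    (fun r => hochB M (LinearMap.id : R →ₗ[k] R) r) n

/-! ### Crossed products -/

section Actions

variable {k : Type u} [CommRing k] {A C H : Type u} [AddCommGroup A] [Module k A]
variable [AddCommGroup C] [Module k C] [Coalgebra k C]

/-- For a bilinear map `(c, a) ↦ a^c`, the map `c ⊗ (a ⊗ q) ↦ a^{c⁽¹⁾} ⊗ (c⁽²⁾ ⊗ q)`. -/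
def actPast (act : C →ₗ[k] A →ₗ[k] A) (Q : Type u) [AddCommGroup Q] [Module k Q] :
    C ⊗[k] (A ⊗[k] Q) →ₗ[k] A ⊗[k] (C ⊗[k] Q) :=
  LinearMap.rTensor (C ⊗[k] Q) (TensorProduct.lift act)
    ∘ₗ (TensorProduct.tensorTensorTensorComm k C C A Q).toLinearMap
    ∘ₗ LinearMap.rTensor (A ⊗[k] Q) Coalgebra.comul

variable [Ring H] [HopfAlgebra k H]

/-- `h ⊗ l ↦ f(h⁽¹⁾, l⁽¹⁾) ⊗ h⁽²⁾ l⁽²⁾`. -/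
def cocycleMul (f : H ⊗[k] H →ₗ[k] A) : H ⊗[k] H →ₗ[k] A ⊗[k] H :=
  TensorProduct.map f (LinearMap.mul' k H) ∘ₗ Coalgebra.comul

end Actions

section CrossedMul

variable {k : Type u} [CommRing k] {A H : Type u} [Ring A] [Algebra k A]
variable [Ring H] [HopfAlgebra k H]

/-- `a ⊗ (b ⊗ h) ↦ a b ⊗ h`. -/
def mulInto (k : Type u) [CommRing k] (A H : Type u) [Ring A] [Algebra k A]
    [Ring H] [HopfAlgebra k H] : A ⊗[k] (A ⊗[k] H) →ₗ[k] A ⊗[k] H :=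
  LinearMap.rTensor H (LinearMap.mul' k A) ∘ₗ (TensorProduct.assoc k A A H).symm.toLinearMap

/-- The multiplication of `A #_f H` on `A ⊗ H`, as a linear map:
`(a ⊗ h) ⊗ (b ⊗ l) ↦ a b^{h⁽¹⁾} f(h⁽²⁾, l⁽¹⁾) ⊗ h⁽³⁾ l⁽²⁾`. -/
def crossedMul (act : H →ₗ[k] A →ₗ[k] A) (f : H ⊗[k] H →ₗ[k] A) :
    (A ⊗[k] H) ⊗[k] (A ⊗[k] H) →ₗ[k] A ⊗[k] H :=
  mulInto k A H ∘ₗ LinearMap.lTensor A (mulInto k A H)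
    ∘ₗ LinearMap.lTensor A (LinearMap.lTensor A (cocycleMul f))
    ∘ₗ LinearMap.lTensor A (actPast act H)
    ∘ₗ (TensorProduct.assoc k A H (A ⊗[k] H)).toLinearMap

end CrossedMul

/-- The data defining a crossed product `A #_f H`: a weak action `(h, a) ↦ a^h` of the Hopf algebra
`H` on the algebra `A` and a linear map `f : H ⊗ H → A` such that the multiplication
`(a ⊗ h)(b ⊗ l) = a b^{h⁽¹⁾} f(h⁽²⁾, l⁽¹⁾) ⊗ h⁽³⁾ l⁽²⁾` of `A ⊗ H` is associative with identity
`1 ⊗ 1`. -/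
structure CrossedSystem (k A H : Type u) [CommRing k] [Ring A] [Algebra k A] [Ring H]
    [HopfAlgebra k H] where
  /-- The weak action `h ↦ (a ↦ a^h)`. -/
  act : H →ₗ[k] A →ₗ[k] A
  /-- The cocycle. -/
  f : H ⊗[k] H →ₗ[k] A
  /-- `(a b)^h = a^{h⁽¹⁾} b^{h⁽²⁾}`. -/
  act_mul : ∀ (h : H) (a b : A), act h (a * b) =
    LinearMap.mul' k A (TensorProduct.map (act.flip a) (act.flip b) (Coalgebra.comul (R := k) h))
  /-- `1^h = ε(h) 1`. -/
  act_one : ∀ h : H, act h 1 = algebraMap k A (Coalgebra.counit h)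
  /-- `a^1 = a`. -/
  one_act : ∀ a : A, act 1 a = a
  mul_assoc : ∀ x y z : A ⊗[k] H,
    crossedMul act f (crossedMul act f (x ⊗ₜ[k] y) ⊗ₜ[k] z) =
      crossedMul act f (x ⊗ₜ[k] crossedMul act f (y ⊗ₜ[k] z))
  one_mul : ∀ x : A ⊗[k] H, crossedMul act f (((1 : A) ⊗ₜ[k] (1 : H)) ⊗ₜ[k] x) = x
  mul_one : ∀ x : A ⊗[k] H, crossedMul act f (x ⊗ₜ[k] ((1 : A) ⊗ₜ[k] (1 : H))) = x

namespace CrossedSystem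

variable {k A H : Type u} [CommRing k] [Ring A] [Algebra k A] [Ring H] [HopfAlgebra k H]
variable (D : CrossedSystem k A H)

/-- The underlying module `A ⊗ H` of the crossed product `E = A #_f H`. -/
def E (_D : CrossedSystem k A H) : Type u := A ⊗[k] H

instance : AddCommGroup D.E := inferInstanceAs (AddCommGroup (A ⊗[k] H))

instance : Module k D.E := inferInstanceAs (Module k (A ⊗[k] H))

/-- The identification `A ⊗ H = E`, `a ⊗ h ↦ a # h`. -/
def toE : A ⊗[k] H ≃ₗ[k] D.E := LinearEquiv.refl k (A ⊗[k] H)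

/-- The ring `E = A #_f H`. -/
instance : Ring D.E :=
  { (inferInstance : AddCommGroup D.E) with
    mul := fun x y => D.toE (crossedMul D.act D.f (D.toE.symm x ⊗ₜ[k] D.toE.symm y))
    one := D.toE ((1 : A) ⊗ₜ[k] (1 : H))
    left_distrib := fun x y z => by
      change D.toE (crossedMul D.act D.f (D.toE.symm x ⊗ₜ[k] D.toE.symm (y + z))) =
        D.toE (crossedMul D.act D.f (D.toE.symm x ⊗ₜ[k] D.toE.symm y)) +
          D.toE (crossedMul D.act D.f (D.toE.symm x ⊗ₜ[k] D.toE.symm z))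
      rw [map_add, TensorProduct.tmul_add, map_add, map_add]
    right_distrib := fun x y z => by
      change D.toE (crossedMul D.act D.f (D.toE.symm (x + y) ⊗ₜ[k] D.toE.symm z)) =
        D.toE (crossedMul D.act D.f (D.toE.symm x ⊗ₜ[k] D.toE.symm z)) +
          D.toE (crossedMul D.act D.f (D.toE.symm y ⊗ₜ[k] D.toE.symm z))
      rw [map_add, TensorProduct.add_tmul, map_add, map_add]
    zero_mul := fun x => by
      change D.toE (crossedMul D.act D.f (D.toE.symm 0 ⊗ₜ[k] D.toE.symm x)) = 0
      rw [map_zero, TensorProduct.zero_tmul, map_zero, map_zero]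
    mul_zero := fun x => by
      change D.toE (crossedMul D.act D.f (D.toE.symm x ⊗ₜ[k] D.toE.symm 0)) = 0
      rw [map_zero, TensorProduct.tmul_zero, map_zero, map_zero]
    mul_assoc := fun x y z => D.mul_assoc x y z
    one_mul := fun x => D.one_mul x
    mul_one := fun x => D.mul_one x }

/-- The `k`-algebra `E = A #_f H`. -/
instance : Algebra k D.E :=
  Algebra.ofModule
    (fun c x y => by
      change D.toE (crossedMul D.act D.f (D.toE.symm (c • x) ⊗ₜ[k] D.toE.symm y)) =
        c • D.toE (crossedMul D.act D.f (D.toE.symm x ⊗ₜ[k] D.toE.symm y))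
      rw [map_smul, ← TensorProduct.smul_tmul', map_smul, map_smul])
    (fun c x y => by
      change D.toE (crossedMul D.act D.f (D.toE.symm x ⊗ₜ[k] D.toE.symm (c • y))) =
        c • D.toE (crossedMul D.act D.f (D.toE.symm x ⊗ₜ[k] D.toE.symm y))
      rw [map_smul, TensorProduct.tmul_smul, map_smul, map_smul])

/-- `A → E`, `a ↦ a # 1`. -/
def incl : A →ₗ[k] D.E := D.toE.toLinearMap ∘ₗ (TensorProduct.mk k A H).flip 1

/-- `H → E`, `h ↦ 1 # h`. -/
def gam : H →ₗ[k] D.E := D.toE.toLinearMap ∘ₗ TensorProduct.mk k A H 1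

/-- The cocycle `f : H ⊗ H → A` is convolution invertible. -/
def InvertibleCocycle : Prop := IsUnit (WithConv.toConv D.f)

variable {D}

/-- The convolution inverse `f⁻¹ : H ⊗ H → A` of an invertible cocycle. -/
def fInv (hf : D.InvertibleCocycle) : H ⊗[k] H →ₗ[k] A :=
  WithConv.ofConv (↑(IsUnit.unit hf)⁻¹ : WithConv (H ⊗[k] H →ₗ[k] A))

/-- `h ↦ (1 # h)⁻¹ = f⁻¹(S(h⁽²⁾), h⁽³⁾) # S(h⁽¹⁾)`, the convolution inverse of `h ↦ 1 # h`. -/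
def gamInv (hf : D.InvertibleCocycle) : H →ₗ[k] D.E :=
  D.toE.toLinearMap ∘ₗ (TensorProduct.comm k H A).toLinearMap
    ∘ₗ TensorProduct.map (HopfAlgebra.antipode k)
        (fInv hf ∘ₗ LinearMap.rTensor H (HopfAlgebra.antipode k) ∘ₗ Coalgebra.comul)
    ∘ₗ Coalgebra.comul

variable (D)

/-- `h₁ ⊗ ⋯ ⊗ h_s ↦ (1 # h₁) ⋯ (1 # h_s)`. -/
def gamPow (s : ℕ) : TPow k H s →ₗ[k] D.E := prodPow s ∘ₗ powMap D.gam s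

/-- The iterated weak action `a^{𝐡̄} = (⋯ (a^{h_s})^{h_{s-1}} ⋯)^{h₁}` of `𝐡 = h₁ ⊗ ⋯ ⊗ h_s`. -/
def actPow : (s : ℕ) → TPow k H s →ₗ[k] A →ₗ[k] A
  | 0 => LinearMap.lsmul k A ∘ₗ nil.symm.toLinearMap
  | s + 1 => TensorProduct.lift ((LinearMap.llcomp k A A A).compl₁₂ D.act (actPow s))
      ∘ₗ cons.symm.toLinearMap

/-- For `0 ≤ j ≤ s`, the map sending `h₁ ⊗ ⋯ ⊗ h_{s+2}` to
`f(h_{j+1}⁽¹⁾, h_{j+2}⁽¹⁾)^{𝐡̄⁽¹⁾} ⊗ (𝐡⁽²⁾ ⊗ h_{j+1}⁽²⁾ h_{j+2}⁽²⁾ ⊗ h_{j+3} ⊗ ⋯ ⊗ h_{s+2})`,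
where `𝐡 = h₁ ⊗ ⋯ ⊗ h_j`. -/
def mergeAt : (j s : ℕ) → TPow k H (s + 2) →ₗ[k] A ⊗[k] TPow k H (s + 1)
  | 0, s => LinearMap.lTensor A cons.toLinearMap
      ∘ₗ (TensorProduct.assoc k A H (TPow k H s)).toLinearMap
      ∘ₗ LinearMap.rTensor (TPow k H s) (cocycleMul D.f)
      ∘ₗ (TensorProduct.assoc k H H (TPow k H s)).symm.toLinearMap
      ∘ₗ LinearMap.lTensor H cons.symm.toLinearMap ∘ₗ cons.symm.toLinearMap
  | j + 1, s + 1 => LinearMap.lTensor A cons.toLinearMap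
      ∘ₗ actPast D.act (TPow k H (s + 1))
      ∘ₗ LinearMap.lTensor H (mergeAt j s) ∘ₗ cons.symm.toLinearMap
  | _ + 1, 0 => 0

/-- `h₁ ⊗ ⋯ ⊗ h_{s+1} ↦ ∑_{i=1}^{s} (-1)^i f(h_i⁽¹⁾, h_{i+1}⁽¹⁾)^{𝐡̄_{1,i-1}⁽¹⁾} ⊗
  (𝐡_{1,i-1}⁽²⁾ ⊗ h_i⁽²⁾ h_{i+1}⁽²⁾ ⊗ h_{i+2} ⊗ ⋯ ⊗ h_{s+1})`,
where `𝐡_{1,i-1} = h₁ ⊗ ⋯ ⊗ h_{i-1}`. -/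
def mergeSum : (s : ℕ) → TPow k H (s + 1) →ₗ[k] A ⊗[k] TPow k H s
  | 0 => 0
  | s + 1 => ∑ j ∈ Finset.range (s + 1), (-1 : k) ^ (j + 1) • D.mergeAt j s

/-- For a map `G`, the map
`𝐡 ⊗ 𝐚 ↦ ∑_{j=1}^{l+1} (-1)^j f(h_j⁽¹⁾, h_{j+1}⁽¹⁾)^{𝐡̄_{1,j-1}⁽¹⁾} ⊗
  G((𝐡_{1,j-1}⁽²⁾ ⊗ h_j⁽²⁾ h_{j+1}⁽²⁾ ⊗ h_{j+2} ⊗ ⋯ ⊗ h_{l+2}) ⊗ 𝐚)`,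
where `𝐡 = h₁ ⊗ ⋯ ⊗ h_{l+2}`. -/
def FMerge {l r n : ℕ} (G : TPow k H (l + 1) ⊗[k] TPow k A r →ₗ[k] TPow k A n) :
    TPow k H (l + 2) ⊗[k] TPow k A r →ₗ[k] TPow k A (n + 1) :=
  cons.toLinearMap ∘ₗ LinearMap.lTensor A G
    ∘ₗ (TensorProduct.assoc k A (TPow k H (l + 1)) (TPow k A r)).toLinearMap
    ∘ₗ LinearMap.rTensor (TPow k A r) (D.mergeSum (l + 1))

/-- For a map `G`, the map `𝐡 ⊗ (a₁ ⊗ ⋯ ⊗ a_{r+1}) ↦ a₁^{𝐡̄⁽¹⁾} ⊗ G(𝐡⁽²⁾ ⊗ (a₂ ⊗ ⋯ ⊗ a_{r+1}))`. -/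
def FAct {s r n : ℕ} (G : TPow k H s ⊗[k] TPow k A r →ₗ[k] TPow k A n) :
    TPow k H s ⊗[k] TPow k A (r + 1) →ₗ[k] TPow k A (n + 1) :=
  cons.toLinearMap ∘ₗ LinearMap.lTensor A G ∘ₗ actPast (D.actPow s) (TPow k A r)
    ∘ₗ LinearMap.lTensor (TPow k H s) cons.symm.toLinearMap

/-- The maps `F_r^{(l+1)} : H^{⊗ (l+1)} ⊗ A^{⊗ r} → A^{⊗ (r+l)}`, written `D.F (r + l) l r`
(`D.F n l r` is `0` if `n ≠ r + l`). They are determined by `F_r^{(1)}(h ⊗ 𝐚) = 𝐚^h` and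
`F_r^{(l+1)}(𝐡 ⊗ 𝐚) = ∑_{j=1}^{l} ∑_{i=0}^{r} (-1)^{i l + j} (a₁ ⊗ ⋯ ⊗ a_i)^{𝐡̄⁽¹⁾} ⊗
  f(h_j⁽²⁾, h_{j+1}⁽²⁾)^{𝐡̄_{1,j-1}⁽²⁾} ⊗
  F_{r-i}^{(l)}((𝐡_{1,j-1}⁽³⁾ ⊗ h_j⁽³⁾ h_{j+1}⁽³⁾ ⊗ 𝐡_{j+2,l+1}⁽²⁾) ⊗ (a_{i+1} ⊗ ⋯ ⊗ a_r))`,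
where `(a₁ ⊗ ⋯ ⊗ a_i)^{𝐡̄} = a₁^{𝐡̄⁽¹⁾} ⊗ ⋯ ⊗ a_i^{𝐡̄⁽ⁱ⁾}`, which is `ε(𝐡)` for `i = 0`.
The term `i = 0` is given by `FMerge`. Since `𝐡 ↦ 𝐡⁽¹⁾ ⊗ 𝐡⁽²⁾` is coassociative, the terms with
`i ≥ 1` add up to `(-1)^l a₁^{𝐡̄⁽¹⁾} ⊗ F_{r-1}^{(l+1)}(𝐡⁽²⁾ ⊗ (a₂ ⊗ ⋯ ⊗ a_r))`, which is given by
`FAct`. The same recursion with `l = 0` (no terms `FMerge`) is `F_r^{(1)}(h ⊗ 𝐚) = 𝐚^h`, which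
is `ε(h)` for `r = 0`. -/
def F : (n l r : ℕ) → TPow k H (l + 1) ⊗[k] TPow k A r →ₗ[k] TPow k A n
  | 0, 0, 0 => (TensorProduct.lid k (TPow k A 0)).toLinearMap
      ∘ₗ LinearMap.rTensor (TPow k A 0) Coalgebra.counit
  | n + 1, l + 1, 0 => D.FMerge (F n l 0)
  | n + 1, 0, r + 1 => D.FAct (F n 0 r)
  | n + 1, l + 1, r + 1 =>
      D.FMerge (F n l (r + 1)) + (-1 : k) ^ (l + 1) • D.FAct (F n (l + 1) r)
  | 0, _ + 1, _ => 0
  | 0, _, _ + 1 => 0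
  | _ + 1, 0, 0 => 0

/-- `𝐡 ⊗ 𝐚 ↦ 𝔥⁽²⁾ ⊗ F_r^{(l+1)}(𝐡⁽¹⁾ ⊗ 𝐚)`, where `𝐡 = h₁ ⊗ ⋯ ⊗ h_{l+1}`, `n = r + l` and
`𝔥 = h₁ ⋯ h_{l+1}`. -/
def prodF (n l r : ℕ) :
    TPow k H (l + 1) ⊗[k] TPow k A r →ₗ[k] H ⊗[k] TPow k A n :=
  TensorProduct.map (prodPow (l + 1)) (D.F n l r)
    ∘ₗ (TensorProduct.assoc k (TPow k H (l + 1)) (TPow k H (l + 1)) (TPow k A r)).toLinearMap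
    ∘ₗ LinearMap.rTensor (TPow k A r)
        ((TensorProduct.comm k (TPow k H (l + 1)) (TPow k H (l + 1))).toLinearMap
          ∘ₗ Coalgebra.comul)

/-! ### The differentials on representatives

The complexes have components `M ⊗ H̄^{⊗ s} ⊗ Ā^{⊗ r}` and `M ⊗ Ā^{⊗ r} ⊗ H̄^{⊗ s}` with
`H̄ = H / k·1` and `Ā = A / k·1`. The formulas for their differentials, and for the isomorphism
between them, are linear maps of representatives, defined on `M ⊗ H^{⊗ s} ⊗ A^{⊗ r}` and
`M ⊗ A^{⊗ r} ⊗ H^{⊗ s}`. -/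

variable (M : Type v) [AddCommGroup M] [Module k M] [Module D.E M] [Module D.Eᵐᵒᵖ M]
variable [IsScalarTower k D.E M] [IsScalarTower k D.Eᵐᵒᵖ M]

/-- `d̂⁰` on `M ⊗ H^{⊗ s} ⊗ A^{⊗ (r+1)}`:
`m ⊗ 𝐡 ⊗ 𝐚 ↦ m a₁^{𝐡̄⁽¹⁾} ⊗ 𝐡⁽²⁾ ⊗ a₂ ⊗ ⋯ ⊗ a_{r+1}
  + ∑_{i=1}^{r} (-1)^i m ⊗ 𝐡 ⊗ a₁ ⊗ ⋯ ⊗ a_i a_{i+1} ⊗ ⋯ ⊗ a_{r+1}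
  + (-1)^{r+1} a_{r+1} m ⊗ 𝐡 ⊗ a₁ ⊗ ⋯ ⊗ a_r`. -/
def dHat0 (r s : ℕ) : M ⊗[k] (TPow k H s ⊗[k] TPow k A (r + 1)) →ₗ[k]
    M ⊗[k] (TPow k H s ⊗[k] TPow k A r) :=
  onRight M D.incl (TPow k H s ⊗[k] TPow k A r)
      ∘ₗ LinearMap.lTensor M (actPast (D.actPow s) (TPow k A r)
        ∘ₗ LinearMap.lTensor (TPow k H s) cons.symm.toLinearMap)
    + LinearMap.lTensor M (LinearMap.lTensor (TPow k H s) (innerSum r))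
    + (-1 : k) ^ (r + 1) • (onLeft M D.incl (TPow k H s ⊗[k] TPow k A r)
      ∘ₗ LinearMap.lTensor M ((TensorProduct.leftComm k (TPow k H s) A (TPow k A r)).toLinearMap
        ∘ₗ LinearMap.lTensor (TPow k H s) (unsnoc r)))

/-- With `p = l + 1`, `s = t + p` and `n = r + l` (otherwise it is `0`), on
`M ⊗ H^{⊗ s} ⊗ A^{⊗ r}`:
`m ⊗ 𝐡 ⊗ 𝐚 ↦ (-1)^{p(r+s)} (1 # 𝔥_{s-p+1,s}⁽²⁾) m ⊗ (h₁ ⊗ ⋯ ⊗ h_{s-p}) ⊗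
  F_r^{(p)}(𝐡_{s-p+1,s}⁽¹⁾ ⊗ 𝐚)`.
For `p ≥ 2` this is `d̂^p`; for `p = 1` it is the last summand of `d̂¹`. -/
def dHatL (l r s n t : ℕ) : M ⊗[k] (TPow k H s ⊗[k] TPow k A r) →ₗ[k]
    M ⊗[k] (TPow k H t ⊗[k] TPow k A n) :=
  (-1 : k) ^ ((l + 1) * (r + s)) •
    (onLeft M D.gam (TPow k H t ⊗[k] TPow k A n)
      ∘ₗ LinearMap.lTensor M
        ((TensorProduct.leftComm k (TPow k H t) H (TPow k A n)).toLinearMap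
          ∘ₗ LinearMap.lTensor (TPow k H t) (D.prodF n l r)
          ∘ₗ (TensorProduct.assoc k (TPow k H t) (TPow k H (l + 1))
              (TPow k A r)).toLinearMap
          ∘ₗ LinearMap.rTensor (TPow k A r) (split s t (l + 1))))

/-- `d̂¹` on `M ⊗ H^{⊗ (s+1)} ⊗ A^{⊗ r}`:
`m ⊗ 𝐡 ⊗ 𝐚 ↦ (-1)^r m (1 # h₁) ⊗ h₂ ⊗ ⋯ ⊗ h_{s+1} ⊗ 𝐚
  + ∑_{i=1}^{s} (-1)^{r+i} m f(h_i⁽¹⁾, h_{i+1}⁽¹⁾)^{𝐡̄_{1,i-1}⁽¹⁾} ⊗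
    𝐡_{1,i-1}⁽²⁾ ⊗ h_i⁽²⁾ h_{i+1}⁽²⁾ ⊗ h_{i+2} ⊗ ⋯ ⊗ h_{s+1} ⊗ 𝐚
  + (-1)^{r+s+1} (1 # h_{s+1}⁽²⁾) m ⊗ h₁ ⊗ ⋯ ⊗ h_s ⊗ 𝐚^{h_{s+1}⁽¹⁾}`. -/
def dHat1 (r s : ℕ) : M ⊗[k] (TPow k H (s + 1) ⊗[k] TPow k A r) →ₗ[k]
    M ⊗[k] (TPow k H s ⊗[k] TPow k A r) :=
  (-1 : k) ^ r • (onRight M D.gam (TPow k H s ⊗[k] TPow k A r)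
      ∘ₗ LinearMap.lTensor M ((TensorProduct.assoc k H (TPow k H s) (TPow k A r)).toLinearMap
        ∘ₗ LinearMap.rTensor (TPow k A r) cons.symm.toLinearMap))
    + (-1 : k) ^ r • (onRight M D.incl (TPow k H s ⊗[k] TPow k A r)
      ∘ₗ LinearMap.lTensor M ((TensorProduct.assoc k A (TPow k H s) (TPow k A r)).toLinearMap
        ∘ₗ LinearMap.rTensor (TPow k A r) (D.mergeSum s)))
    + D.dHatL M 0 r (s + 1) r s

/-- `d̄⁰` on `M ⊗ A^{⊗ (r+1)} ⊗ H^{⊗ s}`: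
`m ⊗ 𝐚 ⊗ 𝐡 ↦ m a₁ ⊗ a₂ ⊗ ⋯ ⊗ a_{r+1} ⊗ 𝐡
  + ∑_{i=1}^{r} (-1)^i m ⊗ a₁ ⊗ ⋯ ⊗ a_i a_{i+1} ⊗ ⋯ ⊗ a_{r+1} ⊗ 𝐡
  + (-1)^{r+1} a_{r+1} m ⊗ a₁ ⊗ ⋯ ⊗ a_r ⊗ 𝐡`. -/
def dBar0 (r s : ℕ) : M ⊗[k] (TPow k A (r + 1) ⊗[k] TPow k H s) →ₗ[k]
    M ⊗[k] (TPow k A r ⊗[k] TPow k H s) :=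
  (TensorProduct.assoc k M (TPow k A r) (TPow k H s)).toLinearMap
    ∘ₗ LinearMap.rTensor (TPow k H s) (hochB M D.incl r)
    ∘ₗ (TensorProduct.assoc k M (TPow k A (r + 1)) (TPow k H s)).symm.toLinearMap

variable {D} in
/-- With `p = l + 1`, `s = t + p` and `n = r + l` (otherwise it is `0`), on
`M ⊗ A^{⊗ r} ⊗ H^{⊗ s}`:
`m ⊗ 𝐚 ⊗ 𝐡 ↦ (-1)^{p(r+s)} (1 # 𝔥_{s-p+1,s}⁽³⁾) m (1 # h_s⁽¹⁾)⁻¹ ⋯ (1 # h_{s-p+1}⁽¹⁾)⁻¹ ⊗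
  F_r^{(p)}(𝐡_{s-p+1,s}⁽²⁾ ⊗ 𝐚) ⊗ (h₁ ⊗ ⋯ ⊗ h_{s-p})`.
For `p ≥ 2` this is `d̄^p`; for `p = 1` it is the last summand of `d̄¹`. -/
def dBarL (hf : D.InvertibleCocycle) (l r s n t : ℕ) :
    M ⊗[k] (TPow k A r ⊗[k] TPow k H s) →ₗ[k]
      M ⊗[k] (TPow k A n ⊗[k] TPow k H t) :=
  (-1 : k) ^ ((l + 1) * (r + s)) •
    (LinearMap.lTensor M
        (TensorProduct.comm k (TPow k H t) (TPow k A n)).toLinearMap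
      ∘ₗ onLeft M D.gam (TPow k H t ⊗[k] TPow k A n)
      ∘ₗ LinearMap.lTensor M
        (TensorProduct.leftComm k (TPow k H t) H (TPow k A n)).toLinearMap
      ∘ₗ onRight M (revProd (gamInv hf) (l + 1))
        (TPow k H t ⊗[k] (H ⊗[k] TPow k A n))
      ∘ₗ LinearMap.lTensor M
        ((TensorProduct.leftComm k (TPow k H t) (TPow k H (l + 1))
            (H ⊗[k] TPow k A n)).toLinearMap
          ∘ₗ LinearMap.lTensor (TPow k H t)
            (LinearMap.lTensor (TPow k H (l + 1)) (D.prodF n l r)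
              ∘ₗ (TensorProduct.assoc k (TPow k H (l + 1)) (TPow k H (l + 1))
                  (TPow k A r)).toLinearMap
              ∘ₗ LinearMap.rTensor (TPow k A r) Coalgebra.comul)
          ∘ₗ (TensorProduct.assoc k (TPow k H t) (TPow k H (l + 1))
              (TPow k A r)).toLinearMap
          ∘ₗ LinearMap.rTensor (TPow k A r) (split s t (l + 1))
          ∘ₗ (TensorProduct.comm k (TPow k A r) (TPow k H s)).toLinearMap))

variable {D} in
/-- `d̄¹` on `M ⊗ A^{⊗ r} ⊗ H^{⊗ (s+1)}`:
`m ⊗ 𝐚 ⊗ 𝐡 ↦ (-1)^r m ε(h₁) ⊗ 𝐚 ⊗ h₂ ⊗ ⋯ ⊗ h_{s+1}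
  + ∑_{i=1}^{s} (-1)^{r+i} m ⊗ 𝐚 ⊗ h₁ ⊗ ⋯ ⊗ h_i h_{i+1} ⊗ ⋯ ⊗ h_{s+1}
  + (-1)^{r+s+1} (1 # h_{s+1}⁽³⁾) m (1 # h_{s+1}⁽¹⁾)⁻¹ ⊗ 𝐚^{h_{s+1}⁽²⁾} ⊗ h₁ ⊗ ⋯ ⊗ h_s`. -/
def dBar1 (hf : D.InvertibleCocycle) (r s : ℕ) :
    M ⊗[k] (TPow k A r ⊗[k] TPow k H (s + 1)) →ₗ[k] M ⊗[k] (TPow k A r ⊗[k] TPow k H s) :=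
  (-1 : k) ^ r • LinearMap.lTensor M (LinearMap.lTensor (TPow k A r)
      ((TensorProduct.lid k (TPow k H s)).toLinearMap
        ∘ₗ LinearMap.rTensor (TPow k H s) Coalgebra.counit ∘ₗ cons.symm.toLinearMap))
    + (-1 : k) ^ r • LinearMap.lTensor M (LinearMap.lTensor (TPow k A r) (innerSum s))
    + dBarL M hf 0 r (s + 1) r s

/-- `m ⊗ 𝐡 ⊗ 𝐚 ↦ m (1 # h₁⁽¹⁾) ⋯ (1 # h_s⁽¹⁾) ⊗ 𝐚 ⊗ 𝐡⁽²⁾`. -/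
def thetaRS (r s : ℕ) : M ⊗[k] (TPow k H s ⊗[k] TPow k A r) →ₗ[k]
    M ⊗[k] (TPow k A r ⊗[k] TPow k H s) :=
  LinearMap.lTensor M (TensorProduct.comm k (TPow k H s) (TPow k A r)).toLinearMap
    ∘ₗ onRight M (D.gamPow s) (TPow k H s ⊗[k] TPow k A r)
    ∘ₗ LinearMap.lTensor M ((TensorProduct.assoc k (TPow k H s) (TPow k H s)
          (TPow k A r)).toLinearMap
        ∘ₗ LinearMap.rTensor (TPow k A r) Coalgebra.comul)

end CrossedSystem

/-! ### The total complexes -/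

section Total

variable {k : Type u} [CommRing k]

/-- The pairs `(r, s)` with `r + s = n`. -/
abbrev Bideg (n : ℕ) : Type := {p : ℕ × ℕ // p.1 + p.2 = n}

variable (k) (V W : Type u) [AddCommGroup V] [Module k V] [AddCommGroup W] [Module k W]
variable (M : Type v) [AddCommGroup M] [Module k M]

/-- `⨁_{r+s=n} M ⊗ W^{⊗ s} ⊗ V^{⊗ r}`. For `V = Ā` and `W = H̄` this is `X̂_n(E, M)`. -/
abbrev XHat (n : ℕ) : Type (max u v) :=
  DirectSum (Bideg n) fun p => M ⊗[k] (TPow k W p.1.2 ⊗[k] TPow k V p.1.1)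

/-- `⨁_{r+s=n} M ⊗ V^{⊗ r} ⊗ W^{⊗ s}`. For `V = Ā` and `W = H̄` this is `X̄_n(E, M)`. -/
abbrev XBar (n : ℕ) : Type (max u v) :=
  DirectSum (Bideg n) fun p => M ⊗[k] (TPow k V p.1.1 ⊗[k] TPow k W p.1.2)

/-- The class map `⨁ M ⊗ H^{⊗ s} ⊗ A^{⊗ r} → X̂_n(E, M)`. -/
def clsHat (A H : Type u) [Ring A] [Algebra k A] [Ring H] [Algebra k H] (n : ℕ) :
    XHat k A H M n →ₗ[k] XHat k (Red k A) (Red k H) M n :=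
  DirectSum.lmap fun p => LinearMap.lTensor M
    (TensorProduct.map (powMap (red k H) p.1.2) (powMap (red k A) p.1.1))

/-- The class map `⨁ M ⊗ A^{⊗ r} ⊗ H^{⊗ s} → X̄_n(E, M)`. -/
def clsBar (A H : Type u) [Ring A] [Algebra k A] [Ring H] [Algebra k H] (n : ℕ) :
    XBar k A H M n →ₗ[k] XBar k (Red k A) (Red k H) M n :=
  DirectSum.lmap fun p => LinearMap.lTensor M
    (TensorProduct.map (powMap (red k A) p.1.1) (powMap (red k H) p.1.2))

variable {k V W}

/-- The inclusion of the component of bidegree `(r, s)`. -/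
def toHat {n : ℕ} (r s : ℕ) (h : r + s = n) :
    M ⊗[k] (TPow k W s ⊗[k] TPow k V r) →ₗ[k] XHat k V W M n :=
  DirectSum.lof k (Bideg n) (fun p => M ⊗[k] (TPow k W p.1.2 ⊗[k] TPow k V p.1.1)) ⟨(r, s), h⟩

/-- The inclusion of the component of bidegree `(r, s)`. -/
def toBar {n : ℕ} (r s : ℕ) (h : r + s = n) :
    M ⊗[k] (TPow k V r ⊗[k] TPow k W s) →ₗ[k] XBar k V W M n :=
  DirectSum.lof k (Bideg n) (fun p => M ⊗[k] (TPow k V p.1.1 ⊗[k] TPow k W p.1.2)) ⟨(r, s), h⟩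

end Total

namespace CrossedSystem

variable {k A H : Type u} [CommRing k] [Ring A] [Algebra k A] [Ring H] [HopfAlgebra k H]
variable (D : CrossedSystem k A H)
variable (M : Type v) [AddCommGroup M] [Module k M] [Module D.E M] [Module D.Eᵐᵒᵖ M]
variable [IsScalarTower k D.E M] [IsScalarTower k D.Eᵐᵒᵖ M]

/-- `d̂⁰` on the component of bidegree `(r, s)` (it is absent for `r = 0`). -/
def dHatFrom0 (n : ℕ) : (r s : ℕ) → r + s = n + 1 →
    (M ⊗[k] (TPow k H s ⊗[k] TPow k A r) →ₗ[k] XHat k A H M n)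
  | 0, _, _ => 0
  | r + 1, s, h => toHat M r s (by omega) ∘ₗ D.dHat0 M r s

/-- `d̂¹` on the component of bidegree `(r, s)` (it is absent for `s = 0`). -/
def dHatFrom1 (n : ℕ) : (r s : ℕ) → r + s = n + 1 →
    (M ⊗[k] (TPow k H s ⊗[k] TPow k A r) →ₗ[k] XHat k A H M n)
  | _, 0, _ => 0
  | r, s + 1, h => toHat M r s (by omega) ∘ₗ D.dHat1 M r s

/-- The total differential `d̂_{n+1} = ∑_{r+s=n+1} ∑_{l=0}^{s} d̂^l` (with `r + l > 0`) on
representatives; the summand with index `i` is `d̂^l` for `l = i + 2`. -/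
def dHat (n : ℕ) : XHat k A H M (n + 1) →ₗ[k] XHat k A H M n :=
  DirectSum.toModule k (Bideg (n + 1)) (XHat k A H M n) fun p =>
    D.dHatFrom0 M n p.1.1 p.1.2 p.2 + D.dHatFrom1 M n p.1.1 p.1.2 p.2
      + ∑ i : Fin (p.1.2 - 1),
        toHat M (p.1.1 + (i + 1)) (p.1.2 - (i + 1 + 1))
          (by have h₁ := p.2; have h₂ := i.2; omega) ∘ₗ D.dHatL M (i + 1) p.1.1 p.1.2 _ _

/-- `d̄⁰` on the component of bidegree `(r, s)` (it is absent for `r = 0`). -/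
def dBarFrom0 (n : ℕ) : (r s : ℕ) → r + s = n + 1 →
    (M ⊗[k] (TPow k A r ⊗[k] TPow k H s) →ₗ[k] XBar k A H M n)
  | 0, _, _ => 0
  | r + 1, s, h => toBar M r s (by omega) ∘ₗ D.dBar0 M r s

variable {D} in
/-- `d̄¹` on the component of bidegree `(r, s)` (it is absent for `s = 0`). -/
def dBarFrom1 (hf : D.InvertibleCocycle) (n : ℕ) : (r s : ℕ) → r + s = n + 1 →
    (M ⊗[k] (TPow k A r ⊗[k] TPow k H s) →ₗ[k] XBar k A H M n)
  | _, 0, _ => 0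
  | r, s + 1, h => toBar M r s (by omega) ∘ₗ dBar1 M hf r s

variable {D} in
/-- The total differential `d̄_{n+1} = ∑_{r+s=n+1} ∑_{l=0}^{s} d̄^l` (with `r + l > 0`) on
representatives; the summand with index `i` is `d̄^l` for `l = i + 2`. -/
def dBar (hf : D.InvertibleCocycle) (n : ℕ) : XBar k A H M (n + 1) →ₗ[k] XBar k A H M n :=
  DirectSum.toModule k (Bideg (n + 1)) (XBar k A H M n) fun p =>
    D.dBarFrom0 M n p.1.1 p.1.2 p.2 + dBarFrom1 M hf n p.1.1 p.1.2 p.2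
      + ∑ i : Fin (p.1.2 - 1),
        toBar M (p.1.1 + (i + 1)) (p.1.2 - (i + 1 + 1))
          (by have h₁ := p.2; have h₂ := i.2; omega) ∘ₗ dBarL M hf (i + 1) p.1.1 p.1.2 _ _

/-- The map `θ_n` on representatives:
`m ⊗ 𝐡 ⊗ 𝐚 ↦ m (1 # h₁⁽¹⁾) ⋯ (1 # h_s⁽¹⁾) ⊗ 𝐚 ⊗ 𝐡⁽²⁾`. -/
def theta (n : ℕ) : XHat k A H M n →ₗ[k] XBar k A H M n :=
  DirectSum.lmap fun p => D.thetaRS M p.1.1 p.1.2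

end CrossedSystem

end

end HopfCrossed

-- Most of the argument uses only one property of the crossed product: `a ⊗ h ↦ (a # 1)(1 # h)` is a
-- bijection from `A ⊗ H` to `E` (`Factorization`). Elements of `X̂` are treated as words: letters
-- of `H` in front, then letters of `A`, then an element of the bimodule, the tail. Three operators
-- act on words. `L` brings one element of `E` out at the front: a letter `a` of `A` simply comes
-- out, and `L (h v) = h ⊗ v - ins (h · L v)`, where `ins` writes an element of `E` as a sum of
-- products `a' h'` and puts `h'` back in front of the word. `I` multiplies adjacent letters of `A`.
-- `rho` lets elements travel to the right end, where they act on the tail from the left. The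
-- relations `L L + I L + L I = 0` (`L_L`), `L rho = rho L` (`L_rho`) and `rho_rho`, all proved by
-- induction on the length, say precisely that "`L` followed by the right action on the tail, plus
-- `I ± rho`" is a differential (`d_d`). Iterating `L` gives a chain map `Phi` to the Hochschild
-- complex (`b_Phi`).
--
-- The homology is compared by dimension shifting. For a bimodule `E ⊗ N'`, free on the left, the
-- Hochschild complex and the complexes of words (reduced and unreduced) are exact in positive
-- degrees, and in degree zero the boundaries form the kernel of `e ⊗ x ↦ x e`. For words there is a
-- homotopy whose defect `T` strictly lowers the number of letters of `H`, so it is nilpotent on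
-- words of given length (`lTensor_trunc_T`, `exists_d_eq`). An arbitrary bimodule `N` sits in `0 →
-- ker → E ⊗ N → N → 0`, which splits over `k` and therefore stays exact on words; `Lifts.succ`
-- moves exactness of the mapping cone up by one degree. This is applied twice: to `Phi`, and to the
-- passage to `A / k·1` and `H / k·1`, which is legitimate because the differential respects classes
-- (`cls_descent`).
--
-- It remains to recognise the formulas. On elementary words `LA` is merging two letters of `H` at
-- the price of `f`, or moving the first letter of `A` past all letters of `H` (`LA_wrd`); iterating
-- it up to the tail reproduces the recursion of the maps `F` (`rho0_wrd`). With the sign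
-- `(-1)^{rs}` on bidegree `(r, s)` the differential becomes the given `d̂` (`Jn_dHat`).
--
-- For `θ`, the map `h ↦ 1 # h` is convolution invertible. That the given formula is a one-sided
-- inverse follows from the relation between `f` and the product of `E`, together with the fact that
-- the antipode reverses the comultiplication (`conv_gamInv_gam`). The other side follows because
-- `(a # g) ⊗ h ↦ (a # g)(1 # h⁽¹⁾) ⊗ h⁽²⁾` is injective, being composed of the invertible maps
-- attached to `f` and to the identity of `H` (`sh_gamInv_gam`). Iterating over the letters shows
-- that `θ` is bijective, on representatives and on classes. Multiplying by `(1 # h₁⁽¹⁾) ⋯ (1 #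
-- h_s⁽¹⁾)` absorbs the action, the cocycle and the inverses `(1 # h)⁻¹`, so `θ` carries the
-- formulas for `d̂` to those for `d̄` (`dBar_theta`). The statements about `d̄` are then
-- transported from `d̂`.

universe w w'

open scoped TensorProduct

namespace HopfCrossed

noncomputable section

/-! ### Words -/

section Words

variable (k : Type u) [CommRing k]

/-- The module `B^{⊗ n} ⊗ N` of words `b₁ ⊗ ⋯ ⊗ b_n ⊗ x`. -/
def Wd (B : Type u) [AddCommGroup B] [Module k B] (N : Type w) [AddCommGroup N] [Module k N] :
    ℕ → ModuleCat.{max u w} k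
  | 0 => ModuleCat.of k (ULift.{u} N)
  | n + 1 => ModuleCat.of k (B ⊗[k] Wd B N n)

/-- The module `⨁_{r+s=n} C^{⊗ s} ⊗ B^{⊗ r} ⊗ N` of words `c₁ ⊗ ⋯ ⊗ c_s ⊗ b₁ ⊗ ⋯ ⊗ b_r ⊗ x`. -/
def HW (B C : Type u) [AddCommGroup B] [Module k B] [AddCommGroup C] [Module k C] (N : Type w)
    [AddCommGroup N] [Module k N] : ℕ → ModuleCat.{max u w} k
  | 0 => Wd k B N 0
  | n + 1 => ModuleCat.of k (Wd k B N (n + 1) × (C ⊗[k] HW B C N n))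

variable {k}
variable {B B' B'' C C' C'' : Type u} [AddCommGroup B] [Module k B] [AddCommGroup B'] [Module k B']
variable [AddCommGroup C] [Module k C] [AddCommGroup C'] [Module k C']
variable {N : Type w} [AddCommGroup N] [Module k N] {N' : Type w'} [AddCommGroup N'] [Module k N']
variable {Q : Type v} [AddCommGroup Q] [Module k Q]

/-- The empty word. -/
def Wd.nil : N ≃ₗ[k] Wd k B N 0 := ULift.moduleEquiv.symm

/-- Prepending a letter. -/
def Wd.cons {n : ℕ} : B ⊗[k] Wd k B N n ≃ₗ[k] Wd k B N (n + 1) :=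
  LinearEquiv.refl k (B ⊗[k] Wd k B N n)

theorem Wd.hom_ext {n : ℕ} {f g : Wd k B N (n + 1) →ₗ[k] Q}
    (h : ∀ b w, f (Wd.cons (b ⊗ₜ w)) = g (Wd.cons (b ⊗ₜ w))) : f = g := by
  have : f ∘ₗ Wd.cons.toLinearMap = g ∘ₗ Wd.cons.toLinearMap := TensorProduct.ext' h
  ext x
  exact LinearMap.congr_fun this (Wd.cons.symm x)

theorem Wd.hom_ext₂ {n : ℕ} {f g : Wd k B N (n + 2) →ₗ[k] Q}
    (h : ∀ a b w, f (Wd.cons (a ⊗ₜ Wd.cons (b ⊗ₜ w))) = g (Wd.cons (a ⊗ₜ Wd.cons (b ⊗ₜ w)))) :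
    f = g := by
  refine Wd.hom_ext fun a w => ?_
  have : f ∘ₗ Wd.cons.toLinearMap ∘ₗ TensorProduct.mk k _ _ a =
      g ∘ₗ Wd.cons.toLinearMap ∘ₗ TensorProduct.mk k _ _ a := Wd.hom_ext fun b w => h a b w
  exact LinearMap.congr_fun this w

theorem Wd.hom_ext₃ {n : ℕ} {f g : Wd k B N (n + 3) →ₗ[k] Q}
    (h : ∀ a b c w, f (Wd.cons (a ⊗ₜ Wd.cons (b ⊗ₜ Wd.cons (c ⊗ₜ w)))) =
      g (Wd.cons (a ⊗ₜ Wd.cons (b ⊗ₜ Wd.cons (c ⊗ₜ w))))) :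
    f = g := by
  refine Wd.hom_ext fun a w => ?_
  have : f ∘ₗ Wd.cons.toLinearMap ∘ₗ TensorProduct.mk k _ _ a =
      g ∘ₗ Wd.cons.toLinearMap ∘ₗ TensorProduct.mk k _ _ a := Wd.hom_ext₂ fun b c w => h a b c w
  exact LinearMap.congr_fun this w

namespace HW

/-- Words in `B` as mixed words. -/
def aw : {n : ℕ} → Wd k B N n →ₗ[k] HW k B C N n
  | 0 => LinearMap.id
  | n + 1 => LinearMap.inl k (Wd k B N (n + 1)) (C ⊗[k] HW k B C N n)

/-- Prepending a letter in `C`. -/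
def hv {n : ℕ} : C ⊗[k] HW k B C N n →ₗ[k] HW k B C N (n + 1) :=
  LinearMap.inr k (Wd k B N (n + 1)) (C ⊗[k] HW k B C N n)

/-- The component of the words without letters in `C`. -/
def fst : {n : ℕ} → HW k B C N n →ₗ[k] Wd k B N n
  | 0 => LinearMap.id
  | n + 1 => LinearMap.fst k (Wd k B N (n + 1)) (C ⊗[k] HW k B C N n)

/-- The component of the words starting with a letter in `C`. -/
def snd {n : ℕ} : HW k B C N (n + 1) →ₗ[k] C ⊗[k] HW k B C N n :=
  LinearMap.snd k (Wd k B N (n + 1)) (C ⊗[k] HW k B C N n)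

@[simp] theorem fst_aw {n : ℕ} (w : Wd k B N n) : fst (aw (C := C) w) = w := by
  cases n <;> rfl

@[simp] theorem snd_aw {n : ℕ} (w : Wd k B N (n + 1)) : snd (aw (C := C) w) = 0 := rfl

@[simp] theorem fst_hv {n : ℕ} (x : C ⊗[k] HW k B C N n) : fst (hv x) = 0 := rfl

@[simp] theorem snd_hv {n : ℕ} (x : C ⊗[k] HW k B C N n) : snd (hv x) = x := rfl

theorem aw_fst_add_hv_snd {n : ℕ} (v : HW k B C N (n + 1)) : aw (fst v) + hv (snd v) = v := by
  refine Prod.ext ?_ ?_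
  · exact add_zero _
  · exact zero_add _

theorem ext_iff' {n : ℕ} {v v' : HW k B C N (n + 1)} :
    v = v' ↔ fst v = fst v' ∧ snd v = snd v' := Prod.ext_iff

theorem aw_zero_surj (v : HW k B C N 0) : aw (fst v) = v := rfl

theorem hom_ext {n : ℕ} {f g : HW k B C N (n + 1) →ₗ[k] Q}
    (h₁ : ∀ b w, f (aw (Wd.cons (b ⊗ₜ w))) = g (aw (Wd.cons (b ⊗ₜ w))))
    (h₂ : ∀ h v, f (hv (h ⊗ₜ v)) = g (hv (h ⊗ₜ v))) : f = g := by
  have e₁ : f ∘ₗ aw = g ∘ₗ aw := Wd.hom_ext h₁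
  have e₂ : f ∘ₗ hv = g ∘ₗ hv := TensorProduct.ext' h₂
  ext v
  rw [← aw_fst_add_hv_snd v, map_add, map_add]
  exact congrArg₂ _ (LinearMap.congr_fun e₁ _) (LinearMap.congr_fun e₂ _)

theorem hom_ext₂ {n : ℕ} {f g : HW k B C N (n + 2) →ₗ[k] Q}
    (h₁ : ∀ a b w, f (aw (Wd.cons (a ⊗ₜ Wd.cons (b ⊗ₜ w)))) =
      g (aw (Wd.cons (a ⊗ₜ Wd.cons (b ⊗ₜ w)))))
    (h₂ : ∀ h v, f (hv (h ⊗ₜ v)) = g (hv (h ⊗ₜ v))) : f = g := by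
  have : f ∘ₗ aw = g ∘ₗ aw := Wd.hom_ext₂ h₁
  exact hom_ext (fun b w => LinearMap.congr_fun this _) h₂

theorem hom_ext' {n : ℕ} {f g : HW k B C N (n + 1) →ₗ[k] Q}
    (h₁ : ∀ w, f (aw w) = g (aw w))
    (h₂ : ∀ h v, f (hv (h ⊗ₜ v)) = g (hv (h ⊗ₜ v))) : f = g :=
  hom_ext (fun _ _ => h₁ _) h₂

end HW

/-- Words are functorial. -/
def Wd.map (β : B →ₗ[k] B') (g : N →ₗ[k] N') : (n : ℕ) → Wd k B N n →ₗ[k] Wd k B' N' n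
  | 0 => Wd.nil.toLinearMap ∘ₗ g ∘ₗ Wd.nil.symm.toLinearMap
  | n + 1 => Wd.cons.toLinearMap ∘ₗ TensorProduct.map β (Wd.map β g n) ∘ₗ Wd.cons.symm.toLinearMap

@[simp] theorem Wd.map_nil (β : B →ₗ[k] B') (g : N →ₗ[k] N') (x : N) :
    Wd.map β g 0 (Wd.nil x) = Wd.nil (g x) := rfl

@[simp] theorem Wd.map_cons (β : B →ₗ[k] B') (g : N →ₗ[k] N') (n : ℕ) (b : B) (w : Wd k B N n) :
    Wd.map β g (n + 1) (Wd.cons (b ⊗ₜ w)) = Wd.cons (β b ⊗ₜ Wd.map β g n w) := rfl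

theorem Wd.map_cons' (β : B →ₗ[k] B') (g : N →ₗ[k] N') (n : ℕ) (x : B ⊗[k] Wd k B N n) :
    Wd.map β g (n + 1) (Wd.cons x) = Wd.cons (TensorProduct.map β (Wd.map β g n) x) := rfl

/-- Mixed words are functorial. -/
def HW.map (β : B →ₗ[k] B') (c : C →ₗ[k] C') (g : N →ₗ[k] N') :
    (n : ℕ) → HW k B C N n →ₗ[k] HW k B' C' N' n
  | 0 => Wd.map β g 0
  | n + 1 => LinearMap.prodMap (Wd.map β g (n + 1)) (TensorProduct.map c (HW.map β c g n))

@[simp] theorem HW.map_aw (β : B →ₗ[k] B') (c : C →ₗ[k] C') (g : N →ₗ[k] N') {n : ℕ}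
    (w : Wd k B N n) : HW.map β c g n (HW.aw w) = HW.aw (Wd.map β g n w) := by
  cases n with
  | zero => rfl
  | succ n => exact Prod.ext rfl (map_zero (TensorProduct.map c (HW.map β c g n)))

theorem HW.map_hv' (β : B →ₗ[k] B') (c : C →ₗ[k] C') (g : N →ₗ[k] N') {n : ℕ}
    (x : C ⊗[k] HW k B C N n) :
    HW.map β c g (n + 1) (HW.hv x) = HW.hv (TensorProduct.map c (HW.map β c g n) x) :=
  Prod.ext (map_zero (Wd.map β g (n + 1))) rfl

@[simp] theorem HW.map_hv (β : B →ₗ[k] B') (c : C →ₗ[k] C') (g : N →ₗ[k] N') {n : ℕ}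
    (h : C) (v : HW k B C N n) :
    HW.map β c g (n + 1) (HW.hv (h ⊗ₜ v)) = HW.hv (c h ⊗ₜ HW.map β c g n v) :=
  HW.map_hv' β c g (h ⊗ₜ v)

theorem HW.fst_map (β : B →ₗ[k] B') (c : C →ₗ[k] C') (g : N →ₗ[k] N') {n : ℕ}
    (v : HW k B C N n) : HW.fst (HW.map β c g n v) = Wd.map β g n (HW.fst v) := by
  cases n <;> rfl

theorem HW.snd_map (β : B →ₗ[k] B') (c : C →ₗ[k] C') (g : N →ₗ[k] N') {n : ℕ}
    (v : HW k B C N (n + 1)) :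
    HW.snd (HW.map β c g (n + 1) v) = TensorProduct.map c (HW.map β c g n) (HW.snd v) := rfl

section Functoriality

variable [AddCommGroup B''] [Module k B''] [AddCommGroup C''] [Module k C'']
variable {N'' : Type*} [AddCommGroup N''] [Module k N'']

protected theorem Wd.map_id (n : ℕ) :
    Wd.map (LinearMap.id : B →ₗ[k] B) (LinearMap.id : N →ₗ[k] N) n = LinearMap.id := by
  induction n with
  | zero => rfl
  | succ n ih => exact Wd.hom_ext fun b w => by simp [ih]

protected theorem Wd.map_comp (β : B →ₗ[k] B') (g : N →ₗ[k] N') (β' : B' →ₗ[k] B'') (g' : N' →ₗ[k] N'')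
    (n : ℕ) : Wd.map (β' ∘ₗ β) (g' ∘ₗ g) n = Wd.map β' g' n ∘ₗ Wd.map β g n := by
  induction n with
  | zero => rfl
  | succ n ih => exact Wd.hom_ext fun b w => by simp [ih]

protected theorem HW.map_id (n : ℕ) :
    HW.map (LinearMap.id : B →ₗ[k] B) (LinearMap.id : C →ₗ[k] C) (LinearMap.id : N →ₗ[k] N) n =
      LinearMap.id := by
  induction n with
  | zero => rfl
  | succ n ih => exact HW.hom_ext (fun b w => by simp [Wd.map_id]) fun h v => by simp [ih]

protected theorem HW.map_comp (β : B →ₗ[k] B') (c : C →ₗ[k] C') (g : N →ₗ[k] N') (β' : B' →ₗ[k] B'')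
    (c' : C' →ₗ[k] C'') (g' : N' →ₗ[k] N'') (n : ℕ) :
    HW.map (β' ∘ₗ β) (c' ∘ₗ c) (g' ∘ₗ g) n = HW.map β' c' g' n ∘ₗ HW.map β c g n := by
  induction n with
  | zero => rfl
  | succ n ih => exact HW.hom_ext (fun b w => by simp [Wd.map_comp]) fun h v => by simp [ih]

protected theorem Wd.map_add (β : B →ₗ[k] B') (g g' : N →ₗ[k] N') (n : ℕ) :
    Wd.map β (g + g') n = Wd.map β g n + Wd.map β g' n := by
  induction n with
  | zero => rfl
  | succ n ih => exact Wd.hom_ext fun b w => by simp [ih, TensorProduct.tmul_add]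

protected theorem Wd.map_smul (β : B →ₗ[k] B') (a : k) (g : N →ₗ[k] N') (n : ℕ) :
    Wd.map β (a • g) n = a • Wd.map β g n := by
  induction n with
  | zero => rfl
  | succ n ih => exact Wd.hom_ext fun b w => by simp [ih]

protected theorem HW.map_add (β : B →ₗ[k] B') (c : C →ₗ[k] C') (g g' : N →ₗ[k] N') (n : ℕ) :
    HW.map β c (g + g') n = HW.map β c g n + HW.map β c g' n := by
  induction n with
  | zero => rfl
  | succ n ih =>
    exact HW.hom_ext (fun b w => by simp [Wd.map_add, -Wd.map_cons])
      fun h v => by simp [ih, TensorProduct.tmul_add]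

protected theorem HW.map_smul (β : B →ₗ[k] B') (c : C →ₗ[k] C') (a : k) (g : N →ₗ[k] N') (n : ℕ) :
    HW.map β c (a • g) n = a • HW.map β c g n := by
  induction n with
  | zero => rfl
  | succ n ih =>
    exact HW.hom_ext (fun b w => by simp [Wd.map_smul, -Wd.map_cons]) fun h v => by simp [ih]

/-- Operators on `N` act on words through the tail. -/
def Wd.tailEnd (n : ℕ) : Module.End k N →ₗ[k] Module.End k (Wd k B N n) where
  toFun g := Wd.map LinearMap.id g n
  map_add' g g' := Wd.map_add _ g g' n
  map_smul' a g := Wd.map_smul _ a g n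

/-- Operators on `N` act on mixed words through the tail. -/
def HW.tailEnd (n : ℕ) : Module.End k N →ₗ[k] Module.End k (HW k B C N n) where
  toFun g := HW.map LinearMap.id LinearMap.id g n
  map_add' g g' := HW.map_add _ _ g g' n
  map_smul' a g := HW.map_smul _ _ a g n

end Functoriality

/-- The action of a linear map on the tails of mixed words. -/
abbrev tm (g : N →ₗ[k] N') (n : ℕ) : HW k B C N n →ₗ[k] HW k B C N' n :=
  HW.map LinearMap.id LinearMap.id g n

theorem tm_hv (g : N →ₗ[k] N') (n : ℕ) (x : C ⊗[k] HW k B C N n) :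
    tm g (n + 1) (HW.hv x) = HW.hv (LinearMap.lTensor C (tm g n) x) := HW.map_hv' _ _ _ _

theorem snd_tm (g : N →ₗ[k] N') (n : ℕ) (v : HW k B C N (n + 1)) :
    HW.snd (tm g (n + 1) v) = LinearMap.lTensor C (tm g n) (HW.snd v) := rfl

theorem Wd.tm_cons (g : N →ₗ[k] N') (n : ℕ) (x : B ⊗[k] Wd k B N n) :
    Wd.map LinearMap.id g (n + 1) (Wd.cons x) =
      Wd.cons (LinearMap.lTensor B (Wd.map LinearMap.id g n) x) := rfl

theorem lTensor_comm {P : Type*} [AddCommGroup P] [Module k P] {V : Type*} [AddCommGroup V]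
    [Module k V] {W : Type*} [AddCommGroup W] [Module k W] {V' : Type*} [AddCommGroup V']
    [Module k V'] {W' : Type*} [AddCommGroup W'] [Module k W'] {f : V →ₗ[k] W} {f' : V' →ₗ[k] W'}
    {g : V →ₗ[k] V'} {g' : W →ₗ[k] W'} (h : ∀ v, f' (g v) = g' (f v)) (z : P ⊗[k] V) :
    LinearMap.lTensor P f' (LinearMap.lTensor P g z) =
      LinearMap.lTensor P g' (LinearMap.lTensor P f z) := by
  rw [← LinearMap.lTensor_comp_apply, ← LinearMap.lTensor_comp_apply]
  congr 2
  exact LinearMap.ext h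

section Inner

variable {R : Type u} [Ring R] [Algebra k R]

/-- `b ⊗ (b' ⊗ q) ↦ b b' ⊗ q`. -/
def mulHead (Q : Type v) [AddCommGroup Q] [Module k Q] : R ⊗[k] (R ⊗[k] Q) →ₗ[k] R ⊗[k] Q :=
  LinearMap.rTensor Q (LinearMap.mul' k R) ∘ₗ (TensorProduct.assoc k R R Q).symm.toLinearMap

@[simp] theorem mulHead_tmul (a b : R) (q : Q) :
    mulHead (k := k) Q (a ⊗ₜ (b ⊗ₜ q)) = (a * b) ⊗ₜ q := rfl

/-- `b₁ ⊗ ⋯ ⊗ b_{n+1} ⊗ x ↦ ∑_{i=1}^{n} (-1)^i b₁ ⊗ ⋯ ⊗ b_i b_{i+1} ⊗ ⋯ ⊗ b_{n+1} ⊗ x`. -/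
def Wd.inner : (n : ℕ) → Wd k R N (n + 1) →ₗ[k] Wd k R N n
  | 0 => 0
  | n + 1 => -(Wd.cons.toLinearMap ∘ₗ mulHead (Wd k R N n)
        ∘ₗ LinearMap.lTensor R Wd.cons.symm.toLinearMap ∘ₗ Wd.cons.symm.toLinearMap)
      - Wd.cons.toLinearMap ∘ₗ LinearMap.lTensor R (Wd.inner n) ∘ₗ Wd.cons.symm.toLinearMap

@[simp] theorem Wd.inner_zero (w : Wd k R N 1) : Wd.inner 0 w = 0 := rfl

@[simp] theorem Wd.inner_succ (n : ℕ) (a b : R) (w : Wd k R N n) :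
    Wd.inner (n + 1) (Wd.cons (a ⊗ₜ Wd.cons (b ⊗ₜ w))) =
      -Wd.cons ((a * b) ⊗ₜ w) - Wd.cons (a ⊗ₜ Wd.inner n (Wd.cons (b ⊗ₜ w))) := rfl

end Inner

end Words

/-! ### Left `E`-linear extensions of maps into `E ⊗ W` -/

section Ext

variable {k : Type u} [CommRing k] {E : Type u} [Ring E] [Algebra k E]
variable {V W : Type v} [AddCommGroup V] [Module k V] [AddCommGroup W] [Module k W]
variable {Q : Type w} [AddCommGroup Q] [Module k Q]

/-- The left `E`-linear extension `e ⊗ v ↦ e f(v)` of a linear map `f : V → E ⊗ W`. -/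
def sh (f : V →ₗ[k] E ⊗[k] W) : E ⊗[k] V →ₗ[k] E ⊗[k] W :=
  TensorProduct.lift
    (LinearMap.compl₂ (Algebra.lsmul k k (E ⊗[k] W) : E →ₐ[k] _).toLinearMap f)

@[simp] theorem sh_tmul (f : V →ₗ[k] E ⊗[k] W) (e : E) (v : V) : sh f (e ⊗ₜ v) = e • f v := rfl

@[simp] theorem sh_smul (f : V →ₗ[k] E ⊗[k] W) (e : E) (z : E ⊗[k] V) :
    sh f (e • z) = e • sh f z := by
  induction z with
  | zero => simp
  | add x y hx hy => simp [hx, hy]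
  | tmul e' v => simp [TensorProduct.smul_tmul', mul_smul]

@[simp] theorem lTensor_smul (f : V →ₗ[k] Q) (e : E) (z : E ⊗[k] V) :
    LinearMap.lTensor E f (e • z) = e • LinearMap.lTensor E f z := by
  induction z with
  | zero => simp
  | add x y hx hy => simp only [smul_add, map_add, hx, hy]
  | tmul e' v => simp [TensorProduct.smul_tmul']

theorem sh_add (f g : V →ₗ[k] E ⊗[k] W) (z : E ⊗[k] V) : sh (f + g) z = sh f z + sh g z := by
  induction z with
  | zero => simp
  | add x y hx hy => simp only [map_add, hx, hy]; abel
  | tmul e' v => simp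

/-- Extension to `E ⊗ _` is functorial, because `g` and `g'` do not touch the factor `E`; this
carries relations between operators on words over to composites such as `sh L ∘ L`. -/
theorem sh_comm {V' W' : Type w'} [AddCommGroup V'] [Module k V'] [AddCommGroup W'] [Module k W']
    {f : V →ₗ[k] E ⊗[k] W} {f' : V' →ₗ[k] E ⊗[k] W'} {g : V →ₗ[k] V'} {g' : W →ₗ[k] W'}
    (h : ∀ v, f' (g v) = LinearMap.lTensor E g' (f v)) (z : E ⊗[k] V) :
    sh f' (LinearMap.lTensor E g z) = LinearMap.lTensor E g' (sh f z) := by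
  induction z with
  | zero => simp
  | add x y hx hy => simp only [map_add, hx, hy]
  | tmul e' v => simp [h]

end Ext

/-! ### Algebras that factor as `E = A H`, and operators on mixed words -/

/-- An algebra `E` with a subalgebra `A` and a module `H` of elements such that
`a ⊗ h ↦ a h` is an isomorphism `A ⊗ H ≃ E`. -/
structure Factorization (k A H E : Type u) [CommRing k] [Ring A] [Algebra k A] [AddCommGroup H]
    [Module k H] [Ring E] [Algebra k E] where
  /-- The inclusion of `A`. -/
  incl : A →ₐ[k] E
  /-- The inclusion of `H`. -/
  gam : H →ₗ[k] E
  /-- The isomorphism `a ⊗ h ↦ a h`. -/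
  equiv : A ⊗[k] H ≃ₗ[k] E
  equiv_tmul : ∀ a h, equiv (a ⊗ₜ h) = incl a * gam h
  /-- The unit of `H`. -/
  one : H
  gam_one : gam one = 1
  /-- An augmentation of `H`. -/
  aug : H →ₗ[k] k
  aug_one : aug one = 1

namespace Factorization

variable {k A H E : Type u} [CommRing k] [Ring A] [Algebra k A] [AddCommGroup H]
variable [Module k H] [Ring E] [Algebra k E] (D : Factorization k A H E)
variable {N : Type w} [AddCommGroup N] [Module k N] {N' : Type w'} [AddCommGroup N'] [Module k N']
variable {Y : Type v} [AddCommGroup Y] [Module k Y] {Q : Type*} [AddCommGroup Q] [Module k Q]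

theorem equiv_symm_mul (a : A) (h : H) : D.equiv.symm (D.incl a * D.gam h) = a ⊗ₜ h := by
  rw [← D.equiv_tmul, LinearEquiv.symm_apply_apply]

/-- The products `a h` span `E` since `A ⊗ H → E` is onto. They appear here as `a • (h ⊗ y)` so that
`A`-linear maps such as `ins` can release `a` at once. -/
theorem hom_ext {f g : E ⊗[k] Y →ₗ[k] Q}
    (h : ∀ a h y, f (D.incl a • D.gam h ⊗ₜ y) = g (D.incl a • D.gam h ⊗ₜ y)) : f = g := by
  have : f ∘ₗ LinearMap.rTensor Y D.equiv.toLinearMap =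
      g ∘ₗ LinearMap.rTensor Y D.equiv.toLinearMap := by
    refine TensorProduct.ext_threefold fun a b y => ?_
    simpa [D.equiv_tmul, TensorProduct.smul_tmul'] using h a b y
  refine TensorProduct.ext' fun e y => ?_
  simpa using LinearMap.congr_fun this (D.equiv.symm e ⊗ₜ y)

/-- `a h ⊗ v ↦ a ⊗ (h ⊗ v)`, prepending the letter `h` to the word `v`. -/
def insA (n : ℕ) : E ⊗[k] HW k A H N n →ₗ[k] A ⊗[k] HW k A H N (n + 1) :=
  LinearMap.lTensor A HW.hv ∘ₗ (TensorProduct.assoc k A H (HW k A H N n)).toLinearMap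
    ∘ₗ LinearMap.rTensor (HW k A H N n) D.equiv.symm.toLinearMap

/-- `a ⊗ y ↦ a ⊗ y`, from `A ⊗ Y` to `E ⊗ Y`. -/
def toE (Y : Type v) [AddCommGroup Y] [Module k Y] : A ⊗[k] Y →ₗ[k] E ⊗[k] Y :=
  LinearMap.rTensor Y D.incl.toLinearMap

@[simp] theorem toE_tmul (a : A) (y : Y) : D.toE Y (a ⊗ₜ y) = D.incl a ⊗ₜ y := rfl

@[simp] theorem toE_smul (a : A) (z : A ⊗[k] Y) : D.toE Y (a • z) = D.incl a • D.toE Y z := by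
  induction z with
  | zero => simp
  | add x y hx hy => simp only [smul_add, map_add, hx, hy]
  | tmul e' v => simp [TensorProduct.smul_tmul']

theorem toE_lTensor (f : Y →ₗ[k] Q) (z : A ⊗[k] Y) :
    LinearMap.lTensor E f (D.toE Y z) = D.toE Q (LinearMap.lTensor A f z) := by
  induction z with
  | zero => simp
  | add x y hx hy => simp only [map_add, hx, hy]
  | tmul e' v => simp

/-- `a h ⊗ v ↦ a ⊗ (h ⊗ v)`, with values in `E ⊗ _`. -/
def ins (n : ℕ) : E ⊗[k] HW k A H N n →ₗ[k] E ⊗[k] HW k A H N (n + 1) :=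
  D.toE _ ∘ₗ D.insA n

@[simp] theorem insA_tmul (n : ℕ) (a : A) (h : H) (v : HW k A H N n) :
    D.insA n ((D.incl a * D.gam h) ⊗ₜ v) = a ⊗ₜ HW.hv (h ⊗ₜ v) := by
  simp [insA, D.equiv_symm_mul]

@[simp] theorem insA_gam (n : ℕ) (h : H) (v : HW k A H N n) :
    D.insA n (D.gam h ⊗ₜ v) = 1 ⊗ₜ HW.hv (h ⊗ₜ v) := by
  simpa using D.insA_tmul n 1 h v

@[simp] theorem insA_smul (n : ℕ) (a : A) (z : E ⊗[k] HW k A H N n) :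
    D.insA n (D.incl a • z) = a • D.insA n z := by
  have : D.insA (N := N) n ∘ₗ (Algebra.lsmul k k (E ⊗[k] HW k A H N n) (D.incl a)) =
      (Algebra.lsmul k k (A ⊗[k] HW k A H N (n + 1)) a) ∘ₗ D.insA n := by
    refine D.hom_ext fun b h v => ?_
    have e : D.incl a • (D.incl b • (D.gam h ⊗ₜ[k] v)) = (D.incl (a * b) * D.gam h) ⊗ₜ[k] v := by
      simp [TensorProduct.smul_tmul', mul_assoc]
    have e' : (D.incl b • (D.gam h ⊗ₜ[k] v)) = (D.incl b * D.gam h) ⊗ₜ[k] v := by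
      simp [TensorProduct.smul_tmul']
    simp only [LinearMap.comp_apply, Algebra.lsmul_coe]
    rw [e, e', insA_tmul, insA_tmul, TensorProduct.smul_tmul', smul_eq_mul]
  exact LinearMap.congr_fun this z

@[simp] theorem ins_gam (n : ℕ) (h : H) (v : HW k A H N n) :
    D.ins n (D.gam h ⊗ₜ v) = 1 ⊗ₜ HW.hv (h ⊗ₜ v) := by
  simp [ins]

@[simp] theorem ins_smul (n : ℕ) (a : A) (z : E ⊗[k] HW k A H N n) :
    D.ins n (D.incl a • z) = D.incl a • D.ins n z := by
  simp [ins]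

theorem insA_one (n : ℕ) (v : HW k A H N n) :
    D.insA n (1 ⊗ₜ v) = 1 ⊗ₜ HW.hv (D.one ⊗ₜ v) := by
  rw [← D.gam_one, insA_gam]

/-- `h ⊗ z ↦ h z`. -/
def gsm (Y : Type v) [AddCommGroup Y] [Module k Y] : H ⊗[k] (E ⊗[k] Y) →ₗ[k] E ⊗[k] Y :=
  TensorProduct.lift ((Algebra.lsmul k k (E ⊗[k] Y) : E →ₐ[k] _).toLinearMap ∘ₗ D.gam)

@[simp] theorem gsm_tmul (h : H) (z : E ⊗[k] Y) : D.gsm Y (h ⊗ₜ z) = D.gam h • z := rfl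

/-- Moving a letter of `A` out of a mixed word to the left, or multiplying two letters of `H` and
moving the resulting element of `A` out to the left, with alternating signs. -/
def LA : (n : ℕ) → HW k A H N (n + 1) →ₗ[k] A ⊗[k] HW k A H N n
  | 0 => LinearMap.lTensor A HW.aw ∘ₗ Wd.cons.symm.toLinearMap ∘ₗ HW.fst
  | n + 1 => LinearMap.lTensor A HW.aw ∘ₗ Wd.cons.symm.toLinearMap ∘ₗ HW.fst
      - D.insA n ∘ₗ D.gsm _
        ∘ₗ LinearMap.lTensor H (D.toE _ ∘ₗ LA n + LinearMap.rTensor _ D.gam ∘ₗ HW.snd) ∘ₗ HW.snd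

/-- The operator `LA`, together with the one moving the first letter of `H` out to the left. -/
def L (n : ℕ) : HW k A H N (n + 1) →ₗ[k] E ⊗[k] HW k A H N n :=
  D.toE _ ∘ₗ D.LA n + LinearMap.rTensor _ D.gam ∘ₗ HW.snd

theorem L_apply (n : ℕ) (v : HW k A H N (n + 1)) :
    D.L n v = D.toE _ (D.LA n v) + LinearMap.rTensor _ D.gam (HW.snd v) := rfl

theorem LA_aw' (n : ℕ) (x : A ⊗[k] Wd k A N n) :
    D.LA n (HW.aw (Wd.cons x)) = LinearMap.lTensor A HW.aw x := by
  cases n with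
  | zero => rfl
  | succ n => simp [LA]

@[simp] theorem LA_aw (n : ℕ) (a : A) (w : Wd k A N n) :
    D.LA n (HW.aw (Wd.cons (a ⊗ₜ w))) = a ⊗ₜ HW.aw w := LA_aw' D n _

@[simp] theorem LA_hv_zero (x : H ⊗[k] HW k A H N 0) : D.LA 0 (HW.hv x) = 0 := by
  simp [LA]

theorem LA_hv' (n : ℕ) (x : H ⊗[k] HW k A H N (n + 1)) :
    D.LA (n + 1) (HW.hv x) = -D.insA n (D.gsm _ (LinearMap.lTensor H (D.L n) x)) := by
  simp [LA, L]

@[simp] theorem LA_hv (n : ℕ) (h : H) (v : HW k A H N (n + 1)) :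
    D.LA (n + 1) (HW.hv (h ⊗ₜ v)) = -D.insA n (D.gam h • D.L n v) := by
  simp [LA_hv']

@[simp] theorem L_aw (n : ℕ) (a : A) (w : Wd k A N n) :
    D.L n (HW.aw (Wd.cons (a ⊗ₜ w))) = D.incl a ⊗ₜ HW.aw w := by
  simp [L_apply]

@[simp] theorem L_hv_zero (h : H) (v : HW k A H N 0) :
    D.L 0 (HW.hv (h ⊗ₜ v)) = D.gam h ⊗ₜ v := by
  simp [L_apply]

@[simp] theorem L_hv (n : ℕ) (h : H) (v : HW k A H N (n + 1)) :
    D.L (n + 1) (HW.hv (h ⊗ₜ v)) = D.gam h ⊗ₜ v - D.ins n (D.gam h • D.L n v) := by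
  simp [L_apply, ins]; abel

/-- On `a h ⊗ v` the letter put back by `ins` is the one that `L` takes out again; there is no
correction, since `v` is an empty word. -/
theorem sh_L_ins_zero (z : E ⊗[k] HW k A H N 0) : sh (D.L 0) (D.ins 0 z) = z := by
  have : sh (D.L (N := N) 0) ∘ₗ D.ins 0 = LinearMap.id := by
    refine D.hom_ext fun a h v => ?_
    simp
  exact LinearMap.congr_fun this z

/-- On `a h ⊗ v` the letter `h` is put back and taken out again, and the recursion of `L` leaves the
correction `ins (a h · L v)`. This is the cancellation behind `L L + I L + L I = 0`. -/
theorem sh_L_ins_succ (n : ℕ) (z : E ⊗[k] HW k A H N (n + 1)) :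
    sh (D.L (n + 1)) (D.ins (n + 1) z) = z - D.ins n (sh (D.L n) z) := by
  have : sh (D.L (N := N) (n + 1)) ∘ₗ D.ins (n + 1) = LinearMap.id - D.ins n ∘ₗ sh (D.L n) := by
    refine D.hom_ext fun a h v => ?_
    simp [smul_sub]
  exact LinearMap.congr_fun this z

variable {D} in
/-- Multiplication of the letters in `A`, with alternating signs. -/
def I : (n : ℕ) → HW k A H N (n + 1) →ₗ[k] HW k A H N n
  | 0 => 0
  | n + 1 => HW.aw ∘ₗ Wd.inner (n + 1) ∘ₗ HW.fst - HW.hv ∘ₗ LinearMap.lTensor H (I n) ∘ₗ HW.snd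

@[simp] theorem I_zero (v : HW k A H N 1) : I 0 v = 0 := rfl

@[simp] theorem I_aw (n : ℕ) (w : Wd k A N (n + 1)) :
    I n (HW.aw (C := H) w) = HW.aw (Wd.inner n w) := by
  cases n with
  | zero => simp
  | succ n => simp [I]

theorem I_hv' (n : ℕ) (x : H ⊗[k] HW k A H N (n + 1)) :
    I (n + 1) (HW.hv x) = -HW.hv (LinearMap.lTensor H (I n) x) := by
  simp [I]

@[simp] theorem I_hv (n : ℕ) (h : H) (v : HW k A H N (n + 1)) :
    I (n + 1) (HW.hv (h ⊗ₜ v)) = -HW.hv (h ⊗ₜ I n v) := by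
  simp [I_hv']

theorem I_zero' : I (k := k) (A := A) (H := H) (N := N) 0 = 0 := rfl

/-- The sign appears because `I` now has to pass the letter of `H` that `ins` puts in front. -/
theorem ins_lTensor_I (n : ℕ) (z : E ⊗[k] HW k A H N (n + 1)) :
    LinearMap.lTensor E (I (n + 1)) (D.ins (n + 1) z) = -D.ins n (LinearMap.lTensor E (I n) z) := by
  have : LinearMap.lTensor E (I (N := N) (n + 1)) ∘ₗ D.ins (n + 1) =
      -(D.ins n ∘ₗ LinearMap.lTensor E (I n)) := by
    refine D.hom_ext fun a h v => ?_
    simp [TensorProduct.tmul_neg]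
  exact LinearMap.congr_fun this z

theorem snd_I (n : ℕ) (v : HW k A H N (n + 2)) :
    HW.snd (I (n + 1) v) = -LinearMap.lTensor H (I n) (HW.snd v) := by
  rw [← HW.aw_fst_add_hv_snd v]; simp [I_hv']

/-- `L L + I L + L I = 0`. -/
theorem L_L (n : ℕ) (v : HW k A H N (n + 2)) :
    sh (D.L n) (D.L (n + 1) v) + LinearMap.lTensor E (I n) (D.L (n + 1) v)
      + D.L n (I (n + 1) v) = 0 := by
  suffices H : sh (D.L (N := N) n) ∘ₗ D.L (n + 1) + LinearMap.lTensor E (I n) ∘ₗ D.L (n + 1)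
      + D.L n ∘ₗ I (n + 1) = 0 from LinearMap.congr_fun H v
  clear v
  induction n with
  | zero =>
    refine HW.hom_ext₂ (fun a b w => ?_) fun h v => ?_
    · simp [TensorProduct.smul_tmul', I_zero']
    · simp [sh_L_ins_zero, I_zero']
  | succ n ih =>
    refine HW.hom_ext₂ (fun a b w => ?_) fun h v => ?_
    · simp [TensorProduct.smul_tmul']
    · have e := LinearMap.congr_fun ih v
      simp only [LinearMap.add_apply, LinearMap.comp_apply, LinearMap.zero_apply] at e ⊢
      -- The terms `h • L v` and `h ⊗ I v` cancel; what remains is the identity for the shorter word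
      -- `v`, multiplied by `h` and put back through `ins`.
      have e' := congrArg (fun z => D.ins n (D.gam h • z)) e
      simp only [smul_add, map_add, smul_zero, map_zero] at e'
      simp only [L_hv, I_hv, map_sub, sh_L_ins_succ, sh_tmul, sh_smul, ins_lTensor_I, map_neg,
        lTensor_smul, LinearMap.lTensor_tmul]
      rw [← e']; abel

theorem inner_inner (n : ℕ) (w : Wd k A N (n + 2)) : Wd.inner n (Wd.inner (n + 1) w) = 0 := by
  suffices H : Wd.inner n ∘ₗ Wd.inner (R := A) (k := k) (N := N) (n + 1) = 0 from
    LinearMap.congr_fun H w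
  clear w
  induction n with
  | zero => rfl
  | succ n ih =>
    refine Wd.hom_ext₃ fun a b c w => ?_
    have e := LinearMap.congr_fun ih (Wd.cons (b ⊗ₜ Wd.cons (c ⊗ₜ w)))
    simp only [LinearMap.comp_apply, Wd.inner_succ, map_sub, map_neg, LinearMap.zero_apply] at e
    have e2 := congrArg (fun z => Wd.cons (a ⊗ₜ[k] z)) e
    simp only [TensorProduct.tmul_sub, TensorProduct.tmul_neg, TensorProduct.tmul_zero, map_sub,
      map_neg, map_zero] at e2
    simp [TensorProduct.tmul_sub, TensorProduct.tmul_neg, mul_assoc]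
    rw [← e2]
    abel

theorem I_I (n : ℕ) (v : HW k A H N (n + 2)) : I n (I (n + 1) v) = 0 := by
  suffices H : I n ∘ₗ I (A := A) (H := H) (k := k) (N := N) (n + 1) = 0 from
    LinearMap.congr_fun H v
  clear v
  induction n with
  | zero => rfl
  | succ n ih =>
    refine HW.hom_ext' (fun w => ?_) fun h v => ?_
    · simp [inner_inner]
    · have := LinearMap.congr_fun ih v
      simp only [LinearMap.comp_apply, LinearMap.zero_apply] at this
      simp [this]

end Factorization

/-! ### Action on the tail and the Hochschild boundary on words -/

section Bar

variable {k : Type u} [CommRing k] {R B : Type u} [Ring R] [Algebra k R]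
variable [AddCommGroup B] [Module k B]
variable {N : Type w} [AddCommGroup N] [Module k N] {N' : Type w'} [AddCommGroup N'] [Module k N']

/-- The action of a ring on the empty words. -/
def actTail (B : Type u) [AddCommGroup B] [Module k B] (l : R →ₐ[k] Module.End k N) :
    R ⊗[k] Wd k B N 0 →ₗ[k] Wd k B N 0 :=
  TensorProduct.lift (Wd.tailEnd 0 ∘ₗ l.toLinearMap)

@[simp] theorem actTail_tmul (l : R →ₐ[k] Module.End k N) (e : R) (x : N) :
    actTail B l (e ⊗ₜ Wd.nil x) = Wd.nil (l e x) := rfl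

/-- This is the multiplicativity of `l`: `e` times a factor acts as that factor followed by `e`. -/
theorem actTail_smul (l : R →ₐ[k] Module.End k N) (e : R) (z : R ⊗[k] Wd k B N 0) :
    actTail B l (e • z) = actTail B l (e ⊗ₜ actTail B l z) := by
  induction z with
  | zero => simp
  | add x y hx hy => simp only [smul_add, map_add, TensorProduct.tmul_add, hx, hy]
  | tmul e' v =>
    obtain ⟨x, rfl⟩ := Wd.nil.surjective v
    simp [TensorProduct.smul_tmul']

/-- The action of a ring on the empty mixed words. -/
def actNil (B C : Type u) [AddCommGroup B] [Module k B] [AddCommGroup C] [Module k C]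
    (l : R →ₐ[k] Module.End k N) : R ⊗[k] HW k B C N 0 →ₗ[k] Wd k B N 0 :=
  actTail B l ∘ₗ LinearMap.lTensor R HW.fst

theorem actNil_smul {C : Type u} [AddCommGroup C] [Module k C] (l : R →ₐ[k] Module.End k N) (e : R)
    (z : R ⊗[k] HW k B C N 0) :
    actNil B C l (e • z) = actNil B C l (e ⊗ₜ HW.aw (actNil B C l z)) := by
  rw [actNil, LinearMap.comp_apply, lTensor_smul, actTail_smul]
  simp

@[simp] theorem actNil_tmul {C : Type u} [AddCommGroup C] [Module k C]
    (l : R →ₐ[k] Module.End k N) (e : R) (x : N) :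
    actNil B C l (e ⊗ₜ HW.aw (Wd.nil x)) = Wd.nil (l e x) := rfl

/-- The sum of the inner terms and of the last term of the Hochschild boundary, for words
`b₁ ⊗ ⋯ ⊗ b_{n+1} ⊗ x`. -/
def Wd.bar (l : R →ₐ[k] Module.End k N) : (n : ℕ) → Wd k R N (n + 1) →ₗ[k] Wd k R N n
  | 0 => -(actTail R l ∘ₗ Wd.cons.symm.toLinearMap)
  | n + 1 => -(Wd.cons.toLinearMap ∘ₗ mulHead (Wd k R N n)
        ∘ₗ LinearMap.lTensor R Wd.cons.symm.toLinearMap ∘ₗ Wd.cons.symm.toLinearMap)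
      - Wd.cons.toLinearMap ∘ₗ LinearMap.lTensor R (Wd.bar l n) ∘ₗ Wd.cons.symm.toLinearMap

theorem Wd.bar_zero' (l : R →ₐ[k] Module.End k N) (z : R ⊗[k] Wd k R N 0) :
    Wd.bar l 0 (Wd.cons z) = -actTail R l z := rfl

@[simp] theorem Wd.bar_zero (l : R →ₐ[k] Module.End k N) (a : R) (x : N) :
    Wd.bar l 0 (Wd.cons (a ⊗ₜ Wd.nil x)) = -Wd.nil (l a x) := rfl

@[simp] theorem Wd.bar_succ (l : R →ₐ[k] Module.End k N) (n : ℕ) (a b : R) (w : Wd k R N n) :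
    Wd.bar l (n + 1) (Wd.cons (a ⊗ₜ Wd.cons (b ⊗ₜ w))) =
      -Wd.cons ((a * b) ⊗ₜ w) - Wd.cons (a ⊗ₜ Wd.bar l n (Wd.cons (b ⊗ₜ w))) := rfl

/-- The second letter and the rest form an arbitrary tensor `z`, since `L` produces sums and not
single words; multiplying `a` into the first letter of `z` is then `a • z`. -/
theorem Wd.bar_succ' (l : R →ₐ[k] Module.End k N) (n : ℕ) (a : R) (z : R ⊗[k] Wd k R N n) :
    Wd.bar l (n + 1) (Wd.cons (a ⊗ₜ Wd.cons z)) =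
      -Wd.cons (a • z) - Wd.cons (a ⊗ₜ Wd.bar l n (Wd.cons z)) := by
  induction z with
  | zero => simp
  | add x y hx hy =>
    have : (Wd.cons (x + y) : Wd k R N (n + 1)) = Wd.cons x + Wd.cons y := rfl
    rw [smul_add, this, TensorProduct.tmul_add, map_add, map_add, hx, hy, map_add, map_add,
      TensorProduct.tmul_add, map_add]
    abel
  | tmul e' v => simp [TensorProduct.smul_tmul']

theorem Wd.bar_map {l : R →ₐ[k] Module.End k N} {l' : R →ₐ[k] Module.End k N'} {g : N →ₗ[k] N'}
    (hg : ∀ e x, g (l e x) = l' e (g x)) (n : ℕ) (w : Wd k R N (n + 1)) :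
    Wd.bar l' n (Wd.map LinearMap.id g (n + 1) w) = Wd.map LinearMap.id g n (Wd.bar l n w) := by
  suffices H : Wd.bar l' n ∘ₗ Wd.map LinearMap.id g (n + 1) =
    Wd.map LinearMap.id g n ∘ₗ Wd.bar l n from LinearMap.congr_fun H w
  clear w
  induction n with
  | zero =>
    refine Wd.hom_ext fun a w => ?_
    obtain ⟨x, rfl⟩ := Wd.nil.surjective w
    simp [hg]
  | succ n ih =>
    refine Wd.hom_ext₂ fun a b w => ?_
    have := LinearMap.congr_fun ih (Wd.cons (b ⊗ₜ w))
    simp at this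
    simp [this]

end Bar

/-! ### The terms that act on the tail from the left -/

namespace Factorization

variable {k A H E : Type u} [CommRing k] [Ring A] [Algebra k A] [AddCommGroup H]
variable [Module k H] [Ring E] [Algebra k E] (D : Factorization k A H E)
variable {N : Type w} [AddCommGroup N] [Module k N] {N' : Type w'} [AddCommGroup N'] [Module k N']

/-- The retraction `a h ↦ ε(h) a` of the inclusion of `A`. -/
def retr : E →ₗ[k] A :=
  (TensorProduct.rid k A).toLinearMap ∘ₗ LinearMap.lTensor A D.aug ∘ₗ D.equiv.symm.toLinearMap

theorem retr_incl (a : A) : D.retr (D.incl a) = a := by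
  have := D.equiv_symm_mul a D.one
  rw [D.gam_one, mul_one] at this
  simp [retr, this, D.aug_one]

/-- The augmentation of `H` gives a `k`-linear retraction of `A → E`, so injectivity survives
tensoring with any `Y`, without flatness. -/
theorem toE_injective (Y : Type*) [AddCommGroup Y] [Module k Y] :
    Function.Injective (D.toE Y) := by
  refine Function.LeftInverse.injective (g := LinearMap.rTensor Y D.retr) fun z => ?_
  induction z with
  | zero => simp
  | add x y hx hy => simp only [map_add, hx, hy]
  | tmul a y => simp [retr_incl]

/-- A word with no component starting in `H` is a word in `A`, and on those `L` just takes off the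
first letter, which loses nothing. Identities between operators can therefore be tested after `L`
and after `HW.snd`, and both tests lead to shorter words. -/
theorem eq_zero_of_L_eq_zero {n : ℕ} {v : HW k A H N (n + 1)} (h : D.L n v = 0)
    (h' : HW.snd v = 0) : v = 0 := by
  have hv : v = HW.aw (HW.fst v) := by
    conv_lhs => rw [← HW.aw_fst_add_hv_snd v, h', map_zero, add_zero]
  rw [hv] at h ⊢
  obtain ⟨z, hz⟩ := Wd.cons.surjective (HW.fst v)
  rw [← hz] at h ⊢
  rw [L_apply, HW.snd_aw, map_zero, add_zero, LA_aw'] at h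
  have h2 := D.toE_injective _ (h.trans (map_zero _).symm)
  have h3 := congrArg (LinearMap.lTensor A HW.fst) h2
  rw [← LinearMap.lTensor_comp_apply, map_zero] at h3
  have : HW.fst ∘ₗ HW.aw (k := k) (B := A) (C := H) (N := N) (n := n) = LinearMap.id :=
    LinearMap.ext fun w => HW.fst_aw w
  rw [this, LinearMap.lTensor_id, LinearMap.id_apply] at h3
  rw [h3, map_zero, map_zero]

theorem insA_lTensor {m n : ℕ} (f : HW k A H N m →ₗ[k] HW k A H N' n) (z : E ⊗[k] HW k A H N m) :
    D.insA n (LinearMap.lTensor E f z) =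
      LinearMap.lTensor A (HW.hv ∘ₗ LinearMap.lTensor H f ∘ₗ HW.snd) (D.insA m z) := by
  suffices h : D.insA n ∘ₗ LinearMap.lTensor E f =
      LinearMap.lTensor A (HW.hv ∘ₗ LinearMap.lTensor H f ∘ₗ HW.snd) ∘ₗ D.insA m from
    LinearMap.congr_fun h z
  refine D.hom_ext fun a h v => ?_
  simp

theorem ins_lTensor {m n : ℕ} (f : HW k A H N m →ₗ[k] HW k A H N' n) (z : E ⊗[k] HW k A H N m) :
    D.ins n (LinearMap.lTensor E f z) =
      LinearMap.lTensor E (HW.hv ∘ₗ LinearMap.lTensor H f ∘ₗ HW.snd) (D.ins m z) := by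
  simp [ins, insA_lTensor, toE_lTensor]

section Naturality

variable (g : N →ₗ[k] N')

theorem insA_tm (n : ℕ) (z : E ⊗[k] HW k A H N n) :
    D.insA n (LinearMap.lTensor E (tm g n) z) =
      LinearMap.lTensor A (tm g (n + 1)) (D.insA n z) := by
  suffices h : D.insA n ∘ₗ LinearMap.lTensor E (tm g n) =
      LinearMap.lTensor A (tm g (n + 1)) ∘ₗ D.insA n from
    LinearMap.congr_fun h z
  refine D.hom_ext fun a h v => ?_
  simp

theorem ins_tm (n : ℕ) (z : E ⊗[k] HW k A H N n) :
    D.ins n (LinearMap.lTensor E (tm g n) z) =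
      LinearMap.lTensor E (tm g (n + 1)) (D.ins n z) := by
  simp [ins, insA_tm, toE_lTensor]

theorem LA_tm (n : ℕ) (v : HW k A H N (n + 1)) :
    D.LA n (tm g (n + 1) v) = LinearMap.lTensor A (tm g n) (D.LA n v) := by
  suffices h : D.LA n ∘ₗ tm g (n + 1) = LinearMap.lTensor A (tm g n) ∘ₗ D.LA n from
    LinearMap.congr_fun h v
  clear v
  induction n with
  | zero => exact HW.hom_ext (fun a w => by simp) fun h v => by simp
  | succ n ih =>
    refine HW.hom_ext (fun a w => by simp) fun h v => ?_
    have e : D.L n (tm g (n + 1) v) = LinearMap.lTensor E (tm g n) (D.L n v) := by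
      rw [L_apply, L_apply, map_add, HW.snd_map, toE_lTensor, 
        ← LinearMap.comp_apply (LinearMap.lTensor A (tm g n)), ← ih]
      congr 1
      generalize HW.snd v = z
      induction z with
      | zero => simp
      | add x y hx hy => simp only [map_add, hx, hy]
      | tmul a y => simp
    simp [e, ← lTensor_smul, insA_tm]

theorem L_tm (n : ℕ) (v : HW k A H N (n + 1)) :
    D.L n (tm g (n + 1) v) = LinearMap.lTensor E (tm g n) (D.L n v) := by
  rw [L_apply, L_apply, map_add, HW.snd_map, toE_lTensor, ← LA_tm]
  congr 1
  generalize HW.snd v = z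
  induction z with
  | zero => simp
  | add x y hx hy => simp only [map_add, hx, hy]
  | tmul a y => simp

theorem inner_tm (n : ℕ) (w : Wd k A N (n + 1)) :
    Wd.inner n (Wd.map LinearMap.id g (n + 1) w) = Wd.map LinearMap.id g n (Wd.inner n w) := by
  suffices h : Wd.inner n ∘ₗ Wd.map LinearMap.id g (n + 1) =
      Wd.map LinearMap.id g n ∘ₗ Wd.inner (R := A) (k := k) n from LinearMap.congr_fun h w
  clear w
  induction n with
  | zero => ext; simp
  | succ n ih =>
    refine Wd.hom_ext₂ fun a b w => ?_
    have := LinearMap.congr_fun ih (Wd.cons (b ⊗ₜ w))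
    simp at this
    simp [this]

theorem I_tm (n : ℕ) (v : HW k A H N (n + 1)) : I n (tm g (n + 1) v) = tm g n (I n v) := by
  suffices h : I n ∘ₗ tm g (n + 1) = tm g n ∘ₗ I (A := A) (H := H) (k := k) n from
    LinearMap.congr_fun h v
  clear v
  induction n with
  | zero => ext; simp
  | succ n ih =>
    refine HW.hom_ext' (fun w => ?_) fun h v => ?_
    · simp [inner_tm]
    · have := LinearMap.congr_fun ih v
      simp at this
      simp [this]

end Naturality

variable (l : E →ₐ[k] Module.End k N)

/-- The terms of the right differential without letters of `H`. -/
def rho0 : (n : ℕ) → HW k A H N (n + 1) →ₗ[k] Wd k A N n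
  | 0 => actNil A H l ∘ₗ D.L 0
  | n + 1 => Wd.cons.toLinearMap ∘ₗ LinearMap.lTensor A (rho0 n) ∘ₗ D.LA (n + 1)

/-- The right differential, up to sign. -/
def rho : (n : ℕ) → HW k A H N (n + 1) →ₗ[k] HW k A H N n
  | 0 => HW.aw ∘ₗ D.rho0 l 0
  | n + 1 => HW.aw ∘ₗ D.rho0 l (n + 1) + HW.hv ∘ₗ LinearMap.lTensor H (rho n) ∘ₗ HW.snd

theorem rho0_zero (v : HW k A H N 1) : D.rho0 l 0 v = actNil A H l (D.L 0 v) := rfl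

theorem rho0_succ (n : ℕ) (v : HW k A H N (n + 2)) :
    D.rho0 l (n + 1) v = Wd.cons (LinearMap.lTensor A (D.rho0 l n) (D.LA (n + 1) v)) := rfl

theorem rho_zero (v : HW k A H N 1) : D.rho l 0 v = HW.aw (actNil A H l (D.L 0 v)) := rfl

theorem rho_succ (n : ℕ) (v : HW k A H N (n + 2)) :
    D.rho l (n + 1) v = HW.aw (D.rho0 l (n + 1) v)
      + HW.hv (LinearMap.lTensor H (D.rho l n) (HW.snd v)) := rfl

theorem snd_rho (n : ℕ) (v : HW k A H N (n + 2)) :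
    HW.snd (D.rho l (n + 1) v) = LinearMap.lTensor H (D.rho l n) (HW.snd v) := by
  rw [rho_succ, map_add, HW.snd_aw, HW.snd_hv, zero_add]

theorem rTensor_gam_lTensor {Y Y' : Type*} [AddCommGroup Y] [Module k Y] [AddCommGroup Y']
    [Module k Y'] (f : Y →ₗ[k] Y') (z : H ⊗[k] Y) :
    LinearMap.rTensor Y' D.gam (LinearMap.lTensor H f z) =
      LinearMap.lTensor E f (LinearMap.rTensor Y D.gam z) := by
  induction z with
  | zero => simp
  | add x y hx hy => simp only [map_add, hx, hy]
  | tmul a y => simp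

/-- `rho` works behind a first letter of `H` without changing it, so that component commutes
trivially and only the part `LA` needs an argument. -/
theorem L_rho_of_LA_rho {n : ℕ} {v : HW k A H N (n + 2)}
    (h : D.LA n (D.rho l (n + 1) v) = LinearMap.lTensor A (D.rho l n) (D.LA (n + 1) v)) :
    D.L n (D.rho l (n + 1) v) = LinearMap.lTensor E (D.rho l n) (D.L (n + 1) v) := by
  rw [L_apply, L_apply, h, snd_rho, map_add, toE_lTensor, rTensor_gam_lTensor]

/-- For the words without letters of `H` this is built into `rho0`, which is defined by taking a
letter out with `LA` and continuing behind it. For a word `h v` the remaining part is the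
commutation of `L` and `rho` on `v`, transported through `insA`. -/
theorem LA_rho (n : ℕ) (v : HW k A H N (n + 2)) :
    D.LA n (D.rho l (n + 1) v) = LinearMap.lTensor A (D.rho l n) (D.LA (n + 1) v) := by
  suffices h : D.LA n ∘ₗ D.rho l (n + 1) = LinearMap.lTensor A (D.rho l n) ∘ₗ D.LA (n + 1) from
    LinearMap.congr_fun h v
  clear v
  have key : ∀ (n : ℕ) (v : HW k A H N (n + 2)), D.LA n (HW.aw (D.rho0 l (n + 1) v)) =
      LinearMap.lTensor A (HW.aw ∘ₗ D.rho0 l n) (D.LA (n + 1) v) := by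
    intro n v
    rw [rho0_succ, LA_aw', ← LinearMap.lTensor_comp_apply]
  induction n with
  | zero =>
    ext v
    simp only [LinearMap.comp_apply, rho_succ, map_add, key]
    simp [rho]
  | succ n ih =>
    refine HW.hom_ext' (fun w => ?_) fun h v => ?_
    · obtain ⟨z, rfl⟩ := Wd.cons.surjective w
      simp only [LinearMap.comp_apply, rho_succ, key, HW.snd_aw, map_zero, add_zero, LA_aw',
        ← LinearMap.lTensor_comp_apply]
      congr 2
      ext y
      simp [rho_succ]
    · have e := D.L_rho_of_LA_rho l (LinearMap.congr_fun ih v)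
      rw [LinearMap.comp_apply, LinearMap.comp_apply, rho_succ, map_add, key]
      have e2 : D.rho l (n + 1) = HW.aw ∘ₗ D.rho0 l (n + 1) +
        HW.hv ∘ₗ LinearMap.lTensor H (D.rho l n) ∘ₗ HW.snd := rfl
      conv_rhs => rw [e2, LinearMap.lTensor_add, LinearMap.add_apply]
      refine congrArg _ ?_
      rw [HW.snd_hv, LinearMap.lTensor_tmul, LA_hv, LA_hv, e, ← lTensor_smul, insA_lTensor,
        map_neg]

theorem L_rho (n : ℕ) (v : HW k A H N (n + 2)) :
    D.L n (D.rho l (n + 1) v) = LinearMap.lTensor E (D.rho l n) (D.L (n + 1) v) :=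
  D.L_rho_of_LA_rho l (D.LA_rho l n v)

/-- In degree one the relation is `L_L` applied to the tail: two successive left actions are the
left action by a product, and `L` commutes with `rho`. -/
theorem rho_rho_zero (v : HW k A H N 2) :
    D.rho l 0 (D.rho l 1 v) + D.rho l 0 (I 1 v) = 0 := by
  have aux : ∀ z : E ⊗[k] HW k A H N 1, actNil A H l (LinearMap.lTensor E (D.rho l 0) z) =
      actNil A H l (sh (D.L 0) z) := by
    intro z
    induction z with
    | zero => simp
    | add x y hx hy => rw [map_add, map_add, map_add, map_add, hx, hy]
    | tmul e v => rw [sh_tmul, actNil_smul, LinearMap.lTensor_tmul, rho_zero]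
  have e := congrArg (actNil A H l) (D.L_L 0 v)
  rw [map_add, map_add, ← aux, map_zero, I_zero', LinearMap.lTensor_zero, LinearMap.zero_apply,
    map_zero, add_zero] at e
  rw [rho_zero, L_rho, rho_zero, ← map_add]
  exact (congrArg HW.aw e).trans (map_zero _)

/-- `R R + I R + R I = 0`, where `R = ± rho`. -/
theorem rho_rho (n : ℕ) (v : HW k A H N (n + 2)) :
    D.rho l n (D.rho l (n + 1) v) + (-1 : k) ^ n •
      (D.rho l n (I (n + 1) v) - I n (D.rho l (n + 1) v)) = 0 := by
  suffices h : D.rho l n ∘ₗ D.rho l (n + 1) + (-1 : k) ^ n •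
      (D.rho l n ∘ₗ I (n + 1) - I n ∘ₗ D.rho l (n + 1)) = 0 from LinearMap.congr_fun h v
  clear v
  induction n with
  | zero => ext v; simpa using D.rho_rho_zero l v
  | succ n ih =>
    ext v
    -- After `L`, and likewise after `HW.snd`, the identity becomes the one in the previous degree
    -- tensored with a letter: `L` and `HW.snd` commute with `rho`, and their failure to commute
    -- with `I` only contributes signs and terms that cancel.
    refine D.eq_zero_of_L_eq_zero ?_ ?_
    -- The commutator of `I` and `rho` passes through `L` with a change of sign: in `L_L` for `rho
    -- v` and in `rho` applied to `L_L` for `v` the terms `L L` agree, and subtracting removes them.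
    · have hI : ∀ v : HW k A H N (n + 3), D.L n (I (n + 1) (D.rho l (n + 2) v)) -
          D.L n (D.rho l (n + 1) (I (n + 2) v)) =
          LinearMap.lTensor E (D.rho l n ∘ₗ I (n + 1) - I n ∘ₗ D.rho l (n + 1))
            (D.L (n + 2) v) := by
        intro v
        have e1 := D.L_L n (D.rho l (n + 2) v)
        have e2 := congrArg (LinearMap.lTensor E (D.rho l n)) (D.L_L (n + 1) v)
        rw [L_rho, sh_comm (D.L_rho l n)] at e1
        rw [map_add, map_add, map_zero] at e2
        rw [L_rho]
        simp only [LinearMap.lTensor_sub, LinearMap.lTensor_comp, LinearMap.sub_apply,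
          LinearMap.comp_apply]
        rw [add_assoc] at e1 e2
        have e1' := eq_neg_of_add_eq_zero_right e1
        have e2' := eq_neg_of_add_eq_zero_right e2
        rw [← eq_sub_iff_add_eq'] at e1' e2'
        rw [e1', e2']; abel
      have e := congrArg (fun f => LinearMap.lTensor E f (D.L (n + 2) v)) ih
      simp only [LinearMap.lTensor_add, LinearMap.lTensor_smul, LinearMap.add_apply,
        LinearMap.smul_apply, LinearMap.lTensor_zero, LinearMap.zero_apply, ← hI,
        LinearMap.lTensor_comp, LinearMap.comp_apply] at e
      simp only [LinearMap.add_apply, LinearMap.comp_apply, LinearMap.smul_apply,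
        LinearMap.sub_apply, map_add, map_smul, map_sub]
      rw [L_rho, L_rho, ← e, pow_succ, L_rho]
      module
    · have e := congrArg (fun f => LinearMap.lTensor H f (HW.snd v)) ih
      simp only [LinearMap.lTensor_add, LinearMap.lTensor_smul, LinearMap.add_apply,
        LinearMap.smul_apply, LinearMap.lTensor_zero, LinearMap.zero_apply,
        LinearMap.lTensor_comp, LinearMap.comp_apply, LinearMap.lTensor_sub,
        LinearMap.sub_apply] at e
      simp only [LinearMap.add_apply, LinearMap.comp_apply, LinearMap.smul_apply,
        LinearMap.sub_apply, map_add, map_smul, map_sub, snd_rho, snd_I, map_neg]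
      rw [← e, pow_succ]
      module

end Factorization

/-! ### Bimodules given by two commuting actions, and the Hochschild boundary -/

/-- An `R`-bimodule structure on a `k`-module. -/
structure BiAct (k R : Type u) (N : Type w) [CommRing k] [Ring R] [Algebra k R] [AddCommGroup N]
    [Module k N] where
  /-- The left action. -/
  l : R →ₐ[k] Module.End k N
  /-- The right action. -/
  r : Rᵐᵒᵖ →ₐ[k] Module.End k N
  comm : ∀ e e' x, l e (r e' x) = r e' (l e x)

/-- A linear map between bimodules commutes with the actions. -/
structure BiAct.Hom {k R : Type u} {N : Type w} {N' : Type w'} [CommRing k] [Ring R] [Algebra k R]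
    [AddCommGroup N] [Module k N] [AddCommGroup N'] [Module k N'] (S : BiAct k R N)
    (S' : BiAct k R N') (g : N →ₗ[k] N') : Prop where
  l : ∀ e x, g (S.l e x) = S'.l e (g x)
  r : ∀ e x, g (S.r e x) = S'.r e (g x)

section Wd

variable {k R : Type u} [CommRing k] [Ring R] [Algebra k R]
variable {N : Type w} [AddCommGroup N] [Module k N] {N' : Type w'} [AddCommGroup N'] [Module k N']
variable (S : BiAct k R N) (S' : BiAct k R N')

/-- `e ⊗ (b₁ ⊗ ⋯ ⊗ b_n ⊗ x) ↦ b₁ ⊗ ⋯ ⊗ b_n ⊗ x e`. -/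
def BiAct.tlW (n : ℕ) : R ⊗[k] Wd k R N n →ₗ[k] Wd k R N n :=
  TensorProduct.lift (Wd.tailEnd n ∘ₗ S.r.toLinearMap ∘ₗ
    (MulOpposite.opLinearEquiv k : R ≃ₗ[k] Rᵐᵒᵖ).toLinearMap)

@[simp] theorem BiAct.tlW_tmul (n : ℕ) (e : R) (w : Wd k R N n) :
    S.tlW n (e ⊗ₜ w) = Wd.map LinearMap.id (S.r (MulOpposite.op e)) n w := rfl

/-- The boundary of the Hochschild complex. -/
def BiAct.b (n : ℕ) : Wd k R N (n + 1) →ₗ[k] Wd k R N n :=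
  S.tlW n ∘ₗ Wd.cons.symm.toLinearMap + Wd.bar S.l n

theorem BiAct.b_cons (n : ℕ) (z : R ⊗[k] Wd k R N n) :
    S.b n (Wd.cons z) = S.tlW n z + Wd.bar S.l n (Wd.cons z) := rfl

theorem BiAct.b_map {S S'} {g : N →ₗ[k] N'} (hg : BiAct.Hom S S' g) (n : ℕ)
    (w : Wd k R N (n + 1)) :
    S'.b n (Wd.map LinearMap.id g (n + 1) w) = Wd.map LinearMap.id g n (S.b n w) := by
  obtain ⟨z, rfl⟩ := Wd.cons.surjective w
  rw [BiAct.b_cons, map_add, ← Wd.bar_map hg.l, Wd.map_cons', BiAct.b_cons]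
  congr 1
  induction z with
  | zero => simp
  | add x y hx hy => simp only [map_add, hx, hy]
  | tmul e v =>
    simp only [TensorProduct.map_tmul, LinearMap.id_apply, tlW_tmul, ← LinearMap.comp_apply,
      ← Wd.map_comp]
    congr 2
    ext x; simp [hg.r]

end Wd

/-! ### The differential on mixed words and the map to the Hochschild complex -/

namespace Factorization

variable {k A H E : Type u} [CommRing k] [Ring A] [Algebra k A] [AddCommGroup H]
variable [Module k H] [Ring E] [Algebra k E] (D : Factorization k A H E)
variable {N : Type w} [AddCommGroup N] [Module k N] {N' : Type w'} [AddCommGroup N'] [Module k N']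

theorem actNil_tm {l : E →ₐ[k] Module.End k N} {l' : E →ₐ[k] Module.End k N'} {g : N →ₗ[k] N'}
    (hg : ∀ e x, g (l e x) = l' e (g x)) (z : E ⊗[k] HW k A H N 0) :
    actNil A H l' (LinearMap.lTensor E (tm g 0) z) =
      Wd.map LinearMap.id g 0 (actNil A H l z) := by
  induction z with
  | zero => simp
  | add x y hx hy => simp only [map_add, hx, hy]
  | tmul e v =>
    obtain ⟨x, rfl⟩ := Wd.nil.surjective v
    exact congrArg Wd.nil (hg e x).symm

theorem rho0_tm {l : E →ₐ[k] Module.End k N} {l' : E →ₐ[k] Module.End k N'} {g : N →ₗ[k] N'}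
    (hg : ∀ e x, g (l e x) = l' e (g x)) (n : ℕ) (v : HW k A H N (n + 1)) :
    D.rho0 l' n (tm g (n + 1) v) = Wd.map LinearMap.id g n (D.rho0 l n v) := by
  induction n with
  | zero => rw [rho0_zero, rho0_zero, L_tm, actNil_tm hg]
  | succ n ih =>
    rw [rho0_succ, rho0_succ, LA_tm, Wd.tm_cons, lTensor_comm ih]

theorem rho_tm {l : E →ₐ[k] Module.End k N} {l' : E →ₐ[k] Module.End k N'} {g : N →ₗ[k] N'}
    (hg : ∀ e x, g (l e x) = l' e (g x)) (n : ℕ) (v : HW k A H N (n + 1)) :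
    D.rho l' n (tm g (n + 1) v) = tm g n (D.rho l n v) := by
  induction n with
  | zero => rw [rho_zero, rho_zero, L_tm, actNil_tm hg, tm, HW.map_aw]
  | succ n ih =>
    rw [rho_succ, rho_succ, rho0_tm D hg, map_add, HW.map_aw, tm_hv, snd_tm, lTensor_comm ih]

/-- The part of the differential not involving the left action. -/
def B (l : E →ₐ[k] Module.End k N) (n : ℕ) : HW k A H N (n + 1) →ₗ[k] HW k A H N n :=
  I n + (-1 : k) ^ (n + 1) • D.rho l n

theorem B_apply (l : E →ₐ[k] Module.End k N) (n : ℕ) (v : HW k A H N (n + 1)) :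
    D.B l n v = I n v + (-1 : k) ^ (n + 1) • D.rho l n v := rfl

theorem B_tm {l : E →ₐ[k] Module.End k N} {l' : E →ₐ[k] Module.End k N'} {g : N →ₗ[k] N'}
    (hg : ∀ e x, g (l e x) = l' e (g x)) (n : ℕ) (v : HW k A H N (n + 1)) :
    D.B l' n (tm g (n + 1) v) = tm g n (D.B l n v) := by
  rw [B_apply, B_apply, rho_tm D hg, I_tm, map_add, map_smul]

/-- With the sign `(-1)^(n+1)` in front of `rho` and `I I = 0`, the square of `B` is the negative of
the expression in `rho_rho`. -/
theorem B_B (l : E →ₐ[k] Module.End k N) (n : ℕ) (v : HW k A H N (n + 2)) :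
    D.B l n (D.B l (n + 1) v) = 0 := by
  have e := D.rho_rho l n v
  simp only [B_apply, map_add, map_smul, I_I]
  rcases neg_one_pow_eq_or k n with h | h <;> simp only [pow_succ, h] at e ⊢ <;>
    linear_combination (norm := module) -e

theorem B_zero (l : E →ₐ[k] Module.End k N) (v : HW k A H N 1) :
    D.B l 0 v = -HW.aw (actNil A H l (D.L 0 v)) := by
  simp [B_apply, rho_zero]

/-- The terms with `rho` cancel: `rho` commutes with `L`, and its sign in `B` alternates with the
degree. What remains is `L_L`. -/
theorem L_B (l : E →ₐ[k] Module.End k N) (n : ℕ) (v : HW k A H N (n + 2)) :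
    sh (D.L n) (D.L (n + 1) v) + LinearMap.lTensor E (D.B l n) (D.L (n + 1) v)
      + D.L n (D.B l (n + 1) v) = 0 := by
  rw [← D.L_L n v, B, B_apply, LinearMap.lTensor_add, LinearMap.add_apply, LinearMap.lTensor_smul,
    LinearMap.smul_apply, map_add, map_smul, L_rho, pow_succ _ (n + 1)]
  module

variable (S : BiAct k E N) (S' : BiAct k E N')

/-- The right action on tails, `e ⊗ v ↦ v e`. -/
def tl (C : Type u) [AddCommGroup C] [Module k C] (B : Type u) [AddCommGroup B] [Module k B]
    (n : ℕ) : E ⊗[k] HW k B C N n →ₗ[k] HW k B C N n :=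
  TensorProduct.lift (HW.tailEnd n ∘ₗ S.r.toLinearMap ∘ₗ
    (MulOpposite.opLinearEquiv k : E ≃ₗ[k] Eᵐᵒᵖ).toLinearMap)

@[simp] theorem tl_tmul {B C : Type u} [AddCommGroup C] [Module k C] [AddCommGroup B] [Module k B]
    (n : ℕ) (e : E) (v : HW k B C N n) :
    tl S C B n (e ⊗ₜ v) = tm (S.r (MulOpposite.op e)) n v := rfl

theorem tl_smul (n : ℕ) (e : E) (z : E ⊗[k] HW k A H N n) :
    tl S H A n (e • z) = tl S H A n (LinearMap.lTensor E (tm (S.r (MulOpposite.op e)) n) z) := by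
  induction z with
  | zero => simp
  | add x y hx hy => simp only [smul_add, map_add, hx, hy]
  | tmul e' v =>
    rw [TensorProduct.smul_tmul', tl_tmul, LinearMap.lTensor_tmul, tl_tmul, smul_eq_mul,
      MulOpposite.op_mul, map_mul, Module.End.mul_eq_comp, ← LinearMap.comp_apply]
    simp only [tm]
    rw [← HW.map_comp]; simp

/-- For a right action `(x e) e' = x (e e')`. Hence bringing out an element, letting it act, and
doing the same again is a single right action by the product that `sh` forms. The hypothesis `hf`
lets the first action pass the second extraction. -/
theorem tl_sh {m n : ℕ} {f : HW k A H N m →ₗ[k] E ⊗[k] HW k A H N n}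
    (hf : ∀ e v, f (tm (S.r e) m v) = LinearMap.lTensor E (tm (S.r e) n) (f v))
    (z : E ⊗[k] HW k A H N m) : tl S H A n (f (tl S H A m z)) = tl S H A n (sh f z) := by
  induction z with
  | zero => simp
  | add x y hx hy => simp only [map_add, hx, hy]
  | tmul e v => rw [tl_tmul, hf, sh_tmul, tl_smul]

theorem tl_comm {m n : ℕ} {f : HW k A H N m →ₗ[k] HW k A H N n}
    (hf : ∀ e v, f (tm (S.r e) m v) = tm (S.r e) n (f v))
    (z : E ⊗[k] HW k A H N m) : f (tl S H A m z) = tl S H A n (LinearMap.lTensor E f z) := by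
  induction z with
  | zero => simp
  | add x y hx hy => simp only [map_add, hx, hy]
  | tmul e v => rw [tl_tmul, hf, LinearMap.lTensor_tmul, tl_tmul]

variable {S S'} in
theorem tl_tm {B C : Type u} [AddCommGroup C] [Module k C] [AddCommGroup B] [Module k B]
    {g : N →ₗ[k] N'} (hg : S.Hom S' g) (n : ℕ) (z : E ⊗[k] HW k B C N n) :
    tl S' C B n (LinearMap.lTensor E (tm g n) z) = tm g n (tl S C B n z) := by
  induction z with
  | zero => simp
  | add x y hx hy => simp only [map_add, hx, hy]
  | tmul e v =>
    rw [LinearMap.lTensor_tmul, tl_tmul, tl_tmul, ← LinearMap.comp_apply, ← LinearMap.comp_apply]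
    simp only [tm]
    rw [← HW.map_comp, ← HW.map_comp]
    congr 2
    ext x
    simp [hg.r]

/-- The differential of the complex of mixed words. -/
def d (n : ℕ) : HW k A H N (n + 1) →ₗ[k] HW k A H N n :=
  tl S H A n ∘ₗ D.L n + D.B S.l n

theorem d_apply (n : ℕ) (v : HW k A H N (n + 1)) :
    D.d S n v = tl S H A n (D.L n v) + D.B S.l n v := rfl

theorem B_comm (n : ℕ) (e : Eᵐᵒᵖ) (v : HW k A H N (n + 1)) :
    D.B S.l n (tm (S.r e) (n + 1) v) = tm (S.r e) n (D.B S.l n v) :=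
  D.B_tm (fun e' x => (S.comm e' e x).symm) n v

/-- By `tl_sh` the square of the part with `L` is the right action applied to `L L`, and by
`tl_comm` the mixed terms are the right action applied to `B L` and `L B`. Their sum vanishes by
`L_B`, and `B B = 0`. -/
theorem d_d (n : ℕ) (v : HW k A H N (n + 2)) : D.d S n (D.d S (n + 1) v) = 0 := by
  rw [d_apply, d_apply, map_add, map_add, map_add, B_B, add_zero,
    tl_sh S (fun e v => D.L_tm _ n v), tl_comm S (D.B_comm S n),
    ← map_zero (tl S H A n), ← D.L_B S.l n v, map_add, map_add]
  abel

variable {S S'} in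
theorem d_tm {g : N →ₗ[k] N'} (hg : S.Hom S' g) (n : ℕ) (v : HW k A H N (n + 1)) :
    D.d S' n (tm g (n + 1) v) = tm g n (D.d S n v) := by
  rw [d_apply, d_apply, L_tm, tl_tm hg, B_tm D hg.l, map_add]

/-- The comparison map to the Hochschild complex. -/
def Phi : (n : ℕ) → HW k A H N n →ₗ[k] Wd k E N n
  | 0 => Wd.nil.toLinearMap ∘ₗ Wd.nil.symm.toLinearMap ∘ₗ HW.fst
  | n + 1 => Wd.cons.toLinearMap ∘ₗ LinearMap.lTensor E (Phi n) ∘ₗ D.L n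

@[simp] theorem Phi_zero (x : N) : D.Phi 0 (HW.aw (Wd.nil x)) = Wd.nil x := rfl

theorem Phi_succ (n : ℕ) (v : HW k A H N (n + 1)) :
    D.Phi (n + 1) v = Wd.cons (LinearMap.lTensor E (D.Phi n) (D.L n v)) := rfl

theorem Phi_tm (g : N →ₗ[k] N') (n : ℕ) (v : HW k A H N n) :
    D.Phi n (tm g n v) = Wd.map LinearMap.id g n (D.Phi n v) := by
  induction n with
  | zero =>
    obtain ⟨x, rfl⟩ := Wd.nil.surjective v
    rfl
  | succ n ih =>
    rw [Phi_succ, Phi_succ, L_tm, Wd.tm_cons, lTensor_comm ih]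

/-- `Phi` takes letters out with `L` again and again. The bar boundary multiplies the first two
letters, which is `sh (D.L n)`, or continues behind the first, which is `B` by induction; by `L_B`
the two together give `L` of `B v`. -/
theorem bar_Phi (l : E →ₐ[k] Module.End k N) (n : ℕ) (v : HW k A H N (n + 1)) :
    Wd.bar l n (D.Phi (n + 1) v) = D.Phi n (D.B l n v) := by
  suffices h : Wd.bar l n ∘ₗ D.Phi (n + 1) = D.Phi n ∘ₗ D.B l n from LinearMap.congr_fun h v
  clear v
  induction n with
  | zero =>
    ext v
    rw [LinearMap.comp_apply, LinearMap.comp_apply, Phi_succ, Wd.bar_zero', B_zero, map_neg]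
    congr 1
  | succ n ih =>
    ext v
    have aux : ∀ z : E ⊗[k] HW k A H N (n + 1),
        Wd.bar l (n + 1) (Wd.cons (LinearMap.lTensor E (D.Phi (n + 1)) z)) =
        -Wd.cons (LinearMap.lTensor E (D.Phi n) (sh (D.L n) z + LinearMap.lTensor E (D.B l n) z)) := by
      intro z
      induction z with
      | zero => simp
      | add x y hx hy => rw [map_add, map_add, map_add, hx, hy]; simp only [map_add]; abel
      | tmul e v =>
        have := LinearMap.congr_fun ih v
        rw [LinearMap.comp_apply, LinearMap.comp_apply] at this
        rw [LinearMap.lTensor_tmul, Phi_succ, Wd.bar_succ', ← Phi_succ, this, sh_tmul,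
          map_add, map_add, lTensor_smul, LinearMap.lTensor_tmul, LinearMap.lTensor_tmul]
        abel
    rw [LinearMap.comp_apply, LinearMap.comp_apply, Phi_succ, aux,
      eq_neg_of_add_eq_zero_left (D.L_B l n v), map_neg, map_neg, neg_neg, Phi_succ]

theorem b_Phi (n : ℕ) (v : HW k A H N (n + 1)) :
    S.b n (D.Phi (n + 1) v) = D.Phi n (D.d S n v) := by
  rw [Phi_succ, BiAct.b_cons, ← Phi_succ, bar_Phi, d_apply, map_add]
  congr 1
  generalize D.L n v = z
  induction z with
  | zero => simp
  | add x y hx hy => simp only [map_add, hx, hy]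
  | tmul e v => rw [LinearMap.lTensor_tmul, BiAct.tlW_tmul, tl_tmul, Phi_tm]

end Factorization

/-! ### Kernels of tensor products of surjections -/

section Kernels

variable {k : Type*} [CommRing k] {V V' W W' Q : Type*} [AddCommGroup V] [Module k V]
variable [AddCommGroup V'] [Module k V'] [AddCommGroup W] [Module k W] [AddCommGroup W']
variable [Module k W'] [AddCommGroup Q] [Module k Q]

theorem map_lTensor_apply (f : V →ₗ[k] V') (g' : Q →ₗ[k] W) (g : W →ₗ[k] W') (z : V ⊗[k] Q) :
    TensorProduct.map f g (LinearMap.lTensor V g' z) =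
      LinearMap.rTensor W' f (LinearMap.lTensor V (g ∘ₗ g') z) := by
  rw [← LinearMap.comp_apply, ← LinearMap.comp_apply, LinearMap.rTensor_comp_lTensor,
    LinearMap.map_comp_lTensor]

theorem exists_lTensor_ker {g : W →ₗ[k] W'} (hg : Function.Surjective g) {z : V ⊗[k] W}
    (hz : LinearMap.lTensor V g z = 0) :
    ∃ y, LinearMap.lTensor V (LinearMap.ker g).subtype y = z :=
  (lTensor_exact V (LinearMap.exact_subtype_ker_map g) hg z).1 hz

/-- By right exactness the kernel of `f ⊗ g` is the sum of the images of `ker f ⊗ W` and `V ⊗ ker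
g`, and `ker f` is contained in the multiples of `e`. Applied letter by letter, it reduces
statements about degenerate words to words with one unit letter. -/
theorem eq_zero_of_map_eq_zero {f : V →ₗ[k] V'} {g : W →ₗ[k] W'} (hf : Function.Surjective f)
    (hg : Function.Surjective g) {e : V} (he : LinearMap.ker f ≤ Submodule.span k {e})
    {φ : V ⊗[k] W →ₗ[k] Q} (h₁ : ∀ v w, g w = 0 → φ (v ⊗ₜ w) = 0) (h₂ : ∀ w, φ (e ⊗ₜ w) = 0)
    {x : V ⊗[k] W} (hx : TensorProduct.map f g x = 0) : φ x = 0 := by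
  have hx' : x ∈ LinearMap.ker (TensorProduct.map f g) := hx
  rw [TensorProduct.map_ker (LinearMap.exact_subtype_ker_map f) hf
    (LinearMap.exact_subtype_ker_map g) hg] at hx'
  obtain ⟨_, ⟨y, rfl⟩, _, ⟨z, rfl⟩, rfl⟩ := Submodule.mem_sup.1 hx'
  have e₁ : φ ∘ₗ LinearMap.lTensor V (LinearMap.ker g).subtype = 0 :=
    TensorProduct.ext' fun v w => h₁ v w w.2
  have e₂ : φ ∘ₗ LinearMap.rTensor W (LinearMap.ker f).subtype = 0 := by
    refine TensorProduct.ext' fun v w => ?_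
    obtain ⟨c, hc⟩ := Submodule.mem_span_singleton.1 (he v.2)
    have hc' : (v : V) = c • e := hc.symm
    simp only [LinearMap.comp_apply, LinearMap.rTensor_tmul, Submodule.subtype_apply, hc',
      ← TensorProduct.smul_tmul', map_smul, h₂, smul_zero, LinearMap.zero_apply]
  rw [map_add]
  exact (congrArg₂ (· + ·) (LinearMap.congr_fun e₁ y) (LinearMap.congr_fun e₂ z)).trans (add_zero 0)

end Kernels

/-! ### Degenerate words in the Hochschild complex -/

section Wd

variable {k R : Type u} [CommRing k] [Ring R] [Algebra k R]
variable {N : Type w} [AddCommGroup N] [Module k N]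

/-- The Hochschild boundary before the right action of the first letter. -/
def Wd.dW (l : R →ₐ[k] Module.End k N) (n : ℕ) : Wd k R N (n + 1) →ₗ[k] R ⊗[k] Wd k R N n :=
  Wd.cons.symm.toLinearMap + TensorProduct.mk k R _ 1 ∘ₗ Wd.bar l n

theorem Wd.dW_cons' (l : R →ₐ[k] Module.End k N) (n : ℕ) (z : R ⊗[k] Wd k R N n) :
    Wd.dW l n (Wd.cons z) = z + 1 ⊗ₜ Wd.bar l n (Wd.cons z) := rfl

theorem Wd.dW_cons_zero (l : R →ₐ[k] Module.End k N) (a : R) (w : Wd k R N 0) :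
    Wd.dW l 0 (Wd.cons (a ⊗ₜ w)) = a ⊗ₜ w - 1 ⊗ₜ actTail R l (a ⊗ₜ w) := by
  rw [Wd.dW_cons', Wd.bar_zero', TensorProduct.tmul_neg, sub_eq_add_neg]

/-- The recursion closes because `dW w` contains both `w` itself and `1 ⊗ bar w`: multiplying by `a`
yields the product of `a` with the first letter and the boundary behind `a`. -/
theorem Wd.dW_cons (l : R →ₐ[k] Module.End k N) (n : ℕ) (a : R) (w : Wd k R N (n + 1)) :
    Wd.dW l (n + 1) (Wd.cons (a ⊗ₜ w)) = a ⊗ₜ w - 1 ⊗ₜ Wd.cons (a • Wd.dW l n w) := by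
  obtain ⟨z, rfl⟩ := Wd.cons.surjective w
  rw [Wd.dW_cons', Wd.bar_succ', Wd.dW_cons', smul_add, TensorProduct.smul_tmul', smul_eq_mul,
    mul_one, map_add, TensorProduct.tmul_add, TensorProduct.tmul_sub, TensorProduct.tmul_neg]
  abel

variable {R' : Type u} [AddCommGroup R'] [Module k R'] {q : R →ₗ[k] R'}

theorem Wd.map_surjective (hq : Function.Surjective q) (n : ℕ) :
    Function.Surjective (Wd.map q (LinearMap.id : N →ₗ[k] N) n) := by
  induction n with
  | zero => exact fun x => ⟨x, rfl⟩
  | succ n ih => exact TensorProduct.map_surjective hq ih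

/-- Degenerate words form a subcomplex: if the first letter is `1`, the word itself cancels against
the product of `1` with the second letter, and all other terms keep a unit. Working before the right
action keeps the first factor in `R` unreduced, so that any right action can be applied afterwards.
-/
theorem Wd.map_dW (l : R →ₐ[k] Module.End k N) (hq : Function.Surjective q) (hq1 : q 1 = 0)
    (hker : LinearMap.ker q ≤ Submodule.span k {1}) (n : ℕ) {w : Wd k R N (n + 1)}
    (hw : Wd.map q LinearMap.id (n + 1) w = 0) :
    LinearMap.lTensor R (Wd.map q LinearMap.id n) (Wd.dW l n w) = 0 := by
  obtain ⟨z, rfl⟩ := Wd.cons.surjective w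
  change (LinearMap.lTensor R (Wd.map q LinearMap.id n) ∘ₗ Wd.dW l n ∘ₗ Wd.cons.toLinearMap) z = 0
  have aux : ∀ (a : R) n (y : R ⊗[k] Wd k R N n), TensorProduct.map q (Wd.map q LinearMap.id n) (a • y) =
      LinearMap.rTensor _ q (a • LinearMap.lTensor R (Wd.map q LinearMap.id n) y) := by
    intro a n y
    rw [← lTensor_smul, ← LinearMap.comp_apply, LinearMap.rTensor_comp_lTensor]
  induction n with
  | zero =>
    refine eq_zero_of_map_eq_zero hq (Wd.map_surjective hq 0) hker (fun a w h => ?_) (fun w => ?_) hw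
    · have h : w = 0 := h
      simp [h]
    · obtain ⟨x, rfl⟩ := Wd.nil.surjective w
      simp [Wd.dW_cons_zero]
  | succ n ih =>
    refine eq_zero_of_map_eq_zero hq (Wd.map_surjective hq (n + 1)) hker (fun a w h => ?_)
      (fun w => ?_) hw
    · obtain ⟨y, rfl⟩ := Wd.cons.surjective w
      have := ih _ h
      rw [LinearMap.comp_apply, LinearMap.comp_apply] at this
      simp only [LinearMap.comp_apply, LinearEquiv.coe_coe, Wd.dW_cons, map_sub,
        LinearMap.lTensor_tmul, h, Wd.map_cons', aux] at this ⊢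
      simp [this]
    · obtain ⟨y, rfl⟩ := Wd.cons.surjective w
      simp only [LinearMap.comp_apply, LinearEquiv.coe_coe, Wd.dW_cons, map_sub, one_smul,
        LinearMap.lTensor_tmul]
      rw [Wd.map_cons' q _ _ (Wd.dW l n (Wd.cons y)), Wd.map_cons', Wd.dW_cons', map_add,
        TensorProduct.map_tmul, hq1]
      simp

end Wd

/-! ### The differential on words modulo units -/

namespace Factorization

variable {k A H E : Type u} [CommRing k] [Ring A] [Algebra k A] [AddCommGroup H]
variable [Module k H] [Ring E] [Algebra k E] (D : Factorization k A H E)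
variable {N : Type w} [AddCommGroup N] [Module k N] (l : E →ₐ[k] Module.End k N)

/-- The differential before the right action. -/
def dE (n : ℕ) : HW k A H N (n + 1) →ₗ[k] E ⊗[k] HW k A H N n :=
  D.L n + TensorProduct.mk k E _ 1 ∘ₗ D.B l n

theorem dE_apply (n : ℕ) (v : HW k A H N (n + 1)) :
    D.dE l n v = D.L n v + 1 ⊗ₜ D.B l n v := rfl

theorem d_eq (S : BiAct k E N) (n : ℕ) (v : HW k A H N (n + 1)) :
    D.d S n v = tl S H A n (D.dE S.l n v) := by
  rw [d_apply, dE_apply, map_add, tl_tmul, MulOpposite.op_one, map_one]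
  exact congrArg _ (LinearMap.congr_fun (HW.map_id n).symm _)

/-- On a word in `A` the operator `rho0` takes out all letters in order and lets the last one act on
the tail, which is the last term of the Hochschild boundary of `A`. -/
theorem rho0_aw (n : ℕ) (w : Wd k A N (n + 1)) :
    Wd.inner n w + (-1 : k) ^ (n + 1) • D.rho0 l n (HW.aw w) =
      Wd.bar (l.comp D.incl) n w := by
  suffices h : Wd.inner n + (-1 : k) ^ (n + 1) • (D.rho0 l n ∘ₗ HW.aw) =
      Wd.bar (l.comp D.incl) n from LinearMap.congr_fun h w
  clear w
  induction n with
  | zero =>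
    refine Wd.hom_ext fun a w => ?_
    obtain ⟨x, rfl⟩ := Wd.nil.surjective w
    simp [rho0_zero]
  | succ n ih =>
    refine Wd.hom_ext₂ fun a b w => ?_
    have := LinearMap.congr_fun ih (Wd.cons (b ⊗ₜ w))
    simp only [LinearMap.add_apply, LinearMap.smul_apply, LinearMap.comp_apply] at this
    simp only [LinearMap.add_apply, LinearMap.smul_apply, LinearMap.comp_apply, Wd.inner_succ,
      Wd.bar_succ, ← this, rho0_succ, LA_aw, LinearMap.lTensor_tmul, TensorProduct.tmul_add,
      TensorProduct.tmul_smul, map_add, map_smul, pow_succ]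
    module

theorem rho_aw (n : ℕ) (w : Wd k A N (n + 1)) :
    D.rho l n (HW.aw w) = HW.aw (D.rho0 l n (HW.aw w)) := by
  cases n with
  | zero => rfl
  | succ n => rw [rho_succ]; simp

theorem B_aw (n : ℕ) (w : Wd k A N (n + 1)) :
    D.B l n (HW.aw w) = HW.aw (Wd.bar (l.comp D.incl) n w) := by
  rw [B_apply, I_aw, rho_aw, ← rho0_aw, map_add, map_smul]

theorem dE_aw (n : ℕ) (w : Wd k A N (n + 1)) :
    D.dE l n (HW.aw w) =
      TensorProduct.map D.incl.toLinearMap HW.aw (Wd.dW (l.comp D.incl) n w) := by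
  obtain ⟨z, rfl⟩ := Wd.cons.surjective w
  rw [dE_apply, B_aw, Wd.dW_cons', L_apply, HW.snd_aw, map_zero, add_zero, LA_aw', map_add]
  congr 1
  · rw [toE, ← LinearMap.comp_apply, LinearMap.rTensor_comp_lTensor]
  · simp

theorem dE_hv_zero (h : H) (v : HW k A H N 0) :
    D.dE l 0 (HW.hv (h ⊗ₜ v)) = D.gam h ⊗ₜ v - 1 ⊗ₜ HW.aw (D.rho0 l 0 (HW.hv (h ⊗ₜ v))) := by
  rw [dE_apply, B_zero, L_hv_zero, TensorProduct.tmul_neg, sub_eq_add_neg, rho0_zero, L_hv_zero]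

/-- This is the recursion of `L` for the complete operator `dE`; the extra term collects the words
in which `rho` leaves no letter of `H`. -/
theorem dE_hv (n : ℕ) (h : H) (v : HW k A H N (n + 1)) :
    D.dE l (n + 1) (HW.hv (h ⊗ₜ v)) = D.gam h ⊗ₜ v - D.ins n (D.gam h • D.dE l n v)
      + (-1 : k) ^ n • (1 ⊗ₜ HW.aw (D.rho0 l (n + 1) (HW.hv (h ⊗ₜ v)))) := by
  have e : D.ins n (D.gam h • D.dE l n v) =
      D.ins n (D.gam h • D.L n v) + 1 ⊗ₜ HW.hv (h ⊗ₜ D.B l n v) := by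
    rw [dE_apply, smul_add, TensorProduct.smul_tmul', smul_eq_mul, mul_one, map_add, ins_gam]
  rw [e, dE_apply, L_hv, B_apply, I_hv, rho_succ, HW.snd_hv, LinearMap.lTensor_tmul, B_apply]
  simp only [TensorProduct.tmul_add, TensorProduct.tmul_neg, TensorProduct.tmul_smul, map_add,
    map_smul, smul_add, pow_succ]
  module

theorem insA_toE (n : ℕ) (z : A ⊗[k] HW k A H N n) :
    D.insA n (D.toE _ z) =
      LinearMap.lTensor A (HW.hv ∘ₗ TensorProduct.mk k H _ D.one) z := by
  induction z with
  | zero => simp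
  | add x y hx hy => simp only [map_add, hx, hy]
  | tmul a v =>
    have := D.insA_tmul n a D.one v
    rw [D.gam_one, mul_one] at this
    simp [this]

theorem insA_rTensor_gam (n : ℕ) (z : H ⊗[k] HW k A H N n) :
    D.insA n (LinearMap.rTensor _ D.gam z) = 1 ⊗ₜ HW.hv z := by
  induction z with
  | zero => simp
  | add x y hx hy => simp only [map_add, hx, hy, TensorProduct.tmul_add]
  | tmul h v => simp

/-- Every word produced by `insA` starts with a letter of `H`, so only the pure words in `A`
contribute. -/
theorem cons_fst_LA (n : ℕ) (v : HW k A H N (n + 1)) :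
    Wd.cons (LinearMap.lTensor A HW.fst (D.LA n v)) = HW.fst v := by
  have hins : ∀ n (z : E ⊗[k] HW k A H N n), LinearMap.lTensor A HW.fst (D.insA n z) = 0 := by
    intro n z
    suffices h : LinearMap.lTensor A HW.fst ∘ₗ D.insA (N := N) n = 0 from LinearMap.congr_fun h z
    refine D.hom_ext fun a h v => ?_
    simp
  suffices h : Wd.cons.toLinearMap ∘ₗ LinearMap.lTensor A HW.fst ∘ₗ D.LA (N := N) n = HW.fst from
    LinearMap.congr_fun h v
  refine HW.hom_ext (fun a w => by simp) fun h v => ?_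
  cases n with
  | zero => simp
  | succ n => simp [hins]

/-- Quotients `A → A / k·1` and `H → H / k·1`. -/
structure Reduction (A' H' : Type u) [AddCommGroup A'] [Module k A'] [AddCommGroup H']
    [Module k H'] where
  /-- The map on `A`. -/
  qA : A →ₗ[k] A'
  /-- The map on `H`. -/
  qH : H →ₗ[k] H'
  qA_surj : Function.Surjective qA
  qH_surj : Function.Surjective qH
  qA_one : qA 1 = 0
  qH_one : qH D.one = 0
  ker_qA : LinearMap.ker qA ≤ Submodule.span k {1}
  ker_qH : LinearMap.ker qH ≤ Submodule.span k {D.one}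

namespace Reduction

variable {D} {A' H' : Type u} [AddCommGroup A'] [Module k A'] [AddCommGroup H'] [Module k H']
variable (q : D.Reduction A' H')

/-- The class of a word. -/
abbrev clsW (N : Type w) [AddCommGroup N] [Module k N] (n : ℕ) : Wd k A N n →ₗ[k] Wd k A' N n :=
  Wd.map q.qA LinearMap.id n

/-- The class of a mixed word. -/
abbrev cls (N : Type w) [AddCommGroup N] [Module k N] (n : ℕ) :
    HW k A H N n →ₗ[k] HW k A' H' N n :=
  HW.map q.qA q.qH LinearMap.id n

theorem cls_surjective (n : ℕ) : Function.Surjective (q.cls N n) := by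
  induction n with
  | zero => exact fun x => ⟨x, rfl⟩
  | succ n ih =>
    exact Function.Surjective.prodMap (Wd.map_surjective q.qA_surj (n + 1))
      (TensorProduct.map_surjective q.qH_surj ih)

theorem clsW_fst {n : ℕ} {v : HW k A H N n} (hv : q.cls N n v = 0) :
    q.clsW N n (HW.fst v) = 0 := by
  rw [← HW.fst_map q.qA q.qH, hv, map_zero]

theorem map_snd {n : ℕ} {v : HW k A H N (n + 1)} (hv : q.cls N (n + 1) v = 0) :
    TensorProduct.map q.qH (q.cls N n) (HW.snd v) = 0 := by
  rw [← HW.snd_map, hv, map_zero]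

/-- A linear map that kills words without letters of `H` and with class zero, and words `h ⊗ v`
with `v` of class zero or `h` the unit, kills all words of class zero. -/
theorem eq_zero_of_cls {Q : Type*} [AddCommGroup Q] [Module k Q] {n : ℕ}
    {φ : HW k A H N (n + 1) →ₗ[k] Q} (h₁ : ∀ w, q.clsW N (n + 1) w = 0 → φ (HW.aw w) = 0)
    (h₂ : ∀ h v, q.cls N n v = 0 → φ (HW.hv (h ⊗ₜ v)) = 0)
    (h₃ : ∀ v, φ (HW.hv (D.one ⊗ₜ v)) = 0) {v : HW k A H N (n + 1)}
    (hv : q.cls N (n + 1) v = 0) : φ v = 0 := by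
  rw [← HW.aw_fst_add_hv_snd v, map_add, h₁ _ (q.clsW_fst hv), zero_add]
  exact eq_zero_of_map_eq_zero (φ := φ ∘ₗ HW.hv) q.qH_surj (q.cls_surjective n) q.ker_qH h₂ h₃
    (q.map_snd hv)

theorem cls_insA (n : ℕ) {z : E ⊗[k] HW k A H N n}
    (hz : LinearMap.lTensor E (q.cls N n) z = 0) :
    LinearMap.lTensor A (q.cls N (n + 1)) (D.insA n z) = 0 := by
  obtain ⟨y, rfl⟩ := exists_lTensor_ker (q.cls_surjective n) hz
  suffices h : LinearMap.lTensor A (q.cls N (n + 1)) ∘ₗ D.insA n ∘ₗ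
      LinearMap.lTensor E (LinearMap.ker (q.cls N n)).subtype = 0 from LinearMap.congr_fun h y
  refine D.hom_ext fun a h v => ?_
  have : q.cls N n v = 0 := v.2
  simp [this]

theorem cls_ins (n : ℕ) {z : E ⊗[k] HW k A H N n}
    (hz : LinearMap.lTensor E (q.cls N n) z = 0) :
    LinearMap.lTensor E (q.cls N (n + 1)) (D.ins n z) = 0 := by
  rw [ins, LinearMap.comp_apply, toE_lTensor, q.cls_insA n hz, map_zero]

theorem cls_hv_one (n : ℕ) (z : A ⊗[k] HW k A H N n) : LinearMap.lTensor A (q.cls N (n + 1))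
    (LinearMap.lTensor A (HW.hv ∘ₗ TensorProduct.mk k H _ D.one) z) = 0 := by
  rw [← LinearMap.lTensor_comp_apply]
  have : q.cls N (n + 1) ∘ₗ HW.hv ∘ₗ TensorProduct.mk k H _ D.one = 0 := by
    ext v; simp [q.qH_one]
  rw [this, LinearMap.lTensor_zero, LinearMap.zero_apply]

/-- The three claims need each other in the induction. For a word `1 v` with `1` in `H`, the pure
part of `v` in `1 ⊗ v` is cancelled by the value of `rho0` given in the second claim, the part of
`v` starting in `H` is cancelled by its reinsertion, and everything else that is reinserted has
first letter `1`. The first claim, that `rho0` ignores degenerate tails, rests on the third one in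
lower degree. -/
theorem cls_descent (n : ℕ) :
    (∀ h v, q.cls N n v = 0 → q.clsW N n (D.rho0 l n (HW.hv (h ⊗ₜ v))) = 0) ∧
    (∀ v, q.clsW N n (D.rho0 l n (HW.hv (D.one ⊗ₜ v))) = (-1 : k) ^ n • q.clsW N n (HW.fst v)) ∧
    ∀ v, q.cls N (n + 1) v = 0 → LinearMap.lTensor E (q.cls N n) (D.dE l n v) = 0 := by
  have haw : ∀ n w, q.clsW N (n + 1) w = 0 →
      LinearMap.lTensor E (q.cls N n) (D.dE l n (HW.aw w)) = 0 := by
    intro n w hw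
    have key : LinearMap.lTensor E (q.cls N n) ∘ₗ
        TensorProduct.map D.incl.toLinearMap HW.aw =
        TensorProduct.map D.incl.toLinearMap HW.aw ∘ₗ LinearMap.lTensor A (q.clsW N n) :=
      TensorProduct.ext' fun a w => by simp
    rw [dE_aw, ← LinearMap.comp_apply, key, LinearMap.comp_apply,
      Wd.map_dW _ q.qA_surj q.qA_one q.ker_qA n hw, map_zero]
  induction n with
  | zero =>
    have h₁ : ∀ h (v : HW k A H N 0), q.cls N 0 v = 0 →
        q.clsW N 0 (D.rho0 l 0 (HW.hv (h ⊗ₜ v))) = 0 := by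
      intro h v hv
      have hv : v = 0 := hv
      rw [hv, TensorProduct.tmul_zero, map_zero, map_zero, map_zero]
    have h₂ : ∀ v : HW k A H N 0, D.rho0 l 0 (HW.hv (D.one ⊗ₜ v)) = HW.fst v := by
      intro v
      obtain ⟨x, rfl⟩ := Wd.nil.surjective v
      change D.rho0 l 0 (HW.hv (D.one ⊗ₜ HW.aw (Wd.nil x))) = _
      rw [rho0_zero, L_hv_zero, D.gam_one, actNil_tmul, map_one]
      rfl
    refine ⟨h₁, fun v => by rw [h₂, pow_zero, one_smul], fun v hv => ?_⟩
    refine q.eq_zero_of_cls (φ := LinearMap.lTensor E (q.cls N 0) ∘ₗ D.dE l 0) (haw 0)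
      (fun h v hv => ?_) (fun v => ?_) hv
    · simp [dE_hv_zero, hv, h₁ h v hv]
    · rw [LinearMap.comp_apply, dE_hv_zero, h₂, D.gam_one, HW.aw_zero_surj, sub_self, map_zero]
  | succ n ih =>
    obtain ⟨ih₁, ih₂, ih₃⟩ := ih
    -- An element of class zero lifts to `E ⊗ ker`, and there the first claim of the induction
    -- applies to each `a h ⊗ v`.
    have hT : ∀ z : E ⊗[k] HW k A H N n, LinearMap.lTensor E (q.cls N n) z = 0 →
        LinearMap.lTensor A (q.clsW N n ∘ₗ D.rho0 l n) (D.insA n z) = 0 := by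
      intro z hz
      obtain ⟨y, rfl⟩ := exists_lTensor_ker (q.cls_surjective n) hz
      suffices h : LinearMap.lTensor A (q.clsW N n ∘ₗ D.rho0 l n) ∘ₗ D.insA n ∘ₗ
          LinearMap.lTensor E (LinearMap.ker (q.cls N n)).subtype = 0 from LinearMap.congr_fun h y
      refine D.hom_ext fun a h v => ?_
      have : q.cls N n v = 0 := v.2
      simp [ih₁ h _ this]
    have hrho : ∀ h v, q.clsW N (n + 1) (D.rho0 l (n + 1) (HW.hv (h ⊗ₜ v))) =
        -Wd.cons (LinearMap.rTensor _ q.qA (LinearMap.lTensor A (q.clsW N n ∘ₗ D.rho0 l n)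
          (D.insA n (D.gam h • D.L n v)))) := by
      intro h v
      rw [rho0_succ, LA_hv, map_neg, map_neg, map_neg, clsW, Wd.map_cons', map_lTensor_apply]
    have h₁ : ∀ h v, q.cls N (n + 1) v = 0 →
        q.clsW N (n + 1) (D.rho0 l (n + 1) (HW.hv (h ⊗ₜ v))) = 0 := by
      intro h v hv
      -- The operator `dE`, not `L`, respects classes. The difference `h ⊗ B v` is reinserted as `1
      -- ⊗ h (B v)`, and the letter `1` of `A` dies in the quotient.
      have e : D.gam h • D.L n v = D.gam h • D.dE l n v - D.gam h ⊗ₜ D.B l n v := by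
        rw [dE_apply, smul_add, TensorProduct.smul_tmul', smul_eq_mul, mul_one, add_sub_cancel_right]
      rw [hrho, e, map_sub, map_sub, hT _ (by rw [lTensor_smul, ih₃ v hv, smul_zero]), insA_gam,
        LinearMap.lTensor_tmul, zero_sub, map_neg, LinearMap.rTensor_tmul, q.qA_one,
        TensorProduct.zero_tmul, neg_zero, map_zero, neg_zero]
    have h₂ : ∀ v : HW k A H N (n + 1), q.clsW N (n + 1) (D.rho0 l (n + 1) (HW.hv (D.one ⊗ₜ v))) =
        (-1 : k) ^ (n + 1) • q.clsW N (n + 1) (HW.fst v) := by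
      intro v
      have e : (q.clsW N n ∘ₗ D.rho0 l n) ∘ₗ HW.hv ∘ₗ TensorProduct.mk k H _ D.one =
          (-1 : k) ^ n • (q.clsW N n ∘ₗ HW.fst) := LinearMap.ext ih₂
      rw [hrho, D.gam_one, one_smul, L_apply, map_add, insA_toE, insA_rTensor_gam, map_add,
        map_add, LinearMap.lTensor_tmul, LinearMap.rTensor_tmul, q.qA_one,
        TensorProduct.zero_tmul, add_zero, ← LinearMap.lTensor_comp_apply, e,
        LinearMap.lTensor_smul, LinearMap.smul_apply, map_smul, map_smul, ← D.cons_fst_LA,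
        clsW, Wd.map_cons', map_lTensor_apply, pow_succ]
      module
    refine ⟨h₁, h₂, fun v hv => ?_⟩
    refine q.eq_zero_of_cls (φ := LinearMap.lTensor E (q.cls N (n + 1)) ∘ₗ D.dE l (n + 1))
      (haw (n + 1)) (fun h v hv => ?_) (fun v => ?_) hv
    · have e : LinearMap.lTensor E (q.cls N n) (D.gam h • D.dE l n v) = 0 := by
        rw [lTensor_smul, ih₃ v hv, smul_zero]
      rw [LinearMap.comp_apply, dE_hv, map_add, map_sub, q.cls_ins n e, map_smul,
        LinearMap.lTensor_tmul, LinearMap.lTensor_tmul, hv, HW.map_aw, h₁ h v hv]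
      simp
    · rw [LinearMap.comp_apply, dE_hv, D.gam_one, one_smul, map_add, map_smul,
        LinearMap.lTensor_tmul, HW.map_aw, h₂, dE_apply, L_apply, map_add, map_add, ins, LinearMap.comp_apply,
        LinearMap.comp_apply, LinearMap.comp_apply, insA_toE, insA_rTensor_gam, insA_one]
      have e1 : q.cls N (n + 1) v = HW.aw (q.clsW N (n + 1) (HW.fst v)) +
          q.cls N (n + 1) (HW.hv (HW.snd v)) := by
        conv_lhs => rw [← HW.aw_fst_add_hv_snd v, map_add, HW.map_aw]
      simp only [map_sub, map_add, toE_lTensor, q.cls_hv_one, toE_tmul, map_one, LinearMap.lTensor_tmul,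
        HW.map_hv, q.qH_one, TensorProduct.zero_tmul, map_zero, TensorProduct.tmul_zero, e1,
        TensorProduct.tmul_add, map_smul, TensorProduct.tmul_smul, smul_smul, pow_succ]
      -- The sign in `dE_hv` and the one in the second claim multiply to `-1`, which produces the
      -- cancellation.
      have e2 : ((-1 : k) ^ n * (-1) ^ n) = 1 := by rw [← mul_pow]; simp
      rw [← mul_assoc, e2]
      module

theorem cls_tl (S : BiAct k E N) (n : ℕ) (z : E ⊗[k] HW k A H N n) : q.cls N n (tl S H A n z) =
    tl S H' A' n (LinearMap.lTensor E (q.cls N n) z) := by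
  induction z with
  | zero => simp
  | add x y hx hy => simp only [map_add, hx, hy]
  | tmul e v =>
    rw [LinearMap.lTensor_tmul, tl_tmul, tl_tmul, ← LinearMap.comp_apply,
      ← LinearMap.comp_apply, ← HW.map_comp, ← HW.map_comp]
    rfl

theorem cls_d (S : BiAct k E N) {n : ℕ} {v : HW k A H N (n + 1)} (hv : q.cls N (n + 1) v = 0) :
    q.cls N n (D.d S n v) = 0 := by
  rw [d_eq, q.cls_tl, (q.cls_descent S.l n).2.2 v hv, map_zero]

end Reduction

end Factorization

/-! ### Acyclicity for free bimodules -/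

section Wd

variable {k R : Type u} [CommRing k] [Ring R] [Algebra k R]
variable {N : Type w} [AddCommGroup N] [Module k N] {N' : Type w'} [AddCommGroup N'] [Module k N']

/-- Inserting a letter before the tail of a word. -/
def Wd.put (s : N →ₗ[k] R ⊗[k] N) : (n : ℕ) → Wd k R N n →ₗ[k] Wd k R N (n + 1)
  | 0 => Wd.cons.toLinearMap ∘ₗ LinearMap.lTensor R Wd.nil.toLinearMap ∘ₗ s
      ∘ₗ Wd.nil.symm.toLinearMap
  | n + 1 => Wd.cons.toLinearMap ∘ₗ LinearMap.lTensor R (Wd.put s n) ∘ₗ Wd.cons.symm.toLinearMap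

@[simp] theorem Wd.put_nil (s : N →ₗ[k] R ⊗[k] N) (x : N) :
    Wd.put s 0 (Wd.nil x) = Wd.cons (LinearMap.lTensor R Wd.nil.toLinearMap (s x)) := rfl

theorem Wd.put_cons' (s : N →ₗ[k] R ⊗[k] N) (n : ℕ) (z : R ⊗[k] Wd k R N n) :
    Wd.put s (n + 1) (Wd.cons z) = Wd.cons (LinearMap.lTensor R (Wd.put s n) z) := rfl

@[simp] theorem Wd.put_cons (s : N →ₗ[k] R ⊗[k] N) (n : ℕ) (b : R) (w : Wd k R N n) :
    Wd.put s (n + 1) (Wd.cons (b ⊗ₜ w)) = Wd.cons (b ⊗ₜ Wd.put s n w) := rfl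

theorem Wd.put_tm {s : N →ₗ[k] R ⊗[k] N} {s' : N' →ₗ[k] R ⊗[k] N'} {g : N →ₗ[k] N'}
    (hg : ∀ x, s' (g x) = LinearMap.lTensor R g (s x)) (n : ℕ) (w : Wd k R N n) :
    Wd.put s' n (Wd.map LinearMap.id g n w) = Wd.map LinearMap.id g (n + 1) (Wd.put s n w) := by
  suffices h : Wd.put s' n ∘ₗ Wd.map LinearMap.id g n =
    Wd.map LinearMap.id g (n + 1) ∘ₗ Wd.put s n from LinearMap.congr_fun h w
  clear w
  induction n with
  | zero =>
    ext w
    obtain ⟨x, rfl⟩ := Wd.nil.surjective w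
    simp only [LinearMap.comp_apply, Wd.map_nil, Wd.put_nil, hg, Wd.tm_cons]
    exact congrArg _ (lTensor_comm (f := Wd.nil.toLinearMap) (f' := Wd.nil.toLinearMap) (g := g)
      (g' := Wd.map LinearMap.id g 0) (fun _ => rfl) _)
  | succ n ih =>
    refine Wd.hom_ext fun a w => ?_
    have := LinearMap.congr_fun ih w
    simp only [LinearMap.comp_apply] at this
    simp [this]

theorem Wd.map_put {R' : Type u} [AddCommGroup R'] [Module k R'] {q : R →ₗ[k] R'}
    (s : N →ₗ[k] R ⊗[k] N) (n : ℕ) {w : Wd k R N n}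
    (hw : Wd.map q LinearMap.id n w = 0) (hq : Function.Surjective q)
    (hq1 : LinearMap.ker q ≤ Submodule.span k {1}) (hq' : q 1 = 0) :
    Wd.map q LinearMap.id (n + 1) (Wd.put s n w) = 0 := by
  induction n with
  | zero =>
    have hw : w = 0 := hw
    simp [hw]
  | succ n ih =>
    obtain ⟨z, rfl⟩ := Wd.cons.surjective w
    refine eq_zero_of_map_eq_zero (φ := Wd.map q LinearMap.id (n + 2) ∘ₗ Wd.put s (n + 1)
      ∘ₗ Wd.cons.toLinearMap) hq (Wd.map_surjective hq n) hq1 (fun a w h => ?_) (fun w => ?_) hw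
    · simp [ih h]
    · simp [hq']

section Bar

variable {l : R →ₐ[k] Module.End k N} {s : N →ₗ[k] R ⊗[k] N}
variable (hs : ∀ a y, s (l a y) = a • s y)
variable (hs' : ∀ y, actTail R l (LinearMap.lTensor R Wd.nil.toLinearMap (s y)) = Wd.nil y)
include hs hs'

/-- The usual contraction at the right end. Products of old letters commute with inserting. By `hs`,
the product of the last letter with the inserted one is the insertion after the last letter has
acted on the tail; by `hs'`, the action of the inserted letter gives back the word. -/
theorem Wd.bar_put (n : ℕ) (w : Wd k R N (n + 1)) :
    Wd.bar l (n + 1) (Wd.put s (n + 1) w) = Wd.put s n (Wd.bar l n w) + (-1 : k) ^ n • w := by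
  suffices h : Wd.bar l (n + 1) ∘ₗ Wd.put s (n + 1) =
    Wd.put s n ∘ₗ Wd.bar l n + (-1 : k) ^ n • LinearMap.id from LinearMap.congr_fun h w
  clear w
  induction n with
  | zero =>
    refine Wd.hom_ext fun a w => ?_
    obtain ⟨x, rfl⟩ := Wd.nil.surjective w
    simp [Wd.bar_succ', hs, Wd.bar_zero', hs', TensorProduct.tmul_neg]
  | succ n ih =>
    refine Wd.hom_ext₂ fun a b w => ?_
    have := LinearMap.congr_fun ih (Wd.cons (b ⊗ₜ w))
    simp only [LinearMap.comp_apply, LinearMap.add_apply, LinearMap.smul_apply,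
      LinearMap.id_apply, Wd.put_cons] at this
    simp only [LinearMap.comp_apply, LinearMap.add_apply, LinearMap.smul_apply,
      LinearMap.id_apply, Wd.put_cons, Wd.bar_succ, this, map_sub, map_neg,
      TensorProduct.tmul_add, TensorProduct.tmul_smul, map_add, map_smul, pow_succ]
    module

theorem Wd.dW_put (n : ℕ) (w : Wd k R N (n + 1)) :
    Wd.dW l (n + 1) (Wd.put s (n + 1) w) =
      LinearMap.lTensor R (Wd.put s n) (Wd.dW l n w) + (-1 : k) ^ n • (1 ⊗ₜ w) := by
  obtain ⟨z, rfl⟩ := Wd.cons.surjective w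
  have := Wd.bar_put hs hs' n (Wd.cons z)
  rw [Wd.put_cons'] at this ⊢
  rw [Wd.dW_cons', this, Wd.dW_cons', map_add, LinearMap.lTensor_tmul, TensorProduct.tmul_add,
    TensorProduct.tmul_smul, add_assoc]

end Bar

theorem Wd.dW_put_zero {l : R →ₐ[k] Module.End k N} {s : N →ₗ[k] R ⊗[k] N}
    (hs' : ∀ y, actTail R l (LinearMap.lTensor R Wd.nil.toLinearMap (s y)) = Wd.nil y) (x : N) :
    Wd.dW l 0 (Wd.put s 0 (Wd.nil x)) =
      LinearMap.lTensor R Wd.nil.toLinearMap (s x) - 1 ⊗ₜ Wd.nil x := by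
  rw [Wd.put_nil, Wd.dW_cons', Wd.bar_zero', hs', TensorProduct.tmul_neg, sub_eq_add_neg]

theorem BiAct.b_eq (S : BiAct k R N) (n : ℕ) (w : Wd k R N (n + 1)) :
    S.b n w = S.tlW n (Wd.dW S.l n w) := by
  obtain ⟨z, rfl⟩ := Wd.cons.surjective w
  rw [BiAct.b_cons, Wd.dW_cons', map_add, BiAct.tlW_tmul, MulOpposite.op_one, map_one]
  exact congrArg _ (LinearMap.congr_fun (Wd.map_id n).symm _)

variable (R) in
/-- The bimodule `R ⊗ N'` freely generated by a right module `N'` as a left module. -/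
def BiAct.free (r : Rᵐᵒᵖ →ₐ[k] Module.End k N') : BiAct k R (R ⊗[k] N') where
  l := Algebra.lsmul k k (R ⊗[k] N')
  r := (Module.End.lTensorAlgHom k N' R).comp r
  comm e e' x := (lTensor_smul (r e') e x).symm

@[simp] theorem BiAct.free_l (r : Rᵐᵒᵖ →ₐ[k] Module.End k N') (e : R) (x : R ⊗[k] N') :
    (BiAct.free R r).l e x = e • x := rfl

@[simp] theorem BiAct.free_r (r : Rᵐᵒᵖ →ₐ[k] Module.End k N') (e : Rᵐᵒᵖ) :
    (BiAct.free R r).r e = LinearMap.lTensor R (r e) := rfl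

/-- `e ⊗ x ↦ x e`. -/
def augR (r : Rᵐᵒᵖ →ₐ[k] Module.End k N') : R ⊗[k] N' →ₗ[k] N' :=
  TensorProduct.lift (r.toLinearMap ∘ₗ (MulOpposite.opLinearEquiv k : R ≃ₗ[k] Rᵐᵒᵖ).toLinearMap)

@[simp] theorem augR_tmul (r : Rᵐᵒᵖ →ₐ[k] Module.End k N') (e : R) (x : N') :
    augR r (e ⊗ₜ x) = r (MulOpposite.op e) x := rfl

/-- `e ⊗ x ↦ e ⊗ (1 ⊗ x)`. -/
def dup (R : Type u) [Ring R] [Algebra k R] (N' : Type w') [AddCommGroup N'] [Module k N'] :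
    R ⊗[k] N' →ₗ[k] R ⊗[k] (R ⊗[k] N') :=
  LinearMap.lTensor R (TensorProduct.mk k R N' 1)

@[simp] theorem dup_tmul (e : R) (x : N') :
    dup (k := k) R N' (e ⊗ₜ x) = e ⊗ₜ ((1 : R) ⊗ₜ x) := rfl

theorem dup_lTensor (g : N' →ₗ[k] N) (z : R ⊗[k] N') :
    dup R N (LinearMap.lTensor R g z) =
      LinearMap.lTensor R (LinearMap.lTensor R g) (dup R N' z) :=
  lTensor_comm (f := TensorProduct.mk k R N' 1) (f' := TensorProduct.mk k R N 1) (g := g)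
    (g' := LinearMap.lTensor R g) (fun _ => rfl) z

variable (r : Rᵐᵒᵖ →ₐ[k] Module.End k N')

theorem actTail_dup (y : R ⊗[k] N') :
    actTail R (BiAct.free R r).l (LinearMap.lTensor R Wd.nil.toLinearMap (dup R N' y)) =
      Wd.nil y := by
  induction y with
  | zero => simp
  | add x y hx hy => simp only [map_add, hx, hy]
  | tmul e x =>
    change Wd.nil (e • ((1 : R) ⊗ₜ[k] x)) = _
    rw [TensorProduct.smul_tmul', smul_eq_mul, mul_one]

/-- Inserting by `dup` commutes with the right action on the tail, because `dup` puts a new `1` next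
to `N'` and the right action concerns `N'` only; so the contraction of `dW` becomes one of the
Hochschild complex. -/
theorem BiAct.b_put (n : ℕ) (w : Wd k R (R ⊗[k] N') (n + 1)) :
    (BiAct.free R r).b (n + 1) (Wd.put (dup R N') (n + 1) w) =
      Wd.put (dup R N') n ((BiAct.free R r).b n w) + (-1 : k) ^ n • w := by
  rw [BiAct.b_eq, Wd.dW_put (fun a y => lTensor_smul _ a y) (actTail_dup r), map_add, map_smul,
    BiAct.b_eq]
  congr 1
  · generalize Wd.dW (BiAct.free R r).l n w = z
    induction z with
    | zero => simp
    | add x y hx hy => simp only [map_add, hx, hy]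
    | tmul e v =>
      rw [LinearMap.lTensor_tmul, tlW_tmul, tlW_tmul, Wd.put_tm]
      exact dup_lTensor _
  · rw [tlW_tmul, MulOpposite.op_one, map_one]
    exact congrArg _ (LinearMap.congr_fun (Wd.map_id (n + 1)) _)

theorem BiAct.exists_b_eq (n : ℕ) {w : Wd k R (R ⊗[k] N') (n + 1)}
    (hw : (BiAct.free R r).b n w = 0) : ∃ w', (BiAct.free R r).b (n + 1) w' = w := by
  refine ⟨(-1 : k) ^ n • Wd.put (dup R N') (n + 1) w, ?_⟩
  rw [map_smul, BiAct.b_put, hw, map_zero, zero_add, smul_smul, ← mul_pow]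
  simp

end Wd

/-! ### A homotopy for mixed words with tail in `E ⊗ N'` -/

namespace Factorization

variable {k A H E : Type u} [CommRing k] [Ring A] [Algebra k A] [AddCommGroup H]
variable [Module k H] [Ring E] [Algebra k E] (D : Factorization k A H E)
variable {N : Type w} [AddCommGroup N] [Module k N] {N' : Type w'} [AddCommGroup N'] [Module k N']

/-- `a h ⊗ x ↦ a ⊗ (h ⊗ x)`, where `h ⊗ x` is considered in `E ⊗ N'`. -/
def dupA (N' : Type w') [AddCommGroup N'] [Module k N'] :
    E ⊗[k] N' →ₗ[k] A ⊗[k] (E ⊗[k] N') :=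
  LinearMap.lTensor A (LinearMap.rTensor N' D.gam)
    ∘ₗ (TensorProduct.assoc k A H N').toLinearMap
    ∘ₗ LinearMap.rTensor N' D.equiv.symm.toLinearMap

@[simp] theorem dupA_tmul (a : A) (h : H) (x : N') :
    D.dupA N' ((D.incl a * D.gam h) ⊗ₜ x) = a ⊗ₜ (D.gam h ⊗ₜ x) := by
  simp [dupA, D.equiv_symm_mul]

/-- As a left `A`-module `E ⊗ N'` is `A ⊗ (H ⊗ N')`, and `dupA` is the resulting section of the
action of `A`. Its `A`-linearity and the section property are the hypotheses of `Wd.dW_put` over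
`A`. -/
theorem dupA_smul (a : A) (z : E ⊗[k] N') : D.dupA N' (D.incl a • z) = a • D.dupA N' z := by
  have : D.dupA N' ∘ₗ (Algebra.lsmul k k (E ⊗[k] N') (D.incl a)) =
      (Algebra.lsmul k k (A ⊗[k] (E ⊗[k] N')) a) ∘ₗ D.dupA N' := by
    refine D.hom_ext fun b h v => ?_
    have e : D.incl a • (D.incl b • (D.gam h ⊗ₜ[k] v)) = (D.incl (a * b) * D.gam h) ⊗ₜ[k] v := by
      simp [TensorProduct.smul_tmul', mul_assoc]
    have e' : (D.incl b • (D.gam h ⊗ₜ[k] v)) = (D.incl b * D.gam h) ⊗ₜ[k] v := by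
      simp [TensorProduct.smul_tmul']
    simp only [LinearMap.comp_apply, Algebra.lsmul_coe]
    rw [e, e', dupA_tmul, dupA_tmul, TensorProduct.smul_tmul', smul_eq_mul]
  exact LinearMap.congr_fun this z

theorem dupA_lTensor (g : N' →ₗ[k] N) (z : E ⊗[k] N') :
    D.dupA N (LinearMap.lTensor E g z) =
      LinearMap.lTensor A (LinearMap.lTensor E g) (D.dupA N' z) := by
  suffices h : D.dupA N ∘ₗ LinearMap.lTensor E g =
      LinearMap.lTensor A (LinearMap.lTensor E g) ∘ₗ D.dupA N' from LinearMap.congr_fun h z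
  refine D.hom_ext fun a h v => ?_
  have e : (D.incl a • (D.gam h ⊗ₜ[k] v)) = (D.incl a * D.gam h) ⊗ₜ[k] v := by
    simp [TensorProduct.smul_tmul']
  rw [e]
  simp

theorem actTail_dupA (r : Eᵐᵒᵖ →ₐ[k] Module.End k N') (y : E ⊗[k] N') :
    actTail A ((BiAct.free E r).l.comp D.incl)
      (LinearMap.lTensor A Wd.nil.toLinearMap (D.dupA N' y)) = Wd.nil y := by
  suffices h : actTail A ((BiAct.free E r).l.comp D.incl) ∘ₗ
      LinearMap.lTensor A Wd.nil.toLinearMap ∘ₗ D.dupA N' = Wd.nil.toLinearMap from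
    LinearMap.congr_fun h y
  refine D.hom_ext fun a h x => ?_
  have e : (D.incl a • (D.gam h ⊗ₜ[k] x)) = (D.incl a * D.gam h) ⊗ₜ[k] x := by
    simp [TensorProduct.smul_tmul']
  rw [LinearMap.comp_apply, LinearMap.comp_apply, e, dupA_tmul, LinearMap.lTensor_tmul, ← e]
  rfl

/-- `e ⊗ x ↦ e ⊗ (1 ⊗ x)`, with the second factor considered as an empty word. -/
def tau (N' : Type w') [AddCommGroup N'] [Module k N'] :
    HW k A H (E ⊗[k] N') 0 →ₗ[k] E ⊗[k] HW k A H (E ⊗[k] N') 0 :=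
  LinearMap.lTensor E (HW.aw ∘ₗ Wd.nil.toLinearMap) ∘ₗ dup E N' ∘ₗ Wd.nil.symm.toLinearMap

theorem tau_nil (y : E ⊗[k] N') : tau (A := A) (H := H) N' (HW.aw (Wd.nil y)) =
    LinearMap.lTensor E (HW.aw ∘ₗ Wd.nil.toLinearMap) (dup E N' y) := rfl

theorem tau_smul (e : E) (y : E ⊗[k] N') : tau (A := A) (H := H) N' (HW.aw (Wd.nil (e • y))) =
    e • tau (A := A) (H := H) N' (HW.aw (Wd.nil y)) := by
  rw [tau_nil, tau_nil, ← lTensor_smul, dup, lTensor_smul]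

theorem tau_tm (g : N' →ₗ[k] N) (v : HW k A H (E ⊗[k] N') 0) :
    tau N (tm (LinearMap.lTensor E g) 0 v) =
      LinearMap.lTensor E (tm (LinearMap.lTensor E g) 0) (tau N' v) := by
  obtain ⟨y, rfl⟩ := Wd.nil.surjective v
  change tau (A := A) (H := H) N (HW.aw (Wd.nil (LinearMap.lTensor E g y))) =
    LinearMap.lTensor E (tm (LinearMap.lTensor E g) 0) (tau (A := A) (H := H) N' (HW.aw (Wd.nil y)))
  rw [tau_nil, tau_nil, dup_lTensor]
  exact lTensor_comm (f := HW.aw ∘ₗ Wd.nil.toLinearMap) (f' := HW.aw ∘ₗ Wd.nil.toLinearMap)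
    (g := LinearMap.lTensor E g) (g' := tm (LinearMap.lTensor E g) 0) (fun _ => rfl) _

/-- A homotopy for tails `E ⊗ N'`, before the right action of the first letter. -/
def KA (N' : Type w') [AddCommGroup N'] [Module k N'] : (n : ℕ) →
    HW k A H (E ⊗[k] N') n →ₗ[k] A ⊗[k] HW k A H (E ⊗[k] N') (n + 1)
  | 0 => -(TensorProduct.mk k A _ 1 ∘ₗ HW.aw ∘ₗ Wd.put (D.dupA N') 0 ∘ₗ HW.fst)
      - D.insA 0 ∘ₗ tau N'
  | n + 1 => (-1 : k) ^ n • (TensorProduct.mk k A _ 1 ∘ₗ HW.aw ∘ₗ Wd.put (D.dupA N') (n + 1)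
      ∘ₗ HW.fst) - D.insA (n + 1) ∘ₗ D.gsm _ ∘ₗ LinearMap.lTensor H (D.toE _ ∘ₗ KA N' n) ∘ₗ HW.snd

/-- The homotopy `KA`, with values in `E ⊗ _`. -/
def KE (N' : Type w') [AddCommGroup N'] [Module k N'] (n : ℕ) :
    HW k A H (E ⊗[k] N') n →ₗ[k] E ⊗[k] HW k A H (E ⊗[k] N') (n + 1) :=
  D.toE _ ∘ₗ D.KA N' n

/-- A tail `a h ⊗ x` is reduced to `1 ⊗ x` in two stages: first `a` becomes a letter, then `h`. The
two terms belong to these stages. -/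
theorem KA_zero (w : Wd k A (E ⊗[k] N') 0) : D.KA N' 0 (HW.aw w) =
    -(1 ⊗ₜ HW.aw (Wd.put (D.dupA N') 0 w)) - D.insA 0 (tau N' (HW.aw w)) := rfl

theorem KA_aw (n : ℕ) (w : Wd k A (E ⊗[k] N') (n + 1)) : D.KA N' (n + 1) (HW.aw w) =
    (-1 : k) ^ n • (1 ⊗ₜ HW.aw (Wd.put (D.dupA N') (n + 1) w)) := by
  simp [KA]

theorem KA_hv (n : ℕ) (h : H) (v : HW k A H (E ⊗[k] N') n) :
    D.KA N' (n + 1) (HW.hv (h ⊗ₜ v)) = -D.insA (n + 1) (D.gam h • D.KE N' n v) := by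
  simp [KA, KE]

theorem KE_zero (w : Wd k A (E ⊗[k] N') 0) : D.KE N' 0 (HW.aw w) =
    -(1 ⊗ₜ HW.aw (Wd.put (D.dupA N') 0 w)) - D.ins 0 (tau N' (HW.aw w)) := by
  simp [KE, KA_zero, ins]

theorem KE_aw (n : ℕ) (w : Wd k A (E ⊗[k] N') (n + 1)) : D.KE N' (n + 1) (HW.aw w) =
    (-1 : k) ^ n • (1 ⊗ₜ HW.aw (Wd.put (D.dupA N') (n + 1) w)) := by
  simp [KE, KA_aw]

theorem KE_hv (n : ℕ) (h : H) (v : HW k A H (E ⊗[k] N') n) :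
    D.KE N' (n + 1) (HW.hv (h ⊗ₜ v)) = -D.ins (n + 1) (D.gam h • D.KE N' n v) := by
  simp [KE, KA_hv, ins]

theorem KE_tm (g : N' →ₗ[k] N) (n : ℕ) (v : HW k A H (E ⊗[k] N') n) :
    D.KE N n (tm (LinearMap.lTensor E g) n v) =
      LinearMap.lTensor E (tm (LinearMap.lTensor E g) (n + 1)) (D.KE N' n v) := by
  suffices h : D.KE N n ∘ₗ tm (LinearMap.lTensor E g) n =
      LinearMap.lTensor E (tm (LinearMap.lTensor E g) (n + 1)) ∘ₗ D.KE N' n from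
    LinearMap.congr_fun h v
  clear v
  induction n with
  | zero =>
    ext v
    obtain ⟨w, rfl⟩ : ∃ w : Wd k A (E ⊗[k] N') 0, HW.aw (C := H) w = v := ⟨HW.fst v, rfl⟩
    have e := tau_tm (A := A) (H := H) g (HW.aw w)
    rw [tm, HW.map_aw] at e
    rw [LinearMap.comp_apply, LinearMap.comp_apply, tm, HW.map_aw, KE_zero, KE_zero,
      Wd.put_tm (D.dupA_lTensor g), e, ins_tm]
    simp
  | succ n ih =>
    refine HW.hom_ext' (fun w => ?_) fun h v => ?_
    · simp [KE_aw, Wd.put_tm (D.dupA_lTensor g)]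
    · have := LinearMap.congr_fun ih v
      simp only [LinearMap.comp_apply] at this
      simp [KE_hv, this, ← lTensor_smul, ins_tm]

/-- On `a h ⊗ v` the operator `ins` restores the word `h v`, for which the homotopy is defined by
working on `v` and reinserting `h` with a minus sign. -/
theorem sh_KE_ins (n : ℕ) (z : E ⊗[k] HW k A H (E ⊗[k] N') n) :
    sh (D.KE N' (n + 1)) (D.ins n z) = -D.ins (n + 1) (sh (D.KE N' n) z) := by
  suffices h : sh (D.KE N' (n + 1)) ∘ₗ D.ins n = -(D.ins (n + 1) ∘ₗ sh (D.KE N' n)) from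
    LinearMap.congr_fun h z
  refine D.hom_ext fun a h v => ?_
  simp [KE_hv]

section dE

variable (l : E →ₐ[k] Module.End k N)

theorem sh_dE_ins_zero (z : E ⊗[k] HW k A H N 0) : sh (D.dE l 0) (D.ins 0 z) =
    z - LinearMap.lTensor E (HW.aw ∘ₗ D.rho0 l 0) (D.ins 0 z) := by
  suffices h : sh (D.dE l 0) ∘ₗ D.ins 0 = LinearMap.id -
      LinearMap.lTensor E (HW.aw ∘ₗ D.rho0 l 0) ∘ₗ D.ins 0 from LinearMap.congr_fun h z
  refine D.hom_ext fun a h v => ?_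
  simp [dE_hv_zero, smul_sub]

/-- The analogue of `sh_L_ins_succ` for `dE`; the last term consists of pure words in `A`, which do
not matter when only words starting in `H` are compared. -/
theorem sh_dE_ins_succ (n : ℕ) (z : E ⊗[k] HW k A H N (n + 1)) :
    sh (D.dE l (n + 1)) (D.ins (n + 1) z) = z - D.ins n (sh (D.dE l n) z) +
      (-1 : k) ^ n • LinearMap.lTensor E (HW.aw ∘ₗ D.rho0 l (n + 1)) (D.ins (n + 1) z) := by
  suffices h : sh (D.dE l (n + 1)) ∘ₗ D.ins (n + 1) = LinearMap.id -
      D.ins n ∘ₗ sh (D.dE l n) + (-1 : k) ^ n •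
      LinearMap.lTensor E (HW.aw ∘ₗ D.rho0 l (n + 1)) ∘ₗ D.ins (n + 1) from
    LinearMap.congr_fun h z
  refine D.hom_ext fun a h v => ?_
  simp [dE_hv, smul_sub, smul_add, smul_comm _ ((-1 : k) ^ n)]

theorem dE_tm {l' : E →ₐ[k] Module.End k N'} {g : N →ₗ[k] N'}
    (hg : ∀ e x, g (l e x) = l' e (g x)) (n : ℕ) (v : HW k A H N (n + 1)) :
    D.dE l' n (tm g (n + 1) v) = LinearMap.lTensor E (tm g n) (D.dE l n v) := by
  rw [dE_apply, dE_apply, L_tm, B_tm D hg, map_add, LinearMap.lTensor_tmul]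

end dE

end Factorization

/-- For a cycle `x` the relation reads `x = d₁ (K₁ x) - ν x`, and `ν x` is again a cycle. Repeating
this ends at zero because `ν` is nilpotent on `x`; no inverse of `1 + ν` compatible with the
differential is needed. -/
theorem exists_of_nilpotent_homotopy {k : Type*} [CommRing k] {C₀ C₁ C₂ : Type*} [AddCommGroup C₀]
    [Module k C₀] [AddCommGroup C₁] [Module k C₁] [AddCommGroup C₂] [Module k C₂]
    {d₀ : C₁ →ₗ[k] C₀} {d₁ : C₂ →ₗ[k] C₁} (K₀ : C₀ →ₗ[k] C₁) (K₁ : C₁ →ₗ[k] C₂)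
    {ν : C₁ →ₗ[k] C₁} (hν : ∀ x, d₁ (K₁ x) + K₀ (d₀ x) = x + ν x) (hd : ∀ x, d₀ (d₁ x) = 0)
    (m : ℕ) (x : C₁) (hx : d₀ x = 0) (hm : ν^[m] x = 0) : ∃ y, d₁ y = x := by
  induction m generalizing x with
  | zero => exact ⟨0, by rw [map_zero]; exact hm.symm⟩
  | succ m ih =>
    have e : ν x = d₁ (K₁ x) - x := by
      have := hν x
      rw [hx, map_zero, add_zero] at this
      rw [this, add_sub_cancel_left]
    obtain ⟨y, hy⟩ := ih (ν x) (by rw [e, map_sub, hd, hx, sub_zero]) hm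
    exact ⟨K₁ x - y, by rw [map_sub, hy, e, sub_sub_cancel]⟩

/-! ### The defect of the homotopy lowers the number of letters of `H` -/

namespace Factorization

variable {k A H E : Type u} [CommRing k] [Ring A] [Algebra k A] [AddCommGroup H]
variable [Module k H] [Ring E] [Algebra k E] (D : Factorization k A H E)
variable {N' : Type w'} [AddCommGroup N'] [Module k N'] (r : Eᵐᵒᵖ →ₐ[k] Module.End k N')

/-- The defect of the homotopy, before the right action of the first letter. -/
def T (n : ℕ) : HW k A H (E ⊗[k] N') (n + 1) →ₗ[k] E ⊗[k] HW k A H (E ⊗[k] N') (n + 1) :=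
  sh (D.dE (BiAct.free E r).l (n + 1)) ∘ₗ D.KE N' (n + 1)
    + sh (D.KE N' n) ∘ₗ D.dE (BiAct.free E r).l n - TensorProduct.mk k E _ 1

theorem T_apply (n : ℕ) (v : HW k A H (E ⊗[k] N') (n + 1)) :
    D.T r n v = sh (D.dE (BiAct.free E r).l (n + 1)) (D.KE N' (n + 1) v)
      + sh (D.KE N' n) (D.dE (BiAct.free E r).l n v) - 1 ⊗ₜ v := rfl

/-- A telescoping sum: for a tail `a h ⊗ x` the first stage of the homotopy contributes `1 ⊗ (a h ⊗
x) - a ⊗ (h ⊗ x)` and the second `a ⊗ (h ⊗ x) - a h ⊗ (1 ⊗ x)`. -/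
theorem sh_dE_KE_zero (v : HW k A H (E ⊗[k] N') 0) :
    sh (D.dE (BiAct.free E r).l 0) (D.KE N' 0 v) = 1 ⊗ₜ v - tau N' v := by
  obtain ⟨y, rfl⟩ := Wd.nil.surjective v
  change sh (D.dE (BiAct.free E r).l 0) (D.KE N' 0 (HW.aw (Wd.nil y))) =
    1 ⊗ₜ (HW.aw (Wd.nil y)) - tau (A := A) (H := H) N' (HW.aw (Wd.nil y))
  rw [KE_zero, map_sub, map_neg, sh_tmul, one_smul, dE_aw, Wd.dW_put_zero (D.actTail_dupA r),
    sh_dE_ins_zero, map_sub, TensorProduct.map_tmul]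
  -- The intermediate term `a ⊗ (h ⊗ x)`, which occurs once in each stage.
  have key : TensorProduct.map D.incl.toLinearMap (HW.aw (C := H)) ∘ₗ
      LinearMap.lTensor A (Wd.nil (k := k) (B := A)).toLinearMap ∘ₗ D.dupA N' =
      LinearMap.lTensor E (HW.aw ∘ₗ D.rho0 (BiAct.free E r).l 0) ∘ₗ D.ins 0 ∘ₗ
        LinearMap.lTensor E (HW.aw ∘ₗ Wd.nil.toLinearMap) ∘ₗ dup E N' := by
    refine D.hom_ext fun a h x => ?_
    have e : (D.incl a • (D.gam h ⊗ₜ[k] x)) = (D.incl a * D.gam h) ⊗ₜ[k] x := by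
      simp [TensorProduct.smul_tmul']
    rw [e]
    simp only [LinearMap.comp_apply, dupA_tmul, dup_tmul, LinearMap.lTensor_tmul,
      TensorProduct.map_tmul, ins, insA_tmul, toE_tmul, LinearEquiv.coe_coe, rho0_zero, L_hv_zero,
      actNil_tmul, BiAct.free_l, TensorProduct.smul_tmul', smul_eq_mul, mul_one]
    rfl
  have key' := LinearMap.congr_fun key y
  simp only [LinearMap.comp_apply] at key'
  rw [key', tau_nil]
  simp only [LinearMap.lTensor_comp, LinearMap.comp_apply, AlgHom.toLinearMap_apply, map_one]
  abel

/-- On pure words in `A` the homotopy is the contraction over `A`, which has no defect by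
`Wd.dW_put`. The term with `tau` in degree zero is harmless: `tau` is `E`-linear, so it kills `a ⊗ y
- 1 ⊗ a y`. -/
theorem T_aw (n : ℕ) (w : Wd k A (E ⊗[k] N') (n + 1)) : D.T r n (HW.aw w) = 0 := by
  have hs : ∀ (a : A) (y : E ⊗[k] N'), D.dupA N' (((BiAct.free E r).l.comp D.incl) a y) =
    a • D.dupA N' y := D.dupA_smul
  rw [T_apply, KE_aw, map_smul, sh_tmul, one_smul, dE_aw, Wd.dW_put hs (D.actTail_dupA r), dE_aw]
  rw [map_add, map_smul, TensorProduct.map_tmul, smul_add, smul_smul, ← mul_pow, neg_one_mul,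
    neg_neg, one_pow, one_smul, AlgHom.toLinearMap_apply, map_one]
  cases n with
  | zero =>
    have key : ∀ z : A ⊗[k] Wd k A (E ⊗[k] N') 0, sh (D.KE N' 0)
        (TensorProduct.map D.incl.toLinearMap (HW.aw (C := H)) z) =
        - TensorProduct.map D.incl.toLinearMap (HW.aw (C := H))
          (LinearMap.lTensor A (Wd.put (D.dupA N') 0) z)
        - D.ins 0 (sh (tau N') (TensorProduct.map D.incl.toLinearMap (HW.aw (C := H)) z)) := by
      intro z
      induction z with
      | zero => simp
      | add x y hx hy => simp only [map_add, hx, hy]; abel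
      | tmul a w => simp [KE_zero, smul_sub, TensorProduct.smul_tmul']
    have key2 : sh (tau N') (TensorProduct.map D.incl.toLinearMap (HW.aw (C := H))
        (Wd.dW ((BiAct.free E r).l.comp D.incl) 0 w)) = 0 := by
      suffices h : sh (tau N') ∘ₗ TensorProduct.map D.incl.toLinearMap (HW.aw (C := H)) ∘ₗ
        Wd.dW ((BiAct.free E r).l.comp D.incl) 0 = 0 from LinearMap.congr_fun h w
      refine Wd.hom_ext fun a w => ?_
      obtain ⟨y, rfl⟩ := Wd.nil.surjective w
      simp only [LinearMap.comp_apply, Wd.dW_cons_zero, map_sub, TensorProduct.map_tmul,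
        actTail_tmul, sh_tmul, AlgHom.toLinearMap_apply, map_one, one_smul, AlgHom.comp_apply,
        BiAct.free_l, tau_smul, sub_self, LinearMap.zero_apply]
    rw [key, key2, map_zero]
    simp
  | succ n =>
    have key : ∀ z : A ⊗[k] Wd k A (E ⊗[k] N') (n + 1), sh (D.KE N' (n + 1))
        (TensorProduct.map D.incl.toLinearMap (HW.aw (C := H)) z) =
        (-1 : k) ^ n • TensorProduct.map D.incl.toLinearMap (HW.aw (C := H))
          (LinearMap.lTensor A (Wd.put (D.dupA N') (n + 1)) z) := by
      intro z
      induction z with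
      | zero => simp
      | add x y hx hy => simp only [map_add, hx, hy, smul_add]
      | tmul a w => simp [KE_aw, TensorProduct.smul_tmul']
    rw [key, pow_succ]
    module

theorem lTensor_snd_lTensor_aw {V : Type*} [AddCommGroup V] [Module k V] {n : ℕ}
    {N : Type w} [AddCommGroup N] [Module k N]
    (f : V →ₗ[k] Wd k A N (n + 1)) (z : E ⊗[k] V) :
    LinearMap.lTensor E (HW.snd (C := H)) (LinearMap.lTensor E (HW.aw ∘ₗ f) z) = 0 := by
  rw [← LinearMap.lTensor_comp_apply]
  have : (HW.snd (C := H)) ∘ₗ HW.aw ∘ₗ f = 0 := rfl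
  rw [this, LinearMap.lTensor_zero, LinearMap.zero_apply]

/-- For a single letter of `H` the terms starting in `H` cancel completely: those with `tau` agree
because `tau` is `E`-linear. -/
theorem snd_T_hv_zero (h : H) (v : HW k A H (E ⊗[k] N') 0) :
    LinearMap.lTensor E HW.snd (D.T r 0 (HW.hv (h ⊗ₜ v))) = 0 := by
  have e1 : D.KE N' 0 (HW.aw (D.rho0 (BiAct.free E r).l 0 (HW.hv (h ⊗ₜ v)))) =
      -(1 ⊗ₜ HW.aw (Wd.put (D.dupA N') 0 (D.rho0 (BiAct.free E r).l 0 (HW.hv (h ⊗ₜ v))))) -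
      D.ins 0 (D.gam h • tau N' v) := by
    rw [KE_zero]
    congr 2
    obtain ⟨y, rfl⟩ := Wd.nil.surjective v
    change tau (A := A) (H := H) N' (HW.aw (D.rho0 (BiAct.free E r).l 0
      (HW.hv (h ⊗ₜ HW.aw (Wd.nil y))))) = D.gam h • tau (A := A) (H := H) N' (HW.aw (Wd.nil y))
    rw [rho0_zero, L_hv_zero, actNil_tmul, BiAct.free_l, tau_smul]
  rw [T_apply, KE_hv, map_neg, sh_dE_ins_succ, sh_smul, sh_dE_KE_zero, dE_hv_zero, map_sub,
    map_sub (sh (D.KE N' 0)), sh_tmul, sh_tmul, one_smul, e1, ← D.ins_gam, pow_zero, one_smul]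
  have e2 : D.gam h ⊗ₜ v = D.gam h • ((1 : E) ⊗ₜ[k] v) := by
    rw [TensorProduct.smul_tmul', smul_eq_mul, mul_one]
  rw [e2, smul_sub, map_sub]
  simp only [map_add, map_sub, map_neg, lTensor_snd_lTensor_aw, LinearMap.lTensor_tmul, HW.snd_aw,
    TensorProduct.tmul_zero]
  abel

/-- Up to pure words in `A`, the homotopy and `dE` both work behind `h` and reinsert it with a sign,
so the defect of `h v` is the defect of `v` multiplied by `h` and reinserted. Hence `T` cannot raise
the number of letters of `H`, and it lowers it as soon as it does so on shorter words. -/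
theorem snd_T_hv_succ (n : ℕ) (h : H) (v : HW k A H (E ⊗[k] N') (n + 1)) :
    LinearMap.lTensor E HW.snd (D.T r (n + 1) (HW.hv (h ⊗ₜ v))) =
      LinearMap.lTensor E HW.snd (D.ins (n + 1) (D.gam h • D.T r n v)) := by
  rw [T_apply, KE_hv, map_neg, sh_dE_ins_succ, sh_smul, dE_hv, map_sub,
    map_add (sh (D.KE N' (n + 1))), map_smul (sh (D.KE N' (n + 1))),
    map_sub (sh (D.KE N' (n + 1))), sh_KE_ins, sh_tmul (f := D.KE N' (n + 1)), sh_tmul, one_smul, sh_smul, ← D.ins_gam, KE_aw, T_apply]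
  have e2 : D.gam h ⊗ₜ v = D.gam h • ((1 : E) ⊗ₜ[k] v) := by
    rw [TensorProduct.smul_tmul', smul_eq_mul, mul_one]
  rw [e2, smul_sub, smul_add, map_sub, map_add]
  simp only [map_add, map_sub, map_neg, map_smul, lTensor_snd_lTensor_aw, LinearMap.lTensor_tmul,
    HW.snd_aw, TensorProduct.tmul_zero]
  module

/-- The projection on the words with fewer than `j` letters in `H`. -/
def trunc {N : Type w} [AddCommGroup N] [Module k N] : (j n : ℕ) →
    HW k A H N n →ₗ[k] HW k A H N n
  | 0, _ => 0
  | _ + 1, 0 => LinearMap.id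
  | j + 1, n + 1 => HW.aw ∘ₗ HW.fst + HW.hv ∘ₗ LinearMap.lTensor H (trunc j n) ∘ₗ HW.snd

theorem trunc_succ_succ {N : Type w} [AddCommGroup N] [Module k N] (j n : ℕ)
    (v : HW k A H N (n + 1)) : trunc (j + 1) (n + 1) v =
      HW.aw (HW.fst v) + HW.hv (LinearMap.lTensor H (trunc j n) (HW.snd v)) := rfl

theorem trunc_eq_id {N : Type w} [AddCommGroup N] [Module k N] (n : ℕ) :
    trunc (k := k) (A := A) (H := H) (N := N) (n + 1) n = LinearMap.id := by
  induction n with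
  | zero => rfl
  | succ n ih =>
    ext v
    rw [trunc_succ_succ, ih, LinearMap.lTensor_id, LinearMap.id_apply, HW.aw_fst_add_hv_snd,
      LinearMap.id_apply]

theorem trunc_tm {N : Type w} [AddCommGroup N] [Module k N] (g : N →ₗ[k] N') (j n : ℕ)
    (v : HW k A H N n) : trunc j n (tm g n v) = tm g n (trunc j n v) := by
  induction n generalizing j with
  | zero => cases j with
    | zero => exact (map_zero _).symm
    | succ j => rfl
  | succ n ih => cases j with
    | zero => exact (map_zero _).symm
    | succ j =>
      rw [trunc_succ_succ, trunc_succ_succ, map_add, HW.fst_map, HW.map_aw, tm_hv, snd_tm,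
        lTensor_comm (ih j)]

/-- Pure words in `A` survive every truncation with positive index, so only the part starting in `H`
has to be tested. -/
theorem lTensor_trunc_eq {N : Type w} [AddCommGroup N] [Module k N] {j n : ℕ}
    {z : E ⊗[k] HW k A H N (n + 1)}
    (hz : LinearMap.lTensor E (LinearMap.lTensor H (trunc j n)) (LinearMap.lTensor E HW.snd z) =
      LinearMap.lTensor E HW.snd z) :
    LinearMap.lTensor E (trunc (j + 1) (n + 1)) z = z := by
  have e1 : LinearMap.lTensor E (trunc (j + 1) (n + 1)) z =
      LinearMap.lTensor E (HW.aw ∘ₗ HW.fst) z + LinearMap.lTensor E HW.hv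
        (LinearMap.lTensor E (LinearMap.lTensor H (trunc j n)) (LinearMap.lTensor E HW.snd z)) := by
    rw [trunc, LinearMap.lTensor_add, LinearMap.add_apply]
    simp only [LinearMap.lTensor_comp, LinearMap.comp_apply]
  rw [e1, hz, ← LinearMap.lTensor_comp_apply, ← LinearMap.add_apply, ← LinearMap.lTensor_add]
  have : HW.aw ∘ₗ HW.fst + HW.hv ∘ₗ HW.snd = (LinearMap.id : HW k A H N (n + 1) →ₗ[k] _) :=
    LinearMap.ext HW.aw_fst_add_hv_snd
  rw [this, LinearMap.lTensor_id, LinearMap.id_apply]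

/-- This is the strict decrease: words with at most `j` letters of `H` have a defect with fewer than
`j`. Pure words have no defect, and for `h v` the induction runs through `snd_T_hv_succ`. -/
theorem lTensor_trunc_T (j n : ℕ) (v : HW k A H (E ⊗[k] N') (n + 1)) :
    LinearMap.lTensor E (trunc j (n + 1)) (D.T r n (trunc (j + 1) (n + 1) v)) =
      D.T r n (trunc (j + 1) (n + 1) v) := by
  suffices h : LinearMap.lTensor E (trunc j (n + 1)) ∘ₗ D.T r n ∘ₗ HW.hv ∘ₗ
      LinearMap.lTensor H (trunc j n) = D.T r n ∘ₗ HW.hv ∘ₗ LinearMap.lTensor H (trunc j n) by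
    have := LinearMap.congr_fun h (HW.snd v)
    simp only [LinearMap.comp_apply] at this
    rw [trunc_succ_succ, map_add, T_aw, zero_add, this]
  clear v
  induction j generalizing n with
  | zero =>
    have : trunc (k := k) (A := A) (H := H) (N := E ⊗[k] N') 0 n = 0 := by cases n <;> rfl
    rw [this, LinearMap.lTensor_zero]
    simp only [LinearMap.comp_zero]
  | succ j ih =>
    refine TensorProduct.ext' fun h v => ?_
    simp only [LinearMap.comp_apply, LinearMap.lTensor_tmul]
    apply lTensor_trunc_eq
    cases n with
    | zero => rw [snd_T_hv_zero, map_zero]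
    | succ n =>
      have ih' := LinearMap.congr_fun (ih n) (HW.snd v)
      simp only [LinearMap.comp_apply] at ih'
      have key : LinearMap.lTensor E (trunc j (n + 1))
          (D.gam h • D.T r n (trunc (j + 1) (n + 1) v)) =
          D.gam h • D.T r n (trunc (j + 1) (n + 1) v) := by
        rw [lTensor_smul, trunc_succ_succ, map_add (D.T r n), T_aw, zero_add, ih']
      have key2 : ∀ z : E ⊗[k] HW k A H (E ⊗[k] N') (n + 1), LinearMap.lTensor E
          (LinearMap.lTensor H (trunc j (n + 1))) (LinearMap.lTensor E HW.snd (D.ins (n + 1) z)) =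
          LinearMap.lTensor E HW.snd (D.ins (n + 1) (LinearMap.lTensor E (trunc j (n + 1)) z)) := by
        intro z
        rw [ins_lTensor, ← LinearMap.lTensor_comp_apply, ← LinearMap.lTensor_comp_apply]
        rfl
      rw [snd_T_hv_succ, key2, key]

end Factorization

/-! ### Exactness of the complexes of words for free bimodules -/

/-- The map induced on the target of a surjection. -/
def descend {k V W Q : Type*} [CommRing k] [AddCommGroup V] [Module k V] [AddCommGroup W]
    [Module k W] [AddCommGroup Q] [Module k Q] {f : V →ₗ[k] W} (hf : Function.Surjective f)
    (g : V →ₗ[k] Q) (h : ∀ v, f v = 0 → g v = 0) : W →ₗ[k] Q :=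
  (LinearMap.ker f).liftQ g h ∘ₗ (f.quotKerEquivOfSurjective hf).symm.toLinearMap

@[simp] theorem descend_apply {k V W Q : Type*} [CommRing k] [AddCommGroup V] [Module k V]
    [AddCommGroup W] [Module k W] [AddCommGroup Q] [Module k Q] {f : V →ₗ[k] W}
    (hf : Function.Surjective f) (g : V →ₗ[k] Q) (h : ∀ v, f v = 0 → g v = 0) (v : V) :
    descend hf g h (f v) = g v := by
  have : (f.quotKerEquivOfSurjective hf).symm (f v) = (LinearMap.ker f).mkQ v := by
    rw [LinearEquiv.symm_apply_eq]; rfl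
  rw [descend, LinearMap.comp_apply, LinearEquiv.coe_coe, this]
  rfl

namespace Factorization

variable {k A H E : Type u} [CommRing k] [Ring A] [Algebra k A] [AddCommGroup H]
variable [Module k H] [Ring E] [Algebra k E] (D : Factorization k A H E)
variable {N : Type w} [AddCommGroup N] [Module k N]
variable {N' : Type w'} [AddCommGroup N'] [Module k N'] (r : Eᵐᵒᵖ →ₐ[k] Module.End k N')

/-- A homotopy for tails `E ⊗ N'`. -/
def K (n : ℕ) : HW k A H (E ⊗[k] N') n →ₗ[k] HW k A H (E ⊗[k] N') (n + 1) :=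
  tl (BiAct.free E r) H A (n + 1) ∘ₗ D.KE N' n

theorem tl_one (S : BiAct k E N) {C B : Type u} [AddCommGroup C] [Module k C] [AddCommGroup B]
    [Module k B] (n : ℕ) (v : HW k B C N n) : tl S C B n (1 ⊗ₜ v) = v := by
  rw [tl_tmul, MulOpposite.op_one, map_one]
  exact LinearMap.congr_fun (HW.map_id n) _

theorem d_K_eq (n : ℕ) (v : HW k A H (E ⊗[k] N') n) : D.d (BiAct.free E r) n (D.K r n v) =
    tl (BiAct.free E r) H A n (sh (D.dE (BiAct.free E r).l n) (D.KE N' n v)) := by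
  rw [d_eq, K, LinearMap.comp_apply, tl_sh]
  exact fun e v => D.dE_tm _ (fun e' x => ((BiAct.free E r).comm e' e x).symm) n v

/-- Both `dE` and `KE` commute with the right action on tails, so composing them and acting
afterwards is the right action applied to the composite formed with `sh`. -/
theorem d_K (n : ℕ) (v : HW k A H (E ⊗[k] N') (n + 1)) :
    D.d (BiAct.free E r) (n + 1) (D.K r (n + 1) v) + D.K r n (D.d (BiAct.free E r) n v) =
      v + tl (BiAct.free E r) H A (n + 1) (D.T r n v) := by
  rw [d_K_eq, d_eq, K, LinearMap.comp_apply, tl_sh, T_apply, map_sub, map_add, tl_one,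
    add_sub_cancel]
  exact fun e v => D.KE_tm (r e) n v

theorem iterate_defect (n j : ℕ) (v : HW k A H (E ⊗[k] N') (n + 1)) :
    (tl (BiAct.free E r) H A (n + 1) ∘ₗ D.T r n)^[j] (trunc j (n + 1) v) = 0 := by
  induction j generalizing v with
  | zero => rfl
  | succ j ih =>
    rw [Function.iterate_succ_apply, LinearMap.comp_apply, ← lTensor_trunc_T, ← tl_comm, ih]
    exact fun e v => trunc_tm _ j (n + 1) v

/-- A word of length `n + 1` has fewer than `n + 2` letters of `H`, so truncation at `n + 2` changes
nothing. -/
theorem iterate_defect_eq_zero (n : ℕ) (v : HW k A H (E ⊗[k] N') (n + 1)) :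
    (tl (BiAct.free E r) H A (n + 1) ∘ₗ D.T r n)^[n + 2] v = 0 := by
  have := D.iterate_defect r n (n + 2) v
  rwa [trunc_eq_id, LinearMap.id_apply] at this

theorem exists_d_eq (n : ℕ) {v : HW k A H (E ⊗[k] N') (n + 1)}
    (hv : D.d (BiAct.free E r) n v = 0) : ∃ v', D.d (BiAct.free E r) (n + 1) v' = v :=
  exists_of_nilpotent_homotopy _ _ (D.d_K r n) (D.d_d _ n) (n + 2) v hv
    (D.iterate_defect_eq_zero r n v)

/-- The homotopy gives `y - 1 ⊗ augR r y` as a boundary, since letting the factor brought out by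
`tau` act from the right turns `e ⊗ x` into `1 ⊗ x e`. -/
theorem exists_d_zero_eq {y : E ⊗[k] N'} (hy : augR r y = 0) :
    ∃ v, D.d (BiAct.free E r) 0 v = HW.aw (Wd.nil y) := by
  have key : ∀ y : E ⊗[k] N', tl (BiAct.free E r) H A 0 (tau N' (HW.aw (Wd.nil y))) =
      HW.aw (Wd.nil (1 ⊗ₜ augR r y)) := by
    intro y
    rw [tau_nil]
    induction y with
    | zero => simp
    | add x y hx hy => simp only [map_add, hx, hy, TensorProduct.tmul_add]
    | tmul e v => rfl
  refine ⟨D.K r 0 (HW.aw (Wd.nil y)), ?_⟩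
  rw [d_K_eq, sh_dE_KE_zero, map_sub, tl_one, key, hy, TensorProduct.tmul_zero, map_zero, map_zero,
    sub_zero]

namespace Reduction

variable {D} {A' H' : Type u} [AddCommGroup A'] [Module k A'] [AddCommGroup H'] [Module k H']
variable (q : D.Reduction A' H')

/-- The differential on classes of words. -/
def d (S : BiAct k E N) (n : ℕ) : HW k A' H' N (n + 1) →ₗ[k] HW k A' H' N n :=
  descend (q.cls_surjective (n + 1)) (q.cls N n ∘ₗ D.d S n) fun _ h => q.cls_d S h

@[simp] theorem d_cls (S : BiAct k E N) (n : ℕ) (v : HW k A H N (n + 1)) :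
    q.d S n (q.cls N (n + 1) v) = q.cls N n (D.d S n v) :=
  descend_apply _ _ _ _

theorem d_d (S : BiAct k E N) (n : ℕ) (v : HW k A' H' N (n + 2)) :
    q.d S n (q.d S (n + 1) v) = 0 := by
  obtain ⟨v, rfl⟩ := q.cls_surjective _ v
  rw [d_cls, d_cls, D.d_d, map_zero]

theorem cls_tm {g : N →ₗ[k] N'} (n : ℕ) (v : HW k A H N n) :
    q.cls N' n (tm g n v) = tm g n (q.cls N n v) := by
  rw [← LinearMap.comp_apply, ← LinearMap.comp_apply, ← HW.map_comp, ← HW.map_comp]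
  rfl

theorem d_tm {S : BiAct k E N} {S' : BiAct k E N'} {g : N →ₗ[k] N'} (hg : S.Hom S' g) (n : ℕ)
    (v : HW k A' H' N (n + 1)) : q.d S' n (tm g (n + 1) v) = tm g n (q.d S n v) := by
  obtain ⟨v, rfl⟩ := q.cls_surjective _ v
  rw [← cls_tm, d_cls, d_cls, D.d_tm hg, cls_tm]

/-- A degenerate tail stays degenerate after inserting a further letter, and when the letter `1` of
`H` is in front, `insA` puts it back in front. -/
theorem cls_KA (n : ℕ) {v : HW k A H (E ⊗[k] N') n} (hv : q.cls _ n v = 0) :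
    LinearMap.lTensor A (q.cls _ (n + 1)) (D.KA N' n v) = 0 := by
  induction n with
  | zero =>
    have hv : v = 0 := hv
    rw [hv, map_zero, map_zero]
  | succ n ih =>
    refine q.eq_zero_of_cls (φ := LinearMap.lTensor A (q.cls _ (n + 2)) ∘ₗ D.KA N' (n + 1))
      (fun w hw => ?_) (fun h v hv => ?_) (fun v => ?_) hv
    · rw [LinearMap.comp_apply, KA_aw, map_smul, LinearMap.lTensor_tmul, HW.map_aw,
        Wd.map_put _ _ hw q.qA_surj q.ker_qA q.qA_one, map_zero, TensorProduct.tmul_zero, smul_zero]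
    · rw [LinearMap.comp_apply, KA_hv, map_neg, q.cls_insA, neg_zero]
      rw [lTensor_smul, KE, LinearMap.comp_apply, toE_lTensor, ih hv, map_zero, smul_zero]
    · rw [LinearMap.comp_apply, KA_hv, D.gam_one, one_smul, KE, LinearMap.comp_apply, insA_toE,
        map_neg, q.cls_hv_one, neg_zero]

theorem cls_K (n : ℕ) {v : HW k A H (E ⊗[k] N') n} (hv : q.cls _ n v = 0) :
    q.cls _ (n + 1) (D.K r n v) = 0 := by
  rw [K, LinearMap.comp_apply, q.cls_tl, KE, LinearMap.comp_apply, toE_lTensor, q.cls_KA n hv,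
    map_zero, map_zero]

/-- The homotopy on classes of words. -/
def K (n : ℕ) : HW k A' H' (E ⊗[k] N') n →ₗ[k] HW k A' H' (E ⊗[k] N') (n + 1) :=
  descend (q.cls_surjective n) (q.cls _ (n + 1) ∘ₗ D.K r n) fun _ h => q.cls_K r n h

@[simp] theorem K_cls (n : ℕ) (v : HW k A H (E ⊗[k] N') n) :
    q.K r n (q.cls _ n v) = q.cls _ (n + 1) (D.K r n v) :=
  descend_apply _ _ _ _

theorem exists_d_eq (n : ℕ) {v : HW k A' H' (E ⊗[k] N') (n + 1)}
    (hv : q.d (BiAct.free E r) n v = 0) : ∃ v', q.d (BiAct.free E r) (n + 1) v' = v := by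
  obtain ⟨ν, hν⟩ : ∃ ν : HW k A' H' (E ⊗[k] N') (n + 1) →ₗ[k] HW k A' H' (E ⊗[k] N') (n + 1),
      ν = q.d (BiAct.free E r) (n + 1) ∘ₗ q.K r (n + 1) + q.K r n ∘ₗ q.d (BiAct.free E r) n
        - LinearMap.id := ⟨_, rfl⟩
  -- The defect on classes is induced by the defect on representatives, hence nilpotent with the
  -- same exponent.
  have e : ∀ v, ν (q.cls _ (n + 1) v) =
      q.cls _ (n + 1) ((tl (BiAct.free E r) H A (n + 1) ∘ₗ D.T r n) v) := by
    intro v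
    have := D.d_K r n v
    simp only [hν, LinearMap.sub_apply, LinearMap.add_apply, LinearMap.comp_apply, K_cls, d_cls,
      LinearMap.id_apply, ← map_add, ← map_sub, this, add_sub_cancel_left]
  refine exists_of_nilpotent_homotopy (q.K r n) (q.K r (n + 1))
    (ν := ν) (fun x => ?_) (q.d_d _ n) (n + 2) v hv ?_
  · simp [hν]
  · obtain ⟨v, rfl⟩ := q.cls_surjective _ v
    have h := Function.Semiconj.iterate_right (f := q.cls (E ⊗[k] N') (n + 1))
      (fun x => (e x).symm) (n + 2) v
    rw [← h, D.iterate_defect_eq_zero, map_zero]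

end Reduction

end Factorization

/-! ### Quasi-isomorphisms -/

section Lifts

variable {k : Type u} [CommRing k]
variable {V₁ V₂ V₃ W₁ W₂ W₃ : ℕ → Type*}
variable [∀ n, AddCommGroup (V₁ n)] [∀ n, Module k (V₁ n)] [∀ n, AddCommGroup (V₂ n)]
variable [∀ n, Module k (V₂ n)] [∀ n, AddCommGroup (V₃ n)] [∀ n, Module k (V₃ n)]
variable [∀ n, AddCommGroup (W₁ n)] [∀ n, Module k (W₁ n)] [∀ n, AddCommGroup (W₂ n)]
variable [∀ n, Module k (W₂ n)] [∀ n, AddCommGroup (W₃ n)] [∀ n, Module k (W₃ n)]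

/-- The mapping cone of `φ` is exact in degree `n`. -/
def Lifts (d : ∀ n, V₁ (n + 1) →ₗ[k] V₁ n) (d' : ∀ n, W₁ (n + 1) →ₗ[k] W₁ n)
    (φ : ∀ n, V₁ n →ₗ[k] W₁ n) : ℕ → Prop
  | 0 => ∀ y, ∃ x' y', y = φ 0 x' + d' 0 y'
  | 1 => ∀ x y, d' 0 y = φ 0 x → ∃ x' y', d 0 x' = x ∧ y = φ 1 x' + d' 1 y'
  | n + 2 => ∀ x y, d n x = 0 → d' (n + 1) y = φ (n + 1) x →
      ∃ x' y', d (n + 1) x' = x ∧ y = φ (n + 2) x' + d' (n + 2) y'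

/-- A short exact sequence of sequences of modules. -/
structure ShortExact (i : ∀ n, V₁ n →ₗ[k] V₂ n) (p : ∀ n, V₂ n →ₗ[k] V₃ n) : Prop where
  inj : ∀ n, Function.Injective (i n)
  surj : ∀ n, Function.Surjective (p n)
  zero : ∀ n x, p n (i n x) = 0
  exact : ∀ n x, p n x = 0 → ∃ y, i n y = x

variable {d₁ : ∀ n, V₁ (n + 1) →ₗ[k] V₁ n} {d₂ : ∀ n, V₂ (n + 1) →ₗ[k] V₂ n}
variable {d₃ : ∀ n, V₃ (n + 1) →ₗ[k] V₃ n} {d₁' : ∀ n, W₁ (n + 1) →ₗ[k] W₁ n}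
variable {d₂' : ∀ n, W₂ (n + 1) →ₗ[k] W₂ n} {d₃' : ∀ n, W₃ (n + 1) →ₗ[k] W₃ n}
variable {φ₁ : ∀ n, V₁ n →ₗ[k] W₁ n} {φ₂ : ∀ n, V₂ n →ₗ[k] W₂ n} {φ₃ : ∀ n, V₃ n →ₗ[k] W₃ n}
variable {i : ∀ n, V₁ n →ₗ[k] V₂ n} {p : ∀ n, V₂ n →ₗ[k] V₃ n}
variable {i' : ∀ n, W₁ n →ₗ[k] W₂ n} {p' : ∀ n, W₂ n →ₗ[k] W₃ n}

/-- A piece of the long exact sequence of mapping cones: the homology of the third cone in degree `n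
+ 1` lies between that of the second in degree `n + 1` and that of the first in degree `n`. The
proof is the corresponding diagram chase. -/
theorem Lifts.succ (hV : ShortExact i p) (hW : ShortExact i' p')
    (hi : ∀ n x, i n (d₁ n x) = d₂ n (i (n + 1) x))
    (hp : ∀ n x, p n (d₂ n x) = d₃ n (p (n + 1) x))
    (hi' : ∀ n x, i' n (d₁' n x) = d₂' n (i' (n + 1) x))
    (hp' : ∀ n x, p' n (d₂' n x) = d₃' n (p' (n + 1) x))
    (hφi : ∀ n x, φ₂ n (i n x) = i' n (φ₁ n x)) (hφp : ∀ n x, φ₃ n (p n x) = p' n (φ₂ n x))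
    (hφ : ∀ n x, φ₂ n (d₂ n x) = d₂' n (φ₂ (n + 1) x))
    (hd : ∀ n x, d₂ n (d₂ (n + 1) x) = 0) (hd' : ∀ n x, d₂' n (d₂' (n + 1) x) = 0)
    (n : ℕ) (h₁ : Lifts d₁ d₁' φ₁ n) (h₂ : Lifts d₂ d₂' φ₂ (n + 1)) :
    Lifts d₃ d₃' φ₃ (n + 1) := by
  match n, h₁, h₂ with
  | 0, h₁, h₂ =>
    intro x y hxy
    obtain ⟨x₂, rfl⟩ := hV.surj _ x
    obtain ⟨y₂, rfl⟩ := hW.surj _ y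
    obtain ⟨y₁, hy₁⟩ := hW.exact _ (d₂' 0 y₂ - φ₂ 0 x₂) (by
      rw [map_sub, hp', hxy, hφp, sub_self])
    -- The lifts chosen in the middle fail to be a cycle of the cone by an element of the first
    -- cone; `h₁` provides the correction.
    obtain ⟨x₁', y₁', h⟩ := h₁ (-y₁)
    have e : i' 0 y₁ = -(i' 0 (φ₁ 0 x₁') + i' 0 (d₁' 0 y₁')) := by
      rw [← map_add, ← h, map_neg, neg_neg]
    obtain ⟨x₂', y₂', hx, hy⟩ := h₂ (x₂ - i 0 x₁') (y₂ + i' 1 y₁') (by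
      rw [map_add, map_sub, ← hi', hφi, sub_eq_iff_eq_add.1 hy₁.symm, e]; abel)
    refine ⟨p 1 x₂', p' 2 y₂', ?_, ?_⟩
    · rw [← hp, hx, map_sub, hV.zero, sub_zero]
    · rw [hφp, ← hp', ← map_add, ← hy, map_add, hW.zero, add_zero]
  | n + 1, h₁, h₂ =>
    intro x y hx0 hxy
    obtain ⟨x₂, rfl⟩ := hV.surj _ x
    obtain ⟨y₂, rfl⟩ := hW.surj _ y
    obtain ⟨x₁, hx₁⟩ := hV.exact _ (d₂ n x₂) (by rw [hp, hx0])
    obtain ⟨y₁, hy₁⟩ := hW.exact _ (d₂' (n + 1) y₂ - φ₂ (n + 1) x₂) (by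
      rw [map_sub, hp', hxy, hφp, sub_self])
    have hy₁' : d₁' n (-y₁) = φ₁ n x₁ := by
      apply hW.inj
      rw [hi', map_neg, hy₁, map_neg, map_sub, hd', zero_sub, neg_neg, ← hφ, ← hx₁, hφi]
    obtain ⟨x₁', y₁', hx₁', h⟩ : ∃ x₁' y₁', d₁ n x₁' = x₁ ∧ -y₁ = φ₁ (n + 1) x₁' +
        d₁' (n + 1) y₁' := by
      cases n with
      | zero => exact h₁ x₁ (-y₁) hy₁'
      | succ n =>
        refine h₁ x₁ (-y₁) ?_ hy₁'
        apply hV.inj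
        rw [hi, hx₁, hd, map_zero]
    have e : i' (n + 1) y₁ = -(i' (n + 1) (φ₁ (n + 1) x₁') + i' (n + 1) (d₁' (n + 1) y₁')) := by
      rw [← map_add, ← h, map_neg, neg_neg]
    obtain ⟨x₂', y₂', hx, hy⟩ := h₂ (x₂ - i (n + 1) x₁') (y₂ + i' (n + 2) y₁')
      (by rw [map_sub, ← hi, hx₁', hx₁, sub_self])
      (by rw [map_add, map_sub, ← hi', hφi, sub_eq_iff_eq_add.1 hy₁.symm, e]; abel)
    refine ⟨p (n + 2) x₂', p' (n + 3) y₂', ?_, ?_⟩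
    · rw [← hp, hx, map_sub, hV.zero, sub_zero]
    · rw [hφp, ← hp', ← map_add, ← hy, map_add, hW.zero, add_zero]

/-- If both complexes are exact in positive degrees, the cone can only fail to be exact in low
degrees, which `h₀` and `h₁` exclude. -/
theorem Lifts.of_exact (hd : ∀ n x, d₁ n x = 0 → ∃ y, d₁ (n + 1) y = x)
    (hd' : ∀ n x, d₁' n x = 0 → ∃ y, d₁' (n + 1) y = x)
    (hφ : ∀ n x, φ₁ n (d₁ n x) = d₁' n (φ₁ (n + 1) x)) (h₀ : Function.Surjective (φ₁ 0))
    (h₁ : ∀ x y, d₁' 0 y = φ₁ 0 x → ∃ x', d₁ 0 x' = x) (n : ℕ) : Lifts d₁ d₁' φ₁ n := by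
  have key : ∀ n x x' y, d₁' n y = φ₁ n x → d₁ n x' = x →
      ∃ x' y', d₁ n x' = x ∧ y = φ₁ (n + 1) x' + d₁' (n + 1) y' := by
    intro n x x' y h hx'
    obtain ⟨y', hy'⟩ := hd' n (y - φ₁ (n + 1) x') (by rw [map_sub, ← hφ, h, hx', sub_self])
    exact ⟨x', y', hx', by rw [hy', add_sub_cancel]⟩
  match n with
  | 0 =>
    intro y
    obtain ⟨x, rfl⟩ := h₀ y
    exact ⟨x, 0, by rw [map_zero, add_zero]⟩
  | 1 =>
    intro x y h
    obtain ⟨x', hx'⟩ := h₁ x y h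
    exact key 0 x x' y h hx'
  | n + 2 =>
    intro x y hx h
    obtain ⟨x', hx'⟩ := hd n x hx
    exact key (n + 1) x x' y h hx'

theorem Lifts.of_bijective (hφ : ∀ n x, φ₁ n (d₁ n x) = d₁' n (φ₁ (n + 1) x))
    (h : ∀ n, Function.Bijective (φ₁ n)) (n : ℕ) : Lifts d₁ d₁' φ₁ n := by
  have key : ∀ n x y, d₁' n y = φ₁ n x →
      ∃ x' y', d₁ n x' = x ∧ y = φ₁ (n + 1) x' + d₁' (n + 1) y' := by
    intro n x y hxy
    obtain ⟨x', rfl⟩ := (h (n + 1)).2 y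
    exact ⟨x', 0, (h n).1 (by rw [hφ, hxy]), by rw [map_zero, add_zero]⟩
  match n with
  | 0 =>
    intro y
    obtain ⟨x, rfl⟩ := (h 0).2 y
    exact ⟨x, 0, by rw [map_zero, add_zero]⟩
  | 1 => exact key 0
  | n + 2 => exact fun x y _ h => key (n + 1) x y h

end Lifts

section Homology

variable {k : Type u} [CommRing k] {V : ℕ → Type w} {W : ℕ → Type w'}
variable [∀ n, AddCommGroup (V n)] [∀ n, Module k (V n)]
variable [∀ n, AddCommGroup (W n)] [∀ n, Module k (W n)]
variable {d : ∀ n, V (n + 1) →ₗ[k] V n} {d' : ∀ n, W (n + 1) →ₗ[k] W n}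
variable {φ : ∀ n, V n →ₗ[k] W n}

/-- Exactness of the cone in degree `n` gives surjectivity on the `n`-th homology, exactness in
degree `n + 1` gives injectivity. -/
theorem Lifts.homology (hφ : ∀ n x, φ n (d n x) = d' n (φ (n + 1) x))
    (h : ∀ n, Lifts d d' φ n) (n : ℕ) : Nonempty (Homology d n ≃ₗ[k] Homology d' n) := by
  match n with
  | 0 =>
    refine ⟨LinearEquiv.ofBijective (Submodule.mapQ (LinearMap.range (d 0))
      (LinearMap.range (d' 0)) (φ 0) ?_) ⟨?_, ?_⟩⟩
    · rintro _ ⟨x, rfl⟩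
      exact ⟨φ 1 x, (hφ 0 x).symm⟩
    · rw [← LinearMap.ker_eq_bot, LinearMap.ker_eq_bot']
      intro x hx
      obtain ⟨x, rfl⟩ := Submodule.mkQ_surjective _ x
      rw [Submodule.mkQ_apply, Submodule.mapQ_apply, Submodule.Quotient.mk_eq_zero] at hx
      obtain ⟨y, hy⟩ := hx
      obtain ⟨x', -, hx', -⟩ := h 1 x y hy
      rw [Submodule.mkQ_apply, Submodule.Quotient.mk_eq_zero]
      exact ⟨x', hx'⟩
    · intro y
      obtain ⟨y, rfl⟩ := Submodule.mkQ_surjective _ y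
      obtain ⟨x', y', e⟩ := h 0 y
      refine ⟨Submodule.Quotient.mk x', ?_⟩
      rw [Submodule.mapQ_apply, Submodule.mkQ_apply, Submodule.Quotient.eq]
      exact ⟨-y', by rw [e, map_neg]; abel⟩
  | n + 1 =>
    have hk : ∀ x ∈ LinearMap.ker (d n), φ (n + 1) x ∈ LinearMap.ker (d' n) := by
      intro x hx
      rw [LinearMap.mem_ker] at hx ⊢
      rw [← hφ, hx, map_zero]
    refine ⟨LinearEquiv.ofBijective (Submodule.mapQ
      ((LinearMap.range (d (n + 1))).comap (LinearMap.ker (d n)).subtype)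
      ((LinearMap.range (d' (n + 1))).comap (LinearMap.ker (d' n)).subtype)
      ((φ (n + 1)).restrict hk) ?_) ⟨?_, ?_⟩⟩
    · rintro ⟨_, hx⟩ ⟨x, rfl⟩
      exact ⟨φ (n + 2) x, (hφ (n + 1) x).symm⟩
    · rw [← LinearMap.ker_eq_bot, LinearMap.ker_eq_bot']
      intro x hx
      obtain ⟨x, rfl⟩ := Submodule.mkQ_surjective _ x
      rw [Submodule.mkQ_apply, Submodule.mapQ_apply, Submodule.Quotient.mk_eq_zero] at hx
      obtain ⟨y, hy⟩ := hx
      obtain ⟨x', -, hx', -⟩ := h (n + 2) x y x.2 hy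
      rw [Submodule.mkQ_apply, Submodule.Quotient.mk_eq_zero]
      exact ⟨x', hx'⟩
    · intro y
      obtain ⟨y, rfl⟩ := Submodule.mkQ_surjective _ y
      have hy : d' n y = φ n 0 := by rw [map_zero]; exact y.2
      obtain ⟨x', y', hx', e⟩ : ∃ x' y', d n x' = 0 ∧ (y : W (n + 1)) =
          φ (n + 1) x' + d' (n + 1) y' := by
        match n, h (n + 1) with
        | 0, h => exact h 0 y hy
        | n + 1, h => exact h 0 y (map_zero _) hy
      refine ⟨Submodule.Quotient.mk ⟨x', hx'⟩, ?_⟩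
      rw [Submodule.mapQ_apply, Submodule.mkQ_apply, Submodule.Quotient.eq]
      refine ⟨-y', ?_⟩
      change d' (n + 1) (-y') = φ (n + 1) x' - y
      rw [e, map_neg]; abel

end Homology

/-! ### Dimension shifting -/

section Shift

variable {k R : Type u} [CommRing k] [Ring R] [Algebra k R]
variable {N : Type w} [AddCommGroup N] [Module k N] (S : BiAct k R N)

/-- The map `e ⊗ x ↦ e x` from the free bimodule. -/
def augL : R ⊗[k] N →ₗ[k] N := TensorProduct.lift S.l.toLinearMap

@[simp] theorem augL_tmul (e : R) (x : N) : augL S (e ⊗ₜ x) = S.l e x := rfl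

theorem augL_hom : (BiAct.free R S.r).Hom S (augL S) where
  l e x := by
    induction x with
    | zero => simp
    | add x y hx hy => simp only [map_add, hx, hy]
    | tmul e' x => simp [TensorProduct.smul_tmul']
  r e x := by
    induction x with
    | zero => simp
    | add x y hx hy => simp only [map_add, hx, hy]
    | tmul e' x => simp [S.comm]

variable {S} in
/-- The kernel of a map of bimodules. -/
def BiAct.Hom.kerAct {N' : Type w'} [AddCommGroup N'] [Module k N'] {S' : BiAct k R N'}
    {g : N →ₗ[k] N'} (hg : S.Hom S' g) : BiAct k R (LinearMap.ker g) where
  l :=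
    { toFun := fun e => (S.l e).restrict fun x hx => by
        rw [LinearMap.mem_ker] at hx ⊢; rw [hg.l, hx, map_zero]
      map_one' := by ext; simp
      map_mul' := fun _ _ => by ext; simp
      map_zero' := by ext; simp
      map_add' := fun _ _ => by ext; simp
      commutes' := fun _ => by ext; simp [Module.algebraMap_end_apply] }
  r :=
    { toFun := fun e => (S.r e).restrict fun x hx => by
        rw [LinearMap.mem_ker] at hx ⊢; rw [hg.r, hx, map_zero]
      map_one' := by ext; simp
      map_mul' := fun _ _ => by ext; simp
      map_zero' := by ext; simp
      map_add' := fun _ _ => by ext; simp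
      commutes' := fun c => LinearMap.ext fun x =>
        Subtype.ext (LinearMap.congr_fun (S.r.commutes c) (x : N)) }
  comm e e' x := Subtype.ext (S.comm e e' x)

theorem BiAct.Hom.kerAct_subtype {N' : Type w'} [AddCommGroup N'] [Module k N']
    {S' : BiAct k R N'} {g : N →ₗ[k] N'} (hg : S.Hom S' g) :
    hg.kerAct.Hom S (LinearMap.ker g).subtype where
  l _ _ := rfl
  r _ _ := rfl

/-- The retraction of the kernel of `augL`. -/
def kerRetr : R ⊗[k] N →ₗ[k] LinearMap.ker (augL S) :=
  (LinearMap.id - TensorProduct.mk k R N 1 ∘ₗ augL S).codRestrict _ fun x => by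
    simp [LinearMap.mem_ker]

theorem coe_kerRetr (x : R ⊗[k] N) : (kerRetr S x : R ⊗[k] N) = x - 1 ⊗ₜ augL S x := rfl

theorem kerRetr_comp : kerRetr S ∘ₗ (LinearMap.ker (augL S)).subtype = LinearMap.id := by
  refine LinearMap.ext fun x => Subtype.ext ?_
  have : augL S x = 0 := x.2
  rw [LinearMap.comp_apply, coe_kerRetr, Submodule.subtype_apply, this, TensorProduct.tmul_zero,
    sub_zero, LinearMap.id_apply]

theorem augL_mk : augL S ∘ₗ TensorProduct.mk k R N 1 = LinearMap.id := by
  ext; simp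

theorem kerRetr_add : (LinearMap.ker (augL S)).subtype ∘ₗ kerRetr S +
    TensorProduct.mk k R N 1 ∘ₗ augL S = LinearMap.id := by
  refine LinearMap.ext fun x => ?_
  rw [LinearMap.add_apply, LinearMap.comp_apply, Submodule.subtype_apply, coe_kerRetr]
  exact sub_add_cancel _ _

variable {B C : Type u} [AddCommGroup B] [Module k B] [AddCommGroup C] [Module k C]

theorem augL_comp_subtype : augL S ∘ₗ (LinearMap.ker (augL S)).subtype = 0 := by
  ext x; exact x.2

theorem tm_tm {N' N'' : Type*} [AddCommGroup N'] [Module k N'] [AddCommGroup N''] [Module k N'']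
    (g : N →ₗ[k] N') (g' : N' →ₗ[k] N'') (n : ℕ) (x : HW k B C N n) :
    tm g' n (tm g n x) = tm (g' ∘ₗ g) n x := by
  rw [← LinearMap.comp_apply, ← HW.map_comp]
  rfl

theorem Wd.tm_tm {N' N'' : Type*} [AddCommGroup N'] [Module k N'] [AddCommGroup N'']
    [Module k N''] (g : N →ₗ[k] N') (g' : N' →ₗ[k] N'') (n : ℕ) (x : Wd k B N n) :
    Wd.map LinearMap.id g' n (Wd.map LinearMap.id g n x) = Wd.map LinearMap.id (g' ∘ₗ g) n x := by
  rw [← LinearMap.comp_apply, ← Wd.map_comp]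
  rfl

/-- The sequence `0 → ker → E ⊗ N → N → 0` is split over `k` by `x ↦ 1 ⊗ x`, although not as
bimodules, and a `k`-split sequence stays exact when letters are tensored to it. -/
theorem HW.shortExact : ShortExact (fun n =>
      tm (B := B) (C := C) (N := LinearMap.ker (augL S)) (LinearMap.ker (augL S)).subtype n)
    (fun n => tm (augL S) n) where
  inj n := by
    refine Function.LeftInverse.injective (g := tm (kerRetr S) n) fun x => ?_
    rw [tm_tm, kerRetr_comp, tm, HW.map_id, LinearMap.id_apply]
  surj n y := ⟨tm (TensorProduct.mk k R N 1) n y, by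
    rw [tm_tm, augL_mk, tm, HW.map_id, LinearMap.id_apply]⟩
  zero n x := by
    rw [tm_tm, augL_comp_subtype, ← zero_smul k (0 : LinearMap.ker (augL S) →ₗ[k] N), tm,
      HW.map_smul, zero_smul, LinearMap.zero_apply]
  exact n x hx := by
    refine ⟨tm (kerRetr S) n x, ?_⟩
    have h := LinearMap.congr_fun (HW.map_add (LinearMap.id : B →ₗ[k] B) (LinearMap.id : C →ₗ[k] C)
      ((LinearMap.ker (augL S)).subtype ∘ₗ kerRetr S) (TensorProduct.mk k R N 1 ∘ₗ augL S) n) x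
    rw [kerRetr_add, HW.map_id, LinearMap.add_apply, ← tm, ← tm, ← tm_tm, hx, map_zero,
      add_zero] at h
    exact (tm_tm _ _ n x).trans h.symm

theorem Wd.shortExact : ShortExact
    (fun n => Wd.map (N := LinearMap.ker (augL S)) (LinearMap.id : B →ₗ[k] B)
      (LinearMap.ker (augL S)).subtype n)
    (fun n => Wd.map LinearMap.id (augL S) n) where
  inj n := by
    refine Function.LeftInverse.injective (g := Wd.map LinearMap.id (kerRetr S) n) fun x => ?_
    rw [Wd.tm_tm, kerRetr_comp, Wd.map_id, LinearMap.id_apply]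
  surj n y := ⟨Wd.map LinearMap.id (TensorProduct.mk k R N 1) n y, by
    rw [Wd.tm_tm, augL_mk, Wd.map_id, LinearMap.id_apply]⟩
  zero n x := by
    rw [Wd.tm_tm, augL_comp_subtype, ← zero_smul k (0 : LinearMap.ker (augL S) →ₗ[k] N),
      Wd.map_smul, zero_smul, LinearMap.zero_apply]
  exact n x hx := by
    refine ⟨Wd.map LinearMap.id (kerRetr S) n x, ?_⟩
    have h := LinearMap.congr_fun (Wd.map_add (LinearMap.id : B →ₗ[k] B)
      ((LinearMap.ker (augL S)).subtype ∘ₗ kerRetr S) (TensorProduct.mk k R N 1 ∘ₗ augL S) n) x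
    rw [kerRetr_add, Wd.map_id, LinearMap.add_apply, ← Wd.tm_tm, hx, map_zero,
      add_zero] at h
    exact (Wd.tm_tm _ _ n x).trans h.symm

end Shift

/-! ### Comparison with Hochschild homology -/

section Comparison

variable {k A H E : Type u} [CommRing k] [Ring A] [Algebra k A] [AddCommGroup H]
variable [Module k H] [Ring E] [Algebra k E] (D : Factorization k A H E)

/-- The boundary of `a ⊗ (e ⊗ x)` is `e ⊗ x a - a e ⊗ x`, and both terms are sent to `x a e`. -/
theorem BiAct.augR_b {N' : Type w} [AddCommGroup N'] [Module k N']
    (r : Eᵐᵒᵖ →ₐ[k] Module.End k N') (w : Wd k E (E ⊗[k] N') 1) :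
    augR r (Wd.nil.symm ((BiAct.free E r).b 0 w)) = 0 := by
  suffices h : augR r ∘ₗ Wd.nil.symm.toLinearMap ∘ₗ (BiAct.free E r).b 0 = 0 from
    LinearMap.congr_fun h w
  refine Wd.hom_ext fun a w => ?_
  obtain ⟨y, rfl⟩ := Wd.nil.surjective w
  have e : (BiAct.free E r).b 0 (Wd.cons (a ⊗ₜ Wd.nil y)) =
      Wd.nil (LinearMap.lTensor E (r (MulOpposite.op a)) y - a • y) := by
    rw [BiAct.b_cons, Wd.bar_zero', BiAct.tlW_tmul, Wd.map_nil, actTail_tmul, map_sub,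
      sub_eq_add_neg]
    rfl
  simp only [LinearMap.comp_apply, e, LinearEquiv.coe_coe, LinearEquiv.symm_apply_apply,
    LinearMap.zero_apply]
  clear e
  induction y with
  | zero => simp
  | add x y hx hy =>
    rw [map_add, smul_add, add_sub_add_comm, map_add, hx, hy, add_zero]
  | tmul e x => simp [TensorProduct.smul_tmul']

theorem Factorization.augR_d {N' : Type w} [AddCommGroup N'] [Module k N']
    (r : Eᵐᵒᵖ →ₐ[k] Module.End k N') (v : HW k A H (E ⊗[k] N') 1) :
    augR r (Wd.nil.symm (HW.fst (D.d (BiAct.free E r) 0 v))) = 0 :=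
  (congrArg (fun w => augR r (Wd.nil.symm w)) (D.b_Phi (BiAct.free E r) 0 v).symm).trans
    (BiAct.augR_b r _)

variable {N : Type w} [AddCommGroup N] [Module k N] (S : BiAct k E N)

theorem Wd.dW_cons_succ (l : E →ₐ[k] Module.End k N) (n : ℕ) (z : E ⊗[k] Wd k E N (n + 1)) :
    Wd.dW l (n + 1) (Wd.cons z) = z - 1 ⊗ₜ Wd.cons (sh (Wd.dW l n) z) := by
  induction z with
  | zero => simp
  | add x y hx hy =>
    rw [map_add, map_add, hx, hy, map_add, map_add, TensorProduct.tmul_add, add_sub_add_comm]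
  | tmul e w => rw [Wd.dW_cons, sh_tmul]

/-- In `dW (a ⊗ w) = a ⊗ w - 1 ⊗ a · dW w` a second application produces `a · dW w` twice with
opposite signs; what is left is the same identity for `w`. -/
theorem Wd.sh_dW_dW (l : E →ₐ[k] Module.End k N) (n : ℕ) (w : Wd k E N (n + 2)) :
    sh (Wd.dW l n) (Wd.dW l (n + 1) w) = 0 := by
  suffices h : sh (Wd.dW l n) ∘ₗ Wd.dW l (n + 1) = 0 from LinearMap.congr_fun h w
  clear w
  induction n with
  | zero =>
    refine Wd.hom_ext₂ fun a b w => ?_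
    have e : ∀ z : E ⊗[k] Wd k E N 0, Wd.dW l 0 (Wd.cons z) = z - 1 ⊗ₜ actTail E l z := by
      intro z
      rw [Wd.dW_cons', Wd.bar_zero', TensorProduct.tmul_neg, sub_eq_add_neg]
    rw [LinearMap.comp_apply, Wd.dW_cons, map_sub, sh_tmul, sh_tmul, one_smul, e, e, actTail_smul,
      map_sub, ← actTail_smul, one_smul, sub_self,
      TensorProduct.tmul_zero, map_zero, TensorProduct.tmul_zero, sub_zero, sub_self,
      LinearMap.zero_apply]
  | succ n ih =>
    refine Wd.hom_ext fun a w => ?_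
    have := LinearMap.congr_fun ih w
    rw [LinearMap.comp_apply] at this
    rw [LinearMap.comp_apply, Wd.dW_cons, map_sub, sh_tmul, sh_tmul, one_smul, Wd.dW_cons_succ,
      sh_smul, this, LinearMap.zero_apply, smul_zero, map_zero, TensorProduct.tmul_zero, sub_zero,
      sub_self, LinearMap.zero_apply]

theorem BiAct.tlW_smul (n : ℕ) (e : E) (z : E ⊗[k] Wd k E N n) :
    S.tlW n (e • z) =
      S.tlW n (LinearMap.lTensor E (Wd.map LinearMap.id (S.r (MulOpposite.op e)) n) z) := by
  induction z with
  | zero => simp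
  | add x y hx hy => simp only [smul_add, map_add, hx, hy]
  | tmul e' v =>
    rw [TensorProduct.smul_tmul', tlW_tmul, LinearMap.lTensor_tmul, tlW_tmul, smul_eq_mul,
      MulOpposite.op_mul, map_mul, Module.End.mul_eq_comp, Wd.tm_tm]

theorem BiAct.b_b (n : ℕ) (w : Wd k E N (n + 2)) : S.b n (S.b (n + 1) w) = 0 := by
  have hnat : ∀ (e : Eᵐᵒᵖ) (v : Wd k E N (n + 1)),
      Wd.dW S.l n (Wd.map LinearMap.id (S.r e) (n + 1) v) =
      LinearMap.lTensor E (Wd.map LinearMap.id (S.r e) n) (Wd.dW S.l n v) := by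
    intro e v
    obtain ⟨z, rfl⟩ := Wd.cons.surjective v
    have := Wd.bar_map (l' := S.l) (fun e' x => (S.comm e' e x).symm) n (Wd.cons z)
    rw [Wd.tm_cons] at this ⊢
    rw [Wd.dW_cons', this, Wd.dW_cons', map_add, LinearMap.lTensor_tmul]
  have key : ∀ z : E ⊗[k] Wd k E N (n + 1),
      S.tlW n (Wd.dW S.l n (S.tlW (n + 1) z)) = S.tlW n (sh (Wd.dW S.l n) z) := by
    intro z
    induction z with
    | zero => simp
    | add x y hx hy => simp only [map_add, hx, hy]
    | tmul e v => rw [tlW_tmul, hnat, sh_tmul, tlW_smul]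
  rw [b_eq, b_eq, key, Wd.sh_dW_dW, map_zero]

/-- One dimension shift: the free bimodule in the middle contributes exact complexes, so degree `n +
1` for `N` follows from degree `n` for the kernel. The kernel lies in `E ⊗ N`, hence in the universe
over which `h` ranges. -/
theorem Factorization.lifts_Phi_succ (n : ℕ)
    (h : ∀ (N₁ : Type (max u w)) [AddCommGroup N₁] [Module k N₁] (S₁ : BiAct k E N₁),
      Lifts (D.d S₁) S₁.b (D.Phi (N := N₁)) n) :
    Lifts (D.d S) S.b (D.Phi (N := N)) (n + 1) := by
  refine Lifts.succ (HW.shortExact S) (Wd.shortExact S)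
    (fun n x => (D.d_tm (augL_hom S).kerAct_subtype n x).symm)
    (fun n x => (D.d_tm (augL_hom S) n x).symm)
    (fun n x => (BiAct.b_map (augL_hom S).kerAct_subtype n x).symm)
    (fun n x => (BiAct.b_map (augL_hom S) n x).symm)
    (fun n x => D.Phi_tm _ n x) (fun n x => D.Phi_tm _ n x)
    (fun n x => (D.b_Phi _ n x).symm) (D.d_d _) (BiAct.b_b _) n (h _ _) ?_
  refine Lifts.of_exact (D.exists_d_eq S.r) (BiAct.exists_b_eq S.r)
    (fun n x => (D.b_Phi _ n x).symm) (φ₁ := D.Phi (N := E ⊗[k] N)) (fun y => ⟨y, rfl⟩) (fun x y hxy => ?_) _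
  obtain ⟨z, rfl⟩ := Wd.nil.surjective x
  refine D.exists_d_zero_eq S.r ?_
  have := BiAct.augR_b S.r y
  rw [hxy] at this
  exact this

theorem Factorization.Reduction.lifts_cls_succ {A' H' : Type u} [AddCommGroup A'] [Module k A']
    [AddCommGroup H'] [Module k H'] {D : Factorization k A H E} (q : D.Reduction A' H') (n : ℕ)
    (h : ∀ (N₁ : Type (max u w)) [AddCommGroup N₁] [Module k N₁] (S₁ : BiAct k E N₁),
      Lifts (D.d S₁) (q.d S₁) (q.cls N₁) n) :
    Lifts (D.d S) (q.d S) (q.cls N) (n + 1) := by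
  refine Lifts.succ (HW.shortExact S) (HW.shortExact S)
    (fun n x => (D.d_tm (augL_hom S).kerAct_subtype n x).symm)
    (fun n x => (D.d_tm (augL_hom S) n x).symm)
    (fun n x => (q.d_tm (augL_hom S).kerAct_subtype n x).symm)
    (fun n x => (q.d_tm (augL_hom S) n x).symm)
    (fun n x => q.cls_tm n x) (fun n x => q.cls_tm n x)
    (fun n x => (q.d_cls _ n x).symm) (D.d_d _) (q.d_d _) n (h _ _) ?_
  refine Lifts.of_exact (D.exists_d_eq S.r) (q.exists_d_eq S.r)
    (fun n x => (q.d_cls _ n x).symm) (q.cls_surjective 0) (fun x y hxy => ?_) _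
  obtain ⟨z, rfl⟩ := Wd.nil.surjective x
  obtain ⟨y, rfl⟩ := q.cls_surjective 1 y
  refine D.exists_d_zero_eq S.r ?_
  -- In degree zero a class is its own representative, so the boundary on classes is one of
  -- representatives and is killed by `augR`.
  have := D.augR_d S.r y
  rw [q.d_cls] at hxy
  rw [show D.d (BiAct.free E S.r) 0 y = Wd.nil z from hxy] at this
  exact this

theorem Factorization.lifts_Phi (n : ℕ) : Lifts (D.d S) S.b (D.Phi (N := N)) n := by
  cases n with
  | zero => exact fun y => ⟨y, 0, by rw [map_zero, add_zero]; rfl⟩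
  | succ n =>
    -- The first shift leads into the universe `max u w`; after that the kernels stay there and the
    -- induction can run over all bimodules in that universe.
    refine D.lifts_Phi_succ S n ?_
    induction n with
    | zero => exact fun _ _ _ _ y => ⟨y, 0, by rw [map_zero, add_zero]; rfl⟩
    | succ n ih => exact fun N₁ _ _ S₁ => D.lifts_Phi_succ S₁ n ih

theorem Factorization.Reduction.lifts_cls {A' H' : Type u} [AddCommGroup A'] [Module k A']
    [AddCommGroup H'] [Module k H'] {D : Factorization k A H E} (q : D.Reduction A' H') (n : ℕ) :
    Lifts (D.d S) (q.d S) (q.cls N) n := by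
  cases n with
  | zero => exact fun y => ⟨y, 0, by rw [map_zero, add_zero]; rfl⟩
  | succ n =>
    refine q.lifts_cls_succ S n ?_
    induction n with
    | zero => exact fun _ _ _ _ y => ⟨y, 0, by rw [map_zero, add_zero]; rfl⟩
    | succ n ih => exact fun N₁ _ _ S₁ => q.lifts_cls_succ S₁ n ih

/-- The unreduced complex of words is the middle term: it maps to the Hochschild complex by `Phi`
and to the reduced words by taking classes, and both maps are isomorphisms on homology. -/
theorem Factorization.Reduction.homology {A' H' : Type u} [AddCommGroup A'] [Module k A']
    [AddCommGroup H'] [Module k H'] {D : Factorization k A H E} (q : D.Reduction A' H') (n : ℕ) :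
    Nonempty (Homology (C := fun n => Wd k E N n) S.b n ≃ₗ[k]
      Homology (C := fun n => HW k A' H' N n) (q.d S) n) := by
  obtain ⟨e₁⟩ := Lifts.homology (fun n x => (D.b_Phi S n x).symm) (D.lifts_Phi S) n
  obtain ⟨e₂⟩ := Lifts.homology (fun n x => (q.d_cls S n x).symm) (q.lifts_cls S) n
  exact ⟨e₁.symm.trans e₂⟩

end Comparison

/-! ### Convolution as composition of `E`-linear maps -/

section Convolution

variable {k : Type u} [CommRing k] {C R : Type u} [AddCommGroup C] [Module k C] [Coalgebra k C]
variable [Ring R] [Algebra k R]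

/-- `c ↦ g(c⁽¹⁾) ⊗ c⁽²⁾`. -/
def cv (g : C →ₗ[k] R) : C →ₗ[k] R ⊗[k] C := LinearMap.rTensor C g ∘ₗ Coalgebra.comul

theorem cv_apply (g : C →ₗ[k] R) (c : C) :
    cv g c = LinearMap.rTensor C g (Coalgebra.comul c) := rfl

/-- The convolution product of linear maps. -/
def conv (f g : C →ₗ[k] R) : C →ₗ[k] R :=
  LinearMap.mul' k R ∘ₗ TensorProduct.map f g ∘ₗ Coalgebra.comul

/-- Coassociativity: both sides are `f(c⁽¹⁾) g(c⁽²⁾) ⊗ c⁽³⁾`. Thus convolution becomes composition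
of the endomorphisms `sh (cv g)`, in reverse order, and convolution inverses become inverse maps. -/
theorem sh_cv_cv (f g : C →ₗ[k] R) (c : C) : sh (cv g) (cv f c) = cv (conv f g) c := by
  have h₁ : ∀ z : C ⊗[k] C, sh (cv g) (LinearMap.rTensor C f z) =
      LinearMap.rTensor C (LinearMap.mul' k R ∘ₗ TensorProduct.map f g)
        ((TensorProduct.assoc k C C C).symm (LinearMap.lTensor C Coalgebra.comul z)) := by
    intro z
    induction z with
    | zero => simp
    | add x y hx hy => simp only [map_add, hx, hy]
    | tmul x y =>
      rw [LinearMap.rTensor_tmul, sh_tmul, LinearMap.lTensor_tmul, cv, LinearMap.comp_apply]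
      generalize Coalgebra.comul (R := k) y = t
      induction t with
      | zero => simp
      | add p q hp hq => simp only [map_add, smul_add, TensorProduct.tmul_add, hp, hq]
      | tmul p q => simp [TensorProduct.smul_tmul']
  have h₂ : cv f c = LinearMap.rTensor C f (Coalgebra.comul c) := rfl
  rw [h₂, h₁, ← Coalgebra.coassoc_apply, LinearEquiv.symm_apply_apply,
    ← LinearMap.rTensor_comp_apply]
  rfl

theorem cv_counit (c : C) : cv (Algebra.linearMap k R ∘ₗ Coalgebra.counit) c = 1 ⊗ₜ c := by
  rw [cv, LinearMap.comp_apply, LinearMap.rTensor_comp_apply, Coalgebra.rTensor_counit_comul]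
  simp

end Convolution

section Sh

variable {k : Type u} [CommRing k] {R : Type u} [Ring R] [Algebra k R]

theorem sh_mk {C : Type u} [AddCommGroup C] [Module k C] (z : R ⊗[k] C) : sh (TensorProduct.mk k R C 1) z = z := by
  induction z with
  | zero => simp
  | add x y hx hy => simp only [map_add, hx, hy]
  | tmul e v => simp [TensorProduct.smul_tmul']

theorem sh_sh {V W X : Type u} [AddCommGroup V] [Module k V] [AddCommGroup W] [Module k W]
    [AddCommGroup X] [Module k X] (f : V →ₗ[k] R ⊗[k] W) (g : W →ₗ[k] R ⊗[k] X) (z : R ⊗[k] V) :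
    sh g (sh f z) = sh (sh g ∘ₗ f) z := by
  induction z with
  | zero => simp
  | add x y hx hy => simp only [map_add, hx, hy]
  | tmul e v => simp

end Sh

section ActPast

variable {k : Type u} [CommRing k] {A C : Type u} [AddCommGroup A] [Module k A]
variable [AddCommGroup C] [Module k C] [Coalgebra k C]
variable {Q Q' : Type u} [AddCommGroup Q] [Module k Q] [AddCommGroup Q'] [Module k Q']

theorem actPast_tmul (act : C →ₗ[k] A →ₗ[k] A) (c : C) (a : A) (q : Q) :
    actPast act Q (c ⊗ₜ (a ⊗ₜ q)) = LinearMap.lTensor A ((TensorProduct.mk k C Q).flip q)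
      (LinearMap.rTensor C (act.flip a) (Coalgebra.comul c)) := by
  rw [actPast, LinearMap.comp_apply, LinearMap.comp_apply, LinearMap.rTensor_tmul]
  generalize Coalgebra.comul (R := k) c = t
  induction t with
  | zero => simp
  | add p q hp hq => simp only [map_add, TensorProduct.add_tmul, hp, hq]
  | tmul p q => simp

end ActPast

/-! ### The crossed product as a factorization `E = A H` -/

namespace CrossedSystem

variable {k A H : Type u} [CommRing k] [Ring A] [Algebra k A] [Ring H] [HopfAlgebra k H]
variable (D : CrossedSystem k A H)

theorem actPast_one (Q : Type u) [AddCommGroup Q] [Module k Q] (h : H) (q : Q) :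
    actPast D.act Q (h ⊗ₜ ((1 : A) ⊗ₜ q)) = 1 ⊗ₜ (h ⊗ₜ q) := by
  have e : D.act.flip 1 = Algebra.linearMap k A ∘ₗ Coalgebra.counit := by
    ext h; exact D.act_one h
  rw [actPast_tmul, e, LinearMap.rTensor_comp_apply, Coalgebra.rTensor_counit_comul]
  simp

theorem one_actPast (Q : Type u) [AddCommGroup Q] [Module k Q] (a : A) (q : Q) :
    actPast D.act Q ((1 : H) ⊗ₜ (a ⊗ₜ q)) = a ⊗ₜ ((1 : H) ⊗ₜ q) := by
  rw [actPast_tmul, Bialgebra.comul_one, Algebra.TensorProduct.one_def]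
  simp [D.one_act]

@[simp] theorem mulInto_tmul (a b : A) (h : H) :
    mulInto k A H (a ⊗ₜ (b ⊗ₜ h)) = (a * b) ⊗ₜ h := rfl

theorem mulInto_one (x : A ⊗[k] H) : mulInto k A H (1 ⊗ₜ x) = x := by
  induction x with
  | zero => simp
  | add x y hx hy => simp only [map_add, TensorProduct.tmul_add, hx, hy]
  | tmul a h => simp

theorem mulInto_lTensor_mk (x : A ⊗[k] H) :
    mulInto k A H (LinearMap.lTensor A (TensorProduct.mk k A H 1) x) = x := by
  induction x with
  | zero => simp
  | add x y hx hy => simp only [map_add, hx, hy]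
  | tmul a h => simp

theorem crossedMul_tmul (a b : A) (h l : H) :
    crossedMul D.act D.f ((a ⊗ₜ h) ⊗ₜ (b ⊗ₜ l)) = mulInto k A H (a ⊗ₜ (mulInto k A H
      (LinearMap.lTensor A (cocycleMul D.f) (actPast D.act H (h ⊗ₜ (b ⊗ₜ l)))))) := rfl

/-- Normality of the cocycle is not assumed; it is read off from `1 # 1` being a left unit,
evaluated on `1 # l`. -/
theorem cocycleMul_one_left (l : H) : cocycleMul D.f (1 ⊗ₜ l) = 1 ⊗ₜ l := by
  have h := D.one_mul (1 ⊗ₜ l)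
  rwa [crossedMul_tmul, mulInto_one, one_actPast, LinearMap.lTensor_tmul, mulInto_one] at h

theorem cocycleMul_one_right (h : H) : cocycleMul D.f (h ⊗ₜ 1) = 1 ⊗ₜ h := by
  have e := D.mul_one (1 ⊗ₜ h)
  rwa [crossedMul_tmul, mulInto_one, actPast_one, LinearMap.lTensor_tmul, mulInto_one] at e

theorem toE_mul (x y : A ⊗[k] H) :
    D.toE x * D.toE y = D.toE (crossedMul D.act D.f (x ⊗ₜ y)) := rfl

theorem incl_apply (a : A) : D.incl a = D.toE (a ⊗ₜ 1) := rfl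

theorem gam_apply (h : H) : D.gam h = D.toE (1 ⊗ₜ h) := rfl

theorem gam_one : D.gam 1 = 1 := rfl

theorem incl_mul_toE (a b : A) (h : H) : D.incl a * D.toE (b ⊗ₜ h) = D.toE ((a * b) ⊗ₜ h) := by
  rw [incl_apply, toE_mul, crossedMul_tmul, one_actPast, LinearMap.lTensor_tmul,
    cocycleMul_one_left, mulInto_tmul, _root_.mul_one, mulInto_tmul]

theorem incl_mul_gam (a : A) (h : H) : D.incl a * D.gam h = D.toE (a ⊗ₜ h) := by
  rw [gam_apply, incl_mul_toE, _root_.mul_one]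

/-- The commutation rule `(1 # h)(a # 1) = a^{h⁽¹⁾} # h⁽²⁾`; normality of the cocycle in its second
argument removes `f`. -/
theorem gam_mul_incl (h : H) (a : A) :
    D.gam h * D.incl a = D.toE (LinearMap.rTensor H (D.act.flip a) (Coalgebra.comul h)) := by
  rw [gam_apply, incl_apply, toE_mul, crossedMul_tmul, mulInto_one, actPast_tmul,
    ← LinearMap.lTensor_comp_apply]
  have : cocycleMul D.f ∘ₗ (TensorProduct.mk k H H).flip 1 = TensorProduct.mk k A H 1 := by
    ext h; exact D.cocycleMul_one_right h
  rw [this, mulInto_lTensor_mk]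

theorem gam_mul_gam (h l : H) : D.gam h * D.gam l = D.toE (cocycleMul D.f (h ⊗ₜ l)) := by
  rw [gam_apply, gam_apply, toE_mul, crossedMul_tmul, mulInto_one, actPast_one,
    LinearMap.lTensor_tmul, mulInto_one]

/-- The inclusion `A → E` as an algebra homomorphism. -/
def inclHom : A →ₐ[k] D.E :=
  AlgHom.ofLinearMap D.incl rfl fun a b => by
    rw [D.incl_apply b, incl_mul_toE, incl_apply]

/-- The factorization `E = A H` of a crossed product. -/
def fact : Factorization k A H D.E where
  incl := D.inclHom
  gam := D.gam
  equiv := D.toE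
  equiv_tmul a h := (D.incl_mul_gam a h).symm
  one := 1
  gam_one := rfl
  aug := Coalgebra.counit
  aug_one := Bialgebra.counit_one

/-- The quotients `A → A / k·1` and `H → H / k·1`. -/
def reduction : D.fact.Reduction (Red k A) (Red k H) where
  qA := red k A
  qH := red k H
  qA_surj := Submodule.mkQ_surjective _
  qH_surj := Submodule.mkQ_surjective _
  qA_one := (Submodule.Quotient.mk_eq_zero _).2 (Submodule.mem_span_singleton_self _)
  qH_one := (Submodule.Quotient.mk_eq_zero _).2 (Submodule.mem_span_singleton_self _)
  ker_qA := (Submodule.ker_mkQ _).le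
  ker_qH := (Submodule.ker_mkQ _).le

variable {N : Type w} [AddCommGroup N] [Module k N]

@[simp] theorem fact_gam (h : H) : D.fact.gam h = D.gam h := rfl

@[simp] theorem fact_incl (a : A) : D.fact.incl a = D.incl a := rfl

theorem insA_toE_tmul (n : ℕ) (x : A ⊗[k] H) (v : HW k A H N n) :
    D.fact.insA n (D.toE x ⊗ₜ v) =
      LinearMap.lTensor A (HW.hv ∘ₗ (TensorProduct.mk k H (HW k A H N n)).flip v) x := by
  induction x with
  | zero => simp
  | add x y hx hy => simp only [map_add, TensorProduct.add_tmul, hx, hy]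
  | tmul a h =>
    rw [← incl_mul_gam]
    exact D.fact.insA_tmul n a h v

end CrossedSystem

/-! ### Elementary tensors as words -/

section Words

variable {k : Type u} [CommRing k]
variable {B B' C C' : Type u} [AddCommGroup B] [Module k B] [AddCommGroup B'] [Module k B']
variable [AddCommGroup C] [Module k C] [AddCommGroup C'] [Module k C']
variable {N : Type w} [AddCommGroup N] [Module k N]

/-- `b₁ ⊗ ⋯ ⊗ b_r ↦ b₁ ⊗ ⋯ ⊗ b_r ⊗ m` if `n = r` (and `0` if `n ≠ r`). -/
def wA (m : N) : (n r : ℕ) → TPow k B r →ₗ[k] Wd k B N n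
  | 0, 0 => Wd.nil.toLinearMap ∘ₗ LinearMap.toSpanSingleton k N m ∘ₗ nil.symm.toLinearMap
  | n + 1, r + 1 => Wd.cons.toLinearMap ∘ₗ LinearMap.lTensor B (wA m n r) ∘ₗ cons.symm.toLinearMap
  | 0, _ + 1 => 0
  | _ + 1, 0 => 0

/-- `(c₁ ⊗ ⋯ ⊗ c_s) ⊗ (b₁ ⊗ ⋯ ⊗ b_r) ↦ c₁ ⊗ ⋯ ⊗ c_s ⊗ b₁ ⊗ ⋯ ⊗ b_r ⊗ m` if `n = r + s` (and `0` if
`n ≠ r + s`). -/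
def wrd (m : N) : (n s r : ℕ) → TPow k C s ⊗[k] TPow k B r →ₗ[k] HW k B C N n
  | n, 0, r => HW.aw ∘ₗ wA m n r ∘ₗ (TensorProduct.lid k (TPow k B r)).toLinearMap
      ∘ₗ LinearMap.rTensor (TPow k B r) nil.symm.toLinearMap
  | n + 1, s + 1, r => HW.hv ∘ₗ LinearMap.lTensor C (wrd m n s r)
      ∘ₗ (TensorProduct.assoc k C (TPow k C s) (TPow k B r)).toLinearMap
      ∘ₗ LinearMap.rTensor (TPow k B r) cons.symm.toLinearMap
  | 0, _ + 1, _ => 0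

theorem wA_zero (m : N) (a : k) : wA m 0 0 (nil (V := B) a) = Wd.nil (a • m) := rfl

theorem wA_cons (m : N) (n r : ℕ) (b : B) (x : TPow k B r) :
    wA m (n + 1) (r + 1) (cons (b ⊗ₜ x)) = Wd.cons (b ⊗ₜ wA m n r x) := rfl

theorem wrd_nil (m : N) (n r : ℕ) (a : k) (x : TPow k B r) :
    wrd m n 0 r (nil (V := C) a ⊗ₜ x) = a • HW.aw (wA m n r x) := by
  cases n <;> simp [wrd]

theorem wrd_cons (m : N) (n s r : ℕ) (c : C) (p : TPow k C s) (x : TPow k B r) :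
    wrd m (n + 1) (s + 1) r (cons (c ⊗ₜ p) ⊗ₜ x) = HW.hv (c ⊗ₜ wrd m n s r (p ⊗ₜ x)) := rfl

theorem pow_hom_ext {s : ℕ} {X Q : Type*} [AddCommGroup X] [Module k X] [AddCommGroup Q]
    [Module k Q] {f g : TPow k C (s + 1) ⊗[k] X →ₗ[k] Q}
    (h : ∀ c p x, f (cons (c ⊗ₜ p) ⊗ₜ x) = g (cons (c ⊗ₜ p) ⊗ₜ x)) : f = g := by
  have : f ∘ₗ LinearMap.rTensor X (cons (n := s)).toLinearMap =
      g ∘ₗ LinearMap.rTensor X (cons (n := s)).toLinearMap :=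
    TensorProduct.ext_threefold fun c p x => h c p x
  refine TensorProduct.ext' fun t x => ?_
  exact LinearMap.congr_fun this (cons.symm t ⊗ₜ x)

theorem nil_hom_ext {X Q : Type*} [AddCommGroup X] [Module k X] [AddCommGroup Q]
    [Module k Q] {f g : TPow k C 0 ⊗[k] X →ₗ[k] Q}
    (h : ∀ x, f (nil 1 ⊗ₜ x) = g (nil 1 ⊗ₜ x)) : f = g := by
  refine TensorProduct.ext' fun t x => ?_
  obtain ⟨a, rfl⟩ := (nil (k := k) (V := C)).surjective t
  have e : nil (k := k) (V := C) a = a • nil 1 := by rw [← map_smul, smul_eq_mul, mul_one]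
  rw [e, ← TensorProduct.smul_tmul', map_smul, map_smul, h]

theorem TPow.hom_ext {s : ℕ} {Q : Type*} [AddCommGroup Q] [Module k Q]
    {f g : TPow k C (s + 1) →ₗ[k] Q} (h : ∀ c p, f (cons (c ⊗ₜ p)) = g (cons (c ⊗ₜ p))) :
    f = g := by
  have : f ∘ₗ (cons (n := s)).toLinearMap = g ∘ₗ (cons (n := s)).toLinearMap :=
    TensorProduct.ext' fun c p => h c p
  ext t
  exact LinearMap.congr_fun this (cons.symm t)

theorem TPow.hom_ext_nil {Q : Type*} [AddCommGroup Q] [Module k Q]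
    {f g : TPow k C 0 →ₗ[k] Q} (h : f (nil 1) = g (nil 1)) : f = g := by
  refine LinearMap.ext fun t => ?_
  obtain ⟨a, rfl⟩ := (nil (k := k) (V := C)).surjective t
  have e : nil (k := k) (V := C) a = a • nil 1 := by rw [← map_smul, smul_eq_mul, mul_one]
  rw [e, map_smul, map_smul, h]

@[simp] theorem powMap_nil (g : C →ₗ[k] C') (a : k) : powMap g 0 (nil a) = nil a := rfl

@[simp] theorem powMap_cons (g : C →ₗ[k] C') (s : ℕ) (c : C) (p : TPow k C s) :
    powMap g (s + 1) (cons (c ⊗ₜ p)) = cons (g c ⊗ₜ powMap g s p) := rfl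

theorem map_wA (g : B →ₗ[k] B') (m : N) (n r : ℕ) (x : TPow k B r) :
    Wd.map g LinearMap.id n (wA m n r x) = wA m n r (powMap g r x) := by
  induction n generalizing r with
  | zero =>
    cases r with
    | zero => rfl
    | succ r => exact map_zero _
  | succ n ih =>
    cases r with
    | zero => exact map_zero _
    | succ r =>
      suffices h : Wd.map g LinearMap.id (n + 1) ∘ₗ wA m (n + 1) (r + 1) =
          wA m (n + 1) (r + 1) ∘ₗ powMap g (r + 1) from LinearMap.congr_fun h x
      refine TPow.hom_ext fun b p => ?_
      simp [wA_cons, ih]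

theorem map_wrd (g : B →ₗ[k] B') (c : C →ₗ[k] C') (m : N) (n s r : ℕ)
    (z : TPow k C s ⊗[k] TPow k B r) :
    HW.map g c LinearMap.id n (wrd m n s r z) =
      wrd m n s r (TensorProduct.map (powMap c s) (powMap g r) z) := by
  suffices h : HW.map g c LinearMap.id n ∘ₗ wrd m n s r =
      wrd m n s r ∘ₗ TensorProduct.map (powMap c s) (powMap g r) from LinearMap.congr_fun h z
  clear z
  induction s generalizing n with
  | zero =>
    refine nil_hom_ext fun x => ?_
    simp [wrd_nil, map_wA]
  | succ s ih =>
    cases n with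
    | zero => rfl
    | succ n =>
      refine pow_hom_ext fun d p x => ?_
      have := LinearMap.congr_fun (ih n) (p ⊗ₜ x)
      simp only [LinearMap.comp_apply, TensorProduct.map_tmul] at this
      simp [wrd_cons, this]

theorem wA_add (m m' : N) (n r : ℕ) : wA (k := k) (B := B) (m + m') n r = wA m n r + wA m' n r := by
  induction n generalizing r with
  | zero =>
    cases r with
    | zero => exact TPow.hom_ext_nil (by simp [wA_zero])
    | succ r => exact (add_zero _).symm
  | succ n ih =>
    cases r with
    | zero => exact (add_zero _).symm
    | succ r => exact TPow.hom_ext fun b p => by simp [wA_cons, ih, TensorProduct.tmul_add]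

theorem wA_smul (a : k) (m : N) (n r : ℕ) : wA (k := k) (B := B) (a • m) n r = a • wA m n r := by
  induction n generalizing r with
  | zero =>
    cases r with
    | zero => exact TPow.hom_ext_nil (by simp [wA_zero])
    | succ r => exact (smul_zero _).symm
  | succ n ih =>
    cases r with
    | zero => exact (smul_zero _).symm
    | succ r => exact TPow.hom_ext fun b p => by simp [wA_cons, ih]

theorem wrd_add (m m' : N) (n s r : ℕ) :
    wrd (k := k) (B := B) (C := C) (m + m') n s r = wrd m n s r + wrd m' n s r := by
  induction s generalizing n with
  | zero => exact nil_hom_ext fun x => by simp [wrd_nil, wA_add]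
  | succ s ih =>
    cases n with
    | zero => exact (add_zero _).symm
    | succ n => exact pow_hom_ext fun d p x => by simp [wrd_cons, ih, TensorProduct.tmul_add]

theorem wrd_smul (a : k) (m : N) (n s r : ℕ) :
    wrd (k := k) (B := B) (C := C) (a • m) n s r = a • wrd m n s r := by
  induction s generalizing n with
  | zero => exact nil_hom_ext fun x => by simp [wrd_nil, wA_smul]
  | succ s ih =>
    cases n with
    | zero => exact (smul_zero _).symm
    | succ n => exact pow_hom_ext fun d p x => by simp [wrd_cons, ih]

variable (B C N) in
/-- `m ⊗ 𝐜 ⊗ 𝐛 ↦ c₁ ⊗ ⋯ ⊗ c_s ⊗ b₁ ⊗ ⋯ ⊗ b_r ⊗ m`. -/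
def Jb (n s r : ℕ) : N ⊗[k] (TPow k C s ⊗[k] TPow k B r) →ₗ[k] HW k B C N n :=
  TensorProduct.lift
    { toFun := fun m => wrd m n s r
      map_add' := fun m m' => wrd_add m m' n s r
      map_smul' := fun a m => wrd_smul a m n s r }

@[simp] theorem Jb_tmul (n s r : ℕ) (m : N) (z : TPow k C s ⊗[k] TPow k B r) :
    Jb B C N n s r (m ⊗ₜ z) = wrd m n s r z := rfl

variable (B N) in
/-- `m ⊗ 𝐛 ↦ b₁ ⊗ ⋯ ⊗ b_r ⊗ m`. -/
def JA (n r : ℕ) : N ⊗[k] TPow k B r →ₗ[k] Wd k B N n :=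
  TensorProduct.lift
    { toFun := fun m => wA m n r
      map_add' := fun m m' => wA_add m m' n r
      map_smul' := fun a m => wA_smul a m n r }

@[simp] theorem JA_tmul (n r : ℕ) (m : N) (x : TPow k B r) :
    JA B N n r (m ⊗ₜ x) = wA m n r x := rfl

/-! ### The inverse of the word map -/

variable (B N) in
/-- `b₁ ⊗ ⋯ ⊗ b_n ⊗ m ↦ m ⊗ 𝐛` if `n = r` (and `0` if `n ≠ r`). -/
def prA : (n r : ℕ) → Wd k B N n →ₗ[k] N ⊗[k] TPow k B r
  | 0, 0 => (TensorProduct.mk k N (TPow k B 0)).flip (nil 1) ∘ₗ Wd.nil.symm.toLinearMap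
  | n + 1, r + 1 => LinearMap.lTensor N cons.toLinearMap
      ∘ₗ (TensorProduct.leftComm k B N (TPow k B r)).toLinearMap
      ∘ₗ LinearMap.lTensor B (prA n r) ∘ₗ Wd.cons.symm.toLinearMap
  | 0, _ + 1 => 0
  | _ + 1, 0 => 0

variable (B C N) in
/-- The component of bidegree `(r, s)` of a mixed word. -/
def pr : (n s r : ℕ) → HW k B C N n →ₗ[k] N ⊗[k] (TPow k C s ⊗[k] TPow k B r)
  | n, 0, r => LinearMap.lTensor N (TensorProduct.mk k (TPow k C 0) (TPow k B r) (nil 1))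
      ∘ₗ prA B N n r ∘ₗ HW.fst
  | n + 1, s + 1, r => LinearMap.lTensor N (LinearMap.rTensor (TPow k B r) cons.toLinearMap
        ∘ₗ (TensorProduct.assoc k C (TPow k C s) (TPow k B r)).symm.toLinearMap)
      ∘ₗ (TensorProduct.leftComm k C N (TPow k C s ⊗[k] TPow k B r)).toLinearMap
      ∘ₗ LinearMap.lTensor C (pr n s r) ∘ₗ HW.snd
  | 0, _ + 1, _ => 0

theorem prA_wA (m : N) (n : ℕ) (x : TPow k B n) : prA B N n n (wA m n n x) = m ⊗ₜ x := by
  suffices h : prA B N n n ∘ₗ wA m n n = TensorProduct.mk k N (TPow k B n) m from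
    LinearMap.congr_fun h x
  clear x
  induction n with
  | zero =>
    refine TPow.hom_ext_nil ?_
    simp [wA_zero, prA]
  | succ n ih =>
    refine TPow.hom_ext fun b p => ?_
    have := LinearMap.congr_fun ih p
    simp only [LinearMap.comp_apply, TensorProduct.mk_apply] at this
    simp [wA_cons, prA, this]

theorem pr_cons (n s r : ℕ) (c : C) (v : HW k B C N n) :
    pr B C N (n + 1) (s + 1) r (HW.hv (c ⊗ₜ v)) =
      LinearMap.lTensor N (LinearMap.rTensor (TPow k B r) cons.toLinearMap
        ∘ₗ (TensorProduct.assoc k C (TPow k C s) (TPow k B r)).symm.toLinearMap)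
      (TensorProduct.leftComm k C N (TPow k C s ⊗[k] TPow k B r) (c ⊗ₜ pr B C N n s r v)) := rfl

/-- Together with `pr_wrd_of_ne` this recovers the components of a word by their number of letters
of `C`, which gives injectivity of `Jn`. -/
theorem pr_wrd (m : N) {n s r : ℕ} (hn : r + s = n) (z : TPow k C s ⊗[k] TPow k B r) :
    pr B C N n s r (wrd m n s r z) = m ⊗ₜ z := by
  suffices h : pr B C N n s r ∘ₗ wrd m n s r = TensorProduct.mk k N _ m from
    LinearMap.congr_fun h z
  clear z
  induction s generalizing n with
  | zero =>
    obtain rfl : r = n := hn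
    refine nil_hom_ext fun x => ?_
    cases r <;> simp [wrd_nil, pr, prA_wA]
  | succ s ih =>
    cases n with
    | zero => omega
    | succ n =>
      refine pow_hom_ext fun d p x => ?_
      have := LinearMap.congr_fun (ih (n := n) (by omega)) (p ⊗ₜ x)
      simp only [LinearMap.comp_apply, TensorProduct.mk_apply] at this
      rw [LinearMap.comp_apply, wrd_cons, pr_cons, this]
      simp

theorem pr_wrd_of_ne (m : N) (n : ℕ) {s s' : ℕ} (r r' : ℕ) (h : s ≠ s')
    (z : TPow k C s ⊗[k] TPow k B r) : pr B C N n s' r' (wrd m n s r z) = 0 := by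
  suffices h : pr B C N n s' r' ∘ₗ wrd m n s r = 0 from LinearMap.congr_fun h z
  clear z
  induction s generalizing n s' with
  | zero =>
    cases s' with
    | zero => exact absurd rfl h
    | succ s' =>
      cases n with
      | zero => rfl
      | succ n => exact nil_hom_ext fun x => by simp [wrd_nil, pr]
  | succ s ih =>
    cases n with
    | zero => exact LinearMap.comp_zero _
    | succ n =>
      refine pow_hom_ext fun d p x => ?_
      cases s' with
      | zero => simp [wrd_cons, pr]
      | succ s' =>
        have := LinearMap.congr_fun (ih n (s' := s') (by omega)) (p ⊗ₜ x)
        simp only [LinearMap.comp_apply, LinearMap.zero_apply] at this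
        rw [LinearMap.comp_apply, wrd_cons, pr_cons, this]
        simp

theorem Wd.mem_of_wA {n : ℕ} {P : Submodule k (Wd k B N n)} (h : ∀ m x, wA m n n x ∈ P)
    (w : Wd k B N n) : w ∈ P := by
  induction n with
  | zero =>
    obtain ⟨x, rfl⟩ := Wd.nil.surjective w
    simpa [wA_zero] using h x (HopfCrossed.nil 1)
  | succ n ih =>
    obtain ⟨z, rfl⟩ := Wd.cons.surjective w
    induction z with
    | zero => exact P.zero_mem
    | add x y hx hy => rw [map_add]; exact P.add_mem hx hy
    | tmul b w =>
      exact ih (P := P.comap (Wd.cons.toLinearMap ∘ₗ TensorProduct.mk k B (Wd k B N n) b))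
        (fun m x => h m (HopfCrossed.cons (b ⊗ₜ x))) w

theorem HW.mem_of_wrd {n : ℕ} {P : Submodule k (HW k B C N n)}
    (h : ∀ s r m z, r + s = n → wrd m n s r z ∈ P) (v : HW k B C N n) : v ∈ P := by
  have key : ∀ (n : ℕ) (P : Submodule k (HW k B C N n)),
      (∀ s r m z, r + s = n → wrd m n s r z ∈ P) → ∀ w, HW.aw w ∈ P := by
    intro n P h w
    refine Wd.mem_of_wA (P := P.comap HW.aw) (fun m x => ?_) w
    have := h 0 n m (nil 1 ⊗ₜ x) rfl
    rwa [wrd_nil, one_smul] at this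
  induction n with
  | zero => exact key 0 P h v
  | succ n ih =>
    rw [← HW.aw_fst_add_hv_snd v]
    refine P.add_mem (key _ P h _) ?_
    generalize HW.snd v = z
    induction z with
    | zero => exact P.zero_mem
    | add x y hx hy => rw [map_add]; exact P.add_mem hx hy
    | tmul c v =>
      refine ih (P := P.comap (HW.hv ∘ₗ TensorProduct.mk k C (HW k B C N n) c))
        (fun s r m z hz => ?_) v
      induction z with
      | zero => rw [map_zero]; exact Submodule.zero_mem _
      | add x y hx hy => rw [map_add]; exact Submodule.add_mem _ hx hy
      | tmul p x => exact h (s + 1) r m (cons (c ⊗ₜ p) ⊗ₜ x) (by omega)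

variable (B C N) in
/-- The isomorphism from `⨁_{r+s=n} N ⊗ C^{⊗ s} ⊗ B^{⊗ r}` to mixed words. -/
def Jn (n : ℕ) : XHat k B C N n →ₗ[k] HW k B C N n :=
  DirectSum.toModule k (Bideg n) (HW k B C N n) fun p =>
    -- On words, `I` carries `(-1)^s` for the `s` letters of `H` it passes, while in `d̂⁰` the
    -- products of letters of `A` have no such sign; merging two letters of `H` has no sign from
    -- `r`, while in `d̂¹` it carries `(-1)^r`. Conjugation by `(-1)^{rs}` exchanges the two
    -- conventions.
    (-1 : k) ^ (p.1.1 * p.1.2) • Jb B C N n p.1.2 p.1.1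

theorem Jn_toHat {n r s : ℕ} (h : r + s = n) (y : N ⊗[k] (TPow k C s ⊗[k] TPow k B r)) :
    Jn B C N n (toHat N r s h y) = (-1 : k) ^ (r * s) • Jb B C N n s r y :=
  DirectSum.toModule_lof k _ _

theorem Jn_bijective (n : ℕ) : Function.Bijective (Jn (k := k) B C N n) := by
  constructor
  · rw [injective_iff_map_eq_zero]
    intro x hx
    have key : ∀ p : Bideg n, pr B C N n p.1.2 p.1.1 ∘ₗ Jn B C N n =
        (-1 : k) ^ (p.1.1 * p.1.2) • DirectSum.component k (Bideg n) _ p := by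
      intro p
      refine DirectSum.linearMap_ext k fun q => TensorProduct.ext' fun m z => ?_
      rw [LinearMap.comp_apply, LinearMap.comp_apply, LinearMap.comp_apply, Jn,
        DirectSum.toModule_lof, LinearMap.smul_apply, map_smul, Jb_tmul, LinearMap.smul_apply]
      by_cases hq : q = p
      · subst hq
        rw [pr_wrd m q.2, DirectSum.component.lof_self]
      · rw [pr_wrd_of_ne _ _ _ _ fun e => hq (Subtype.ext (Prod.ext ?_ e)),
          DirectSum.component.of, dif_neg hq, smul_zero, smul_zero]
        have h₁ := q.2
        have h₂ := p.2
        omega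
    refine DFinsupp.ext fun p => ?_
    have := LinearMap.congr_fun (key p) x
    rw [LinearMap.comp_apply, hx, map_zero, LinearMap.smul_apply] at this
    have h := congrArg (fun y => (-1 : k) ^ (p.1.1 * p.1.2) • y) this
    rw [smul_smul, ← mul_pow, neg_mul_neg, one_mul, one_pow, one_smul, smul_zero] at h
    exact h.symm
  · intro v
    refine HW.mem_of_wrd (P := LinearMap.range (Jn B C N n)) (fun s r m z h => ?_) v
    refine ⟨(-1 : k) ^ (r * s) • toHat N r s h (m ⊗ₜ z), ?_⟩
    rw [map_smul, Jn_toHat, smul_smul, ← mul_pow]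
    simp

variable (B N) in
theorem JA_bijective (n : ℕ) : Function.Bijective (JA (k := k) B N n n) := by
  constructor
  · refine Function.LeftInverse.injective (g := prA B N n n) fun x => ?_
    induction x with
    | zero => simp
    | add x y hx hy => simp only [map_add, hx, hy]
    | tmul m x => exact prA_wA m n x
  · intro w
    exact Wd.mem_of_wA (P := LinearMap.range (JA B N n n)) (fun m x => ⟨m ⊗ₜ x, rfl⟩) w

theorem hat_hom_ext {n : ℕ} {Q : Type*} [AddCommGroup Q] [Module k Q]
    {f g : XHat k B C N n →ₗ[k] Q}
    (h : ∀ r s (hn : r + s = n) m z, f (toHat N r s hn (m ⊗ₜ z)) = g (toHat N r s hn (m ⊗ₜ z))) :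
    f = g :=
  DirectSum.linearMap_ext k fun p => TensorProduct.ext' fun m z => h p.1.1 p.1.2 p.2 m z

end Words

/-! ### Moving a letter of `A` past an element of a coalgebra -/

section Past

variable {k : Type u} [CommRing k] {A C : Type u} [AddCommGroup A] [Module k A]
variable [AddCommGroup C] [Module k C] [Coalgebra k C]

/-- For a bilinear map `(c, a) ↦ a^c`, the map `c ⊗ (a ⊗ q) ↦ a^{c⁽¹⁾} ⊗ (c⁽²⁾ ⊗ q)`. -/
def past (act : C →ₗ[k] A →ₗ[k] A) (Q : Type w) [AddCommGroup Q] [Module k Q] :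
    C ⊗[k] (A ⊗[k] Q) →ₗ[k] A ⊗[k] (C ⊗[k] Q) :=
  LinearMap.rTensor (C ⊗[k] Q) (TensorProduct.lift act)
    ∘ₗ (TensorProduct.tensorTensorTensorComm k C C A Q).toLinearMap
    ∘ₗ LinearMap.rTensor (A ⊗[k] Q) Coalgebra.comul

/-- The version `past` also admits tails containing elements of `M`, which may live in another
universe. -/
theorem actPast_eq_past (act : C →ₗ[k] A →ₗ[k] A) (Q : Type u) [AddCommGroup Q] [Module k Q] :
    actPast act Q = past act Q := rfl

variable {Q : Type w} {Q' : Type w'} [AddCommGroup Q] [Module k Q] [AddCommGroup Q'] [Module k Q']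

theorem past_tmul (act : C →ₗ[k] A →ₗ[k] A) (c : C) (a : A) (q : Q) :
    past act Q (c ⊗ₜ (a ⊗ₜ q)) = LinearMap.lTensor A ((TensorProduct.mk k C Q).flip q)
      (LinearMap.rTensor C (act.flip a) (Coalgebra.comul c)) := by
  rw [past, LinearMap.comp_apply, LinearMap.comp_apply, LinearMap.rTensor_tmul]
  generalize Coalgebra.comul (R := k) c = t
  induction t with
  | zero => simp
  | add p q hp hq => simp only [map_add, TensorProduct.add_tmul, hp, hq]
  | tmul p q => simp

theorem past_lTensor (act : C →ₗ[k] A →ₗ[k] A) (g : Q →ₗ[k] Q') (c : C) (z : A ⊗[k] Q) :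
    past act Q' (c ⊗ₜ (LinearMap.lTensor A g z)) =
      LinearMap.lTensor A (LinearMap.lTensor C g) (past act Q (c ⊗ₜ z)) := by
  induction z with
  | zero => simp
  | add x y hx hy => simp only [map_add, TensorProduct.tmul_add, hx, hy]
  | tmul a q =>
    simp only [LinearMap.lTensor_tmul, past_tmul, ← LinearMap.lTensor_comp_apply]
    rfl

end Past

section InnerSum

variable {k : Type u} [CommRing k] {B : Type u} [Ring B] [Algebra k B]

theorem mulAt_zero (n : ℕ) (a b : B) (p : TPow k B n) :
    mulAt 0 n (cons (a ⊗ₜ cons (b ⊗ₜ p))) = cons ((a * b) ⊗ₜ p) := rfl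

theorem mulAt_succ (i n : ℕ) (b : B) (p : TPow k B (n + 2)) :
    mulAt (i + 1) (n + 1) (cons (b ⊗ₜ p)) = cons (b ⊗ₜ mulAt i n p) := rfl

theorem innerSum_succ (n : ℕ) (b : B) (p : TPow k B (n + 1)) :
    innerSum (n + 1) (cons (b ⊗ₜ p)) =
      -mulAt 0 n (cons (b ⊗ₜ p)) - cons (b ⊗ₜ innerSum n p) := by
  cases n with
  | zero => simp [innerSum]
  | succ n =>
    rw [innerSum, Finset.sum_range_succ', LinearMap.add_apply, LinearMap.sum_apply, innerSum,
      LinearMap.sum_apply, TensorProduct.tmul_sum, map_sum, zero_add, pow_one,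
      LinearMap.smul_apply, neg_one_smul, add_comm (Finset.sum _ _), sub_eq_add_neg, ← Finset.sum_neg_distrib]
    congr 1
    refine Finset.sum_congr rfl fun i _ => ?_
    simp only [LinearMap.smul_apply, TensorProduct.tmul_smul, map_smul, mulAt_succ,
      pow_succ _ (i + 1)]
    module

variable {C : Type u} [AddCommGroup C] [Module k C] {N : Type w} [AddCommGroup N] [Module k N]

theorem inner_wA (m : N) (n r : ℕ) (x : TPow k B (r + 1)) :
    Wd.inner n (wA m (n + 1) (r + 1) x) = wA m n r (innerSum r x) := by
  suffices h : Wd.inner n ∘ₗ wA m (n + 1) (r + 1) = wA m n r ∘ₗ innerSum r from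
    LinearMap.congr_fun h x
  clear x
  induction n generalizing r with
  | zero =>
    cases r with
    | zero => simp [Wd.inner, innerSum]
    | succ r => rfl
  | succ n ih =>
    cases r with
    | zero =>
      refine TPow.hom_ext fun b p => ?_
      simp [wA, innerSum]
    | succ r =>
      refine TPow.hom_ext fun b p => ?_
      have h := LinearMap.congr_fun (ih r) p
      suffices h' : Wd.inner (n + 1) ∘ₗ wA m (n + 2) (r + 2) ∘ₗ cons.toLinearMap ∘ₗ
          TensorProduct.mk k B _ b = wA m (n + 1) (r + 1) ∘ₗ innerSum (r + 1) ∘ₗ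
          cons.toLinearMap ∘ₗ TensorProduct.mk k B _ b from LinearMap.congr_fun h' p
      refine TPow.hom_ext fun b' p => ?_
      have h := LinearMap.congr_fun (ih r) (cons (b' ⊗ₜ p))
      simp only [LinearMap.comp_apply, wA_cons] at h
      simp [wA_cons, innerSum_succ, mulAt_zero, h]

end InnerSum

/-! ### The operators `LA` and `I` on elementary words of a crossed product -/

namespace CrossedSystem

variable {k A H : Type u} [CommRing k] [Ring A] [Algebra k A] [Ring H] [HopfAlgebra k H]
variable (D : CrossedSystem k A H)

theorem mergeAt_zero (s : ℕ) (h l : H) (p : TPow k H s) :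
    D.mergeAt 0 s (cons (h ⊗ₜ cons (l ⊗ₜ p))) =
      LinearMap.lTensor A (cons.toLinearMap ∘ₗ (TensorProduct.mk k H (TPow k H s)).flip p)
        (cocycleMul D.f (h ⊗ₜ l)) := by
  have : D.mergeAt 0 s (cons (h ⊗ₜ cons (l ⊗ₜ p))) = LinearMap.lTensor A cons.toLinearMap
      (TensorProduct.assoc k A H (TPow k H s) (cocycleMul D.f (h ⊗ₜ l) ⊗ₜ p)) := rfl
  rw [this]
  generalize cocycleMul D.f (h ⊗ₜ l) = t
  induction t with
  | zero => simp
  | add x y hx hy => simp only [map_add, TensorProduct.add_tmul, hx, hy]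
  | tmul a h => simp

theorem mergeAt_succ (j s : ℕ) (h : H) (p : TPow k H (s + 2)) :
    D.mergeAt (j + 1) (s + 1) (cons (h ⊗ₜ p)) =
      LinearMap.lTensor A cons.toLinearMap (actPast D.act _ (h ⊗ₜ D.mergeAt j s p)) := rfl

theorem mergeSum_succ (s : ℕ) (h : H) (p : TPow k H (s + 1)) :
    D.mergeSum (s + 1) (cons (h ⊗ₜ p)) = -D.mergeAt 0 s (cons (h ⊗ₜ p)) -
      LinearMap.lTensor A cons.toLinearMap (actPast D.act _ (h ⊗ₜ D.mergeSum s p)) := by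
  cases s with
  | zero => simp [mergeSum]
  | succ s =>
    rw [mergeSum, Finset.sum_range_succ', LinearMap.add_apply, LinearMap.sum_apply, mergeSum,
      LinearMap.sum_apply, TensorProduct.tmul_sum, map_sum, map_sum, zero_add, pow_one,
      LinearMap.smul_apply, neg_one_smul, add_comm (Finset.sum _ _), sub_eq_add_neg, ← Finset.sum_neg_distrib]
    congr 1
    refine Finset.sum_congr rfl fun i _ => ?_
    simp only [LinearMap.smul_apply, TensorProduct.tmul_smul, map_smul, mergeAt_succ,
      pow_succ _ (i + 1)]
    module

theorem comul_nil : Coalgebra.comul (R := k) (nil (k := k) (V := H) 1) = nil 1 ⊗ₜ nil 1 := rfl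

theorem comul_cons (s : ℕ) (h : H) (p : TPow k H s) :
    Coalgebra.comul (R := k) (cons (h ⊗ₜ p)) =
      TensorProduct.map cons.toLinearMap cons.toLinearMap
        (TensorProduct.tensorTensorTensorComm k H H (TPow k H s) (TPow k H s)
          (Coalgebra.comul h ⊗ₜ Coalgebra.comul p)) := by
  have : (TensorProduct.map cons.toLinearMap cons.toLinearMap :
      (H ⊗[k] TPow k H s) ⊗[k] (H ⊗[k] TPow k H s) →ₗ[k] TPow k H (s + 1) ⊗[k] TPow k H (s + 1))
      = LinearMap.id := TensorProduct.map_id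
  rw [this]
  rfl

theorem past_actPow_zero {Q : Type w} [AddCommGroup Q] [Module k Q] (y : A ⊗[k] Q) :
    past (D.actPow 0) Q (nil 1 ⊗ₜ y) =
      LinearMap.lTensor A (TensorProduct.mk k (TPow k H 0) Q (nil 1)) y := by
  induction y with
  | zero => simp
  | add x y hx hy => simp only [map_add, TensorProduct.tmul_add, hx, hy]
  | tmul a q =>
    rw [past_tmul, comul_nil]
    simp [actPow]

theorem actPow_cons (s : ℕ) (h : H) (p : TPow k H s) (a : A) :
    D.actPow (s + 1) (cons (h ⊗ₜ p)) a = D.act h (D.actPow s p a) := rfl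

/-- Since the comultiplication of `H^{⊗ (s+1)}` works letter by letter, moving `a` past `h ⊗ p`
means moving it past `p` and then past `h`. -/
theorem past_actPow_succ {Q : Type w} [AddCommGroup Q] [Module k Q] (s : ℕ) (h : H)
    (p : TPow k H s) (y : A ⊗[k] Q) :
    past (D.actPow (s + 1)) Q (cons (h ⊗ₜ p) ⊗ₜ y) =
      LinearMap.lTensor A (LinearMap.rTensor Q cons.toLinearMap
        ∘ₗ (TensorProduct.assoc k H (TPow k H s) Q).symm.toLinearMap)
        (past D.act _ (h ⊗ₜ past (D.actPow s) Q (p ⊗ₜ y))) := by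
  induction y with
  | zero => simp
  | add x y hx hy => simp only [map_add, TensorProduct.tmul_add, hx, hy]
  | tmul a q =>
    rw [past_tmul, past_tmul, comul_cons]
    generalize Coalgebra.comul (R := k) p = t
    induction t with
    | zero => simp
    | add x y hx hy => simp only [map_add, TensorProduct.tmul_add, hx, hy]
    | tmul p₁ p₂ =>
      rw [LinearMap.rTensor_tmul, LinearMap.lTensor_tmul, past_tmul]
      generalize Coalgebra.comul (R := k) h = t'
      induction t' with
      | zero => simp
      | add x y hx hy => simp only [map_add, TensorProduct.add_tmul, hx, hy]
      | tmul h₁ h₂ => simp [actPow_cons]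

variable {N : Type w} [AddCommGroup N] [Module k N]

theorem insA_gam_toE (n : ℕ) (h : H) (z : A ⊗[k] HW k A H N n) :
    D.fact.insA n (D.gam h • D.fact.toE _ z) =
      LinearMap.lTensor A HW.hv (past D.act _ (h ⊗ₜ z)) := by
  induction z with
  | zero => simp
  | add x y hx hy => simp only [map_add, smul_add, TensorProduct.tmul_add, hx, hy]
  | tmul a v =>
    rw [Factorization.toE_tmul, TensorProduct.smul_tmul', smul_eq_mul]
    change D.fact.insA n ((D.gam h * D.incl a) ⊗ₜ v) = _
    rw [gam_mul_incl, insA_toE_tmul, past_tmul, LinearMap.lTensor_comp_apply]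

/-- The product `(1 # h)(1 # l) = f(h⁽¹⁾, l⁽¹⁾) # h⁽²⁾ l⁽²⁾` read as an operation on words: two
letters merge and the cocycle comes out. -/
theorem insA_gam_gam (n : ℕ) (h l : H) (v : HW k A H N n) :
    D.fact.insA n (D.gam h • (D.gam l ⊗ₜ v)) =
      LinearMap.lTensor A (HW.hv ∘ₗ (TensorProduct.mk k H (HW k A H N n)).flip v)
        (cocycleMul D.f (h ⊗ₜ l)) := by
  rw [TensorProduct.smul_tmul', smul_eq_mul, gam_mul_gam, insA_toE_tmul]

/-- The part of `LA` that multiplies two letters of `H`. -/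
def mW (m : N) (n : ℕ) : (s r : ℕ) → TPow k H s ⊗[k] TPow k A r →ₗ[k] A ⊗[k] HW k A H N n
  | 0, _ => 0
  | s + 1, r => LinearMap.lTensor A (wrd m n s r)
      ∘ₗ (TensorProduct.assoc k A (TPow k H s) (TPow k A r)).toLinearMap
      ∘ₗ LinearMap.rTensor (TPow k A r) (D.mergeSum s)

/-- The part of `LA` that moves a letter of `A` out of a word. -/
def aW (m : N) (n s : ℕ) : (r : ℕ) → TPow k H s ⊗[k] TPow k A r →ₗ[k] A ⊗[k] HW k A H N n
  | 0 => 0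
  | r + 1 => LinearMap.lTensor A (wrd m n s r) ∘ₗ actPast (D.actPow s) (TPow k A r)
      ∘ₗ LinearMap.lTensor (TPow k H s) cons.symm.toLinearMap

theorem assoc_tmul_eq {P X : Type u} [AddCommGroup P] [Module k P] [AddCommGroup X] [Module k X]
    (t : A ⊗[k] P) (x : X) : TensorProduct.assoc k A P X (t ⊗ₜ x) =
      LinearMap.lTensor A ((TensorProduct.mk k P X).flip x) t := by
  induction t with
  | zero => simp
  | add x y hx hy => simp only [map_add, TensorProduct.add_tmul, hx, hy]
  | tmul a h => simp

theorem mW_tmul (m : N) (n s r : ℕ) (p : TPow k H (s + 1)) (x : TPow k A r) :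
    D.mW m n (s + 1) r (p ⊗ₜ x) =
      LinearMap.lTensor A (wrd m n s r ∘ₗ (TensorProduct.mk k _ _).flip x) (D.mergeSum s p) := by
  rw [mW, LinearMap.comp_apply, LinearMap.comp_apply, LinearMap.rTensor_tmul,
    LinearEquiv.coe_coe, assoc_tmul_eq, ← LinearMap.lTensor_comp_apply]

theorem mW_one (m : N) (n r : ℕ) (z : TPow k H 1 ⊗[k] TPow k A r) : D.mW m n 1 r z = 0 := by
  simp [mW, mergeSum]

theorem wrd_zero_succ (m : N) (s r : ℕ) : wrd (k := k) (B := A) (C := H) m 0 (s + 1) r = 0 := rfl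

theorem mW_cons (m : N) (n s r : ℕ) (h l : H) (p : TPow k H s) (x : TPow k A r) :
    D.mW m (n + 1) (s + 2) r (cons (h ⊗ₜ cons (l ⊗ₜ p)) ⊗ₜ x) =
      -LinearMap.lTensor A (HW.hv ∘ₗ (TensorProduct.mk k H _).flip (wrd m n s r (p ⊗ₜ x)))
        (cocycleMul D.f (h ⊗ₜ l)) -
      LinearMap.lTensor A HW.hv
        (past D.act _ (h ⊗ₜ D.mW m n (s + 1) r (cons (l ⊗ₜ p) ⊗ₜ x))) := by
  rw [mW_tmul, mW_tmul, mergeSum_succ, map_sub, map_neg, mergeAt_zero, past_lTensor,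
    ← LinearMap.lTensor_comp_apply, ← LinearMap.lTensor_comp_apply,
    ← LinearMap.lTensor_comp_apply]
  congr 2
  congr 1
  exact TensorProduct.ext' fun h p => rfl

theorem aW_cons (m : N) (n s r : ℕ) (h : H) (p : TPow k H s) (x : TPow k A r) :
    D.aW m (n + 1) (s + 1) r (cons (h ⊗ₜ p) ⊗ₜ x) =
      LinearMap.lTensor A HW.hv (past D.act _ (h ⊗ₜ D.aW m n s r (p ⊗ₜ x))) := by
  cases r with
  | zero => simp [aW]
  | succ r =>
    simp only [aW, LinearMap.comp_apply, actPast_eq_past, LinearMap.lTensor_tmul]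
    rw [past_lTensor, past_actPow_succ, ← LinearMap.lTensor_comp_apply,
      ← LinearMap.lTensor_comp_apply]
    congr 2
    exact TensorProduct.ext' fun h p => by
      induction p with
      | zero => simp
      | add x y hx hy => simp only [map_add, TensorProduct.tmul_add, hx, hy]
      | tmul p x => rfl

/-- Unwinding the recursion, an element of `E` on its way to the front is either a letter of `A`
passing all letters of `H`, each passage with a sign, or the result of merging two adjacent letters
of `H`, whose cocycle passes the letters in front of it. -/
theorem LA_wrd (m : N) (n s r : ℕ) (z : TPow k H s ⊗[k] TPow k A r) :
    D.fact.LA n (wrd m (n + 1) s r z) = D.mW m n s r z + (-1 : k) ^ s • D.aW m n s r z := by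
  suffices e : D.fact.LA n ∘ₗ wrd m (n + 1) s r = D.mW m n s r + (-1 : k) ^ s • D.aW m n s r from
    LinearMap.congr_fun e z
  clear z
  induction s generalizing n with
  | zero =>
    refine nil_hom_ext fun x => ?_
    cases r with
    | zero => simp [mW, aW, wrd_nil, wA]
    | succ r =>
      suffices e : D.fact.LA n ∘ₗ HW.aw ∘ₗ wA m (n + 1) (r + 1) =
          D.aW m n 0 (r + 1) ∘ₗ TensorProduct.mk k _ _ (nil 1) by
        have := LinearMap.congr_fun e x
        simpa [mW, wrd_nil] using this
      refine TPow.hom_ext fun a x => ?_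
      simp only [aW, LinearMap.comp_apply, wA_cons, Factorization.LA_aw, actPast_eq_past,
        TensorProduct.mk_apply, LinearMap.lTensor_tmul, LinearEquiv.coe_coe,
        LinearEquiv.symm_apply_apply, past_actPow_zero, wrd_nil, one_smul]
  | succ s ih =>
    refine pow_hom_ext fun h p x => ?_
    cases n with
    | zero =>
      have h₁ : D.mW m 0 (s + 1) r = 0 := by
        cases s with
        | zero => exact LinearMap.ext fun z => D.mW_one m 0 r z
        | succ s => rw [mW, wrd_zero_succ, LinearMap.lTensor_zero, LinearMap.zero_comp]
      have h₂ : D.aW m 0 (s + 1) r = 0 := by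
        cases r with
        | zero => rfl
        | succ r => rw [aW, wrd_zero_succ, LinearMap.lTensor_zero, LinearMap.zero_comp]
      rw [h₁, h₂, LinearMap.comp_apply, wrd_cons, Factorization.LA_hv_zero, smul_zero, add_zero,
        LinearMap.zero_apply]
    | succ n =>
      have ih' := LinearMap.congr_fun (ih n) (p ⊗ₜ x)
      simp only [LinearMap.comp_apply, LinearMap.add_apply, LinearMap.smul_apply] at ih'
      rw [LinearMap.comp_apply, wrd_cons, Factorization.LA_hv, Factorization.L_apply, ih', smul_add,
        map_add, fact_gam, insA_gam_toE, LinearMap.add_apply, LinearMap.smul_apply, aW_cons]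
      simp only [TensorProduct.tmul_add, TensorProduct.tmul_smul, map_add, map_smul, pow_succ]
      cases s with
      -- If `h` is the last letter of `H`, there is nothing to merge with.
      | zero =>
        have e : HW.snd (wrd m (n + 1) 0 r (p ⊗ₜ x)) = 0 := by
          obtain ⟨a, rfl⟩ := nil.surjective p
          rw [wrd_nil, map_smul, HW.snd_aw, smul_zero]
        rw [e, mW_one, map_zero, smul_zero, map_zero, mW]
        simp
      | succ s =>
        suffices e : -LinearMap.lTensor A HW.hv (past D.act _ (h ⊗ₜ D.mW m n (s + 1) r (p ⊗ₜ x))) -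
            D.fact.insA n (D.gam h • LinearMap.rTensor _ D.gam
              (HW.snd (wrd m (n + 1) (s + 1) r (p ⊗ₜ x)))) =
            D.mW m (n + 1) (s + 2) r (cons (h ⊗ₜ p) ⊗ₜ x) by
          rw [← e]
          change _ = _ - D.fact.insA n (D.gam h • LinearMap.rTensor _ D.fact.gam _) + _
          module
        clear ih'
        obtain ⟨t, rfl⟩ := cons.surjective p
        induction t with
        | zero => simp
        | add x y hx hy =>
          simp only [map_add, TensorProduct.add_tmul, TensorProduct.tmul_add, smul_add]
            at hx hy ⊢
          rw [← hx, ← hy]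
          abel
        | tmul l p =>
          rw [mW_cons, wrd_cons, HW.snd_hv, LinearMap.rTensor_tmul, insA_gam_gam]
          abel

theorem I_wrd_zero (m : N) (n s : ℕ) (z : TPow k H s ⊗[k] TPow k A 0) :
    Factorization.I n (wrd m (n + 1) s 0 z) = 0 := by
  suffices e : Factorization.I n ∘ₗ wrd m (n + 1) s 0 =
    (0 : TPow k H s ⊗[k] TPow k A 0 →ₗ[k] HW k A H N n) from LinearMap.congr_fun e z
  clear z
  induction s generalizing n with
  | zero => exact nil_hom_ext fun x => by simp [wrd_nil, wA]
  | succ s ih =>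
    refine pow_hom_ext fun h p x => ?_
    cases n with
    | zero => rfl
    | succ n =>
      have ih' := LinearMap.congr_fun (ih n) (p ⊗ₜ x)
      simp only [LinearMap.comp_apply, LinearMap.zero_apply] at ih'
      simp [wrd_cons, ih']

theorem I_wrd_succ (m : N) (n s r : ℕ) (z : TPow k H s ⊗[k] TPow k A (r + 1)) :
    Factorization.I n (wrd m (n + 1) s (r + 1) z) =
      (-1 : k) ^ s • wrd m n s r (LinearMap.lTensor _ (innerSum r) z) := by
  suffices e : Factorization.I n ∘ₗ wrd m (n + 1) s (r + 1) =
    (-1 : k) ^ s • (wrd m n s r ∘ₗ LinearMap.lTensor _ (innerSum (B := A) r)) from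
      LinearMap.congr_fun e z
  clear z
  induction s generalizing n with
  | zero => exact nil_hom_ext fun x => by simp [wrd_nil, inner_wA]
  | succ s ih =>
    refine pow_hom_ext fun h p x => ?_
    cases n with
    | zero => simp [wrd_zero_succ]
    | succ n =>
      have ih' := LinearMap.congr_fun (ih n) (p ⊗ₜ x)
      simp only [LinearMap.comp_apply, LinearMap.smul_apply, LinearMap.lTensor_tmul] at ih'
      simp [wrd_cons, ih', pow_succ]

end CrossedSystem

/-! ### Compatibility of the maps `F` with the products `𝔥⁽²⁾` -/

section Coassoc

variable {k : Type u} [CommRing k] {C : Type u} [AddCommGroup C] [Module k C] [Coalgebra k C]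

theorem coassoc_map {Q : Type*} [AddCommGroup Q] [Module k Q]
    (Φ : C ⊗[k] (C ⊗[k] C) →ₗ[k] Q) (c : C) :
    Φ (LinearMap.lTensor C Coalgebra.comul (Coalgebra.comul c)) =
      Φ (TensorProduct.assoc k C C C (LinearMap.rTensor C Coalgebra.comul (Coalgebra.comul c))) := by
  rw [Coalgebra.coassoc_apply]

end Coassoc

namespace CrossedSystem

variable {k A H : Type u} [CommRing k] [Ring A] [Algebra k A] [Ring H] [HopfAlgebra k H]

section PastR

variable {Q Q' : Type u} [AddCommGroup Q] [Module k Q] [AddCommGroup Q'] [Module k Q']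

/-- `h ⊗ (g ⊗ q) ↦ h⁽²⁾ g ⊗ (h⁽¹⁾ ⊗ q)`. -/
def pastR (k H : Type u) [CommRing k] [Ring H] [HopfAlgebra k H] (Q : Type u) [AddCommGroup Q]
    [Module k Q] : H ⊗[k] (H ⊗[k] Q) →ₗ[k] H ⊗[k] (H ⊗[k] Q) :=
  LinearMap.rTensor (H ⊗[k] Q) (LinearMap.mul' k H)
    ∘ₗ (TensorProduct.tensorTensorTensorComm k H H H Q).toLinearMap
    ∘ₗ LinearMap.rTensor (H ⊗[k] Q) ((TensorProduct.comm k H H).toLinearMap ∘ₗ Coalgebra.comul)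

theorem pastR_tmul (h g : H) (q : Q) :
    pastR k H Q (h ⊗ₜ (g ⊗ₜ q)) = (LinearMap.lTensor H ((TensorProduct.mk k H Q).flip q) ∘ₗ
      LinearMap.rTensor H (LinearMap.mulRight k g) ∘ₗ (TensorProduct.comm k H H).toLinearMap)
        (Coalgebra.comul h) := by
  rw [pastR, LinearMap.comp_apply, LinearMap.comp_apply, LinearMap.rTensor_tmul,
    LinearMap.comp_apply]
  generalize Coalgebra.comul (R := k) h = t
  induction t with
  | zero => simp
  | add p q hp hq => simp only [map_add, TensorProduct.add_tmul, hp, hq]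
  | tmul p q => simp

theorem pastR_lTensor (f : Q →ₗ[k] Q') (h : H) (y : H ⊗[k] Q) :
    pastR k H Q' (h ⊗ₜ LinearMap.lTensor H f y) =
      LinearMap.lTensor H (LinearMap.lTensor H f) (pastR k H Q (h ⊗ₜ y)) := by
  induction y with
  | zero => simp
  | add x y hx hy => simp only [map_add, TensorProduct.tmul_add, hx, hy]
  | tmul g q =>
    rw [LinearMap.lTensor_tmul, pastR_tmul, pastR_tmul]
    generalize Coalgebra.comul (R := k) h = t
    induction t with
    | zero => simp
    | add p q hp hq => simp only [map_add, hp, hq]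
    | tmul p q => simp

variable (D : CrossedSystem k A H)

/-- Coassociativity: on both sides `h⁽¹⁾` acts on `a`, `h⁽²⁾` stays a letter and `h⁽³⁾` is
multiplied to `g`. -/
theorem past_pastR (h : H) (y : H ⊗[k] (A ⊗[k] Q)) :
    LinearMap.lTensor A (pastR k H Q) (past D.act _ (h ⊗ₜ TensorProduct.leftComm k H A Q y)) =
      TensorProduct.leftComm k H A (H ⊗[k] Q)
        (LinearMap.lTensor H (past D.act Q) (pastR k H (A ⊗[k] Q) (h ⊗ₜ y))) := by
  induction y with
  | zero => simp
  | add x y hx hy => simp only [map_add, TensorProduct.tmul_add, hx, hy]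
  | tmul g z =>
    induction z with
    | zero => simp
    | add x y hx hy => simp only [map_add, TensorProduct.tmul_add, hx, hy]
    | tmul a q =>
      have key := coassoc_map (TensorProduct.map (D.act.flip a)
        (LinearMap.lTensor H ((TensorProduct.mk k H Q).flip q) ∘ₗ
          LinearMap.rTensor H (LinearMap.mulRight k g) ∘ₗ
            (TensorProduct.comm k H H).toLinearMap)) h
      rw [TensorProduct.leftComm_tmul, past_tmul, pastR_tmul]
      refine Eq.trans ?_ (key.trans ?_)
      · generalize Coalgebra.comul (R := k) h = t
        induction t with
        | zero => simp
        | add p q hp hq => simp only [map_add, hp, hq]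
        | tmul p q =>
          simp only [LinearMap.rTensor_tmul, LinearMap.lTensor_tmul, TensorProduct.map_tmul,
            LinearMap.flip_apply, TensorProduct.mk_apply, pastR_tmul]
      · generalize Coalgebra.comul (R := k) h = t
        induction t with
        | zero => simp
        | add p q hp hq => simp only [map_add, hp, hq]
        | tmul p q' =>
          rw [LinearMap.rTensor_tmul]
          simp only [LinearMap.comp_apply, LinearEquiv.coe_coe, TensorProduct.comm_tmul,
            LinearMap.rTensor_tmul, LinearMap.lTensor_tmul, LinearMap.flip_apply,
            TensorProduct.mk_apply, past_tmul]
          generalize Coalgebra.comul (R := k) p = t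
          induction t with
          | zero => simp
          | add p q hp hq => simp only [map_add, TensorProduct.add_tmul, TensorProduct.tmul_add,
              hp, hq]
          | tmul x y => simp

end PastR

/-- `𝐡 ↦ 𝔥⁽²⁾ ⊗ 𝐡⁽¹⁾`. -/
def coP (k H : Type u) [CommRing k] [Ring H] [HopfAlgebra k H] (s : ℕ) :
    TPow k H s →ₗ[k] H ⊗[k] TPow k H s :=
  LinearMap.rTensor (TPow k H s) (prodPow s)
    ∘ₗ (TensorProduct.comm k (TPow k H s) (TPow k H s)).toLinearMap ∘ₗ Coalgebra.comul

theorem coP_cons (s : ℕ) (h : H) (p : TPow k H s) :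
    coP k H (s + 1) (cons (h ⊗ₜ p)) =
      LinearMap.lTensor H cons.toLinearMap (pastR k H _ (h ⊗ₜ coP k H s p)) := by
  simp only [coP, LinearMap.comp_apply, comul_cons]
  generalize Coalgebra.comul (R := k) p = t
  induction t with
  | zero => simp
  | add p q hp hq => simp only [map_add, TensorProduct.tmul_add, hp, hq]
  | tmul p₁ p₂ =>
    rw [LinearEquiv.coe_coe, LinearEquiv.coe_coe, TensorProduct.comm_tmul, LinearMap.rTensor_tmul,
      pastR_tmul]
    generalize Coalgebra.comul (R := k) h = t'
    induction t' with
    | zero => simp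
    | add p q hp hq => simp only [map_add, TensorProduct.add_tmul, hp, hq]
    | tmul h₁ h₂ => simp [prodPow]

variable (D : CrossedSystem k A H)

/-- Coassociativity in `H ⊗ H`, where the cocycle uses the first part, combined with
multiplicativity of the comultiplication on the merged letter. -/
theorem coP_mergeAt_zero (s : ℕ) (h l : H) (p : TPow k H s) :
    LinearMap.lTensor A (coP k H (s + 1)) (D.mergeAt 0 s (cons (h ⊗ₜ cons (l ⊗ₜ p)))) =
      TensorProduct.leftComm k H A (TPow k H (s + 1)) (LinearMap.lTensor H (D.mergeAt 0 s)
        (coP k H (s + 2) (cons (h ⊗ₜ cons (l ⊗ₜ p))))) := by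
  rw [mergeAt_zero, coP_cons, coP_cons, ← LinearMap.lTensor_comp_apply]
  have e : coP k H (s + 1) ∘ₗ cons.toLinearMap ∘ₗ (TensorProduct.mk k H (TPow k H s)).flip p =
      LinearMap.lTensor H cons.toLinearMap ∘ₗ pastR k H (TPow k H s) ∘ₗ
        (TensorProduct.mk k H _).flip (coP k H s p) := by
    ext h
    exact coP_cons s h p
  rw [e]
  generalize coP k H s p = y
  induction y with
  | zero => simp
  | add x y hx hy =>
    have : (TensorProduct.mk k H (H ⊗[k] TPow k H s)).flip (x + y) =
        (TensorProduct.mk k H _).flip x + (TensorProduct.mk k H _).flip y := map_add _ _ _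
    simp only [map_add, TensorProduct.tmul_add, this, LinearMap.comp_add, LinearMap.lTensor_add,
      LinearMap.add_apply, hx, hy]
  | tmul g q =>
    have key := coassoc_map (C := H ⊗[k] H) (TensorProduct.map D.f
      (LinearMap.lTensor H (cons.toLinearMap ∘ₗ (TensorProduct.mk k H (TPow k H s)).flip q) ∘ₗ
          LinearMap.rTensor H (LinearMap.mulRight k g) ∘ₗ
            (TensorProduct.comm k H H).toLinearMap ∘ₗ
            TensorProduct.map (LinearMap.mul' k H) (LinearMap.mul' k H))) (h ⊗ₜ l)
    refine Eq.trans ?_ (key.trans ?_)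
    · rw [cocycleMul, LinearMap.comp_apply]
      generalize Coalgebra.comul (R := k) (h ⊗ₜ[k] l) = t
      induction t with
      | zero => simp
      | add p q hp hq => simp only [map_add, hp, hq]
      | tmul x y =>
        rw [TensorProduct.map_tmul, LinearMap.lTensor_tmul, LinearMap.lTensor_tmul,
          TensorProduct.map_tmul]
        congr 1
        have hm : Coalgebra.comul (R := k) (LinearMap.mul' k H y) =
            TensorProduct.map (LinearMap.mul' k H) (LinearMap.mul' k H) (Coalgebra.comul y) := by
          induction y with
          | zero => simp
          | add x y hx hy => simp only [map_add, hx, hy]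
          | tmul a b =>
            rw [LinearMap.mul'_apply, Bialgebra.comul_mul, TensorProduct.comul_tmul]
            generalize Coalgebra.comul (R := k) a = t
            generalize Coalgebra.comul (R := k) b = t'
            induction t with
            | zero => simp
            | add p q hp hq => simp only [map_add, TensorProduct.add_tmul, add_mul, hp, hq]
            | tmul x y =>
              induction t' with
              | zero => simp
              | add p q hp hq => simp only [map_add, TensorProduct.tmul_add, mul_add, hp, hq]
              | tmul x y => simp
        simp only [LinearMap.comp_apply, LinearMap.flip_apply, TensorProduct.mk_apply, pastR_tmul,
          hm]
        rw [← LinearMap.lTensor_comp_apply]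
    · rw [TensorProduct.comul_tmul, pastR_tmul]
      generalize Coalgebra.comul (R := k) l = t'
      induction t' with
      | zero => simp
      | add p q hp hq => simp only [map_add, TensorProduct.tmul_add, hp, hq]
      | tmul l₁ l₂ =>
        simp only [LinearMap.comp_apply, LinearEquiv.coe_coe, TensorProduct.comm_tmul,
          LinearMap.rTensor_tmul, LinearMap.lTensor_tmul, LinearMap.flip_apply,
          TensorProduct.mk_apply, pastR_tmul]
        generalize Coalgebra.comul (R := k) h = t
        induction t with
        | zero => simp
        | add p q hp hq => simp only [map_add, TensorProduct.add_tmul, hp, hq]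
        | tmul h₁ h₂ =>
          simp only [TensorProduct.AlgebraTensorModule.tensorTensorTensorComm_tmul,
            TensorProduct.comm_tmul, LinearMap.rTensor_tmul, LinearMap.lTensor_tmul,
            LinearMap.flip_apply, TensorProduct.mk_apply, LinearEquiv.coe_coe, mergeAt_zero,
            LinearMap.mulRight_apply, cocycleMul, LinearMap.comp_apply]
          generalize Coalgebra.comul (R := k) (h₁ ⊗ₜ[k] l₁) = t
          induction t with
          | zero => simp
          | add p q hp hq =>
            simp only [map_add, TensorProduct.add_tmul, TensorProduct.tmul_add, hp, hq]
          | tmul x y => simp [_root_.mul_assoc]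

/-- Merging adjacent letters does not change the product of all letters, so the factor `𝔥⁽²⁾` can be
split off before or after merging. -/
theorem coP_mergeAt (j s : ℕ) (t : TPow k H (s + 2)) :
    LinearMap.lTensor A (coP k H (s + 1)) (D.mergeAt j s t) =
      TensorProduct.leftComm k H A (TPow k H (s + 1)) (LinearMap.lTensor H (D.mergeAt j s)
        (coP k H (s + 2) t)) := by
  suffices e : LinearMap.lTensor A (coP k H (s + 1)) ∘ₗ D.mergeAt j s =
      (TensorProduct.leftComm k H A (TPow k H (s + 1))).toLinearMap ∘ₗ
        LinearMap.lTensor H (D.mergeAt j s) ∘ₗ coP k H (s + 2) from LinearMap.congr_fun e t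
  clear t
  induction j generalizing s with
  | zero =>
    refine TPow.hom_ext fun h p => ?_
    obtain ⟨t, rfl⟩ := cons.surjective p
    induction t with
    | zero => simp
    | add x y hx hy => rw [map_add, TensorProduct.tmul_add, map_add, map_add, map_add, hx, hy]
    | tmul l p => exact D.coP_mergeAt_zero s h l p
  | succ j ih =>
    cases s with
    | zero => simp [mergeAt]
    | succ s =>
      refine TPow.hom_ext fun h p => ?_
      have e₁ : coP k H (s + 2) ∘ₗ cons.toLinearMap = LinearMap.lTensor H cons.toLinearMap ∘ₗ
          pastR k H _ ∘ₗ LinearMap.lTensor H (coP k H (s + 1)) :=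
        TensorProduct.ext' fun h p => coP_cons (s + 1) h p
      have e₂ : D.mergeAt (j + 1) (s + 1) ∘ₗ cons.toLinearMap =
          LinearMap.lTensor A cons.toLinearMap ∘ₗ past D.act _ ∘ₗ
            LinearMap.lTensor H (D.mergeAt j s) :=
        TensorProduct.ext' fun h p => D.mergeAt_succ j s h p
      have ih' := LinearMap.congr_fun (ih s) p
      simp only [LinearMap.comp_apply, LinearEquiv.coe_coe] at ih'
      rw [LinearMap.comp_apply, LinearMap.comp_apply, LinearMap.comp_apply, mergeAt_succ, coP_cons,
        ← LinearMap.lTensor_comp_apply, e₁, ← LinearMap.lTensor_comp_apply, e₂,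
        LinearMap.lTensor_comp_apply, LinearMap.lTensor_comp_apply, LinearMap.lTensor_comp_apply,
        LinearMap.lTensor_comp_apply, ← pastR_lTensor, actPast_eq_past, ← past_lTensor, ih',
        past_pastR]
      generalize LinearMap.lTensor H (past D.act (TPow k H (s + 1))) _ = y
      induction y with
      | zero => simp
      | add x y hx hy => simp only [map_add, hx, hy]
      | tmul g y =>
        induction y with
        | zero => simp
        | add x y hx hy => simp only [map_add, TensorProduct.tmul_add, hx, hy]
        | tmul a y => simp

theorem coP_mergeSum (s : ℕ) (t : TPow k H (s + 1)) :
    LinearMap.lTensor A (coP k H s) (D.mergeSum s t) =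
      TensorProduct.leftComm k H A (TPow k H s) (LinearMap.lTensor H (D.mergeSum s)
        (coP k H (s + 1) t)) := by
  cases s with
  | zero => simp [mergeSum]
  | succ s =>
    have e : LinearMap.lTensor H (D.mergeSum (s + 1)) = ∑ i ∈ Finset.range (s + 1),
        (-1 : k) ^ (i + 1) • LinearMap.lTensor H (D.mergeAt i s) := by
      simp only [← LinearMap.lTensor_smul]
      exact map_sum (LinearMap.lTensorHom H) _ _
    rw [e, mergeSum, LinearMap.sum_apply, LinearMap.sum_apply, map_sum, map_sum]
    refine Finset.sum_congr rfl fun i _ => ?_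
    rw [LinearMap.smul_apply, LinearMap.smul_apply, map_smul, map_smul, coP_mergeAt]

/-- `𝐡 ⊗ x ↦ 𝔥⁽²⁾ ⊗ G(𝐡⁽¹⁾ ⊗ x)`. -/
def withProd {s : ℕ} {X Y : Type u} [AddCommGroup X] [Module k X] [AddCommGroup Y] [Module k Y]
    (G : TPow k H s ⊗[k] X →ₗ[k] Y) : TPow k H s ⊗[k] X →ₗ[k] H ⊗[k] Y :=
  TensorProduct.map (prodPow s) G
    ∘ₗ (TensorProduct.assoc k (TPow k H s) (TPow k H s) X).toLinearMap
    ∘ₗ LinearMap.rTensor X ((TensorProduct.comm k (TPow k H s) (TPow k H s)).toLinearMap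
        ∘ₗ Coalgebra.comul)

theorem prodF_eq (n l r : ℕ) : D.prodF n l r = withProd (D.F n l r) := rfl

section WithProd

variable {s : ℕ} {X Y : Type u} [AddCommGroup X] [Module k X] [AddCommGroup Y] [Module k Y]

theorem withProd_tmul (G : TPow k H s ⊗[k] X →ₗ[k] Y) (t : TPow k H s) (x : X) :
    withProd G (t ⊗ₜ x) =
      LinearMap.lTensor H (G ∘ₗ (TensorProduct.mk k _ X).flip x) (coP k H s t) := by
  simp only [withProd, coP, LinearMap.comp_apply, LinearMap.rTensor_tmul]
  generalize Coalgebra.comul (R := k) t = z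
  induction z with
  | zero => simp
  | add x y hx hy => simp only [map_add, TensorProduct.add_tmul, hx, hy]
  | tmul x y => simp

theorem withProd_add (G G' : TPow k H s ⊗[k] X →ₗ[k] Y) (z : TPow k H s ⊗[k] X) :
    withProd (G + G') z = withProd G z + withProd G' z := by
  rw [withProd, TensorProduct.map_add_right, LinearMap.add_comp]
  rfl

theorem withProd_smul (a : k) (G : TPow k H s ⊗[k] X →ₗ[k] Y) (z : TPow k H s ⊗[k] X) :
    withProd (a • G) z = a • withProd G z := by
  rw [withProd, TensorProduct.map_smul_right, LinearMap.smul_comp]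
  rfl

theorem withProd_FMerge {l r n : ℕ} (G : TPow k H (l + 1) ⊗[k] TPow k A r →ₗ[k] TPow k A n)
    (t : TPow k H (l + 2)) (x : TPow k A r) :
    withProd (D.FMerge G) (t ⊗ₜ x) = LinearMap.lTensor H cons.toLinearMap
      (TensorProduct.leftComm k A H (TPow k A n)
        (LinearMap.lTensor A (withProd G ∘ₗ (TensorProduct.mk k _ _).flip x)
          (D.mergeSum (l + 1) t))) := by
  have e : withProd G ∘ₗ (TensorProduct.mk k _ _).flip x =
      LinearMap.lTensor H (G ∘ₗ (TensorProduct.mk k _ _).flip x) ∘ₗ coP k H (l + 1) := by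
    ext t
    exact withProd_tmul G t x
  rw [withProd_tmul, e, LinearMap.lTensor_comp_apply A, coP_mergeSum]
  generalize coP k H _ t = y
  induction y with
  | zero => simp
  | add x y hx hy => simp only [map_add, hx, hy]
  | tmul g t =>
    simp only [LinearMap.lTensor_tmul, LinearMap.comp_apply, FMerge, LinearMap.flip_apply,
      TensorProduct.mk_apply, LinearMap.rTensor_tmul]
    generalize D.mergeSum _ t = y
    induction y with
    | zero => simp
    | add x y hx hy => simp only [map_add, TensorProduct.add_tmul, TensorProduct.tmul_add, hx, hy]
    | tmul a t => simp

/-- Again coassociativity, now in `H^{⊗ s}`: the part acting on `a` comes first and the part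
entering the product comes last. -/
theorem withProd_FAct {r n : ℕ} (G : TPow k H s ⊗[k] TPow k A r →ₗ[k] TPow k A n)
    (t : TPow k H s) (a : A) (x : TPow k A r) :
    withProd (D.FAct G) (t ⊗ₜ cons (a ⊗ₜ x)) = LinearMap.lTensor H cons.toLinearMap
      (TensorProduct.leftComm k A H (TPow k A n)
        (LinearMap.lTensor A (withProd G) (past (D.actPow s) _ (t ⊗ₜ (a ⊗ₜ x))))) := by
  have key := coassoc_map ((TensorProduct.leftComm k A H (TPow k A n)).toLinearMap ∘ₗ
    TensorProduct.map ((D.actPow s).flip a) (LinearMap.lTensor H (G ∘ₗ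
      (TensorProduct.mk k _ _).flip x) ∘ₗ LinearMap.rTensor _ (prodPow s) ∘ₗ
      (TensorProduct.comm k (TPow k H s) (TPow k H s)).toLinearMap)) t
  rw [withProd_tmul, past_tmul]
  refine Eq.trans ?_ (congrArg (LinearMap.lTensor H cons.toLinearMap) (key.symm.trans ?_))
  · rw [coP, LinearMap.comp_apply, LinearMap.comp_apply]
    generalize Coalgebra.comul (R := k) t = y
    induction y with
    | zero => simp
    | add x y hx hy => simp only [map_add, hx, hy]
    | tmul t₁ t₂ =>
      simp only [LinearEquiv.coe_coe, TensorProduct.comm_tmul, LinearMap.rTensor_tmul,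
        LinearMap.lTensor_tmul, LinearMap.comp_apply, LinearMap.flip_apply,
        TensorProduct.mk_apply, FAct, LinearEquiv.symm_apply_apply, actPast_eq_past, past_tmul]
      generalize Coalgebra.comul (R := k) t₁ = y
      induction y with
      | zero => simp
      | add x y hx hy => simp only [map_add, TensorProduct.add_tmul, TensorProduct.tmul_add, hx, hy]
      | tmul t₁ t₂ => simp
  · generalize Coalgebra.comul (R := k) t = y
    induction y with
    | zero => simp
    | add x y hx hy => simp only [map_add, hx, hy]
    | tmul t₁ t₂ =>
      simp only [LinearMap.rTensor_tmul, LinearMap.lTensor_tmul, LinearMap.flip_apply,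
        TensorProduct.mk_apply, withProd_tmul, LinearMap.comp_apply, TensorProduct.map_tmul, coP]
      rfl

end WithProd

end CrossedSystem

section Words

variable {k : Type u} [CommRing k] {B C : Type u} [AddCommGroup B] [Module k B]
variable [AddCommGroup C] [Module k C]
variable {N : Type w} [AddCommGroup N] [Module k N] {N' : Type w'} [AddCommGroup N'] [Module k N']

theorem Wd.tm_wA (g : N →ₗ[k] N') (m : N) (n r : ℕ) (x : TPow k B r) :
    Wd.map LinearMap.id g n (wA m n r x) = wA (g m) n r x := by
  suffices h : Wd.map LinearMap.id g n ∘ₗ wA m n r = wA (g m) n r from LinearMap.congr_fun h x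
  clear x
  induction n generalizing r with
  | zero =>
    cases r with
    | zero => exact TPow.hom_ext_nil (by simp [wA_zero])
    | succ r => exact LinearMap.comp_zero _
  | succ n ih =>
    cases r with
    | zero => exact LinearMap.comp_zero _
    | succ r =>
      refine TPow.hom_ext fun b p => ?_
      have := LinearMap.congr_fun (ih r) p
      rw [LinearMap.comp_apply] at this
      simp [wA_cons, this]

theorem tm_wrd (g : N →ₗ[k] N') (m : N) (n s r : ℕ) (z : TPow k C s ⊗[k] TPow k B r) :
    tm g n (wrd m n s r z) = wrd (g m) n s r z := by
  suffices h : tm g n ∘ₗ wrd m n s r = wrd (g m) n s r from LinearMap.congr_fun h z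
  clear z
  induction s generalizing n with
  | zero => exact nil_hom_ext fun x => by simp [wrd_nil, Wd.tm_wA, tm]
  | succ s ih =>
    cases n with
    | zero => exact LinearMap.comp_zero _
    | succ n =>
      refine pow_hom_ext fun d p x => ?_
      have := LinearMap.congr_fun (ih n) (p ⊗ₜ x)
      rw [LinearMap.comp_apply, tm] at this
      simp [wrd_cons, this, tm]

theorem neg_one_pow_eq {R : Type*} [CommRing R] {a b : ℕ} (h : Even (a + b)) :
    (-1 : R) ^ a = (-1) ^ b := by
  rcases Nat.even_or_odd a with ha | ha
  · rw [ha.neg_one_pow, ((Nat.even_add.1 h).1 ha).neg_one_pow]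
  · have hb : Odd b := by
      rw [← Nat.not_even_iff_odd] at ha ⊢
      exact fun hb => ha ((Nat.even_add.1 h).2 hb)
    rw [ha.neg_one_pow, hb.neg_one_pow]

end Words

section Bimodule

variable {k : Type u} [CommRing k] {R : Type u} [Ring R] [Algebra k R]
variable (M : Type v) [AddCommGroup M] [Module k M] [Module R M] [Module Rᵐᵒᵖ M]
variable [IsScalarTower k R M] [IsScalarTower k Rᵐᵒᵖ M]

variable (k R) in
/-- The actions of `R` on an `R`-bimodule. -/
def BiAct.of [SMulCommClass R Rᵐᵒᵖ M] : BiAct k R M where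
  l := Algebra.lsmul k k M
  r := Algebra.lsmul k k M
  comm e e' x := smul_comm e e' x

end Bimodule

section OneSided

variable {k : Type u} [CommRing k] {R : Type u} [Ring R] [Algebra k R]
variable {M : Type v} [AddCommGroup M] [Module k M]
variable {V Q : Type u} [AddCommGroup V] [Module k V] [AddCommGroup Q] [Module k Q]

theorem onRight_tmul [Module Rᵐᵒᵖ M] [IsScalarTower k Rᵐᵒᵖ M] (g : V →ₗ[k] R) (m : M) (v : V)
    (q : Q) : onRight M g Q (m ⊗ₜ (v ⊗ₜ q)) = (MulOpposite.op (g v) • m) ⊗ₜ q := rfl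

theorem onLeft_tmul [Module R M] [IsScalarTower k R M] (g : V →ₗ[k] R) (m : M) (v : V) (q : Q) :
    onLeft M g Q (m ⊗ₜ (v ⊗ₜ q)) = (g v • m) ⊗ₜ q := rfl

end OneSided

/-! ### The maps `F` arise from the operator `rho0` -/

namespace CrossedSystem

variable {k A H : Type u} [CommRing k] [Ring A] [Algebra k A] [Ring H] [HopfAlgebra k H]
variable (D : CrossedSystem k A H)
variable {M : Type v} [AddCommGroup M] [Module k M] [Module D.E M]
variable [IsScalarTower k D.E M]

/-- `h ⊗ 𝐚 ↦ a₁ ⊗ ⋯ ⊗ a_n ⊗ (1 # h) m`. -/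
def gamWord (m : M) (n : ℕ) : H ⊗[k] TPow k A n →ₗ[k] Wd k A M n :=
  JA A M n n ∘ₗ onLeft M D.gam (TPow k A n) ∘ₗ TensorProduct.mk k M _ m

theorem gamWord_tmul (m : M) (n : ℕ) (h : H) (x : TPow k A n) :
    D.gamWord m n (h ⊗ₜ x) = wA (D.gam h • m) n n x := rfl

theorem gamWord_cons (m : M) (n : ℕ) (y : A ⊗[k] (H ⊗[k] TPow k A n)) :
    D.gamWord m (n + 1) (LinearMap.lTensor H cons.toLinearMap (TensorProduct.leftComm k A H _ y)) =
      Wd.cons (LinearMap.lTensor A (D.gamWord m n) y) := by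
  induction y with
  | zero => simp
  | add x y hx hy => simp only [map_add, hx, hy]
  | tmul a y =>
    induction y with
    | zero => simp
    | add x y hx hy => simp only [map_add, TensorProduct.tmul_add, hx, hy]
    | tmul h x => rfl

theorem counit_cons_nil (h : H) :
    Coalgebra.counit (R := k) (cons (h ⊗ₜ[k] nil (V := H) 1)) = Coalgebra.counit (R := k) h := by
  change Coalgebra.counit (R := k) (h ⊗ₜ[k] (1 : k)) = _
  simp

/-- Here `F` is the counit, and `ε(h⁽¹⁾) h⁽²⁾ = h`. -/
theorem prodF_zero (h : H) (x : TPow k A 0) :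
    D.prodF 0 0 0 (cons (h ⊗ₜ nil 1) ⊗ₜ x) = h ⊗ₜ x := by
  have e : coP k H 0 (nil 1) = 1 ⊗ₜ nil 1 := by
    rw [coP, LinearMap.comp_apply, LinearMap.comp_apply, comul_nil]
    simp [prodPow]
  rw [prodF_eq, withProd_tmul, coP_cons, e, pastR_tmul]
  have key := Coalgebra.rTensor_counit_comul (R := k) h
  have : h ⊗ₜ[k] x = (TensorProduct.mk k H (TPow k A 0)).flip x
      (TensorProduct.lid k H (LinearMap.rTensor H Coalgebra.counit (Coalgebra.comul h))) := by
    rw [key]; simp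
  rw [this]
  generalize Coalgebra.comul (R := k) h = t
  induction t with
  | zero => simp
  | add p q hp hq => simp only [map_add, hp, hq]
  | tmul p q =>
    have h₁ : D.F 0 0 0 (cons (p ⊗ₜ nil 1) ⊗ₜ x) = Coalgebra.counit (R := k) p • x := by
      rw [← counit_cons_nil]
      rfl
    simp [h₁]

/-- The left action of `E` on a module. -/
abbrev lam (M : Type v) [AddCommGroup M] [Module k M] [Module D.E M] [IsScalarTower k D.E M] :
    D.E →ₐ[k] Module.End k M := Algebra.lsmul k k M

theorem rho0_wrd_zero (m : M) (l r : ℕ) (z : TPow k H (l + 1) ⊗[k] TPow k A r) :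
    D.fact.rho0 (D.lam M) 0 (wrd m 1 (l + 1) r z) =
      (-1 : k) ^ r • D.gamWord m 0 (D.prodF 0 l r z) := by
  suffices e : D.fact.rho0 (D.lam M) 0 ∘ₗ wrd m 1 (l + 1) r =
      (-1 : k) ^ r • (D.gamWord m 0 ∘ₗ D.prodF 0 l r) from LinearMap.congr_fun e z
  -- Only `l = r = 0` has the right length; in all other cases both sides vanish by the default
  -- values of `wrd` and `F`.
  cases l with
  | zero =>
    cases r with
    | zero =>
      refine pow_hom_ext fun h p x => ?_
      obtain ⟨a, rfl⟩ := (nil (k := k) (V := H)).surjective p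
      obtain ⟨b, rfl⟩ := (nil (k := k) (V := A)).surjective x
      have e : nil (k := k) (V := H) a = a • nil 1 := by
        rw [← map_smul, smul_eq_mul, _root_.mul_one]
      rw [e]
      simp only [TensorProduct.tmul_smul, map_smul, ← TensorProduct.smul_tmul']
      congr 1
      simp only [LinearMap.comp_apply, prodF_zero, gamWord_tmul, wA_zero,
        wrd_cons, wrd_nil, one_smul, pow_zero, Factorization.rho0_zero, Factorization.L_hv_zero]
      rw [actNil_tmul, smul_comm]
      rfl
    | succ r =>
      refine pow_hom_ext fun h p x => ?_
      obtain ⟨a, rfl⟩ := (nil (k := k) (V := H)).surjective p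
      simp [wrd_cons, wrd_nil, wA, prodF, F]
  | succ l =>
    refine pow_hom_ext fun h p x => ?_
    simp [wrd_cons, wrd_zero_succ, prodF, F]

theorem lTensor_rho0_mW {m : M} {n l r : ℕ}
    (ih : ∀ z, D.fact.rho0 (D.lam M) n (wrd m (n + 1) (l + 1) r z) =
      (-1 : k) ^ r • D.gamWord m n (D.prodF n l r z)) (z : TPow k H (l + 2) ⊗[k] TPow k A r) :
    Wd.cons (LinearMap.lTensor A (D.fact.rho0 (D.lam M) n) (D.mW m (n + 1) (l + 2) r z)) =
      (-1 : k) ^ r • D.gamWord m (n + 1) (withProd (D.FMerge (D.F n l r)) z) := by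
  induction z with
  | zero => simp
  | add x y hx hy => simp only [map_add, smul_add, hx, hy]
  | tmul t x =>
    rw [mW_tmul, withProd_FMerge, gamWord_cons, ← LinearMap.lTensor_comp_apply,
      ← LinearMap.lTensor_comp_apply, ← map_smul]
    congr 1
    generalize D.mergeSum _ t = y
    induction y with
    | zero => simp
    | add x y hx hy => simp only [map_add, smul_add, hx, hy]
    | tmul a t =>
      simp only [LinearMap.lTensor_tmul, LinearMap.comp_apply, LinearMap.flip_apply,
        TensorProduct.mk_apply, ih, prodF_eq, TensorProduct.tmul_smul]

theorem lTensor_rho0_aW {m : M} {n l r : ℕ}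
    (ih : ∀ z, D.fact.rho0 (D.lam M) n (wrd m (n + 1) (l + 1) r z) =
      (-1 : k) ^ r • D.gamWord m n (D.prodF n l r z))
    (z : TPow k H (l + 1) ⊗[k] TPow k A (r + 1)) :
    Wd.cons (LinearMap.lTensor A (D.fact.rho0 (D.lam M) n) (D.aW m (n + 1) (l + 1) (r + 1) z)) =
      (-1 : k) ^ r • D.gamWord m (n + 1) (withProd (D.FAct (D.F n l r)) z) := by
  induction z with
  | zero => simp
  | add x y hx hy => simp only [map_add, smul_add, hx, hy]
  | tmul t x =>
    obtain ⟨x, rfl⟩ := cons.surjective x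
    induction x with
    | zero => simp
    | add x y hx hy => simp only [map_add, smul_add, TensorProduct.tmul_add, hx, hy]
    | tmul a x =>
      rw [withProd_FAct, gamWord_cons, aW, LinearMap.comp_apply, LinearMap.comp_apply,
        ← LinearMap.lTensor_comp_apply, ← LinearMap.lTensor_comp_apply, actPast_eq_past,
        LinearMap.lTensor_tmul, LinearEquiv.coe_coe, LinearEquiv.symm_apply_apply, ← map_smul]
      congr 1
      generalize past (D.actPow (l + 1)) (TPow k A r) _ = y
      induction y with
      | zero => simp
      | add x y hx hy => simp only [map_add, smul_add, hx, hy]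
      | tmul a t =>
        simp only [LinearMap.lTensor_tmul, LinearMap.comp_apply, ih, prodF_eq,
          TensorProduct.tmul_smul]

/-- The recursion of `rho0` through `LA` is the recursion of `F`: the merging part of `LA` gives
`FMerge` and the moving part gives `FAct`. The sign `(-1)^r` accounts for the difference between the
sign `(-1)^s` in `LA_wrd` and the one in `F`. -/
theorem rho0_wrd (m : M) (n l r : ℕ) (z : TPow k H (l + 1) ⊗[k] TPow k A r) :
    D.fact.rho0 (D.lam M) n (wrd m (n + 1) (l + 1) r z) =
      (-1 : k) ^ r • D.gamWord m n (D.prodF n l r z) := by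
  induction n generalizing l r with
  | zero => exact D.rho0_wrd_zero m l r z
  | succ n ih =>
    rw [Factorization.rho0_succ, LA_wrd, map_add, map_add, map_smul, map_smul]
    cases l with
    | zero =>
      rw [mW_one, map_zero, map_zero, zero_add]
      cases r with
      | zero => simp [aW, prodF, F]
      | succ r =>
        rw [D.lTensor_rho0_aW (ih 0 r), prodF_eq, F, pow_succ]
        module
    | succ l =>
      rw [D.lTensor_rho0_mW (ih l r)]
      cases r with
      | zero => rw [prodF_eq, F]; simp [aW]
      | succ r =>
        rw [D.lTensor_rho0_aW (ih (l + 1) r), prodF_eq, F, withProd_add, withProd_smul, map_add,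
          map_smul, smul_add, pow_succ _ r, pow_succ _ (l + 1)]
        module

theorem rho0_wA (m : M) (n r : ℕ) (x : TPow k A (r + 1)) :
    D.fact.rho0 (D.lam M) n (HW.aw (wA m (n + 1) (r + 1) x)) =
      JA A M n r (onLeft M D.incl _ (m ⊗ₜ unsnoc r x)) := by
  suffices e : D.fact.rho0 (D.lam M) n ∘ₗ HW.aw ∘ₗ wA m (n + 1) (r + 1) =
      JA A M n r ∘ₗ onLeft M D.incl _ ∘ₗ TensorProduct.mk k M _ m ∘ₗ unsnoc r from
    LinearMap.congr_fun e x
  clear x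
  induction n generalizing r with
  | zero =>
    refine TPow.hom_ext fun a p => ?_
    cases r with
    | zero =>
      obtain ⟨b, rfl⟩ := (nil (k := k) (V := A)).surjective p
      simp only [LinearMap.comp_apply, wA_cons, wA_zero, Factorization.rho0_zero,
        Factorization.L_aw, actNil_tmul, unsnoc]
      rw [LinearEquiv.coe_coe, LinearEquiv.symm_apply_apply, TensorProduct.mk_apply, onLeft_tmul,
        JA_tmul, wA_zero, map_smul]
      rfl
    | succ r =>
      have h₁ : JA (k := k) A M 0 (r + 1) = 0 := TensorProduct.ext' fun m x => rfl
      rw [h₁, LinearMap.zero_comp]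
      simp [wA]
  | succ n ih =>
    refine TPow.hom_ext fun a p => ?_
    cases r with
    | zero =>
      have h₁ : JA (k := k) A M (n + 1) 0 = 0 := TensorProduct.ext' fun m x => rfl
      rw [h₁, LinearMap.zero_comp]
      simp [wA]
    | succ r =>
      have ih' := LinearMap.congr_fun (ih r) p
      simp only [LinearMap.comp_apply] at ih'
      simp only [LinearMap.comp_apply]
      rw [wA_cons, Factorization.rho0_succ, Factorization.LA_aw, LinearMap.lTensor_tmul, ih', unsnoc]
      simp only [LinearMap.comp_apply, LinearEquiv.coe_coe, LinearEquiv.symm_apply_apply,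
        LinearMap.lTensor_tmul]
      generalize unsnoc r p = y
      induction y with
      | zero => simp
      | add x y hx hy => simp only [map_add, TensorProduct.tmul_add, hx, hy]
      | tmul b x => rfl

end CrossedSystem

/-! ### Cutting off the last letters of `H` -/

section Split

variable {k : Type u} [CommRing k] {V : Type u} [AddCommGroup V] [Module k V]

theorem idPow_self (n : ℕ) : idPow (k := k) (V := V) n n = LinearMap.id := by
  induction n with
  | zero => rfl
  | succ n ih => rw [idPow, ih, LinearMap.lTensor_id]; rfl

theorem split_zero (s : ℕ) (t : TPow k V s) : split s 0 s t = nil 1 ⊗ₜ t := by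
  cases s <;> simp [split, idPow_self]

theorem split_succ (s t l : ℕ) (v : V) (p : TPow k V s) :
    split (s + 1) (t + 1) l (cons (v ⊗ₜ p)) = LinearMap.rTensor (TPow k V l) cons.toLinearMap
      ((TensorProduct.assoc k V (TPow k V t) (TPow k V l)).symm (v ⊗ₜ split s t l p)) := rfl

end Split

namespace CrossedSystem

variable {k A H : Type u} [CommRing k] [Ring A] [Algebra k A] [Ring H] [HopfAlgebra k H]
variable (D : CrossedSystem k A H)

/-- `𝐡 ⊗ 𝐚 ↦ 𝔥_{t+1,s}⁽²⁾ ⊗ (h₁ ⊗ ⋯ ⊗ h_t) ⊗ F_r^{(l+1)}(𝐡_{t+1,s}⁽¹⁾ ⊗ 𝐚)` for `s = t + l + 1`. -/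
def cutF (l r s n t : ℕ) : TPow k H s ⊗[k] TPow k A r →ₗ[k]
    H ⊗[k] (TPow k H t ⊗[k] TPow k A n) :=
  (TensorProduct.leftComm k (TPow k H t) H (TPow k A n)).toLinearMap
    ∘ₗ LinearMap.lTensor (TPow k H t) (D.prodF n l r)
    ∘ₗ (TensorProduct.assoc k (TPow k H t) (TPow k H (l + 1)) (TPow k A r)).toLinearMap
    ∘ₗ LinearMap.rTensor (TPow k A r) (split s t (l + 1))

theorem cutF_zero (l r n : ℕ) (z : TPow k H (l + 1) ⊗[k] TPow k A r) :
    D.cutF l r (l + 1) n 0 z =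
      LinearMap.lTensor H (TensorProduct.mk k (TPow k H 0) (TPow k A n) (nil 1))
        (D.prodF n l r z) := by
  induction z with
  | zero => simp
  | add x y hx hy => simp only [map_add, hx, hy]
  | tmul t x =>
    simp only [cutF, LinearMap.comp_apply, LinearMap.rTensor_tmul, split_zero,
      LinearEquiv.coe_coe, TensorProduct.assoc_tmul, LinearMap.lTensor_tmul]
    generalize D.prodF n l r _ = y
    induction y with
    | zero => simp
    | add x y hx hy => simp only [map_add, TensorProduct.tmul_add, hx, hy]
    | tmul h x => simp

theorem cutF_succ (l r s n t : ℕ) (h : H) (p : TPow k H s) (x : TPow k A r) :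
    D.cutF l r (s + 1) n (t + 1) (cons (h ⊗ₜ p) ⊗ₜ x) =
      LinearMap.lTensor H (LinearMap.rTensor (TPow k A n) cons.toLinearMap
        ∘ₗ (TensorProduct.assoc k H (TPow k H t) (TPow k A n)).symm.toLinearMap
        ∘ₗ TensorProduct.mk k H _ h) (D.cutF l r s n t (p ⊗ₜ x)) := by
  simp only [cutF, LinearMap.comp_apply, LinearMap.rTensor_tmul, split_succ]
  generalize split s t (l + 1) p = y
  induction y with
  | zero => simp
  | add x y hx hy => simp only [map_add, TensorProduct.add_tmul, TensorProduct.tmul_add, hx, hy]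
  | tmul p q =>
    simp only [TensorProduct.assoc_symm_tmul, LinearMap.rTensor_tmul,
      LinearEquiv.coe_coe, TensorProduct.assoc_tmul, LinearMap.lTensor_tmul]
    generalize D.prodF n l r _ = y
    induction y with
    | zero => simp
    | add x y hx hy => simp only [map_add, TensorProduct.tmul_add, hx, hy]
    | tmul h x => simp

variable {M : Type v} [AddCommGroup M] [Module k M] [Module D.E M]
variable [IsScalarTower k D.E M]

/-- `h ⊗ z ↦ (1 # h) m ⊗ z` as a mixed word. -/
def gamWrd (m : M) (n s r : ℕ) : H ⊗[k] (TPow k H s ⊗[k] TPow k A r) →ₗ[k] HW k A H M n :=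
  Jb A H M n s r ∘ₗ onLeft M D.gam _ ∘ₗ TensorProduct.mk k M _ m

theorem gamWrd_cutF_zero (m : M) (l r n t : ℕ) (ht : t = 0)
    (z : TPow k H (l + 1) ⊗[k] TPow k A r) :
    D.gamWrd m n t n (D.cutF l r (l + 1) n t z) = HW.aw (D.gamWord m n (D.prodF n l r z)) := by
  subst ht
  rw [cutF_zero]
  generalize D.prodF n l r z = y
  induction y with
  | zero => simp
  | add x y hx hy => simp only [map_add, hx, hy]
  | tmul h x =>
    rw [gamWord_tmul, LinearMap.lTensor_tmul]
    change wrd (D.gam h • m) n 0 n (nil 1 ⊗ₜ x) = _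
    rw [wrd_nil, one_smul]

theorem gamWrd_cutF_succ (m : M) (l r s n N t t' : ℕ) (ht : t' = t + 1) (h : H) (p : TPow k H s)
    (x : TPow k A r) :
    D.gamWrd m (N + 1) t' n (D.cutF l r (s + 1) n t' (cons (h ⊗ₜ p) ⊗ₜ x)) =
      HW.hv (h ⊗ₜ D.gamWrd m N t n (D.cutF l r s n t (p ⊗ₜ x))) := by
  subst ht
  rw [cutF_succ]
  generalize D.cutF l r s n t _ = y
  induction y with
  | zero => simp
  | add x y hx hy => simp only [map_add, TensorProduct.tmul_add, hx, hy]
  | tmul g y =>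
    induction y with
    | zero => simp
    | add x y hx hy => simp only [map_add, TensorProduct.tmul_add, hx, hy]
    | tmul p x => rfl

/-- The last summand of `d̂⁰` as a mixed word. -/
def lastWrd (m : M) (n s : ℕ) : (r : ℕ) → TPow k H s ⊗[k] TPow k A r →ₗ[k] HW k A H M n
  | 0 => 0
  | r + 1 => Jb A H M n s r ∘ₗ onLeft M D.incl _ ∘ₗ TensorProduct.mk k M _ m
      ∘ₗ (TensorProduct.leftComm k (TPow k H s) A (TPow k A r)).toLinearMap
      ∘ₗ LinearMap.lTensor (TPow k H s) (unsnoc r)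

theorem lastWrd_cons (m : M) (n s r : ℕ) (h : H) (p : TPow k H s) (x : TPow k A r) :
    D.lastWrd m (n + 1) (s + 1) r (cons (h ⊗ₜ p) ⊗ₜ x) =
      HW.hv (h ⊗ₜ D.lastWrd m n s r (p ⊗ₜ x)) := by
  cases r with
  | zero => simp [lastWrd]
  | succ r =>
    simp only [lastWrd, LinearMap.comp_apply, LinearMap.lTensor_tmul]
    generalize unsnoc r x = y
    induction y with
    | zero => simp
    | add x y hx hy => simp only [map_add, TensorProduct.tmul_add, hx, hy]
    | tmul a x => rfl

/-- `rho` either works behind the first letter of `H` or removes all letters of `H` by `rho0`. After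
leaving some letters untouched it therefore consumes the last `l + 1` of them, for some `l < s`; if
it leaves all of them, only the last letter of `A` acts on the tail. -/
theorem rho_wrd (m : M) (n s r : ℕ) (hn : r + s = n + 1) (z : TPow k H s ⊗[k] TPow k A r) :
    D.fact.rho (D.lam M) n (wrd m (n + 1) s r z) = D.lastWrd m n s r z + (-1 : k) ^ r •
      ∑ l ∈ Finset.range s, D.gamWrd m n (s - (l + 1)) (r + l)
        (D.cutF l r s (r + l) (s - (l + 1)) z) := by
  suffices e : D.fact.rho (D.lam M) n ∘ₗ wrd m (n + 1) s r = D.lastWrd m n s r + (-1 : k) ^ r •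
      ∑ l ∈ Finset.range s, D.gamWrd m n (s - (l + 1)) (r + l) ∘ₗ
        D.cutF l r s (r + l) (s - (l + 1)) by
    have := LinearMap.congr_fun e z
    simpa [LinearMap.sum_apply] using this
  clear z
  induction s generalizing n with
  | zero =>
    obtain rfl : r = n + 1 := hn
    refine nil_hom_ext fun x => ?_
    rw [LinearMap.comp_apply, wrd_nil, one_smul, Factorization.rho_aw, rho0_wA]
    simp only [Finset.range_zero, Finset.sum_empty, smul_zero, add_zero, lastWrd,
      LinearMap.comp_apply, LinearMap.lTensor_tmul]
    generalize unsnoc n x = y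
    induction y with
    | zero => simp
    | add x y hx hy => simp only [map_add, TensorProduct.tmul_add, hx, hy]
    | tmul a x =>
      change _ = wrd (D.incl a • m) n 0 n (nil 1 ⊗ₜ x)
      rw [wrd_nil, one_smul]
      rfl
  | succ s ih =>
    obtain rfl : r + s = n := by omega
    refine pow_hom_ext fun h p x => ?_
    -- The top index consumes all letters of `H` and is `rho0`; the other terms keep `h` and come
    -- from the induction.
    rw [Finset.sum_range_succ]
    simp only [LinearMap.comp_apply, LinearMap.add_apply, LinearMap.smul_apply,
      LinearMap.sum_apply]
    rw [gamWrd_cutF_zero _ _ _ _ _ _ (Nat.sub_self _)]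
    have h₁ := D.rho0_wrd m (r + s) s r (cons (h ⊗ₜ p) ⊗ₜ x)
    cases hrs : r + s with
    | zero =>
      obtain ⟨rfl, rfl⟩ : r = 0 ∧ s = 0 := by omega
      rw [hrs] at h₁
      rw [Factorization.rho_zero, ← Factorization.rho0_zero, h₁]
      simp [lastWrd]
    | succ N =>
      rw [hrs] at h₁
      have ih' := LinearMap.congr_fun (ih N hrs) (p ⊗ₜ x)
      simp only [LinearMap.comp_apply, LinearMap.add_apply, LinearMap.smul_apply,
        LinearMap.sum_apply] at ih'
      rw [Factorization.rho_succ, h₁, wrd_cons, HW.snd_hv, LinearMap.lTensor_tmul, ih',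
        lastWrd_cons]
      have h₂ : ∀ l ∈ Finset.range s, D.gamWrd m (N + 1) (s + 1 - (l + 1)) (r + l)
          (D.cutF l r (s + 1) (r + l) (s + 1 - (l + 1)) (cons (h ⊗ₜ p) ⊗ₜ x)) =
          HW.hv (h ⊗ₜ D.gamWrd m N (s - (l + 1)) (r + l)
            (D.cutF l r s (r + l) (s - (l + 1)) (p ⊗ₜ x))) := fun l hl =>
        D.gamWrd_cutF_succ m l r s (r + l) N _ _ (by have := Finset.mem_range.1 hl; omega) h p x
      rw [Finset.sum_congr rfl h₂]
      simp only [TensorProduct.tmul_add, TensorProduct.tmul_smul, TensorProduct.tmul_sum, map_add,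
        map_smul, map_sum, smul_add]
      abel

end CrossedSystem

/-! ### Identification of the differential `d̂` -/

namespace CrossedSystem

variable {k A H : Type u} [CommRing k] [Ring A] [Algebra k A] [Ring H] [HopfAlgebra k H]
variable (D : CrossedSystem k A H)
variable {M : Type v} [AddCommGroup M] [Module k M] [Module D.E M] [Module D.Eᵐᵒᵖ M]
variable [IsScalarTower k D.E M] [IsScalarTower k D.Eᵐᵒᵖ M] [SMulCommClass D.E D.Eᵐᵒᵖ M]

theorem tl_wrd {V : Type u} [AddCommGroup V] [Module k V] (g : V →ₗ[k] D.E) (m : M) (n s r : ℕ)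
    (y : V ⊗[k] (TPow k H s ⊗[k] TPow k A r)) :
    Factorization.tl (BiAct.of k D.E M) H A n
      (LinearMap.rTensor _ g (LinearMap.lTensor V (wrd m n s r) y)) =
      Jb A H M n s r (onRight M g _ (m ⊗ₜ y)) := by
  induction y with
  | zero => simp
  | add x y hx hy => simp only [map_add, TensorProduct.tmul_add, hx, hy]
  | tmul v z =>
    rw [LinearMap.lTensor_tmul, LinearMap.rTensor_tmul, Factorization.tl_tmul, tm_wrd, onRight_tmul,
      Jb_tmul]
    rfl

variable (M) in
/-- The right action of `E` on the tails of mixed words. -/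
abbrev tlM (n : ℕ) : D.E ⊗[k] HW k A H M n →ₗ[k] HW k A H M n :=
  Factorization.tl (BiAct.of k D.E M) H A n

theorem d_wrd (m : M) (n s r : ℕ) (z : TPow k H s ⊗[k] TPow k A r) :
    D.fact.d (BiAct.of k D.E M) n (wrd m (n + 1) s r z) =
      D.tlM M n (LinearMap.rTensor _ D.incl (D.mW m n s r z))
      + (-1 : k) ^ s • D.tlM M n (LinearMap.rTensor _ D.incl (D.aW m n s r z))
      + D.tlM M n (LinearMap.rTensor _ D.gam (HW.snd (wrd m (n + 1) s r z)))
      + Factorization.I n (wrd m (n + 1) s r z)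
      + (-1 : k) ^ (n + 1) • D.fact.rho (D.lam M) n (wrd m (n + 1) s r z) := by
  rw [Factorization.d_apply, Factorization.L_apply, LA_wrd, Factorization.B_apply, map_add, map_add,
    map_add, map_smul, map_smul, ← add_assoc]
  rfl

theorem Jn_dHatFrom0 (m : M) (n r s : ℕ) (h : r + s = n + 1) (z : TPow k H s ⊗[k] TPow k A r) :
    Jn A H M n (D.dHatFrom0 M n r s h (m ⊗ₜ z)) = (-1 : k) ^ (r * s) •
      ((-1 : k) ^ s • D.tlM M n (LinearMap.rTensor _ D.incl (D.aW m n s r z))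
      + Factorization.I n (wrd m (n + 1) s r z)
      + ((-1 : k) ^ r * (-1) ^ s) • D.lastWrd m n s r z) := by
  cases r with
  | zero => simp [dHatFrom0, I_wrd_zero, aW, lastWrd]
  | succ r =>
    have h₁ : Jb A H M n s r (D.dHat0 M r s (m ⊗ₜ z)) =
        D.tlM M n (LinearMap.rTensor _ D.incl (D.aW m n s (r + 1) z)) +
          wrd m n s r (LinearMap.lTensor _ (innerSum r) z) +
          (-1 : k) ^ (r + 1) • D.lastWrd m n s (r + 1) z := by
      rw [aW, LinearMap.comp_apply, tl_wrd, dHat0, LinearMap.add_apply, LinearMap.add_apply, map_add,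
        map_add, LinearMap.smul_apply, map_smul]
      rfl
    rw [dHatFrom0, LinearMap.comp_apply, Jn_toHat, h₁, I_wrd_succ]
    have e₁ : (-1 : k) ^ ((r + 1) * s) * (-1 : k) ^ s = (-1) ^ (r * s) := by
      rw [← pow_add]
      exact neg_one_pow_eq (by simp only [Nat.even_add, Nat.even_mul, Nat.not_even_one, iff_false]; tauto)
    have e₂ : (-1 : k) ^ ((r + 1) * s) * ((-1) ^ (r + 1) * (-1 : k) ^ s) =
        (-1) ^ (r * s) * (-1) ^ (r + 1) := by
      rw [← e₁]; ring
    simp only [smul_add, smul_smul, e₁, e₂]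

/-- The sign of the target bidegree `(r + l, t)` times the sign of `d̂^{l+1}` does not depend on
`l`; this is why one sign `(-1)^{rs}` handles all the higher terms together. -/
theorem sign_cut {r s l t : ℕ} (hs : s = t + l + 1) :
    (-1 : k) ^ ((r + l) * t) * (-1) ^ ((l + 1) * (r + s)) = (-1) ^ (r * s) * (-1) ^ s := by
  subst hs
  rw [← pow_add, ← pow_add]
  exact neg_one_pow_eq (by simp only [Nat.even_add, Nat.even_mul, Nat.not_even_one, iff_false]; tauto)

theorem Jn_dHatL (m : M) (n l r s t : ℕ) (h : r + l + t = n) (hs : s = t + l + 1)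
    (z : TPow k H s ⊗[k] TPow k A r) :
    Jn A H M n (toHat M (r + l) t h (D.dHatL M l r s (r + l) t (m ⊗ₜ z))) =
      ((-1 : k) ^ (r * s) * (-1) ^ s) • D.gamWrd m n t (r + l) (D.cutF l r s (r + l) t z) := by
  rw [Jn_toHat, ← sign_cut hs, mul_smul, dHatL, LinearMap.smul_apply, map_smul]
  rfl

theorem Jn_dHatFrom1 (m : M) (n r s : ℕ) (h : r + (s + 1) = n + 1)
    (z : TPow k H (s + 1) ⊗[k] TPow k A r) :
    Jn A H M n (D.dHatFrom1 M n r (s + 1) h (m ⊗ₜ z)) = (-1 : k) ^ (r * (s + 1)) •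
      (D.tlM M n (LinearMap.rTensor _ D.incl (D.mW m n (s + 1) r z))
      + D.tlM M n (LinearMap.rTensor _ D.gam (HW.snd (wrd m (n + 1) (s + 1) r z)))
      + (-1 : k) ^ (s + 1) • D.gamWrd m n s r (D.cutF 0 r (s + 1) r s z)) := by
  have h₁ : HW.snd (wrd m (n + 1) (s + 1) r z) = LinearMap.lTensor H (wrd m n s r)
      (TensorProduct.assoc k H (TPow k H s) (TPow k A r) (LinearMap.rTensor _
        cons.symm.toLinearMap z)) := rfl
  have h₂ : Jn A H M n (toHat M r s (Nat.succ.inj h) (D.dHatL M 0 r (s + 1) r s (m ⊗ₜ z))) =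
      ((-1 : k) ^ (r * (s + 1)) * (-1) ^ (s + 1)) • D.gamWrd m n s r (D.cutF 0 r (s + 1) r s z) :=
    D.Jn_dHatL m n 0 r (s + 1) s (Nat.succ.inj h) rfl z
  rw [h₁, mW, LinearMap.comp_apply, tl_wrd, tl_wrd, dHatFrom1, LinearMap.comp_apply, dHat1,
    LinearMap.add_apply, map_add, map_add, h₂, Jn_toHat, smul_add, mul_smul]
  refine congrArg₂ _ ?_ rfl
  have e : (-1 : k) ^ (r * (s + 1)) = (-1) ^ (r * s) * (-1) ^ r := by rw [← pow_add, mul_add]; simp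
  rw [LinearMap.add_apply, map_add, LinearMap.smul_apply, map_smul, LinearMap.smul_apply, map_smul,
    e, mul_smul, ← smul_add, add_comm]
  rfl

/-- Applied with `a`, `b`, `c` the signs `(-1)^{rs}`, `(-1)^r`, `(-1)^s` for the bidegree `(r, s)`.
The groups of terms on the left are `d̂⁰`, `d̂¹` and the `d̂^l` with `l ≥ 2`; on the right they are
grouped as in `d_wrd` and `rho_wrd`. -/
theorem collect_terms {V : Type*} [AddCommGroup V] [Module k V] {a b c : k} (hb : b * b = 1)
    (x₁ x₂ x₃ x₄ x₅ x₆ x₇ : V) :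
    a • (c • x₁ + x₂ + (b * c) • x₃) + a • (x₄ + x₅ + c • x₆) + (a * c) • x₇ =
      a • (x₄ + c • x₁ + x₅ + x₂ + (b * c) • (x₃ + b • (x₇ + x₆))) := by
  have e : a * (b * c) * b = a * c := by linear_combination (a * c) * hb
  simp only [smul_add, smul_smul, ← _root_.mul_assoc]
  rw [_root_.mul_assoc a b c, e]
  abel

/-- Each summand of `d̂` is one of the terms of the word differential: the right action on what `LA`
or the first letter of `H` gives, the products inside `A`, and the pieces of `rho`. -/
theorem Jn_dHat (n : ℕ) (x : XHat k A H M (n + 1)) :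
    Jn A H M n (D.dHat M n x) = D.fact.d (BiAct.of k D.E M) n (Jn A H M (n + 1) x) := by
  suffices e : Jn A H M n ∘ₗ D.dHat M n = D.fact.d (BiAct.of k D.E M) n ∘ₗ Jn A H M (n + 1) from
    LinearMap.congr_fun e x
  clear x
  refine hat_hom_ext fun r s h m z => ?_
  have h₁ : D.dHat M n (toHat M r s h (m ⊗ₜ z)) = D.dHatFrom0 M n r s h (m ⊗ₜ z)
      + D.dHatFrom1 M n r s h (m ⊗ₜ z)
      + ∑ i : Fin (s - 1), toHat M (r + (i + 1)) (s - (i + 1 + 1))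
          (by have h₂ := i.2; omega) (D.dHatL M (i + 1) r s _ _ (m ⊗ₜ z)) := by
    rw [dHat, toHat, DirectSum.toModule_lof]
    simp [LinearMap.sum_apply]
  rw [LinearMap.comp_apply, h₁, LinearMap.comp_apply, Jn_toHat, map_smul, Jb_tmul, d_wrd,
    D.rho_wrd m n s r h, map_add, map_add, Jn_dHatFrom0,
    show (-1 : k) ^ (n + 1) = (-1) ^ r * (-1) ^ s by rw [← h, pow_add]]
  cases s with
  | zero =>
    have h₂ : HW.snd (wrd m (n + 1) 0 r z) = 0 := by
      have : HW.snd ∘ₗ wrd (k := k) (B := A) (C := H) m (n + 1) 0 r = 0 := nil_hom_ext fun x => by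
        rw [LinearMap.comp_apply, wrd_nil, map_smul, HW.snd_aw, smul_zero, LinearMap.zero_apply]
      exact LinearMap.congr_fun this z
    rw [h₂]
    simp [dHatFrom1, mW]
  | succ s =>
    have h₂ : ∀ i : Fin s, Jn A H M n (toHat M (r + (i + 1)) (s + 1 - (i + 1 + 1))
        (by have h₂ := i.2; omega) (D.dHatL M (i + 1) r (s + 1) _ _ (m ⊗ₜ z))) =
        ((-1 : k) ^ (r * (s + 1)) * (-1) ^ (s + 1)) •
          D.gamWrd m n (s + 1 - ((i + 1 : ℕ) + 1)) (r + (i + 1 : ℕ))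
            (D.cutF (i + 1 : ℕ) r (s + 1) (r + (i + 1 : ℕ)) (s + 1 - ((i + 1 : ℕ) + 1)) z) :=
      fun i => D.Jn_dHatL m n _ r _ _ _ (by have h₂ := i.2; omega) z
    -- The term with index `0` in the sum for `rho` belongs to `d̂¹`; the others are the `d̂^l` with
    -- `l ≥ 2`.
    rw [map_sum, Finset.sum_range_succ', Jn_dHatFrom1]
    refine (congrArg₂ _ rfl (Finset.sum_congr rfl fun i _ => h₂ i)).trans ?_
    rw [Finset.sum_range (fun i => D.gamWrd m n (s + 1 - (i + 1 + 1)) (r + (i + 1))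
            (D.cutF (i + 1) r (s + 1) (r + (i + 1)) (s + 1 - (i + 1 + 1)) z)), ← Finset.smul_sum]
    refine collect_terms ?_ _ _ _ _ _ _ _
    rw [← mul_pow, neg_mul_neg, _root_.one_mul, one_pow]

end CrossedSystem

/-! ### The Hochschild complex written with words -/

section Hochschild

variable {k : Type u} [CommRing k] {R : Type u} [Ring R] [Algebra k R]
variable {M : Type v} [AddCommGroup M] [Module k M] [Module R M] [Module Rᵐᵒᵖ M]
variable [IsScalarTower k R M] [IsScalarTower k Rᵐᵒᵖ M] [SMulCommClass R Rᵐᵒᵖ M]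

theorem bar_wA (m : M) (n : ℕ) (x : TPow k R (n + 1)) :
    Wd.bar (BiAct.of k R M).l n (wA m (n + 1) (n + 1) x) = wA m n n (innerSum n x) +
      (-1 : k) ^ (n + 1) • JA R M n n (onLeft M LinearMap.id _ (m ⊗ₜ unsnoc n x)) := by
  suffices e : Wd.bar (BiAct.of k R M).l n ∘ₗ wA m (n + 1) (n + 1) = wA m n n ∘ₗ innerSum n +
      (-1 : k) ^ (n + 1) • (JA R M n n ∘ₗ onLeft M LinearMap.id _ ∘ₗ
        TensorProduct.mk k M _ m ∘ₗ unsnoc n) from LinearMap.congr_fun e x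
  clear x
  induction n with
  | zero =>
    refine TPow.hom_ext fun a p => ?_
    obtain ⟨b, rfl⟩ := (nil (k := k) (V := R)).surjective p
    simp only [LinearMap.comp_apply, wA_cons, wA_zero, LinearMap.add_apply, LinearMap.smul_apply,
      unsnoc, LinearEquiv.coe_coe, LinearEquiv.symm_apply_apply, innerSum, LinearMap.zero_apply,
      map_zero, zero_add, pow_one, TensorProduct.mk_apply, onLeft_tmul, JA_tmul,
      LinearMap.id_apply, map_smul]
    simp [BiAct.of]
  | succ n ih =>
    refine TPow.hom_ext fun a p => ?_
    obtain ⟨t, rfl⟩ := cons.surjective p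
    induction t with
    | zero => simp
    | add x y hx hy => rw [map_add, TensorProduct.tmul_add, map_add, map_add, map_add, hx, hy]
    | tmul b p =>
      have ih' := LinearMap.congr_fun ih (cons (b ⊗ₜ p))
      simp only [LinearMap.comp_apply, LinearMap.add_apply, LinearMap.smul_apply, wA_cons] at ih'
      simp only [LinearMap.comp_apply, LinearMap.add_apply, LinearMap.smul_apply, wA_cons,
        Wd.bar_succ, ih', innerSum_succ, mulAt_zero, map_sub, map_neg, TensorProduct.tmul_add,
        TensorProduct.tmul_smul, map_add, map_smul]
      have e : JA R M (n + 1) (n + 1) (onLeft M LinearMap.id _ (m ⊗ₜ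
          unsnoc (n + 1) (cons (a ⊗ₜ cons (b ⊗ₜ p))))) =
          Wd.cons (a ⊗ₜ JA R M n n (onLeft M LinearMap.id _ (m ⊗ₜ unsnoc n (cons (b ⊗ₜ p))))) := by
        rw [unsnoc]
        simp only [LinearMap.comp_apply, LinearEquiv.coe_coe, LinearEquiv.symm_apply_apply,
          LinearMap.lTensor_tmul]
        generalize unsnoc n (cons (b ⊗ₜ[k] p)) = y
        induction y with
        | zero => simp
        | add x y hx hy => simp only [map_add, TensorProduct.tmul_add, hx, hy]
        | tmul b x => rfl
      simp only [TensorProduct.mk_apply]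
      rw [e, pow_succ _ (n + 1)]
      module

theorem JA_hochB (n : ℕ) (x : M ⊗[k] TPow k R (n + 1)) :
    JA R M n n (hochB M (LinearMap.id : R →ₗ[k] R) n x) =
      (BiAct.of k R M).b n (JA R M (n + 1) (n + 1) x) := by
  induction x with
  | zero => simp
  | add x y hx hy => simp only [map_add, hx, hy]
  | tmul m x =>
    have h : (BiAct.of k R M).b n (wA m (n + 1) (n + 1) x) =
        (BiAct.of k R M).tlW n (Wd.cons.symm (wA m (n + 1) (n + 1) x)) +
          Wd.bar (BiAct.of k R M).l n (wA m (n + 1) (n + 1) x) := rfl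
    rw [JA_tmul, h, bar_wA, hochB, LinearMap.add_apply, LinearMap.add_apply, map_add, map_add,
      LinearMap.smul_apply, map_smul, ← add_assoc]
    refine congrArg₂ _ (congrArg₂ _ ?_ rfl) rfl
    clear h
    obtain ⟨t, rfl⟩ := cons.surjective x
    induction t with
    | zero => simp
    | add x y hx hy => simp only [map_add, TensorProduct.tmul_add, hx, hy]
    | tmul a x =>
      rw [wA_cons, LinearEquiv.symm_apply_apply, BiAct.tlW_tmul, Wd.tm_wA]
      rfl

end Hochschild

/-! ### The complex `X̂` and its homology -/

namespace CrossedSystem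

variable {k A H : Type u} [CommRing k] [Ring A] [Algebra k A] [Ring H] [HopfAlgebra k H]
variable (D : CrossedSystem k A H)
variable (M : Type v) [AddCommGroup M] [Module k M]

/-- The isomorphism of the components of `X̂_*(E, M)` with modules of mixed words. -/
def hatEquiv (n : ℕ) : XHat k (Red k A) (Red k H) M n ≃ₗ[k] HW k (Red k A) (Red k H) M n :=
  LinearEquiv.ofBijective (Jn _ _ M n) (Jn_bijective n)

theorem hatEquiv_clsHat (n : ℕ) (x : XHat k A H M n) :
    hatEquiv M n (clsHat k M A H n x) = D.reduction.cls M n (Jn A H M n x) := by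
  suffices e : Jn (Red k A) (Red k H) M n ∘ₗ clsHat k M A H n = D.reduction.cls M n ∘ₗ Jn A H M n
    from LinearMap.congr_fun e x
  refine hat_hom_ext fun r s h m z => ?_
  have h₁ : clsHat k M A H n (toHat M r s h (m ⊗ₜ z)) =
      toHat M r s h (m ⊗ₜ TensorProduct.map (powMap (red k H) s) (powMap (red k A) r) z) := by
    rw [clsHat, toHat, DirectSum.lmap_lof]
    rfl
  rw [LinearMap.comp_apply, LinearMap.comp_apply, h₁, Jn_toHat, Jn_toHat, map_smul, Jb_tmul,
    Jb_tmul, ← map_wrd]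
  rfl

variable [Module D.E M] [Module D.Eᵐᵒᵖ M]
variable [IsScalarTower k D.E M] [IsScalarTower k D.Eᵐᵒᵖ M] [SMulCommClass D.E D.Eᵐᵒᵖ M]

/-- The differential of `X̂_*(E, M)`. -/
def hatDiff (n : ℕ) : XHat k (Red k A) (Red k H) M (n + 1) →ₗ[k] XHat k (Red k A) (Red k H) M n :=
  (hatEquiv M n).symm.toLinearMap ∘ₗ D.reduction.d (BiAct.of k D.E M) n
    ∘ₗ (hatEquiv M (n + 1)).toLinearMap

theorem hatEquiv_hatDiff (n : ℕ) (x : XHat k (Red k A) (Red k H) M (n + 1)) :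
    hatEquiv M n (D.hatDiff M n x) =
      D.reduction.d (BiAct.of k D.E M) n (hatEquiv M (n + 1) x) := by
  simp [hatDiff]

/-- The differential of `X̂` is transported from classes of words; that it is given by the formulas
`d̂` is `Jn_dHat` read modulo units. -/
theorem hatDiff_clsHat (n : ℕ) (x : XHat k A H M (n + 1)) :
    D.hatDiff M n (clsHat k M A H (n + 1) x) = clsHat k M A H n (D.dHat M n x) := by
  apply (hatEquiv M n).injective
  rw [hatEquiv_hatDiff, D.hatEquiv_clsHat, D.hatEquiv_clsHat, Factorization.Reduction.d_cls,
    Jn_dHat]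

theorem hatDiff_hatDiff (n : ℕ) (x : XHat k (Red k A) (Red k H) M (n + 2)) :
    D.hatDiff M n (D.hatDiff M (n + 1) x) = 0 := by
  apply (hatEquiv M n).injective
  rw [hatEquiv_hatDiff, hatEquiv_hatDiff, Factorization.Reduction.d_d, map_zero]

theorem hochschildHomology_hat (n : ℕ) :
    Nonempty (HochschildHomology k D.E M n ≃ₗ[k] Homology (D.hatDiff M) n) := by
  obtain ⟨e₁⟩ := Lifts.homology (φ := fun n => JA (k := k) D.E M n n)
    (JA_hochB (k := k) (R := D.E) (M := M))
    (Lifts.of_bijective (JA_hochB (k := k) (R := D.E) (M := M)) fun n => JA_bijective D.E M n) n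
  obtain ⟨e₂⟩ := D.reduction.homology (BiAct.of k D.E M) n
  obtain ⟨e₃⟩ := Lifts.homology (φ := fun n => (hatEquiv M n).toLinearMap) (D.hatEquiv_hatDiff M)
    (Lifts.of_bijective (D.hatEquiv_hatDiff M) fun n => (hatEquiv M n).bijective) n
  exact ⟨e₁ ≪≫ₗ e₂ ≪≫ₗ e₃.symm⟩

end CrossedSystem

/-! ### The antipode and the convolution inverse of `h ↦ 1 # h` -/

section Antipode

open WithConv LinearMap

variable {k : Type u} [CommRing k] {H : Type u} [Ring H] [HopfAlgebra k H]

theorem conv_eq_of_toConv {C R : Type u} [AddCommGroup C] [Module k C] [Coalgebra k C] [Ring R]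
    [Algebra k R] {f g h : C →ₗ[k] R} (e : toConv f * toConv g = toConv h) : conv f g = h :=
  toConv_injective e

theorem algHom_toConv_mul {C R R' : Type u} [AddCommGroup C] [Module k C] [Coalgebra k C] [Ring R]
    [Algebra k R] [Ring R'] [Algebra k R'] (φ : R →ₐ[k] R') {f g : C →ₗ[k] R}
    (e : toConv f * toConv g = 1) :
    toConv (φ.toLinearMap ∘ₗ f) * toConv (φ.toLinearMap ∘ₗ g) = 1 := by
  have h := algHom_comp_convMul_distrib φ (toConv f) (toConv g)
  rw [e, LinearMap.convOne_def] at h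
  refine ofConv_injective (h.symm.trans ?_)
  rw [LinearMap.convOne_def]
  ext c
  simp

/-- The antipode is an anti-homomorphism of coalgebras. -/
theorem comul_antipode (h : H) : Coalgebra.comul (R := k) (HopfAlgebra.antipode k h) =
    TensorProduct.map (HopfAlgebra.antipode k) (HopfAlgebra.antipode k)
      (TensorProduct.comm k H H (Coalgebra.comul h)) := by
  let i₁ : H →ₐ[k] H ⊗[k] H := Algebra.TensorProduct.includeLeft
  let i₂ : H →ₐ[k] H ⊗[k] H := Algebra.TensorProduct.includeRight
  let S : H →ₗ[k] H := HopfAlgebra.antipode k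
  have h₁ : toConv (i₁.toLinearMap ∘ₗ S) * toConv (i₁.toLinearMap ∘ₗ LinearMap.id) = 1 :=
    algHom_toConv_mul i₁ antipode_mul_id
  have h₂ : toConv (i₂.toLinearMap ∘ₗ S) * toConv (i₂.toLinearMap ∘ₗ LinearMap.id) = 1 :=
    algHom_toConv_mul i₂ antipode_mul_id
  have hδ : toConv (i₁.toLinearMap ∘ₗ LinearMap.id) * toConv (i₂.toLinearMap ∘ₗ LinearMap.id) =
      toConv (Coalgebra.comul (R := k) (A := H)) := by
    refine ofConv_injective (LinearMap.ext fun h => ?_)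
    change mul' k _ (TensorProduct.map _ _ (Coalgebra.comul h)) = Coalgebra.comul h
    generalize Coalgebra.comul (R := k) h = t
    induction t with
    | zero => simp
    | add p q hp hq => simp only [map_add, hp, hq]
    | tmul p q => simp [i₁, i₂]
  have hG : toConv (i₂.toLinearMap ∘ₗ S) * toConv (i₁.toLinearMap ∘ₗ S) =
      toConv (TensorProduct.map S S ∘ₗ (TensorProduct.comm k H H).toLinearMap ∘ₗ
        Coalgebra.comul) := by
    refine ofConv_injective (LinearMap.ext fun h => ?_)
    change mul' k _ (TensorProduct.map _ _ (Coalgebra.comul h)) =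
      TensorProduct.map S S (TensorProduct.comm k H H (Coalgebra.comul h))
    generalize Coalgebra.comul (R := k) h = t
    induction t with
    | zero => simp
    | add p q hp hq => simp only [map_add, hp, hq]
    | tmul p q => simp [i₁, i₂]
  -- The comultiplication is the convolution product of the two inclusions `H → H ⊗ H`, so it has
  -- the product of their inverses in reverse order as a left inverse. Composing it with the
  -- antipode gives a right inverse, and the two coincide.
  have key := left_inv_eq_right_inv (a := toConv (Coalgebra.comul (R := k) (A := H)))
    (b := toConv (TensorProduct.map S S ∘ₗ (TensorProduct.comm k H H).toLinearMap ∘ₗ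
        Coalgebra.comul)) (by
      rw [← hG, ← hδ, _root_.mul_assoc, ← _root_.mul_assoc (toConv (i₁.toLinearMap ∘ₗ S)), h₁,
        _root_.one_mul, h₂]) comul_right_inv
  exact (LinearMap.congr_fun (toConv_injective key) h).symm

end Antipode

namespace CrossedSystem

open WithConv LinearMap

variable {k A H : Type u} [CommRing k] [Ring A] [Algebra k A] [Ring H] [HopfAlgebra k H]
variable {D : CrossedSystem k A H}

theorem fInv_mul_f (hf : D.InvertibleCocycle) : toConv (fInv hf) * toConv D.f = 1 :=
  hf.val_inv_mul

theorem f_mul_fInv (hf : D.InvertibleCocycle) : toConv D.f * toConv (fInv hf) = 1 :=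
  hf.mul_val_inv

variable (D) in
theorem mul_map_incl_gam {V W : Type u} [AddCommGroup V] [Module k V] [AddCommGroup W] [Module k W]
    (g : V →ₗ[k] A) (l : W →ₗ[k] H) (t : V ⊗[k] W) :
    mul' k D.E (TensorProduct.map (D.incl ∘ₗ g) (D.gam ∘ₗ l) t) =
      D.toE (TensorProduct.map g l t) := by
  induction t with
  | zero => simp
  | add p q hp hq => simp only [map_add, hp, hq]
  | tmul p q => simp [incl_mul_gam]

variable (D) in
-- The product of two elements `1 # h` and `1 # l` in convolution form; in this shape the invertible
-- factor `f` can be moved to the other side.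
theorem incl_f_mul_gam : toConv (D.incl ∘ₗ D.f) * toConv (D.gam ∘ₗ mul' k H) =
    toConv (mul' k D.E ∘ₗ TensorProduct.map D.gam D.gam) := by
  refine ofConv_injective (TensorProduct.ext' fun h l => ?_)
  change mul' k D.E (TensorProduct.map (D.incl ∘ₗ D.f) (D.gam ∘ₗ mul' k H)
    (Coalgebra.comul (h ⊗ₜ l))) = D.gam h * D.gam l
  rw [mul_map_incl_gam, gam_mul_gam]
  rfl

theorem incl_fInv_mul_gam_gam (hf : D.InvertibleCocycle) (z : H ⊗[k] H) :
    mul' k D.E (TensorProduct.map (D.incl ∘ₗ fInv hf)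
      (mul' k D.E ∘ₗ TensorProduct.map D.gam D.gam) (Coalgebra.comul z)) =
      D.gam (mul' k H z) := by
  have h : toConv (D.incl ∘ₗ fInv hf) * toConv (mul' k D.E ∘ₗ TensorProduct.map D.gam D.gam) =
      toConv (D.gam ∘ₗ mul' k H) := by
    rw [← incl_f_mul_gam, ← _root_.mul_assoc,
      show toConv (D.incl ∘ₗ fInv hf) * toConv (D.incl ∘ₗ D.f) = 1 from
        algHom_toConv_mul D.inclHom (fInv_mul_f hf), _root_.one_mul]
  exact LinearMap.congr_fun (toConv_injective h) z

/-- `a ⊗ (b ⊗ (c ⊗ d)) ↦ f⁻¹(S(b), c) (1 # S(a)) (1 # d)`. -/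
def gamInvMulAux (hf : D.InvertibleCocycle) : H ⊗[k] (H ⊗[k] (H ⊗[k] H)) →ₗ[k] D.E :=
  mul' k D.E ∘ₗ TensorProduct.map (D.incl ∘ₗ fInv hf ∘ₗ rTensor H (HopfAlgebra.antipode k))
      (mul' k D.E ∘ₗ TensorProduct.map (D.gam ∘ₗ HopfAlgebra.antipode k) D.gam)
    ∘ₗ (TensorProduct.leftComm k H (H ⊗[k] H) H).toLinearMap
    ∘ₗ lTensor H (TensorProduct.assoc k H H H).symm.toLinearMap

/-- Solve the product formula for `1 # h l` and insert `S(h⁽¹⁾)` and `h⁽²⁾`: the left side becomes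
`1 # S(h⁽¹⁾) h⁽²⁾ = ε(h)`. Since the antipode reverses the comultiplication, the other side is
`f⁻¹(S(h⁽²⁾), h⁽³⁾) (1 # S(h⁽¹⁾)) (1 # h⁽⁴⁾)`, which is the convolution product in question. -/
theorem conv_gamInv_gam (hf : D.InvertibleCocycle) :
    conv (gamInv hf) D.gam = Algebra.linearMap k D.E ∘ₗ Coalgebra.counit := by
  ext h
  have h₁ : conv (gamInv hf) D.gam h = gamInvMulAux hf (lTensor H
      ((TensorProduct.assoc k H H H).toLinearMap ∘ₗ rTensor H Coalgebra.comul)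
        (TensorProduct.assoc k H H H (rTensor H Coalgebra.comul (Coalgebra.comul h)))) := by
    rw [conv, comp_apply, comp_apply]
    generalize Coalgebra.comul (R := k) h = t
    induction t with
    | zero => simp
    | add p q hp hq => simp only [map_add, hp, hq]
    | tmul x y =>
      rw [TensorProduct.map_tmul, mul'_apply, rTensor_tmul, gamInv, comp_apply, comp_apply,
        comp_apply]
      generalize Coalgebra.comul (R := k) x = t
      induction t with
      | zero => simp
      | add p q hp hq => simp only [map_add, TensorProduct.add_tmul, add_mul, hp, hq]
      | tmul a b =>
        rw [TensorProduct.map_tmul, TensorProduct.assoc_tmul, lTensor_tmul, comp_apply, comp_apply,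
          comp_apply, rTensor_tmul]
        generalize Coalgebra.comul (R := k) b = t
        simp [gamInvMulAux, ← incl_mul_gam, _root_.mul_assoc]
  have h₂ : mul' k D.E (TensorProduct.map (D.incl ∘ₗ fInv hf)
      (mul' k D.E ∘ₗ TensorProduct.map D.gam D.gam) (Coalgebra.comul
        (rTensor H (HopfAlgebra.antipode k) (Coalgebra.comul h)))) =
      gamInvMulAux hf (lTensor H (lTensor H Coalgebra.comul)
        (TensorProduct.assoc k H H H (rTensor H Coalgebra.comul (Coalgebra.comul h)))) := by
    generalize Coalgebra.comul (R := k) h = t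
    induction t with
    | zero => simp
    | add p q hp hq => simp only [map_add, hp, hq]
    | tmul x y =>
      have e : ∀ x y : H, Coalgebra.comul (R := k) (x ⊗ₜ[k] y) =
        TensorProduct.tensorTensorTensorComm k H H H H (Coalgebra.comul x ⊗ₜ Coalgebra.comul y) :=
        fun _ _ => rfl
      rw [rTensor_tmul, rTensor_tmul, e, comul_antipode]
      generalize Coalgebra.comul (R := k) x = t
      induction t with
      | zero => simp
      | add p q hp hq => simp only [map_add, TensorProduct.add_tmul, hp, hq]
      | tmul a b =>
        rw [TensorProduct.assoc_tmul, lTensor_tmul, lTensor_tmul]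
        generalize Coalgebra.comul (R := k) y = t
        induction t with
        | zero => simp
        | add p q hp hq => simp only [map_add, TensorProduct.tmul_add, hp, hq]
        | tmul c d => simp [gamInvMulAux]
  rw [incl_fInv_mul_gam_gam, HopfAlgebra.mul_antipode_rTensor_comul_apply] at h₂
  rw [h₁]
  refine Eq.trans ?_ (h₂.symm.trans ?_)
  · rw [Coalgebra.coassoc_apply, ← lTensor_comp_apply, ← lTensor_comp_apply]
    congr 2
    ext h
    simp [Coalgebra.coassoc_apply]
  · rw [Algebra.algebraMap_eq_smul_one, map_smul, gam_one, comp_apply, Algebra.linearMap_apply,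
      Algebra.algebraMap_eq_smul_one]

theorem sh_gam_gamInv (hf : D.InvertibleCocycle) (h : H) :
    sh (cv D.gam) (cv (gamInv hf) h) = 1 ⊗ₜ h := by
  rw [sh_cv_cv, conv_gamInv_gam, cv_counit]

variable (D) in
/-- The identification of `A ⊗ (H ⊗ H)` with `E ⊗ H`. -/
def toEH : A ⊗[k] (H ⊗[k] H) ≃ₗ[k] D.E ⊗[k] H :=
  (TensorProduct.assoc k A H H).symm ≪≫ₗ TensorProduct.congr D.toE (LinearEquiv.refl k H)

theorem toEH_tmul (a : A) (g h : H) : D.toEH (a ⊗ₜ (g ⊗ₜ h)) = D.toE (a ⊗ₜ g) ⊗ₜ h := rfl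

/-- In the form `A ⊗ H ⊗ H`, right multiplication by `1 # h⁽¹⁾` first multiplies by the cocycle and
then sends `g ⊗ h` to `g h⁽¹⁾ ⊗ h⁽²⁾`. Both factors are maps `sh (cv _)` of convolution invertible
maps. -/
theorem sh_gam_toEH (w : A ⊗[k] (H ⊗[k] H)) : sh (cv D.gam) (D.toEH w) =
    D.toEH (lTensor A (sh (cv LinearMap.id)) (sh (cv D.f) w)) := by
  have hs : ∀ (a : A) (w : A ⊗[k] (H ⊗[k] H)), D.toEH (a • w) = D.incl a • D.toEH w := by
    intro a w
    induction w with
    | zero => simp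
    | add p q hp hq => simp only [map_add, smul_add, hp, hq]
    | tmul b z =>
      induction z with
      | zero => simp
      | add p q hp hq => simp only [map_add, smul_add, TensorProduct.tmul_add, hp, hq]
      | tmul g h =>
        rw [TensorProduct.smul_tmul', toEH_tmul, toEH_tmul, TensorProduct.smul_tmul', smul_eq_mul,
          smul_eq_mul, incl_mul_toE]
  have hl : ∀ (a : A) (w : A ⊗[k] (H ⊗[k] H)), lTensor A (sh (cv (LinearMap.id : H →ₗ[k] H)))
      (a • w) = a • lTensor A (sh (cv LinearMap.id)) w := by
    intro a w
    induction w with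
    | zero => simp
    | add p q hp hq => simp only [map_add, smul_add, hp, hq]
    | tmul b z => simp [TensorProduct.smul_tmul']
  suffices key : ∀ g h : H, D.gam g • cv D.gam h =
      D.toEH (lTensor A (sh (cv LinearMap.id)) (cv D.f (g ⊗ₜ h))) by
    induction w with
    | zero => simp
    | add p q hp hq => simp only [map_add, hp, hq]
    | tmul a z =>
      induction z with
      | zero => simp
      | add p q hp hq => simp only [map_add, TensorProduct.tmul_add, hp, hq]
      | tmul g h =>
        rw [toEH_tmul, ← incl_mul_gam, sh_tmul, sh_tmul, hl, hs, ← key, mul_smul]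
  intro g h
  let Φ : H ⊗[k] (H ⊗[k] H) →ₗ[k] D.E ⊗[k] H := D.toEH.toLinearMap
    ∘ₗ TensorProduct.map D.f (rTensor H (mul' k H) ∘ₗ (TensorProduct.assoc k H H H).symm.toLinearMap)
    ∘ₗ (TensorProduct.tensorTensorTensorComm k H H H (H ⊗[k] H)).toLinearMap
    ∘ₗ TensorProduct.mk k _ _ (Coalgebra.comul (R := k) g)
  have h₁ : D.gam g • cv D.gam h = Φ (TensorProduct.assoc k H H H
      (rTensor H Coalgebra.comul (Coalgebra.comul h))) := by
    rw [cv, comp_apply]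
    generalize Coalgebra.comul (R := k) h = t
    induction t with
    | zero => simp
    | add p q hp hq => simp only [map_add, smul_add, hp, hq]
    | tmul x y =>
      rw [rTensor_tmul, TensorProduct.smul_tmul', smul_eq_mul, gam_mul_gam, rTensor_tmul]
      have e : cocycleMul D.f (g ⊗ₜ x) = TensorProduct.map D.f (mul' k H)
        (TensorProduct.tensorTensorTensorComm k H H H H
          (Coalgebra.comul g ⊗ₜ Coalgebra.comul x)) := rfl
      rw [e]
      simp only [Φ, comp_apply, TensorProduct.mk_apply]
      generalize Coalgebra.comul (R := k) x = t
      generalize Coalgebra.comul (R := k) g = u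
      induction t with
      | zero => simp
      | add p q hp hq => simp only [map_add, TensorProduct.tmul_add, TensorProduct.add_tmul, hp, hq]
      | tmul a b =>
        induction u with
        | zero => simp
        | add p q hp hq =>
          simp only [map_add, TensorProduct.add_tmul, hp, hq]
        | tmul c d => simp [toEH_tmul]
  have h₂ : D.toEH (lTensor A (sh (cv LinearMap.id)) (cv D.f (g ⊗ₜ h))) =
      Φ (lTensor H Coalgebra.comul (Coalgebra.comul h)) := by
    have e : cv D.f (g ⊗ₜ h) = rTensor (H ⊗[k] H) D.f
        (TensorProduct.tensorTensorTensorComm k H H H H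
          (Coalgebra.comul g ⊗ₜ Coalgebra.comul h)) := rfl
    rw [e]
    simp only [Φ, comp_apply, TensorProduct.mk_apply]
    generalize Coalgebra.comul (R := k) h = t
    generalize Coalgebra.comul (R := k) g = u
    induction t with
    | zero => simp
    | add p q hp hq => simp only [map_add, TensorProduct.tmul_add, hp, hq]
    | tmul a b =>
      rw [lTensor_tmul]
      induction u with
      | zero => simp
      | add p q hp hq => simp only [map_add, TensorProduct.add_tmul, hp, hq]
      | tmul c d =>
        simp only [LinearEquiv.coe_coe, TensorProduct.tensorTensorTensorComm_tmul, rTensor_tmul,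
          lTensor_tmul, TensorProduct.map_tmul, comp_apply, sh_tmul, cv, rTensor_id, id_apply]
        generalize Coalgebra.comul (R := k) b = y
        congr 2
        induction y with
        | zero => simp
        | add p q hp hq => simp only [map_add, smul_add, TensorProduct.tmul_add, hp, hq]
        | tmul x y => simp [TensorProduct.smul_tmul']
  rw [h₁, h₂, coassoc_map]

theorem sh_gam_injective (hf : D.InvertibleCocycle) : Function.Injective (sh (cv D.gam)) := by
  have h₁ : ∀ w : A ⊗[k] (H ⊗[k] H), sh (cv (fInv hf)) (sh (cv D.f) w) = w := by
    intro w
    have e : sh (cv (fInv hf)) ∘ₗ cv D.f = TensorProduct.mk k A (H ⊗[k] H) 1 :=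
      LinearMap.ext fun z => by
        rw [comp_apply, sh_cv_cv, conv_eq_of_toConv (f_mul_fInv hf), cv_counit]; rfl
    rw [sh_sh, e, sh_mk]
  have h₂ : ∀ w : A ⊗[k] (H ⊗[k] H), lTensor A (sh (cv (HopfAlgebra.antipode k)))
      (lTensor A (sh (cv (LinearMap.id : H →ₗ[k] H))) w) = w := by
    intro w
    have e : sh (cv (HopfAlgebra.antipode k)) ∘ₗ cv (LinearMap.id : H →ₗ[k] H) =
        TensorProduct.mk k H H 1 :=
      LinearMap.ext fun z => by
        rw [comp_apply, sh_cv_cv, conv_eq_of_toConv id_mul_antipode, cv_counit]; rfl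
    rw [← lTensor_comp_apply, show sh (cv (HopfAlgebra.antipode k)) ∘ₗ
      sh (cv (LinearMap.id : H →ₗ[k] H)) = LinearMap.id from LinearMap.ext fun z => by
        rw [comp_apply, sh_sh, e, sh_mk]; rfl, lTensor_id, id_apply]
  refine Function.LeftInverse.injective (g := fun z => D.toEH (sh (cv (fInv hf))
    (lTensor A (sh (cv (HopfAlgebra.antipode k))) (D.toEH.symm z)))) fun z => ?_
  obtain ⟨w, rfl⟩ := D.toEH.surjective z
  simp only [sh_gam_toEH, LinearEquiv.symm_apply_apply, h₁, h₂]

/-- The other composite is the identity and `sh (cv D.gam)` is injective, so a one-sided inverse is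
two-sided. No direct computation with `f⁻¹` on this side is needed. -/
theorem sh_gamInv_gam (hf : D.InvertibleCocycle) (h : H) :
    sh (cv (gamInv hf)) (cv D.gam h) = 1 ⊗ₜ h := by
  apply sh_gam_injective hf
  have e : sh (cv D.gam) ∘ₗ cv (gamInv hf) = TensorProduct.mk k D.E H 1 :=
    LinearMap.ext (sh_gam_gamInv hf)
  rw [sh_sh, e, sh_mk, sh_tmul, one_smul]

end CrossedSystem

/-! ### Coactions iterated over the letters of a word -/

section Coaction

variable {k : Type u} [CommRing k] {R : Type u} [Ring R] [Algebra k R]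
variable {V V' : Type u} [AddCommGroup V] [Module k V] [AddCommGroup V'] [Module k V']
variable {Q Q' : Type u} [AddCommGroup Q] [Module k Q] [AddCommGroup Q'] [Module k Q']

/-- For `c(v) = ∑ x ⊗ v'`, the map `v ⊗ (e ⊗ q) ↦ ∑ x e ⊗ (v' ⊗ q)`. -/
def lft (c : V →ₗ[k] R ⊗[k] V) (Q : Type u) [AddCommGroup Q] [Module k Q] :
    V ⊗[k] (R ⊗[k] Q) →ₗ[k] R ⊗[k] (V ⊗[k] Q) :=
  LinearMap.rTensor (V ⊗[k] Q) (LinearMap.mul' k R)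
    ∘ₗ (TensorProduct.tensorTensorTensorComm k R V R Q).toLinearMap ∘ₗ LinearMap.rTensor _ c

/-- For `c(v) = ∑ x ⊗ v'`, the map `v ⊗ (e ⊗ q) ↦ ∑ e x ⊗ (v' ⊗ q)`. -/
def rgt (c : V →ₗ[k] R ⊗[k] V) (Q : Type u) [AddCommGroup Q] [Module k Q] :
    V ⊗[k] (R ⊗[k] Q) →ₗ[k] R ⊗[k] (V ⊗[k] Q) :=
  LinearMap.rTensor (V ⊗[k] Q) (LinearMap.mul' k R ∘ₗ (TensorProduct.comm k R R).toLinearMap)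
    ∘ₗ (TensorProduct.tensorTensorTensorComm k R V R Q).toLinearMap ∘ₗ LinearMap.rTensor _ c

theorem lft_tmul (c : V →ₗ[k] R ⊗[k] V) (v : V) (e : R) (q : Q) :
    lft c Q (v ⊗ₜ (e ⊗ₜ q)) =
      TensorProduct.map (LinearMap.mulRight k e) ((TensorProduct.mk k V Q).flip q) (c v) := by
  simp only [lft, LinearMap.comp_apply, LinearMap.rTensor_tmul]
  generalize c v = y
  induction y with
  | zero => simp
  | add x y hx hy => simp only [map_add, TensorProduct.add_tmul, hx, hy]
  | tmul x v => simp

theorem rgt_tmul (c : V →ₗ[k] R ⊗[k] V) (v : V) (e : R) (q : Q) :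
    rgt c Q (v ⊗ₜ (e ⊗ₜ q)) =
      e • LinearMap.lTensor R ((TensorProduct.mk k V Q).flip q) (c v) := by
  simp only [rgt, LinearMap.comp_apply, LinearMap.rTensor_tmul]
  generalize c v = y
  induction y with
  | zero => simp
  | add x y hx hy => simp only [map_add, TensorProduct.add_tmul, smul_add, hx, hy]
  | tmul x v => simp [TensorProduct.smul_tmul']

theorem lft_map {c : V →ₗ[k] R ⊗[k] V} {c' : V' →ₗ[k] R ⊗[k] V'} (g : V →ₗ[k] V')
    (h : ∀ v, c' (g v) = LinearMap.lTensor R g (c v)) (f : Q →ₗ[k] Q') (v : V) (z : R ⊗[k] Q) :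
    lft c' Q' (g v ⊗ₜ LinearMap.lTensor R f z) =
      LinearMap.lTensor R (TensorProduct.map g f) (lft c Q (v ⊗ₜ z)) := by
  induction z with
  | zero => simp
  | add x y hx hy => simp only [map_add, TensorProduct.tmul_add, hx, hy]
  | tmul e q =>
    rw [LinearMap.lTensor_tmul, lft_tmul, lft_tmul, h]
    generalize c v = y
    induction y with
    | zero => simp
    | add x y hx hy => simp only [map_add, hx, hy]
    | tmul x v => simp

theorem lft_lTensor (c : V →ₗ[k] R ⊗[k] V) (f : Q →ₗ[k] Q') (v : V) (z : R ⊗[k] Q) :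
    lft c Q' (v ⊗ₜ LinearMap.lTensor R f z) =
      LinearMap.lTensor R (LinearMap.lTensor V f) (lft c Q (v ⊗ₜ z)) :=
  lft_map LinearMap.id (fun v => by rw [LinearMap.lTensor_id]; rfl) f v z

theorem rgt_smul (c : V →ₗ[k] R ⊗[k] V) (e : R) (v : V) (z : R ⊗[k] Q) :
    rgt c Q (v ⊗ₜ (e • z)) = e • rgt c Q (v ⊗ₜ z) := by
  induction z with
  | zero => simp
  | add x y hx hy => simp only [map_add, TensorProduct.tmul_add, smul_add, hx, hy]
  | tmul x q => rw [TensorProduct.smul_tmul', rgt_tmul, rgt_tmul, smul_eq_mul, mul_smul]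

theorem sh_lft (c : V →ₗ[k] R ⊗[k] V) (L : Q →ₗ[k] R ⊗[k] Q') (v : V) (z : R ⊗[k] Q)
    (G : V ⊗[k] Q →ₗ[k] R ⊗[k] (V ⊗[k] Q'))
    (hG : ∀ v q, G (v ⊗ₜ q) = LinearMap.lTensor R (TensorProduct.mk k V Q' v) (L q)) :
    sh G (lft c Q (v ⊗ₜ z)) = lft c Q' (v ⊗ₜ sh L z) := by
  induction z with
  | zero => simp
  | add x y hx hy => simp only [map_add, TensorProduct.tmul_add, hx, hy]
  | tmul e q =>
    rw [lft_tmul, sh_tmul]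
    have h : ∀ y : R ⊗[k] V, sh G (TensorProduct.map (LinearMap.mulRight k e)
        ((TensorProduct.mk k V Q).flip q) y) = LinearMap.rTensor (V ⊗[k] Q') (LinearMap.mul' k R)
          (TensorProduct.tensorTensorTensorComm k R V R Q' (y ⊗ₜ (e • L q))) := by
      intro y
      induction y with
      | zero => simp
      | add x y hx hy => simp only [map_add, TensorProduct.add_tmul, hx, hy]
      | tmul x v =>
        rw [TensorProduct.map_tmul, sh_tmul, LinearMap.flip_apply, TensorProduct.mk_apply, hG]
        generalize L q = w
        induction w with
        | zero => simp
        | add x y hx hy => simp only [map_add, smul_add, TensorProduct.tmul_add, hx, hy]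
        | tmul f q => simp [TensorProduct.smul_tmul', _root_.mul_assoc]
    exact h (c v)

/-- For a map `c(v) = ∑ x ⊗ v'`, the map `v₁ ⊗ ⋯ ⊗ v_s ↦ ∑ x₁ ⋯ x_s ⊗ (v₁' ⊗ ⋯ ⊗ v_s')`. -/
def lftPow (c : V →ₗ[k] R ⊗[k] V) : (s : ℕ) → TPow k V s →ₗ[k] R ⊗[k] TPow k V s
  | 0 => TensorProduct.mk k R (TPow k V 0) 1
  | s + 1 => LinearMap.lTensor R cons.toLinearMap ∘ₗ lft c (TPow k V s)
      ∘ₗ LinearMap.lTensor V (lftPow c s) ∘ₗ cons.symm.toLinearMap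

/-- For a map `c(v) = ∑ x ⊗ v'`, the map `v₁ ⊗ ⋯ ⊗ v_s ↦ ∑ x_s ⋯ x₁ ⊗ (v₁' ⊗ ⋯ ⊗ v_s')`. -/
def rgtPow (c : V →ₗ[k] R ⊗[k] V) : (s : ℕ) → TPow k V s →ₗ[k] R ⊗[k] TPow k V s
  | 0 => TensorProduct.mk k R (TPow k V 0) 1
  | s + 1 => LinearMap.lTensor R cons.toLinearMap ∘ₗ rgt c (TPow k V s)
      ∘ₗ LinearMap.lTensor V (rgtPow c s) ∘ₗ cons.symm.toLinearMap

theorem lftPow_cons_eq (c : V →ₗ[k] R ⊗[k] V) (s : ℕ) (y : V ⊗[k] TPow k V s) :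
    lftPow c (s + 1) (cons.toLinearMap y) = LinearMap.lTensor R cons.toLinearMap
      ((lft c (TPow k V s) ∘ₗ LinearMap.lTensor V (lftPow c s)) y) := rfl

theorem lftPow_cons (c : V →ₗ[k] R ⊗[k] V) (s : ℕ) (v : V) (p : TPow k V s) :
    lftPow c (s + 1) (cons (v ⊗ₜ p)) =
      LinearMap.lTensor R cons.toLinearMap (lft c _ (v ⊗ₜ lftPow c s p)) := rfl

theorem rgtPow_cons_eq (c : V →ₗ[k] R ⊗[k] V) (s : ℕ) (y : V ⊗[k] TPow k V s) :
    rgtPow c (s + 1) (cons.toLinearMap y) = LinearMap.lTensor R cons.toLinearMap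
      ((rgt c (TPow k V s) ∘ₗ LinearMap.lTensor V (rgtPow c s)) y) := rfl

theorem rgtPow_cons (c : V →ₗ[k] R ⊗[k] V) (s : ℕ) (v : V) (p : TPow k V s) :
    rgtPow c (s + 1) (cons (v ⊗ₜ p)) =
      LinearMap.lTensor R cons.toLinearMap (rgt c _ (v ⊗ₜ rgtPow c s p)) := rfl

theorem lftPow_powMap {c : V →ₗ[k] R ⊗[k] V} {c' : V' →ₗ[k] R ⊗[k] V'} (g : V →ₗ[k] V')
    (h : ∀ v, c' (g v) = LinearMap.lTensor R g (c v)) (s : ℕ) (p : TPow k V s) :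
    lftPow c' s (powMap g s p) = LinearMap.lTensor R (powMap g s) (lftPow c s p) := by
  suffices e : lftPow c' s ∘ₗ powMap g s = LinearMap.lTensor R (powMap g s) ∘ₗ lftPow c s from
    LinearMap.congr_fun e p
  clear p
  induction s with
  | zero => exact LinearMap.ext fun x => rfl
  | succ s ih =>
    refine TPow.hom_ext fun v p => ?_
    have e := LinearMap.congr_fun ih p
    rw [LinearMap.comp_apply, LinearMap.comp_apply] at e
    rw [LinearMap.comp_apply, LinearMap.comp_apply, powMap_cons, lftPow_cons, lftPow_cons, e,
      lft_map g h, ← LinearMap.lTensor_comp_apply, ← LinearMap.lTensor_comp_apply]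
    rfl

/-- The product `x₁ ⋯ x_s y_s ⋯ y₁` cancels from the inside: the last letters cancel first, by
induction, and then the first letter. -/
theorem sh_rgtPow_lftPow {c c' : V →ₗ[k] R ⊗[k] V} (h : ∀ v, sh c' (c v) = 1 ⊗ₜ v) (s : ℕ)
    (p : TPow k V s) : sh (rgtPow c' s) (lftPow c s p) = 1 ⊗ₜ p := by
  suffices e : sh (rgtPow c' s) ∘ₗ lftPow c s = TensorProduct.mk k R _ 1 from
    LinearMap.congr_fun e p
  clear p
  induction s with
  | zero => exact LinearMap.ext fun x => by simp [lftPow, rgtPow]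
  | succ s ih =>
    refine TPow.hom_ext fun v p => ?_
    have e := LinearMap.congr_fun ih p
    rw [LinearMap.comp_apply, TensorProduct.mk_apply] at e
    have key : ∀ z : R ⊗[k] TPow k V s, sh (rgtPow c' (s + 1)) (LinearMap.lTensor R
        cons.toLinearMap (lft c _ (v ⊗ₜ z))) = LinearMap.lTensor R cons.toLinearMap
          (sh (rgt c' _ ∘ₗ (TensorProduct.mk k V _).flip (sh (rgtPow c' s) z)) (c v)) := by
      intro z
      rw [sh_comm (rgtPow_cons_eq c' s)]
      congr 1
      induction z with
      | zero =>
        simp only [map_zero, TensorProduct.tmul_zero]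
        generalize c v = y
        induction y with
        | zero => simp
        | add x y hx hy => rw [map_add, ← hx, ← hy, zero_add]
        | tmul x v => simp
      | add x y hx hy =>
        rw [TensorProduct.tmul_add, map_add, map_add, hx, hy, map_add, map_add,
          LinearMap.comp_add, sh_add]
      | tmul e q =>
        rw [lft_tmul, sh_tmul]
        generalize c v = y
        induction y with
        | zero => simp
        | add x y hx hy => simp only [map_add, hx, hy]
        | tmul x v => simp [rgt_smul, mul_smul]
    rw [LinearMap.comp_apply, lftPow_cons, key, e]
    have h₁ : rgt c' _ ∘ₗ (TensorProduct.mk k V _).flip ((1 : R) ⊗ₜ p) =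
        LinearMap.lTensor R ((TensorProduct.mk k V _).flip p) ∘ₗ c' :=
      LinearMap.ext fun v => by
        rw [LinearMap.comp_apply, LinearMap.flip_apply, TensorProduct.mk_apply, rgt_tmul, one_smul]
        rfl
    have h₂ : sh (LinearMap.lTensor R ((TensorProduct.mk k V _).flip p) ∘ₗ c') (c v) =
        LinearMap.lTensor R ((TensorProduct.mk k V _).flip p) (sh c' (c v)) := by
      rw [← sh_comm (f' := LinearMap.lTensor R ((TensorProduct.mk k V _).flip p) ∘ₗ c')
        (g := LinearMap.id) (fun v => rfl), LinearMap.lTensor_id]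
      rfl
    rw [h₁, h₂, h]
    rfl

/-- In `y_s ⋯ y₁ x₁ ⋯ x_s` the first letter cancels first, and the rest is the induction hypothesis.
-/
theorem sh_lftPow_rgtPow {c c' : V →ₗ[k] R ⊗[k] V} (h : ∀ v, sh c (c' v) = 1 ⊗ₜ v) (s : ℕ)
    (p : TPow k V s) : sh (lftPow c s) (rgtPow c' s p) = 1 ⊗ₜ p := by
  suffices e : sh (lftPow c s) ∘ₗ rgtPow c' s = TensorProduct.mk k R _ 1 from
    LinearMap.congr_fun e p
  clear p
  induction s with
  | zero => exact LinearMap.ext fun x => by simp [lftPow, rgtPow]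
  | succ s ih =>
    refine TPow.hom_ext fun v p => ?_
    have e := LinearMap.congr_fun ih p
    rw [LinearMap.comp_apply, TensorProduct.mk_apply] at e
    have key : ∀ z : R ⊗[k] TPow k V s, sh (lftPow c (s + 1)) (LinearMap.lTensor R
        cons.toLinearMap (rgt c' _ (v ⊗ₜ z))) = LinearMap.lTensor R (cons.toLinearMap ∘ₗ
          TensorProduct.mk k V _ v) (sh (lftPow c s) z) := by
      intro z
      rw [sh_comm (lftPow_cons_eq c s),
        LinearMap.lTensor_comp_apply]
      congr 1
      induction z with
      | zero => simp
      | add x y hx hy => simp only [map_add, TensorProduct.tmul_add, hx, hy]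
      | tmul e q =>
        have h₁ : ∀ w y, sh (lft c (TPow k V s) ∘ₗ (TensorProduct.mk k V _).flip w) y =
            LinearMap.rTensor _ (LinearMap.mul' k R)
              (TensorProduct.tensorTensorTensorComm k R V R _ (sh c y ⊗ₜ w)) := by
          intro w y
          induction y with
          | zero => simp
          | add x y hx hy => simp only [map_add, TensorProduct.add_tmul, hx, hy]
          | tmul x v =>
            induction w with
            | zero => simp
            | add w w' hx hy =>
              rw [map_add, LinearMap.comp_add, sh_add, hx, hy, TensorProduct.tmul_add, map_add,
                map_add]
            | tmul f q =>
              rw [sh_tmul, sh_tmul, LinearMap.comp_apply, LinearMap.flip_apply,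
                TensorProduct.mk_apply, lft_tmul]
              generalize c v = y
              induction y with
              | zero => simp
              | add x y hx hy => simp only [map_add, smul_add, TensorProduct.add_tmul, hx, hy]
              | tmul x v => simp [TensorProduct.smul_tmul', _root_.mul_assoc]
        rw [rgt_tmul, sh_smul, sh_tmul, lTensor_smul]
        congr 1
        have h₂ : sh (lft c _ ∘ₗ LinearMap.lTensor V (lftPow c s)) (LinearMap.lTensor R
            ((TensorProduct.mk k V _).flip q) (c' v)) =
            sh (lft c _ ∘ₗ (TensorProduct.mk k V _).flip (lftPow c s q)) (c' v) := by
          rw [← LinearMap.id_apply (R := k) (sh _ (c' v)), ← LinearMap.lTensor_id]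
          exact sh_comm (fun v => by rw [LinearMap.lTensor_id]; rfl) _
        rw [h₂, h₁, h]
        generalize lftPow c s q = w
        induction w with
        | zero => simp
        | add x y hx hy => simp only [map_add, TensorProduct.tmul_add, hx, hy]
        | tmul f q => simp
    rw [LinearMap.comp_apply, rgtPow_cons, key, e]
    rfl

/-- The map induced by `c : V → R ⊗ V` on a quotient of `V`. -/
theorem exists_coaction {c : V →ₗ[k] R ⊗[k] V} (P : Submodule k V)
    (h : ∀ v ∈ P, LinearMap.lTensor R P.mkQ (c v) = 0) :
    ∃ c₁ : V ⧸ P →ₗ[k] R ⊗[k] (V ⧸ P), ∀ v, c₁ (P.mkQ v) = LinearMap.lTensor R P.mkQ (c v) :=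
  ⟨P.liftQ (LinearMap.lTensor R P.mkQ ∘ₗ c) h, fun _ => rfl⟩

theorem sh_descends {c c' : V →ₗ[k] R ⊗[k] V} {c₁ c₁' : V' →ₗ[k] R ⊗[k] V'} {g : V →ₗ[k] V'}
    (hg : Function.Surjective g) (h₁ : ∀ v, c₁ (g v) = LinearMap.lTensor R g (c v))
    (h₂ : ∀ v, c₁' (g v) = LinearMap.lTensor R g (c' v)) (h : ∀ v, sh c' (c v) = 1 ⊗ₜ v) (v : V') :
    sh c₁' (c₁ v) = 1 ⊗ₜ v := by
  obtain ⟨v, rfl⟩ := hg v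
  rw [h₁, sh_comm h₂, h, LinearMap.lTensor_tmul]

end Coaction

section Sh

variable {k : Type u} [CommRing k] {R : Type u} [Ring R] [Algebra k R]
variable {V W W' : Type u} [AddCommGroup V] [Module k V] [AddCommGroup W] [Module k W]
variable [AddCommGroup W'] [Module k W']

theorem sh_map_mulRight (f : V →ₗ[k] R ⊗[k] W) (e : R) (g : W →ₗ[k] W') (z : R ⊗[k] V) :
    sh (TensorProduct.map (LinearMap.mulRight k e) g ∘ₗ f) z =
      TensorProduct.map (LinearMap.mulRight k e) g (sh f z) := by
  induction z with
  | zero => simp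
  | add x y hx hy => simp only [map_add, hx, hy]
  | tmul x v =>
    rw [sh_tmul, sh_tmul, LinearMap.comp_apply]
    generalize f v = y
    induction y with
    | zero => simp
    | add x y hx hy => simp only [map_add, smul_add, hx, hy]
    | tmul x v => simp [TensorProduct.smul_tmul', mul_assoc]

theorem sh_zero (z : R ⊗[k] V) : sh (0 : V →ₗ[k] R ⊗[k] W) z = 0 := by
  induction z with
  | zero => simp
  | add x y hx hy => rw [map_add, hx, hy, add_zero]
  | tmul x v => simp

theorem sh_lTensor {V' : Type u} [AddCommGroup V'] [Module k V'] (f : V' →ₗ[k] R ⊗[k] W)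
    (g : V →ₗ[k] V') (z : R ⊗[k] V) : sh f (LinearMap.lTensor R g z) = sh (f ∘ₗ g) z := by
  induction z with
  | zero => simp
  | add x y hx hy => simp only [map_add, hx, hy]
  | tmul x v => simp

theorem sh_lTensor_comp (f : V →ₗ[k] R ⊗[k] W) (g : W →ₗ[k] W') (z : R ⊗[k] V) :
    sh (LinearMap.lTensor R g ∘ₗ f) z = LinearMap.lTensor R g (sh f z) := by
  induction z with
  | zero => simp
  | add x y hx hy => simp only [map_add, hx, hy]
  | tmul x v => simp

end Sh

/-! ### The effect of multiplying by `(1 # h₁⁽¹⁾) ⋯ (1 # h_s⁽¹⁾)` on the terms of `d̂` -/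

namespace CrossedSystem

variable {k A H : Type u} [CommRing k] [Ring A] [Algebra k A] [Ring H] [HopfAlgebra k H]
variable (D : CrossedSystem k A H)

theorem gamPow_cons (s : ℕ) (h : H) (p : TPow k H s) :
    D.gamPow (s + 1) (cons (h ⊗ₜ p)) = D.gam h * D.gamPow s p := rfl

theorem revProd_cons {V B : Type u} [AddCommGroup V] [Module k V] [Ring B] [Algebra k B]
    (g : V →ₗ[k] B) (s : ℕ) (v : V) (p : TPow k V s) :
    revProd g (s + 1) (cons (v ⊗ₜ p)) = revProd g s p * g v := rfl

/-- The coaction of the whole word is built letter by letter, which makes `θ` accessible to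
induction on `s`. -/
theorem cv_gamPow (s : ℕ) : cv (D.gamPow s) = lftPow (cv D.gam) s := by
  induction s with
  | zero =>
    refine TPow.hom_ext_nil ?_
    rw [cv, LinearMap.comp_apply, comul_nil]
    simp [lftPow, gamPow, prodPow, powMap_nil]
  | succ s ih =>
    refine TPow.hom_ext fun h p => ?_
    rw [lftPow_cons, ← ih, cv_apply, cv_apply, comul_cons]
    generalize Coalgebra.comul (R := k) p = t
    induction t with
    | zero => simp
    | add p q hp hq => simp only [map_add, TensorProduct.tmul_add, hp, hq]
    | tmul p q =>
      rw [LinearMap.rTensor_tmul, lft_tmul, cv_apply]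
      generalize Coalgebra.comul (R := k) h = t
      induction t with
      | zero => simp
      | add p q hp hq => simp only [map_add, TensorProduct.add_tmul, hp, hq]
      | tmul a b => simp [gamPow_cons]

theorem cv_revProd (g : H →ₗ[k] D.E) (s : ℕ) : cv (revProd g s) = rgtPow (cv g) s := by
  induction s with
  | zero =>
    refine TPow.hom_ext_nil ?_
    rw [cv, LinearMap.comp_apply, comul_nil]
    simp [rgtPow, revProd]
  | succ s ih =>
    refine TPow.hom_ext fun h p => ?_
    rw [rgtPow_cons, ← ih, cv_apply, cv_apply, comul_cons]
    generalize Coalgebra.comul (R := k) p = t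
    induction t with
    | zero => simp
    | add p q hp hq => simp only [map_add, TensorProduct.tmul_add, hp, hq]
    | tmul p q =>
      rw [LinearMap.rTensor_tmul, rgt_tmul, cv_apply]
      generalize Coalgebra.comul (R := k) h = t
      induction t with
      | zero => simp
      | add p q hp hq => simp only [map_add, smul_add, TensorProduct.add_tmul, hp, hq]
      | tmul a b => simp [revProd_cons, TensorProduct.smul_tmul']

theorem conv_incl_gam (a : A) (h : H) :
    conv (D.incl ∘ₗ D.act.flip a) D.gam h = D.gam h * D.incl a := by
  rw [gam_mul_incl, conv, LinearMap.comp_apply, LinearMap.comp_apply]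
  exact D.mul_map_incl_gam (D.act.flip a) LinearMap.id _

/-- The commutation rule `(1 # h) a = a^{h⁽¹⁾} (1 # h⁽²⁾)`, repeated for each letter: the iterated
action disappears when `a` is moved to the right end of the product. This turns the first term of
`d̂⁰` into that of `d̄⁰`. -/
theorem conv_incl_gamPow (a : A) (s : ℕ) (p : TPow k H s) :
    conv (D.incl ∘ₗ (D.actPow s).flip a) (D.gamPow s) p = D.gamPow s p * D.incl a := by
  suffices e : conv (D.incl ∘ₗ (D.actPow s).flip a) (D.gamPow s) =
    LinearMap.mulRight k (D.incl a) ∘ₗ D.gamPow s from LinearMap.congr_fun e p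
  clear p
  induction s with
  | zero =>
    refine TPow.hom_ext_nil ?_
    rw [conv, LinearMap.comp_apply, LinearMap.comp_apply, comul_nil]
    simp [gamPow, prodPow, powMap_nil, actPow]
  | succ s ih =>
    refine TPow.hom_ext fun h p => ?_
    have e := LinearMap.congr_fun ih p
    rw [LinearMap.comp_apply, LinearMap.mulRight_apply] at e
    rw [LinearMap.comp_apply, LinearMap.mulRight_apply, gamPow_cons, _root_.mul_assoc, ← e, conv,
      conv, LinearMap.comp_apply, LinearMap.comp_apply, LinearMap.comp_apply, LinearMap.comp_apply,
      comul_cons]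
    generalize Coalgebra.comul (R := k) p = t
    induction t with
    | zero => simp
    | add p q hp hq => simp only [map_add, TensorProduct.tmul_add, mul_add, hp, hq]
    | tmul p q =>
      rw [TensorProduct.map_tmul, LinearMap.mul'_apply, ← _root_.mul_assoc, LinearMap.comp_apply,
        ← conv_incl_gam, conv, LinearMap.comp_apply, LinearMap.comp_apply]
      generalize Coalgebra.comul (R := k) h = t
      induction t with
      | zero => simp
      | add p q hp hq => simp only [map_add, TensorProduct.add_tmul, add_mul, hp, hq]
      | tmul a b => simp [gamPow_cons, actPow_cons, _root_.mul_assoc]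

theorem sh_lftPow_act (a : A) (s : ℕ) (p : TPow k H s) :
    sh (lftPow (cv D.gam) s) (cv (D.incl ∘ₗ (D.actPow s).flip a) p) =
      sh (TensorProduct.mk k D.E (TPow k H s) (D.incl a)) (lftPow (cv D.gam) s p) := by
  rw [← cv_gamPow, sh_cv_cv, cv, cv, LinearMap.comp_apply, LinearMap.comp_apply]
  generalize Coalgebra.comul (R := k) p = t
  induction t with
  | zero => simp
  | add p q hp hq => simp only [map_add, hp, hq]
  | tmul p q =>
    rw [LinearMap.rTensor_tmul, LinearMap.rTensor_tmul, conv_incl_gamPow, sh_tmul,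
      TensorProduct.mk_apply, TensorProduct.smul_tmul', smul_eq_mul]

section Lft

variable {Q : Type u} [AddCommGroup Q] [Module k Q]

theorem sh_lft_flip (w : D.E ⊗[k] H) (e : D.E) (q : Q) :
    sh (lft (cv D.gam) Q ∘ₗ (TensorProduct.mk k H _).flip (e ⊗ₜ q)) w =
      TensorProduct.map (LinearMap.mulRight k e) ((TensorProduct.mk k H Q).flip q)
        (sh (cv D.gam) w) := by
  rw [← sh_map_mulRight]
  congr 1
  congr 1
  ext h
  rw [LinearMap.comp_apply, LinearMap.flip_apply, TensorProduct.mk_apply, lft_tmul]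
  rfl

theorem lft_incl_smul (h : H) (a : A) (z : D.E ⊗[k] Q) :
    lft (cv D.gam) Q (h ⊗ₜ (D.incl a • z)) =
      sh (lft (cv D.gam) Q ∘ₗ (TensorProduct.mk k H _).flip z)
        (cv (D.incl ∘ₗ D.act.flip a) h) := by
  induction z with
  | zero => rw [smul_zero, TensorProduct.tmul_zero, map_zero, map_zero, LinearMap.comp_zero, sh_zero]
  | add x y hx hy =>
    rw [smul_add, TensorProduct.tmul_add, map_add, hx, hy, map_add, LinearMap.comp_add, sh_add]
  | tmul e q =>
    rw [TensorProduct.smul_tmul', lft_tmul, sh_lft_flip, sh_cv_cv, cv, cv, LinearMap.comp_apply,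
      LinearMap.comp_apply]
    generalize Coalgebra.comul (R := k) h = t
    induction t with
    | zero => simp
    | add p q hp hq => simp only [map_add, hp, hq]
    | tmul x y => simp [conv_incl_gam, _root_.mul_assoc]

theorem cv_gam_mul (z : H ⊗[k] H) : cv D.gam (LinearMap.mul' k H z) =
    LinearMap.lTensor D.E (LinearMap.mul' k H) (cv (D.gam ∘ₗ LinearMap.mul' k H) z) := by
  have h : Coalgebra.comul (R := k) (LinearMap.mul' k H z) =
      TensorProduct.map (LinearMap.mul' k H) (LinearMap.mul' k H) (Coalgebra.comul z) :=
    (LinearMap.congr_fun (Bialgebra.mulCoalgHom k H).map_comp_comul z).symm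
  rw [cv, cv, LinearMap.comp_apply, LinearMap.comp_apply, h]
  generalize Coalgebra.comul (R := k) z = t
  induction t with
  | zero => simp
  | add p q hp hq => simp only [map_add, hp, hq]
  | tmul x y => simp

/-- The cocycle times `1 # h⁽²⁾ l⁽²⁾` is the product of `1 # h⁽¹⁾` and `1 # l⁽¹⁾`, so it is absorbed
and only the plain product of the letters remains. -/
theorem sh_gam_cocycleMul (z : H ⊗[k] H) :
    sh (cv D.gam) (LinearMap.rTensor H D.incl (cocycleMul D.f z)) =
      LinearMap.lTensor D.E (LinearMap.mul' k H)
        (cv (LinearMap.mul' k D.E ∘ₗ TensorProduct.map D.gam D.gam) z) := by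
  have h : LinearMap.rTensor H D.incl (cocycleMul D.f z) =
      LinearMap.lTensor D.E (LinearMap.mul' k H) (cv (D.incl ∘ₗ D.f) z) := by
    rw [cocycleMul, cv, LinearMap.comp_apply, LinearMap.comp_apply]
    generalize Coalgebra.comul (R := k) z = t
    induction t with
    | zero => simp
    | add p q hp hq => simp only [map_add, hp, hq]
    | tmul x y => simp
  rw [h, sh_comm D.cv_gam_mul, sh_cv_cv, conv_eq_of_toConv D.incl_f_mul_gam]

theorem lft_merge {s : ℕ} (h l : H) (z : D.E ⊗[k] TPow k H s) :
    LinearMap.lTensor D.E cons.toLinearMap (sh (lft (cv D.gam) _ ∘ₗ (TensorProduct.mk k H _).flip z)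
        (LinearMap.rTensor H D.incl (cocycleMul D.f (h ⊗ₜ l)))) =
      LinearMap.lTensor D.E (mulAt 0 s) (LinearMap.lTensor D.E cons.toLinearMap
        (lft (cv D.gam) _ (h ⊗ₜ LinearMap.lTensor D.E cons.toLinearMap
          (lft (cv D.gam) _ (l ⊗ₜ z))))) := by
  induction z with
  | zero => rw [map_zero, LinearMap.comp_zero, sh_zero]; simp
  | add x y hx hy =>
    rw [map_add, LinearMap.comp_add, sh_add, map_add, hx, hy]
    simp only [map_add, TensorProduct.tmul_add]
  | tmul e q =>
    rw [sh_lft_flip, sh_gam_cocycleMul, lft_tmul, cv, cv, LinearMap.comp_apply,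
      LinearMap.comp_apply]
    have e₁ : Coalgebra.comul (R := k) (h ⊗ₜ[k] l) =
      TensorProduct.tensorTensorTensorComm k H H H H (Coalgebra.comul h ⊗ₜ Coalgebra.comul l) := rfl
    rw [e₁]
    generalize Coalgebra.comul (R := k) l = t
    induction t with
    | zero => simp
    | add p q hp hq => simp only [map_add, TensorProduct.tmul_add, hp, hq]
    | tmul x y =>
      rw [LinearMap.rTensor_tmul, TensorProduct.map_tmul, LinearMap.lTensor_tmul, lft_tmul,
        LinearMap.comp_apply]
      generalize Coalgebra.comul (R := k) h = t
      induction t with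
      | zero => simp
      | add p q hp hq => simp only [map_add, TensorProduct.add_tmul, hp, hq]
      | tmul a b => simp [mulAt_zero, _root_.mul_assoc]

end Lft

/-- Merging with cocycle becomes plain multiplication of two letters. The cocycle has been moved to
the front by the action, and multiplying by the elements `1 # h` brings it back to the place where
it is absorbed. -/
theorem sh_lftPow_mergeAt (j s : ℕ) (t : TPow k H (s + 2)) :
    sh (lftPow (cv D.gam) (s + 1)) (LinearMap.rTensor _ D.incl (D.mergeAt j s t)) =
      LinearMap.lTensor D.E (mulAt j s) (lftPow (cv D.gam) (s + 2) t) := by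
  suffices e : sh (lftPow (cv D.gam) (s + 1)) ∘ₗ LinearMap.rTensor _ D.incl ∘ₗ D.mergeAt j s =
    LinearMap.lTensor D.E (mulAt j s) ∘ₗ lftPow (cv D.gam) (s + 2) from LinearMap.congr_fun e t
  clear t
  induction j generalizing s with
  | zero =>
    refine TPow.hom_ext fun h t => ?_
    obtain ⟨z, rfl⟩ := cons.surjective t
    induction z with
    | zero => simp
    | add x y hx hy => rw [map_add, TensorProduct.tmul_add, map_add, map_add, map_add, hx, hy]
    | tmul l p =>
      simp only [LinearMap.comp_apply]
      rw [mergeAt_zero, lftPow_cons, lftPow_cons, ← lft_merge]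
      generalize cocycleMul D.f (h ⊗ₜ l) = y
      induction y with
      | zero => simp
      | add x y hx hy => simp only [map_add, hx, hy]
      | tmul a g => simp [lftPow_cons]
  | succ j ih =>
    cases s with
    | zero => ext t; simp [mergeAt, mulAt]
    | succ s =>
      refine TPow.hom_ext fun h t => ?_
      have e := LinearMap.congr_fun (ih s) t
      simp only [LinearMap.comp_apply] at e ⊢
      rw [mergeAt_succ, lftPow_cons]
      have key : ∀ y : A ⊗[k] TPow k H (s + 1), sh (lftPow (cv D.gam) (s + 2))
          (LinearMap.rTensor _ D.incl (LinearMap.lTensor A cons.toLinearMap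
            (actPast D.act _ (h ⊗ₜ y)))) = LinearMap.lTensor D.E cons.toLinearMap
              (lft (cv D.gam) _ (h ⊗ₜ sh (lftPow (cv D.gam) (s + 1))
                (LinearMap.rTensor _ D.incl y))) := by
        intro y
        induction y with
        | zero => simp
        | add x y hx hy => simp only [map_add, TensorProduct.tmul_add, hx, hy]
        | tmul a p =>
          rw [LinearMap.rTensor_tmul, sh_tmul, lft_incl_smul, actPast_tmul, cv_apply]
          generalize Coalgebra.comul (R := k) h = t
          induction t with
          | zero => simp
          | add p q hp hq => simp only [map_add, hp, hq]
          | tmul x y => simp [lftPow_cons]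
      rw [key, e, lft_lTensor, ← LinearMap.lTensor_comp_apply, ← LinearMap.lTensor_comp_apply]
      rfl

theorem sh_lftPow_mergeSum (s : ℕ) (t : TPow k H (s + 1)) :
    sh (lftPow (cv D.gam) s) (LinearMap.rTensor _ D.incl (D.mergeSum s t)) =
      LinearMap.lTensor D.E (innerSum s) (lftPow (cv D.gam) (s + 1) t) := by
  cases s with
  | zero => simp [mergeSum, innerSum]
  | succ s =>
    have h : LinearMap.lTensor D.E (innerSum (k := k) (B := H) (s + 1)) =
        ∑ j ∈ Finset.range (s + 1), (-1 : k) ^ (j + 1) • LinearMap.lTensor D.E (mulAt j s) := by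
      ext e p
      simp [innerSum, TensorProduct.tmul_sum]
    rw [h, mergeSum, LinearMap.sum_apply, LinearMap.sum_apply, map_sum, map_sum]
    refine Finset.sum_congr rfl fun j _ => ?_
    rw [LinearMap.smul_apply, LinearMap.smul_apply, map_smul, map_smul, sh_lftPow_mergeAt]

/-- Applying `ε` to the second part of the first letter leaves `1 # h`: this is why the first term
of `d̄¹` is `ε(h₁)` where that of `d̂¹` is `m (1 # h₁)`. -/
theorem lTensor_counit_lft {Q : Type u} [AddCommGroup Q] [Module k Q] (h : H) (z : D.E ⊗[k] Q) :
    LinearMap.lTensor D.E ((TensorProduct.lid k Q).toLinearMap ∘ₗ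
      LinearMap.rTensor Q Coalgebra.counit) (lft (cv D.gam) Q (h ⊗ₜ z)) = D.gam h • z := by
  induction z with
  | zero => simp
  | add x y hx hy => simp only [map_add, TensorProduct.tmul_add, smul_add, hx, hy]
  | tmul e q =>
    rw [lft_tmul]
    have e₁ : ∀ y : D.E ⊗[k] H, LinearMap.lTensor D.E ((TensorProduct.lid k Q).toLinearMap ∘ₗ
        LinearMap.rTensor Q Coalgebra.counit) (TensorProduct.map (LinearMap.mulRight k e)
          ((TensorProduct.mk k H Q).flip q) y) =
        (TensorProduct.rid k D.E (LinearMap.lTensor D.E Coalgebra.counit y) * e) ⊗ₜ q := by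
      intro y
      induction y with
      | zero => simp
      | add x y hx hy => simp only [map_add, add_mul, TensorProduct.add_tmul, hx, hy]
      | tmul x h => simp [TensorProduct.smul_tmul']
    have e₂ : LinearMap.lTensor D.E Coalgebra.counit (cv D.gam h) = D.gam h ⊗ₜ (1 : k) := by
      have e₃ : ∀ t : H ⊗[k] H, LinearMap.lTensor D.E (Coalgebra.counit (R := k) (A := H))
          (LinearMap.rTensor H D.gam t) =
            LinearMap.rTensor k D.gam (LinearMap.lTensor H Coalgebra.counit t) := by
        intro t
        induction t with
        | zero => simp
        | add x y hx hy => simp only [map_add, hx, hy]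
        | tmul x y => simp
      rw [cv_apply, e₃, Coalgebra.lTensor_counit_comul, LinearMap.rTensor_tmul]
    rw [e₁, e₂]
    simp [TensorProduct.smul_tmul']

/-- The inverses `(1 # h_s)⁻¹ ⋯ (1 # h_{t+1})⁻¹` remove the last `l` factors of the product that `θ`
has introduced and leave the product over the first `t` letters, as required for `θ` of the
shortened word. -/
theorem lftPow_split {c c' : H →ₗ[k] D.E ⊗[k] H} (hc : ∀ h, sh c' (c h) = 1 ⊗ₜ h) (s t l : ℕ)
    (hs : s = t + l) (p : TPow k H s) :
    sh ((TensorProduct.leftComm k (TPow k H t) D.E (TPow k H l)).toLinearMap ∘ₗ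
        LinearMap.lTensor _ (rgtPow c' l))
      (LinearMap.lTensor D.E (split s t l) (lftPow c s p)) =
      TensorProduct.assoc k D.E (TPow k H t) (TPow k H l)
        (LinearMap.rTensor _ (lftPow c t) (split s t l p)) := by
  suffices e : sh ((TensorProduct.leftComm k (TPow k H t) D.E (TPow k H l)).toLinearMap ∘ₗ
        LinearMap.lTensor _ (rgtPow c' l)) ∘ₗ LinearMap.lTensor D.E (split s t l) ∘ₗ lftPow c s =
      (TensorProduct.assoc k D.E (TPow k H t) (TPow k H l)).toLinearMap ∘ₗ
        LinearMap.rTensor _ (lftPow c t) ∘ₗ split s t l from LinearMap.congr_fun e p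
  clear p
  induction t generalizing s with
  | zero =>
    obtain rfl : s = l := by omega
    ext p
    have h₁ : split s 0 s = TensorProduct.mk k (TPow k H 0) (TPow k H s) (nil 1) :=
      LinearMap.ext (split_zero s)
    simp only [LinearMap.comp_apply]
    rw [h₁, sh_lTensor]
    have h₂ : ((TensorProduct.leftComm k (TPow k H 0) D.E (TPow k H s)).toLinearMap ∘ₗ
        LinearMap.lTensor _ (rgtPow c' s)) ∘ₗ TensorProduct.mk k (TPow k H 0) (TPow k H s) (nil 1) =
        LinearMap.lTensor D.E (TensorProduct.mk k (TPow k H 0) (TPow k H s) (nil 1)) ∘ₗ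
          rgtPow c' s := by
      ext p
      simp only [LinearMap.comp_apply, TensorProduct.mk_apply, LinearMap.lTensor_tmul]
      generalize rgtPow c' s p = y
      induction y with
      | zero => simp
      | add x y hx hy => simp only [map_add, TensorProduct.tmul_add, hx, hy]
      | tmul e q => simp
    rw [h₂, sh_lTensor_comp, sh_rgtPow_lftPow hc]
    simp [lftPow]
  | succ t ih =>
    obtain ⟨s, rfl⟩ : ∃ s', s = s' + 1 := ⟨s - 1, by omega⟩
    refine TPow.hom_ext fun h p => ?_
    have e := LinearMap.congr_fun (ih s (by omega)) p
    simp only [LinearMap.comp_apply] at e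
    let κ : H ⊗[k] (TPow k H t ⊗[k] TPow k H l) →ₗ[k] TPow k H (t + 1) ⊗[k] TPow k H l :=
      LinearMap.rTensor (TPow k H l) cons.toLinearMap
        ∘ₗ (TensorProduct.assoc k H (TPow k H t) (TPow k H l)).symm.toLinearMap
    let L : TPow k H t ⊗[k] TPow k H l →ₗ[k] D.E ⊗[k] (TPow k H t ⊗[k] TPow k H l) :=
      (TensorProduct.leftComm k (TPow k H t) D.E (TPow k H l)).toLinearMap ∘ₗ
        LinearMap.lTensor _ (rgtPow c' l)
    let G : H ⊗[k] (TPow k H t ⊗[k] TPow k H l) →ₗ[k]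
        D.E ⊗[k] (H ⊗[k] (TPow k H t ⊗[k] TPow k H l)) :=
      (TensorProduct.leftComm k H D.E _).toLinearMap ∘ₗ LinearMap.lTensor H L
    have hG : ∀ v q, G (v ⊗ₜ q) = LinearMap.lTensor D.E (TensorProduct.mk k H _ v) (L q) := by
      intro v q
      simp only [G, LinearMap.comp_apply, LinearMap.lTensor_tmul]
      generalize L q = y
      induction y with
      | zero => simp
      | add x y hx hy => simp only [map_add, TensorProduct.tmul_add, hx, hy]
      | tmul e q => simp
    have hκ : ∀ y, ((TensorProduct.leftComm k (TPow k H (t + 1)) D.E (TPow k H l)).toLinearMap ∘ₗ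
        LinearMap.lTensor _ (rgtPow c' l)) (κ y) = LinearMap.lTensor D.E κ (G y) := by
      intro y
      induction y with
      | zero => simp
      | add x y hx hy => simp only [map_add, hx, hy]
      | tmul v y =>
        induction y with
        | zero => simp
        | add x y hx hy => simp only [map_add, TensorProduct.tmul_add, hx, hy]
        | tmul q r =>
          simp only [κ, G, L, LinearMap.comp_apply, LinearEquiv.coe_coe, LinearMap.lTensor_tmul,
            TensorProduct.assoc_symm_tmul, LinearMap.rTensor_tmul]
          generalize rgtPow c' l r = y
          induction y with
          | zero => simp
          | add x y hx hy => simp only [map_add, TensorProduct.tmul_add, hx, hy]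
          | tmul e q => simp
    have h₁ : ∀ z, LinearMap.lTensor D.E (split (s + 1) (t + 1) l)
        (LinearMap.lTensor D.E cons.toLinearMap (lft c (TPow k H s) (h ⊗ₜ z))) =
        LinearMap.lTensor D.E κ (lft c _ (h ⊗ₜ LinearMap.lTensor D.E (split s t l) z)) := by
      intro z
      rw [lft_lTensor, ← LinearMap.lTensor_comp_apply, ← LinearMap.lTensor_comp_apply]
      rfl
    simp only [LinearMap.comp_apply]
    rw [lftPow_cons, h₁, sh_comm hκ, sh_lft c L h _ G hG, e, split_succ]
    change LinearMap.lTensor D.E κ _ = TensorProduct.assoc k D.E _ _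
      (LinearMap.rTensor _ (lftPow c (t + 1)) (κ (h ⊗ₜ split s t l p)))
    generalize split s t l p = y
    induction y with
    | zero => simp
    | add x y hx hy => simp only [map_add, TensorProduct.tmul_add, hx, hy]
    | tmul q r =>
      have h₂ : κ (h ⊗ₜ (q ⊗ₜ r)) = cons (h ⊗ₜ q) ⊗ₜ r := rfl
      rw [h₂, LinearMap.rTensor_tmul, LinearMap.rTensor_tmul, LinearEquiv.coe_coe,
        assoc_tmul_eq, assoc_tmul_eq, lft_lTensor, lftPow_cons, ← LinearMap.lTensor_comp_apply,
        ← LinearMap.lTensor_comp_apply]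
      have h₃ : κ ∘ₗ LinearMap.lTensor H ((TensorProduct.mk k _ _).flip r) =
          (TensorProduct.mk k _ _).flip r ∘ₗ cons.toLinearMap := TensorProduct.ext' fun v q => rfl
      rw [h₃]

end CrossedSystem

/-! ### The right action on `M` of the first tensor factor -/

section RightAct

variable {k : Type u} [CommRing k] {R : Type u} [Ring R] [Algebra k R]
variable {M : Type v} [AddCommGroup M] [Module k M] [Module Rᵐᵒᵖ M] [IsScalarTower k Rᵐᵒᵖ M]
variable {V Y Y' : Type u} [AddCommGroup V] [Module k V] [AddCommGroup Y] [Module k Y]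
variable [AddCommGroup Y'] [Module k Y']

variable (R) in
/-- The map `e ⊗ y ↦ m e ⊗ y`. -/
def ract (m : M) (Y : Type u) [AddCommGroup Y] [Module k Y] : R ⊗[k] Y →ₗ[k] M ⊗[k] Y :=
  onRight M LinearMap.id Y ∘ₗ TensorProduct.mk k M (R ⊗[k] Y) m

@[simp] theorem ract_tmul (m : M) (e : R) (y : Y) :
    ract R m Y (e ⊗ₜ[k] y) = (MulOpposite.op e • m) ⊗ₜ y := rfl

theorem onRight_eq_ract (g : V →ₗ[k] R) (m : M) (z : V ⊗[k] Y) :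
    onRight M g Y (m ⊗ₜ z) = ract R m Y (LinearMap.rTensor Y g z) := by
  induction z with
  | zero => simp
  | add x y hx hy => simp only [map_add, TensorProduct.tmul_add, hx, hy]
  | tmul v y => rfl

theorem lTensor_ract (m : M) (f : Y →ₗ[k] Y') (z : R ⊗[k] Y) :
    LinearMap.lTensor M f (ract R m Y z) = ract R m Y' (LinearMap.lTensor R f z) := by
  induction z with
  | zero => simp
  | add x y hx hy => simp only [map_add, hx, hy]
  | tmul e y => rfl

theorem ract_op_smul (m : M) (e : R) (z : R ⊗[k] Y) :
    ract R (MulOpposite.op e • m) Y z = ract R m Y (e • z) := by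
  induction z with
  | zero => simp
  | add x y hx hy => simp only [map_add, smul_add, hx, hy]
  | tmul f y => simp [TensorProduct.smul_tmul', mul_smul]

/-- Two right actions in succession are the right action by the product formed by `sh`; this reduces
statements on `M ⊗ _` to statements in `E ⊗ _`. -/
theorem onRight_lTensor_ract (g : V →ₗ[k] R) (f : Y →ₗ[k] V ⊗[k] Y') (m : M) (z : R ⊗[k] Y) :
    onRight M g Y' (LinearMap.lTensor M f (ract R m Y z)) =
      ract R m Y' (sh (LinearMap.rTensor Y' g ∘ₗ f) z) := by
  induction z with
  | zero => simp
  | add x y hx hy => simp only [map_add, hx, hy]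
  | tmul e y =>
    rw [ract_tmul, LinearMap.lTensor_tmul, onRight_eq_ract, ract_op_smul]
    rfl

theorem ract_smul [Module R M] [IsScalarTower k R M] [SMulCommClass R Rᵐᵒᵖ M] (m : M) (e : R)
    (z : R ⊗[k] Y) : ract R (e • m) Y z = e • ract R m Y z := by
  induction z with
  | zero => simp
  | add x y hx hy => simp only [map_add, smul_add, hx, hy]
  | tmul f y => rw [ract_tmul, ract_tmul, TensorProduct.smul_tmul', (smul_comm e (MulOpposite.op f) m).symm]

end RightAct

/-! ### Compatibility of `θ` with the differentials on representatives -/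

namespace CrossedSystem

variable {k A H : Type u} [CommRing k] [Ring A] [Algebra k A] [Ring H] [HopfAlgebra k H]
variable (D : CrossedSystem k A H)
variable {M : Type v} [AddCommGroup M] [Module k M] [Module D.Eᵐᵒᵖ M] [IsScalarTower k D.Eᵐᵒᵖ M]

theorem thetaRS_tmul (r s : ℕ) (m : M) (p : TPow k H s) (x : TPow k A r) :
    D.thetaRS M r s (m ⊗ₜ (p ⊗ₜ x)) =
      ract D.E m _ (LinearMap.lTensor D.E (TensorProduct.mk k _ _ x) (lftPow (cv D.gam) s p)) := by
  rw [← cv_gamPow, thetaRS, LinearMap.comp_apply, LinearMap.comp_apply, LinearMap.lTensor_tmul,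
    onRight_eq_ract, lTensor_ract, LinearMap.comp_apply, LinearMap.rTensor_tmul, cv_apply]
  congr 1
  generalize Coalgebra.comul (R := k) p = t
  induction t with
  | zero => simp
  | add p q hp hq => simp only [map_add, TensorProduct.add_tmul, hp, hq]
  | tmul a b => rfl

theorem thetaRS_ract (r s : ℕ) (m : M) (x : TPow k A r) (z : D.E ⊗[k] TPow k H s) :
    D.thetaRS M r s (ract D.E m _ (LinearMap.lTensor D.E ((TensorProduct.mk k _ _).flip x) z)) =
      ract D.E m _ (LinearMap.lTensor D.E (TensorProduct.mk k _ _ x)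
        (sh (lftPow (cv D.gam) s) z)) := by
  induction z with
  | zero => simp
  | add x y hx hy => simp only [map_add, hx, hy]
  | tmul e p =>
    rw [LinearMap.lTensor_tmul, ract_tmul, LinearMap.flip_apply, TensorProduct.mk_apply,
      thetaRS_tmul, ract_op_smul, sh_tmul, lTensor_smul]

theorem onRight_actPast (r s : ℕ) (m : M) (p : TPow k H s) (a : A) (x : TPow k A r) :
    D.thetaRS M r s (onRight M D.incl _ (m ⊗ₜ actPast (D.actPow s) _ (p ⊗ₜ (a ⊗ₜ x)))) =
      onRight M D.incl _ (LinearMap.lTensor M ((TensorProduct.mk k A _ a) ∘ₗ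
        TensorProduct.mk k _ _ x) (ract D.E m _ (lftPow (cv D.gam) s p))) := by
  rw [onRight_eq_ract, actPast_tmul]
  have h : LinearMap.rTensor _ D.incl (LinearMap.lTensor A ((TensorProduct.mk k _ _).flip x)
      (LinearMap.rTensor _ ((D.actPow s).flip a) (Coalgebra.comul (R := k) p))) =
      LinearMap.lTensor D.E ((TensorProduct.mk k _ _).flip x)
        (cv (D.incl ∘ₗ (D.actPow s).flip a) p) := by
    rw [cv_apply]
    generalize Coalgebra.comul (R := k) p = t
    induction t with
    | zero => simp
    | add p q hp hq => simp only [map_add, hp, hq]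
    | tmul a b => rfl
  rw [h, thetaRS_ract, sh_lftPow_act, onRight_lTensor_ract, ← sh_lTensor_comp]
  rfl

theorem thetaRS_merge (r s : ℕ) (m : M) (p : TPow k H (s + 1)) (x : TPow k A r) :
    D.thetaRS M r s (onRight M D.incl _ (m ⊗ₜ TensorProduct.assoc k A (TPow k H s) (TPow k A r)
        (D.mergeSum s p ⊗ₜ x))) =
      LinearMap.lTensor M (LinearMap.lTensor _ (innerSum s))
        (D.thetaRS M r (s + 1) (m ⊗ₜ (p ⊗ₜ x))) := by
  have h : ∀ w : A ⊗[k] TPow k H s, LinearMap.rTensor _ D.incl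
      (LinearMap.lTensor A ((TensorProduct.mk k _ _).flip x) w) =
      LinearMap.lTensor D.E ((TensorProduct.mk k _ (TPow k A r)).flip x)
        (LinearMap.rTensor _ D.incl w) := by
    intro w
    induction w with
    | zero => simp
    | add p q hp hq => simp only [map_add, hp, hq]
    | tmul a b => rfl
  rw [onRight_eq_ract, assoc_tmul_eq, h, thetaRS_ract, sh_lftPow_mergeSum, thetaRS_tmul,
    lTensor_ract, ← LinearMap.lTensor_comp_apply, ← LinearMap.lTensor_comp_apply]
  rfl

theorem thetaRS_gam (r s : ℕ) (m : M) (p : TPow k H (s + 1)) (x : TPow k A r) :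
    D.thetaRS M r s (onRight M D.gam _ (m ⊗ₜ TensorProduct.assoc k H (TPow k H s) (TPow k A r)
        (cons.symm p ⊗ₜ x))) =
      LinearMap.lTensor M (LinearMap.lTensor _ ((TensorProduct.lid k (TPow k H s)).toLinearMap
        ∘ₗ LinearMap.rTensor (TPow k H s) Coalgebra.counit ∘ₗ cons.symm.toLinearMap))
        (D.thetaRS M r (s + 1) (m ⊗ₜ (p ⊗ₜ x))) := by
  obtain ⟨z, rfl⟩ := cons.surjective p
  induction z with
  | zero => simp
  | add x y hx hy =>
    simp only [map_add, TensorProduct.tmul_add, TensorProduct.add_tmul,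
      hx, hy]
  | tmul h p =>
    rw [LinearEquiv.symm_apply_apply, TensorProduct.assoc_tmul, onRight_tmul, thetaRS_tmul,
      ract_op_smul, ← lTensor_smul, ← lTensor_counit_lft, thetaRS_tmul, lTensor_ract, lftPow_cons,
      ← LinearMap.lTensor_comp_apply, ← LinearMap.lTensor_comp_apply,
      ← LinearMap.lTensor_comp_apply]
    rfl

variable [Module D.E M] [IsScalarTower k D.E M] [SMulCommClass D.E D.Eᵐᵒᵖ M]

/-- `θ` only uses the right action, and the two actions on `M` commute; hence the terms acting on
`m` from the left pass through `θ`. -/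
theorem thetaRS_smul (r s : ℕ) (e : D.E) (z : M ⊗[k] (TPow k H s ⊗[k] TPow k A r)) :
    D.thetaRS M r s (e • z) = e • D.thetaRS M r s z := by
  induction z with
  | zero => simp
  | add x y hx hy => simp only [map_add, smul_add, hx, hy]
  | tmul m z =>
    induction z with
    | zero => simp
    | add x y hx hy => simp only [map_add, smul_add, TensorProduct.tmul_add, hx, hy]
    | tmul p x => rw [TensorProduct.smul_tmul', thetaRS_tmul, thetaRS_tmul, ract_smul]

theorem dBar0_thetaRS (r s : ℕ) (y : M ⊗[k] (TPow k H s ⊗[k] TPow k A (r + 1))) :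
    D.dBar0 M r s (D.thetaRS M (r + 1) s y) = D.thetaRS M r s (D.dHat0 M r s y) := by
  induction y with
  | zero => simp
  | add x y hx hy => simp only [map_add, hx, hy]
  | tmul m z =>
    induction z with
    | zero => simp
    | add x y hx hy => simp only [map_add, TensorProduct.tmul_add, hx, hy]
    | tmul p x =>
      have h₁ : ∀ z : M ⊗[k] TPow k H s, D.dBar0 M r s (LinearMap.lTensor M
          (TensorProduct.mk k _ _ x) z) =
          TensorProduct.assoc k M _ _ (LinearMap.rTensor _ (onRight M D.incl _ ∘ₗ
            LinearMap.lTensor M cons.symm.toLinearMap) ((TensorProduct.assoc k M _ _).symm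
              (LinearMap.lTensor M (TensorProduct.mk k _ _ x) z))) +
          LinearMap.lTensor M (TensorProduct.mk k _ _ (innerSum r x)) z +
          (-1 : k) ^ (r + 1) • TensorProduct.assoc k M _ _ (LinearMap.rTensor _
            (onLeft M D.incl _) ((TensorProduct.assoc k M _ _).symm
              (LinearMap.lTensor M (TensorProduct.mk k _ _ (unsnoc r x)) z))) := by
        intro z
        induction z with
        | zero => simp
        | add x y hx hy => simp only [map_add, hx, hy, smul_add]; abel
        | tmul m q => simp [dBar0, hochB]
      have h₂ : TensorProduct.assoc k M _ _ (LinearMap.rTensor _ (onRight M D.incl _ ∘ₗ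
            LinearMap.lTensor M cons.symm.toLinearMap) ((TensorProduct.assoc k M _ _).symm
              (LinearMap.lTensor M (TensorProduct.mk k _ _ x)
                (ract D.E m _ (lftPow (cv D.gam) s p))))) =
          D.thetaRS M r s (onRight M D.incl _ (m ⊗ₜ actPast (D.actPow s) _
            (p ⊗ₜ cons.symm x))) := by
        obtain ⟨t, rfl⟩ := cons.surjective x
        clear h₁
        rw [LinearEquiv.symm_apply_apply]
        induction t with
        | zero => simp
        | add x y hx hy =>
          simp only [map_add, TensorProduct.tmul_add, LinearMap.lTensor_add,
            LinearMap.add_apply, hx, hy]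
        | tmul a x =>
          rw [onRight_actPast]
          generalize ract D.E m _ (lftPow (cv D.gam) s p) = z
          induction z with
          | zero => simp
          | add x y hx hy => simp only [map_add, hx, hy]
          | tmul m q => rfl
      have h₃ : TensorProduct.assoc k M _ _ (LinearMap.rTensor _
            (onLeft M D.incl _) ((TensorProduct.assoc k M _ _).symm
              (LinearMap.lTensor M (TensorProduct.mk k _ _ (unsnoc r x))
                (ract D.E m _ (lftPow (cv D.gam) s p))))) =
          D.thetaRS M r s (onLeft M D.incl _ (m ⊗ₜ TensorProduct.leftComm k (TPow k H s) A
            (TPow k A r) (p ⊗ₜ unsnoc r x))) := by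
        clear h₁ h₂
        generalize unsnoc r x = t
        induction t with
        | zero => simp
        | add x y hx hy =>
          simp only [map_add, TensorProduct.tmul_add, LinearMap.lTensor_add,
            LinearMap.add_apply, hx, hy]
        | tmul b x =>
          rw [TensorProduct.leftComm_tmul, onLeft_tmul, ← TensorProduct.smul_tmul', thetaRS_smul,
            thetaRS_tmul, ← lTensor_ract]
          generalize ract D.E m _ (lftPow (cv D.gam) s p) = z
          induction z with
          | zero => simp
          | add x y hx hy => simp only [map_add, smul_add, hx, hy]
          | tmul m q => rfl
      rw [thetaRS_tmul, ← lTensor_ract, h₁, h₂, h₃, dHat0, LinearMap.add_apply,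
        LinearMap.add_apply, map_add, map_add, LinearMap.smul_apply, map_smul]
      refine congrArg₂ _ (congrArg₂ _ rfl ?_) rfl
      rw [lTensor_ract, ← thetaRS_tmul]
      rfl

/-- The inverse factors in `d̄^l` cancel the part of the product in `θ` that belongs to the letters
cut off, by `lftPow_split`. The comultiplication parts left over are those that `d̂^l` uses. -/
theorem dBarL_thetaRS (hf : D.InvertibleCocycle) (l r s n t : ℕ) (hs : s = t + (l + 1))
    (y : M ⊗[k] (TPow k H s ⊗[k] TPow k A r)) :
    dBarL M hf l r s n t (D.thetaRS M r s y) = D.thetaRS M n t (D.dHatL M l r s n t y) := by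
  induction y with
  | zero => simp
  | add x y hx hy => simp only [map_add, hx, hy]
  | tmul m z =>
    induction z with
    | zero => simp
    | add x y hx hy => simp only [map_add, TensorProduct.tmul_add, hx, hy]
    | tmul p x =>
      let g : TPow k H t ⊗[k] TPow k H (l + 1) →ₗ[k] TPow k H t ⊗[k] (H ⊗[k] TPow k A n) :=
        LinearMap.lTensor _ (D.prodF n l r ∘ₗ (TensorProduct.mk k _ _).flip x)
      let big : TPow k A r ⊗[k] TPow k H s →ₗ[k]
          TPow k H (l + 1) ⊗[k] (TPow k H t ⊗[k] (H ⊗[k] TPow k A n)) :=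
        (TensorProduct.leftComm k (TPow k H t) (TPow k H (l + 1))
            (H ⊗[k] TPow k A n)).toLinearMap
          ∘ₗ LinearMap.lTensor (TPow k H t)
            (LinearMap.lTensor (TPow k H (l + 1)) (D.prodF n l r)
              ∘ₗ (TensorProduct.assoc k (TPow k H (l + 1)) (TPow k H (l + 1))
                  (TPow k A r)).toLinearMap
              ∘ₗ LinearMap.rTensor (TPow k A r) Coalgebra.comul)
          ∘ₗ (TensorProduct.assoc k (TPow k H t) (TPow k H (l + 1))
              (TPow k A r)).toLinearMap
          ∘ₗ LinearMap.rTensor (TPow k A r) (split s t (l + 1))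
          ∘ₗ (TensorProduct.comm k (TPow k A r) (TPow k H s)).toLinearMap
      -- The inverse factors are isolated as `rgtPow (cv (gamInv hf))`, the form needed to cancel
      -- them.
      have h₁ : (LinearMap.rTensor _ (revProd (gamInv hf) (l + 1)) ∘ₗ big) ∘ₗ
          TensorProduct.mk k _ _ x = LinearMap.lTensor D.E g ∘ₗ
            ((TensorProduct.leftComm k (TPow k H t) D.E (TPow k H (l + 1))).toLinearMap ∘ₗ
              LinearMap.lTensor _ (rgtPow (cv (gamInv hf)) (l + 1))) ∘ₗ split s t (l + 1) := by
        ext q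
        simp only [big, LinearMap.comp_apply, TensorProduct.mk_apply, LinearEquiv.coe_coe,
          TensorProduct.comm_tmul, LinearMap.rTensor_tmul, ← cv_revProd]
        generalize split s t (l + 1) q = y
        induction y with
        | zero => simp
        | add x y hx hy => simp only [map_add, TensorProduct.add_tmul, hx, hy]
        | tmul u v =>
          rw [LinearMap.lTensor_tmul, cv_apply, TensorProduct.assoc_tmul, LinearMap.lTensor_tmul]
          simp only [LinearMap.comp_apply, LinearMap.rTensor_tmul]
          generalize Coalgebra.comul (R := k) v = c
          induction c with
          | zero => simp
          | add x y hx hy => simp only [map_add, TensorProduct.tmul_add, TensorProduct.add_tmul, hx, hy]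
          | tmul a b => simp [g]
      have h₂ : onRight M (revProd (gamInv hf) (l + 1)) _ (LinearMap.lTensor M big
          (D.thetaRS M r s (m ⊗ₜ (p ⊗ₜ x)))) = ract D.E m _ (LinearMap.lTensor D.E g
            (TensorProduct.assoc k D.E (TPow k H t) (TPow k H (l + 1))
              (LinearMap.rTensor _ (lftPow (cv D.gam) t) (split s t (l + 1) p)))) := by
        rw [thetaRS_tmul, onRight_lTensor_ract, sh_lTensor, h₁, sh_lTensor_comp,
          ← lftPow_split D (sh_gamInv_gam hf) s t (l + 1) hs, sh_lTensor]
      have h₃ : dBarL M hf l r s n t (D.thetaRS M r s (m ⊗ₜ (p ⊗ₜ x))) =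
          (-1 : k) ^ ((l + 1) * (r + s)) • LinearMap.lTensor M
            (TensorProduct.comm k (TPow k H t) (TPow k A n)).toLinearMap
            (onLeft M D.gam _ (LinearMap.lTensor M
              (TensorProduct.leftComm k (TPow k H t) H (TPow k A n)).toLinearMap
              (onRight M (revProd (gamInv hf) (l + 1)) _ (LinearMap.lTensor M big
                (D.thetaRS M r s (m ⊗ₜ (p ⊗ₜ x))))))) := rfl
      have h₄ : D.dHatL M l r s n t (m ⊗ₜ (p ⊗ₜ x)) = (-1 : k) ^ ((l + 1) * (r + s)) •
          onLeft M D.gam _ (m ⊗ₜ TensorProduct.leftComm k (TPow k H t) H (TPow k A n)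
            (LinearMap.lTensor _ (D.prodF n l r) (TensorProduct.assoc k _ _ _
              (split s t (l + 1) p ⊗ₜ x)))) := rfl
      rw [h₃, h₄, h₂, map_smul]
      congr 1
      clear h₁ h₂ h₃ h₄
      generalize split s t (l + 1) p = y
      induction y with
      | zero => simp
      | add x y hx hy => simp only [map_add, TensorProduct.add_tmul, TensorProduct.tmul_add, hx, hy]
      | tmul u v =>
        rw [LinearMap.rTensor_tmul, assoc_tmul_eq, TensorProduct.assoc_tmul,
          LinearMap.lTensor_tmul]
        have h₅ : ∀ z : H ⊗[k] TPow k A n, LinearMap.lTensor M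
            (TensorProduct.comm k (TPow k H t) (TPow k A n)).toLinearMap
            (onLeft M D.gam _ (LinearMap.lTensor M
              (TensorProduct.leftComm k (TPow k H t) H (TPow k A n)).toLinearMap
              (ract D.E m _ (LinearMap.lTensor D.E ((TensorProduct.mk k _ _).flip z)
                (lftPow (cv D.gam) t u))))) =
            D.thetaRS M n t (onLeft M D.gam _ (m ⊗ₜ
              TensorProduct.leftComm k (TPow k H t) H (TPow k A n) (u ⊗ₜ z))) := by
          intro z
          induction z with
          | zero => simp
          | add x y hx hy =>
            simp only [map_add, TensorProduct.tmul_add, LinearMap.lTensor_add,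
              LinearMap.add_apply, hx, hy]
          | tmul h x =>
            rw [TensorProduct.leftComm_tmul, onLeft_tmul, ← TensorProduct.smul_tmul',
              thetaRS_smul, thetaRS_tmul]
            generalize lftPow (cv D.gam) t u = w
            induction w with
            | zero => simp
            | add x y hx hy => simp only [map_add, smul_add, hx, hy]
            | tmul e q => rfl
        rw [← h₅]
        congr 3
        rw [← LinearMap.lTensor_comp_apply]
        rfl

theorem dBar1_thetaRS (hf : D.InvertibleCocycle) (r s : ℕ)
    (y : M ⊗[k] (TPow k H (s + 1) ⊗[k] TPow k A r)) :
    dBar1 M hf r s (D.thetaRS M r (s + 1) y) = D.thetaRS M r s (D.dHat1 M r s y) := by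
  rw [dBar1, dHat1, LinearMap.add_apply, LinearMap.add_apply, LinearMap.add_apply,
    LinearMap.add_apply, map_add, map_add, dBarL_thetaRS D hf 0 r (s + 1) r s rfl]
  refine congrArg₂ _ (congrArg₂ _ ?_ ?_) rfl
  · rw [LinearMap.smul_apply, LinearMap.smul_apply, map_smul]
    congr 1
    induction y with
    | zero => simp
    | add x y hx hy => simp only [map_add, hx, hy]
    | tmul m z =>
      induction z with
      | zero => simp
      | add x y hx hy => simp only [map_add, TensorProduct.tmul_add, hx, hy]
      | tmul p x => exact (D.thetaRS_gam r s m p x).symm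
  · rw [LinearMap.smul_apply, LinearMap.smul_apply, map_smul]
    congr 1
    induction y with
    | zero => simp
    | add x y hx hy => simp only [map_add, hx, hy]
    | tmul m z =>
      induction z with
      | zero => simp
      | add x y hx hy => simp only [map_add, TensorProduct.tmul_add, hx, hy]
      | tmul p x => exact (D.thetaRS_merge r s m p x).symm

end CrossedSystem

/-! ### Bijectivity of `θ` and its passage to classes -/

section Twist

variable {k : Type u} [CommRing k] {R : Type u} [Ring R] [Algebra k R]
variable {M : Type v} [AddCommGroup M] [Module k M] [Module Rᵐᵒᵖ M] [IsScalarTower k Rᵐᵒᵖ M]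
variable {P P' X X' Y Y' : Type u} [AddCommGroup P] [Module k P] [AddCommGroup X] [Module k X]
variable [AddCommGroup P'] [Module k P'] [AddCommGroup X'] [Module k X']
variable [AddCommGroup Y] [Module k Y] [AddCommGroup Y'] [Module k Y']

variable (M) in
/-- For `f(p) = ∑ e ⊗ p'`, the map `m ⊗ (p ⊗ x) ↦ ∑ m e ⊗ (p' ⊗ x)`. -/
def twist (f : P →ₗ[k] R ⊗[k] P') (X : Type u) [AddCommGroup X] [Module k X] :
    M ⊗[k] (P ⊗[k] X) →ₗ[k] M ⊗[k] (P' ⊗[k] X) :=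
  onRight M LinearMap.id _ ∘ₗ
    LinearMap.lTensor M ((TensorProduct.assoc k R P' X).toLinearMap ∘ₗ LinearMap.rTensor X f)

theorem twist_tmul (f : P →ₗ[k] R ⊗[k] P') (m : M) (p : P) (x : X) :
    twist M f X (m ⊗ₜ (p ⊗ₜ x)) =
      ract R m _ (LinearMap.lTensor R ((TensorProduct.mk k P' X).flip x) (f p)) := by
  rw [twist, LinearMap.comp_apply, LinearMap.lTensor_tmul, onRight_eq_ract, LinearMap.rTensor_id,
    LinearMap.id_apply, LinearMap.comp_apply, LinearMap.rTensor_tmul]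
  congr 1
  generalize f p = y
  induction y with
  | zero => simp
  | add x y hx hy => simp only [map_add, TensorProduct.add_tmul, hx, hy]
  | tmul e q => rfl

theorem twist_ract (f : P →ₗ[k] R ⊗[k] P') (m : M) (x : X) (z : R ⊗[k] P) :
    twist M f X (ract R m _ (LinearMap.lTensor R ((TensorProduct.mk k P X).flip x) z)) =
      ract R m _ (LinearMap.lTensor R ((TensorProduct.mk k P' X).flip x) (sh f z)) := by
  induction z with
  | zero => simp
  | add x y hx hy => simp only [map_add, hx, hy]
  | tmul e p =>
    rw [LinearMap.lTensor_tmul, ract_tmul, LinearMap.flip_apply, TensorProduct.mk_apply,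
      twist_tmul, ract_op_smul, sh_tmul, lTensor_smul]

theorem twist_twist {f : P →ₗ[k] R ⊗[k] P'} {g : P' →ₗ[k] R ⊗[k] P}
    (h : ∀ p, sh g (f p) = 1 ⊗ₜ p) (y : M ⊗[k] (P ⊗[k] X)) :
    twist M g X (twist M f X y) = y := by
  induction y with
  | zero => simp
  | add x y hx hy => simp only [map_add, hx, hy]
  | tmul m z =>
    induction z with
    | zero => simp
    | add x y hx hy => simp only [map_add, TensorProduct.tmul_add, hx, hy]
    | tmul p x => rw [twist_tmul, twist_ract, h]; simp

variable (M) in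
/-- For `f(p) = ∑ e ⊗ p'`, the map `m ⊗ (p ⊗ x) ↦ ∑ m e ⊗ (x ⊗ p')`. -/
def twistComm (f : P →ₗ[k] R ⊗[k] P') (X : Type u) [AddCommGroup X] [Module k X] :
    M ⊗[k] (P ⊗[k] X) →ₗ[k] M ⊗[k] (X ⊗[k] P') :=
  LinearMap.lTensor M (TensorProduct.comm k P' X).toLinearMap ∘ₗ twist M f X

theorem twistComm_tmul (f : P →ₗ[k] R ⊗[k] P') (m : M) (p : P) (x : X) :
    twistComm M f X (m ⊗ₜ (p ⊗ₜ x)) =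
      ract R m _ (LinearMap.lTensor R (TensorProduct.mk k X P' x) (f p)) := by
  rw [twistComm, LinearMap.comp_apply, twist_tmul, lTensor_ract, ← LinearMap.lTensor_comp_apply]
  rfl

/-- Twisting by `g` undoes twisting by `f`, and conversely, because right actions compose by
multiplying the factors in `R`; interchanging the tensor factors is bijective anyway. -/
theorem twistComm_bijective {f : P →ₗ[k] R ⊗[k] P'} {g : P' →ₗ[k] R ⊗[k] P}
    (h : ∀ p, sh g (f p) = 1 ⊗ₜ p) (h' : ∀ p, sh f (g p) = 1 ⊗ₜ p) :
    Function.Bijective (twistComm M f X) :=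
  ((TensorProduct.congr (LinearEquiv.refl k M) (TensorProduct.comm k P' X)).bijective).comp
    ⟨Function.LeftInverse.injective (twist_twist h),
      Function.RightInverse.surjective (twist_twist h')⟩

theorem twistComm_map {f : P →ₗ[k] R ⊗[k] P} {f' : P' →ₗ[k] R ⊗[k] P'} {g : P →ₗ[k] P'}
    (h : ∀ p, f' (g p) = LinearMap.lTensor R g (f p)) (g' : X →ₗ[k] X') (y : M ⊗[k] (P ⊗[k] X)) :
    twistComm M f' X' (LinearMap.lTensor M (TensorProduct.map g g') y) =
      LinearMap.lTensor M (TensorProduct.map g' g) (twistComm M f X y) := by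
  induction y with
  | zero => simp
  | add x y hx hy => simp only [map_add, hx, hy]
  | tmul m z =>
    induction z with
    | zero => simp
    | add x y hx hy => simp only [map_add, TensorProduct.tmul_add, hx, hy]
    | tmul p x =>
      rw [LinearMap.lTensor_tmul, TensorProduct.map_tmul, twistComm_tmul, twistComm_tmul, h,
        lTensor_ract, ← LinearMap.lTensor_comp_apply, ← LinearMap.lTensor_comp_apply]
      rfl

end Twist

namespace CrossedSystem

variable {k A H : Type u} [CommRing k] [Ring A] [Algebra k A] [Ring H] [HopfAlgebra k H]
variable (D : CrossedSystem k A H)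
variable (M : Type v) [AddCommGroup M] [Module k M] [Module D.Eᵐᵒᵖ M] [IsScalarTower k D.Eᵐᵒᵖ M]

/-- Since `Δ(1) = 1 ⊗ 1`, the unit goes to `g(1) ⊗ 1`, which vanishes in `E ⊗ H / k·1`. Applied to
`h ↦ 1 # h` and to its inverse, this makes the two inverse coactions descend. -/
theorem exists_coaction_red (g : H →ₗ[k] D.E) :
    ∃ c : Red k H →ₗ[k] D.E ⊗[k] Red k H,
      ∀ h, c (red k H h) = LinearMap.lTensor D.E (red k H) (cv g h) := by
  refine exists_coaction _ fun v hv => ?_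
  obtain ⟨a, rfl⟩ := Submodule.mem_span_singleton.1 hv
  have h : red k H 1 = 0 :=
    (Submodule.Quotient.mk_eq_zero _).2 (Submodule.mem_span_singleton_self _)
  rw [map_smul, map_smul, cv_apply, Bialgebra.comul_one, Algebra.TensorProduct.one_def,
    LinearMap.rTensor_tmul, LinearMap.lTensor_tmul]
  exact (congrArg (fun y => a • (g 1 ⊗ₜ[k] y)) h).trans (by simp)

theorem thetaRS_eq (r s : ℕ) :
    D.thetaRS M r s = twistComm M (lftPow (cv D.gam) s) (TPow k A r) :=
  TensorProduct.ext' fun m z => by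
    induction z with
    | zero => simp
    | add x y hx hy => simp only [map_add, TensorProduct.tmul_add, hx, hy]
    | tmul p x => rw [thetaRS_tmul, twistComm_tmul]

theorem lmap_bijective {ι : Type} [DecidableEq ι] {V W : ι → Type*} [∀ i, AddCommGroup (V i)]
    [∀ i, Module k (V i)] [∀ i, AddCommGroup (W i)] [∀ i, Module k (W i)]
    (f : ∀ i, V i →ₗ[k] W i) (h : ∀ i, Function.Bijective (f i)) :
    Function.Bijective (DirectSum.lmap f) :=
  ⟨(DirectSum.lmap_injective f).2 fun i => (h i).1,
    (DirectSum.lmap_surjective f).2 fun i => (h i).2⟩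

/-- Needed to reach every representative of `X̄` from one of `X̂`, so that the formulas for `d̄` can
be checked through `θ`. -/
theorem theta_surjective (hf : D.InvertibleCocycle) (n : ℕ) :
    Function.Surjective (D.theta M n) :=
  (lmap_bijective _ fun p => by
    rw [thetaRS_eq]
    exact twistComm_bijective (sh_rgtPow_lftPow (sh_gamInv_gam hf) _)
      (sh_lftPow_rgtPow (sh_gam_gamInv hf) _)).2

/-- The isomorphism `θ_n` on the components of the reduced complexes. -/
theorem exists_reduced_theta (hf : D.InvertibleCocycle) :
    ∃ θ : ∀ n, XHat k (Red k A) (Red k H) M n ≃ₗ[k] XBar k (Red k A) (Red k H) M n,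
      ∀ n x, θ n (clsHat k M A H n x) = clsBar k M A H n (D.theta M n x) := by
  obtain ⟨c, hc⟩ := D.exists_coaction_red D.gam
  obtain ⟨c', hc'⟩ := D.exists_coaction_red (gamInv hf)
  have hred : Function.Surjective (red k H) := Submodule.mkQ_surjective _
  have h := sh_descends hred hc hc' (sh_gamInv_gam hf)
  have h' := sh_descends hred hc' hc (sh_gam_gamInv hf)
  refine ⟨fun n => LinearEquiv.ofBijective (DirectSum.lmap fun p : Bideg n =>
    twistComm M (lftPow c p.1.2) (TPow k (Red k A) p.1.1)) (lmap_bijective _ fun p =>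
      twistComm_bijective (sh_rgtPow_lftPow h _) (sh_lftPow_rgtPow h' _)), fun n x => ?_⟩
  rw [LinearEquiv.ofBijective_apply]
  suffices e : (DirectSum.lmap fun p : Bideg n =>
      twistComm M (lftPow c p.1.2) (TPow k (Red k A) p.1.1)) ∘ₗ clsHat k M A H n =
      clsBar k M A H n ∘ₗ D.theta M n from LinearMap.congr_fun e x
  refine DirectSum.linearMap_ext k fun p => LinearMap.ext fun y => ?_
  simp only [LinearMap.comp_apply, clsHat, clsBar, theta, DirectSum.lmap_lof]
  rw [thetaRS_eq, twistComm_map (lftPow_powMap (red k H) hc _)]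

variable [Module D.E M] [IsScalarTower k D.E M] [SMulCommClass D.E D.Eᵐᵒᵖ M]

theorem dBar_theta (hf : D.InvertibleCocycle) (n : ℕ) (x : XHat k A H M (n + 1)) :
    dBar M hf n (D.theta M (n + 1) x) = D.theta M n (D.dHat M n x) := by
  suffices e : dBar M hf n ∘ₗ D.theta M (n + 1) = D.theta M n ∘ₗ D.dHat M n from
    LinearMap.congr_fun e x
  have hθ : ∀ n r s (h : r + s = n) y, D.theta M n (toHat M r s h y) =
      toBar M r s h (D.thetaRS M r s y) := fun n r s h y => by
    rw [theta, toHat, DirectSum.lmap_lof]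
    rfl
  refine DirectSum.linearMap_ext k fun p => LinearMap.ext fun y => ?_
  obtain ⟨⟨r, s⟩, hp⟩ := p
  change dBar M hf n (D.theta M (n + 1) (toHat M r s hp y)) =
    D.theta M n (D.dHat M n (toHat M r s hp y))
  rw [hθ, toBar, toHat, dBar, dHat, DirectSum.toModule_lof, DirectSum.toModule_lof,
    LinearMap.add_apply, LinearMap.add_apply, LinearMap.add_apply, LinearMap.add_apply, map_add,
    map_add, LinearMap.sum_apply, LinearMap.sum_apply, map_sum]
  refine congrArg₂ _ (congrArg₂ _ ?_ ?_) (Finset.sum_congr rfl fun i _ => ?_)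
  · cases r with
    | zero => simp [dBarFrom0, dHatFrom0]
    | succ r =>
      rw [dBarFrom0, dHatFrom0, LinearMap.comp_apply, LinearMap.comp_apply, hθ, dBar0_thetaRS]
  · cases s with
    | zero => simp [dBarFrom1, dHatFrom1]
    | succ s =>
      rw [dBarFrom1, dHatFrom1, LinearMap.comp_apply, LinearMap.comp_apply, hθ, dBar1_thetaRS]
  · have hi := i.2
    rw [LinearMap.comp_apply, LinearMap.comp_apply, hθ, dBarL_thetaRS]
    simp only at hi ⊢
    omega

end CrossedSystem

end

end HopfCrossed

theorem theorem3p1p1 {k A H : Type u} [CommRing k] [Ring A] [Algebra k A] [Ring H]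
    [HopfAlgebra k H] (D : HopfCrossed.CrossedSystem k A H) (hf : D.InvertibleCocycle)
    (M : Type v) [AddCommGroup M] [Module k M] [Module D.E M] [Module D.Eᵐᵒᵖ M]
    [IsScalarTower k D.E M] [IsScalarTower k D.Eᵐᵒᵖ M] [SMulCommClass D.E D.Eᵐᵒᵖ M] :
    ∃ (dh : ∀ n, HopfCrossed.XHat k (HopfCrossed.Red k A) (HopfCrossed.Red k H) M (n + 1) →ₗ[k]
          HopfCrossed.XHat k (HopfCrossed.Red k A) (HopfCrossed.Red k H) M n)
      (db : ∀ n, HopfCrossed.XBar k (HopfCrossed.Red k A) (HopfCrossed.Red k H) M (n + 1) →ₗ[k]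
          HopfCrossed.XBar k (HopfCrossed.Red k A) (HopfCrossed.Red k H) M n)
      (θ : ∀ n, HopfCrossed.XHat k (HopfCrossed.Red k A) (HopfCrossed.Red k H) M n ≃ₗ[k]
          HopfCrossed.XBar k (HopfCrossed.Red k A) (HopfCrossed.Red k H) M n),
      (∀ n x, dh n (HopfCrossed.clsHat k M A H (n + 1) x) =
        HopfCrossed.clsHat k M A H n (D.dHat M n x)) ∧
      (∀ n x, db n (HopfCrossed.clsBar k M A H (n + 1) x) =
        HopfCrossed.clsBar k M A H n (HopfCrossed.CrossedSystem.dBar M hf n x)) ∧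
      (∀ n x, θ n (HopfCrossed.clsHat k M A H n x) =
        HopfCrossed.clsBar k M A H n (D.theta M n x)) ∧
      (∀ n x, dh n (dh (n + 1) x) = 0) ∧
      (∀ n x, db n (db (n + 1) x) = 0) ∧
      (∀ n x, θ n (dh n x) = db n (θ (n + 1) x)) ∧
      ∀ n, Nonempty (HopfCrossed.HochschildHomology k D.E M n ≃ₗ[k]
        HopfCrossed.Homology db n) := by
  obtain ⟨θ, hθ⟩ := D.exists_reduced_theta M hf
  -- The differential of `X̄` is transported along `θ`, so that it squares to zero and commutes with
  -- `θ` by construction; only its formula has to be verified.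
  let db : ∀ n, HopfCrossed.XBar k (HopfCrossed.Red k A) (HopfCrossed.Red k H) M (n + 1) →ₗ[k]
      HopfCrossed.XBar k (HopfCrossed.Red k A) (HopfCrossed.Red k H) M n := fun n =>
    (θ n).toLinearMap ∘ₗ D.hatDiff M n ∘ₗ (θ (n + 1)).symm.toLinearMap
  have hdb : ∀ n x, θ n (D.hatDiff M n x) = db n (θ (n + 1) x) := fun n x => by simp [db]
  refine ⟨D.hatDiff M, db, θ, D.hatDiff_clsHat M, fun n x => ?_, hθ, D.hatDiff_hatDiff M,
    fun n x => ?_, hdb, fun n => ?_⟩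
  -- Every representative is `θ` of a representative, and there the formulas are related by
  -- `dBar_theta`; this also shows that `d̄` is well defined on classes.
  · obtain ⟨y, rfl⟩ := D.theta_surjective M hf (n + 1) x
    rw [← hθ, ← hdb, D.hatDiff_clsHat, hθ, D.dBar_theta]
  · obtain ⟨y, rfl⟩ := (θ (n + 2)).surjective x
    rw [← hdb, ← hdb, D.hatDiff_hatDiff, map_zero]
  · obtain ⟨e₁⟩ := D.hochschildHomology_hat M n
    obtain ⟨e₂⟩ := HopfCrossed.Lifts.homology (φ := fun n => (θ n).toLinearMap) hdb
      (HopfCrossed.Lifts.of_bijective hdb fun n => (θ n).bijective) n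
    exact ⟨e₁ ≪≫ₗ e₂⟩
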